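/- Let $\lambda\in(0,1)$ and, for $s\in\{+,-\}$, put $\ell^{s}(x)=s\,\frac{x_1}{\lambda}+\frac{x_2}{\sqrt{1-\lambda^2}}$ on $\mathbb R^2$. Let $\Omega\subset\mathbb R^2$ be a bounded open set each of whose boundary points is either a smooth boundary point or a straight corner (near which $\Omega$ is a plane sector with that apex, of opening in $(0,2\pi)\setminus\{\pi\}$); let $\mathcal K$ be the set of corners. For $\mu,\nu\in\{+,-\}$, a corner $\kappa\in\mathcal K$ is of type $(\mu,\nu)$ with parameters $\alpha_\pm>0$ if $\mu\,\ell^{-\nu}(x-\kappa)\ge 0$ for all $x\in\Omega$ and, for some neighbourhood $U$ of $\kappa$ and some $\delta>0$, $U\cap\partial\Omega$ is the union of $\{\ell^{\nu}(x-\kappa)=-\alpha_-\ell^{-\nu}(x-\kappa),\ \mu\,\ell^{\nu}(x-\kappa)\in(-\delta,0]\}$ and $\{\ell^{\nu}(x-\kappa)=\alpha_+\ell^{-\nu}(x-\kappa),\ \mu\,\ell^{\nu}(x-\kappa)\in[0,\delta)\}$; its characteristic ratio is $\alpha=\alpha_+/\alpha_-$. Near such a corner use the blown-up coordinates $r=\mu\,\ell^{-\nu}(x-\kappa)$,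 $\tau=\ell^{\nu}(x-\kappa)/\ell^{-\nu}(x-\kappa)\in[-\alpha_-,\alpha_+]$. Let $\omega=\lambda+i\epsilon$ with $\epsilon\in\mathbb R\setminus\{0\}$, let $P(\omega)=(1-\omega^2)\partial_{x_2}^2-\omega^2\partial_{x_1}^2$, let $f\in C_c^\infty(\Omega)$, and let $u\in H^1_0(\Omega)$ be a weak solution of $P(\omega)u=f$. Then (after modification on a null set) $u$ is smooth on $\overline\Omega\setminus\mathcal K$. Furthermore, for every corner $\kappa$ of type $(\mu,\nu)$ with parameters $\alpha_\pm$ there are functions $w_k\in C^\infty([-\alpha_-,\alpha_+])$, $k\ge1$, with $w_k(-\alpha_-)=w_k(\alpha_+)=0$, such that in the blown-up coordinates $$u(r,\tau)\sim\sum_{k=1}^\infty r^{\mathfrak l_\omega k}w_k(\tau)\qquad (r\to0+),$$ in the polyhomogeneous sense: there is $\delta>0$ such that for all $K,i,j\in\mathbb N_0$ there is a constant $C$ with $$\Big|(\partial_r)^i\partial_\tau^j\Big(u(r,\tau)-\sum_{k=1}^K r^{\mathfrak l_\omega k}w_k(\tau)\Big)\Big|\le C\,r^{(K+1)\operatorname{Re}\mathfrak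 l_\omega-i},\qquad 0<r<\delta,\ \tau\in[-\alpha_-,\alpha_+].$$ Here $\mathfrak l_\omega$ depends only on $\omega$, $\alpha_-$ and $\alpha_+$, satisfies $\operatorname{Re}\mathfrak l_\omega>0$, and $$\mathfrak l_\omega=\frac{2\pi i}{i\pi-\log\alpha}+\mathcal O(\epsilon)\quad(\epsilon\to0+),\qquad \mathfrak l_\omega=\frac{2\pi i}{i\pi+\log\alpha}+\mathcal O(\epsilon)\quad(\epsilon\to0-).$$ -/

import Mathlib

open MeasureTheory Filter Set
open scoped Topology ContDiff

noncomputable section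

namespace InternalWaves

/-- The linear functions `ℓ^±(x, lam) = ± x₁ / lam + x₂ / √(1 - lam²)`, the sign being `s`. -/
def ell (s : ℤˣ) (lam : ℝ) (x : ℝ × ℝ) : ℝ :=
  ((s : ℤ) : ℝ) * (x.1 / lam) + x.2 / Real.sqrt (1 - lam ^ 2)

/-- `x` is a smooth boundary point of `Ω`: near `x`, `Ω` is the positivity set of a smooth
function with nonzero differential at `x`. -/
def IsSmoothBoundaryPoint (Ω : Set (ℝ × ℝ)) (x : ℝ × ℝ) : Prop :=
  x ∈ frontier Ω ∧ ∃ φ : ℝ × ℝ → ℝ, ContDiff ℝ ∞ φ ∧ fderiv ℝ φ x ≠ 0 ∧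
    ∃ U ∈ 𝓝 x, Ω ∩ U = {y | 0 < φ y} ∩ U

/-- `x` is a straight corner of `Ω`: near `x`, `Ω` is an open sector with apex `x` of opening
less than `π`, or the complement of a closed such sector. -/
def IsStraightCorner (Ω : Set (ℝ × ℝ)) (x : ℝ × ℝ) : Prop :=
  ∃ v₁ v₂ : ℝ × ℝ, LinearIndependent ℝ ![v₁, v₂] ∧ ∃ U ∈ 𝓝 x,
    (Ω ∩ U = {y | ∃ a b : ℝ, 0 < a ∧ 0 < b ∧ y = x + a • v₁ + b • v₂} ∩ U ∨
      Ω ∩ U = {y | ∃ a b : ℝ, 0 ≤ a ∧ 0 ≤ b ∧ y = x + a • v₁ + b • v₂}ᶜ ∩ U)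

/-- The set of corners: the boundary points at which the boundary fails to be smooth. -/
def corners (Ω : Set (ℝ × ℝ)) : Set (ℝ × ℝ) :=
  {x | x ∈ frontier Ω ∧ ¬ IsSmoothBoundaryPoint Ω x}

/-- Bounded open sets whose boundary is smooth except for straight corners. -/
structure IsStraightCornerDomain (Ω : Set (ℝ × ℝ)) : Prop where
  isOpen : IsOpen Ω
  isBounded : Bornology.IsBounded Ω
  straight : ∀ x ∈ corners Ω, IsStraightCorner Ω x

/-- `κ` is a type-`(μ, ν)` characteristic corner of `Ω` with respect to `lam`, with parameters
`αm = α₋` and `αp = α₊`; its characteristic ratio is `αp / αm`. -/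
structure IsCornerOfType (Ω : Set (ℝ × ℝ)) (lam : ℝ) (κ : ℝ × ℝ) (μ ν : ℤˣ)
    (αm αp : ℝ) : Prop where
  mem_corners : κ ∈ corners Ω
  αm_pos : 0 < αm
  αp_pos : 0 < αp
  side : ∀ x ∈ Ω, 0 ≤ ((μ : ℤ) : ℝ) * ell (-ν) lam (x - κ)
  boundary : ∃ U ∈ 𝓝 κ, ∃ δ > 0,
    U ∩ frontier Ω =
      {x | ell ν lam (x - κ) = -αm * ell (-ν) lam (x - κ) ∧
        ((μ : ℤ) : ℝ) * ell ν lam (x - κ) ∈ Ioc (-δ) 0} ∪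
      {x | ell ν lam (x - κ) = αp * ell (-ν) lam (x - κ) ∧
        ((μ : ℤ) : ℝ) * ell ν lam (x - κ) ∈ Ico 0 δ}

/-- The blow-down map near a type-`(μ, ν)` corner `κ`, in the blown-up coordinates
`r = μ ℓ^{-ν}(x - κ)`, `τ = ℓ^ν(x - κ) / ℓ^{-ν}(x - κ)` (see `ell_neg_blowdown`, `ell_blowdown`).
The front face is `{r = 0}`. -/
def blowdown (lam : ℝ) (κ : ℝ × ℝ) (μ ν : ℤˣ) (p : ℝ × ℝ) : ℝ × ℝ :=
  κ + (((ν : ℤ) : ℝ) * ((μ : ℤ) : ℝ) * lam * p.1 * (p.2 - 1) / 2,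
    ((μ : ℤ) : ℝ) * Real.sqrt (1 - lam ^ 2) * p.1 * (p.2 + 1) / 2)

theorem ell_neg_blowdown {lam : ℝ} (h0 : 0 < lam) (h1 : lam < 1) (κ : ℝ × ℝ) (μ ν : ℤˣ)
    (r τ : ℝ) :
    ((μ : ℤ) : ℝ) * ell (-ν) lam (blowdown lam κ μ ν (r, τ) - κ) = r := by
  have hs : Real.sqrt (1 - lam ^ 2) ≠ 0 := (Real.sqrt_pos.2 (by nlinarith)).ne'
  rcases Int.units_eq_one_or μ with rfl | rfl <;> rcases Int.units_eq_one_or ν with rfl | rfl <;>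
    simp [ell, blowdown] <;> field_simp <;> ring

theorem ell_blowdown {lam : ℝ} (h0 : 0 < lam) (h1 : lam < 1) (κ : ℝ × ℝ) (μ ν : ℤˣ)
    (r τ : ℝ) :
    ell ν lam (blowdown lam κ μ ν (r, τ) - κ) =
      τ * ell (-ν) lam (blowdown lam κ μ ν (r, τ) - κ) := by
  have hs : Real.sqrt (1 - lam ^ 2) ≠ 0 := (Real.sqrt_pos.2 (by nlinarith)).ne'
  rcases Int.units_eq_one_or μ with rfl | rfl <;> rcases Int.units_eq_one_or ν with rfl | rfl <;>
    simp [ell, blowdown] <;> field_simp <;> ring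

/-- Smooth complex-valued functions with compact support contained in `Ω`. -/
structure IsTestFunction (Ω : Set (ℝ × ℝ)) (φ : ℝ × ℝ → ℂ) : Prop where
  contDiff : ContDiff ℝ ∞ φ
  hasCompactSupport : HasCompactSupport φ
  tsupport_subset : tsupport φ ⊆ Ω

def partial₁ (φ : ℝ × ℝ → ℂ) (x : ℝ × ℝ) : ℂ := fderiv ℝ φ x (1, 0)

def partial₂ (φ : ℝ × ℝ → ℂ) (x : ℝ × ℝ) : ℂ := fderiv ℝ φ x (0, 1)

/-- `u ∈ H¹₀(Ω)` with weak gradient `(g₁, g₂)`: `u` is a limit in `H¹(Ω)` of test functions. -/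
structure IsH10 (Ω : Set (ℝ × ℝ)) (u g₁ g₂ : ℝ × ℝ → ℂ) : Prop where
  memLp : MemLp u 2 (volume.restrict Ω)
  memLp₁ : MemLp g₁ 2 (volume.restrict Ω)
  memLp₂ : MemLp g₂ 2 (volume.restrict Ω)
  approx : ∃ φ : ℕ → ℝ × ℝ → ℂ, (∀ n, IsTestFunction Ω (φ n)) ∧
    Tendsto (fun n => eLpNorm (fun x => φ n x - u x) 2 (volume.restrict Ω)) atTop (𝓝 0) ∧
    Tendsto (fun n => eLpNorm (fun x => partial₁ (φ n) x - g₁ x) 2 (volume.restrict Ω))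
      atTop (𝓝 0) ∧
    Tendsto (fun n => eLpNorm (fun x => partial₂ (φ n) x - g₂ x) 2 (volume.restrict Ω))
      atTop (𝓝 0)

/-- `u ∈ H¹₀(Ω)` is a weak solution of the Dirichlet problem `P(om) u = f`, `u = 0` on `∂Ω`, where
`P(om) = (1 - om²) ∂₂² - om² ∂₁²`. -/
def IsDirichletSolution (Ω : Set (ℝ × ℝ)) (om : ℂ) (f u : ℝ × ℝ → ℂ) : Prop :=
  ∃ g₁ g₂ : ℝ × ℝ → ℂ, IsH10 Ω u g₁ g₂ ∧
    ∀ ψ : ℝ × ℝ → ℂ, IsTestFunction Ω ψ →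
      ∫ x in Ω, (om ^ 2 * g₁ x * partial₁ ψ x - (1 - om ^ 2) * g₂ x * partial₂ ψ x) =
        ∫ x in Ω, f x * ψ x

/-- `v(r, τ)`, defined for small `r > 0` and `τ ∈ [a, b]`, is polyhomogeneous conormal to
`{r = 0}`, smoothly up to `τ = a` and `τ = b`, with expansion `v ∼ ∑_{k ≥ 1} r^{l k} w_k(τ)`:
the remainder after `K` terms is `O(r^{(K + 1) Re l})`, together with all its derivatives of the
form `(r ∂_r)^i ∂_τ^j`. -/
def HasPolyhomExpansion (v : ℝ × ℝ → ℂ) (a b : ℝ) (l : ℂ) (w : ℕ → ℝ → ℂ) : Prop :=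
  ∃ δ > 0, ContDiffOn ℝ ∞ v (Ioo 0 δ ×ˢ Icc a b) ∧
    ∀ K i j : ℕ, ∃ C : ℝ, ∀ r ∈ Ioo 0 δ, ∀ τ ∈ Icc a b,
      ‖iteratedDeriv i (fun ρ : ℝ => iteratedDerivWithin j
          (fun t : ℝ => v (ρ, t) - ∑ k ∈ Finset.Icc 1 K, (ρ : ℂ) ^ (l * k) * w k t)
          (Icc a b) τ) r‖ ≤ C * r ^ (l.re * (K + 1) - i)

end InternalWaves

end

namespace InternalWaves

noncomputable section

/-! Write ω = λ + iε and choose b with b² = 1 − ω². Then P(ω) = (−ω∂₁ + b∂₂)(ω∂₁ + b∂₂). For ε ≠ 0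
one has Im(b ω̄) ≠ 0, so each factor is elliptic: it is a ∂̄-operator for one of the two complex
coordinates z₊ = b x₁ + ω x₂ and z₋ = b x₁ − ω x₂ of the plane. Interior smoothness follows by
applying the Cauchy–Pompeiu formula to one factor after the other (`exists_contDiff_of_weak`,
`exists_smooth_solution`). Where f = 0 the differential splits as du = V₊(z₊) dz₊ + V₋(z₋) dz₋ with
V₊ and V₋ holomorphic (`IsSmoothSolution.fderiv_eq`). Primitives then give u = F + G locally, with F
holomorphic in z₊ and G in z₋, and the Dirichlet condition becomes F = −G on the boundary.

At a smooth boundary point, membership in H¹₀ yields, through a Poincaré inequality and interior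
estimates, that u and the distance to the boundary times ∇u tend to zero (`boundary_decay`). Almost
analytic extensions of a boundary curve in the two coordinates carry F to the upper side of a line
and −G to the lower side. The glued function has no jump, and its ∂̄-derivative is a factor blowing
up like the inverse distance times a high power of the distance, hence is C^m once the extension has
order m + 2 (`contDiffOn_flatFun`). By `weak_of_glue` the equation holds weakly across the line, so
interior regularity gives C^m up to the boundary (`exists_glued`, `exists_extension`). As m is
arbitrary, u is smooth there.

At a corner Ω is a sector with edges e₁ and e₂. Put q = z₊(e₂)/z₊(e₁) and q' = z₋(e₂)/z₋(e₁),
arranged so that Im q > 0 > Im q'. In the coordinate log(z₊/z₊(e₁)) the sector is a strip 0 ≤ Im ≤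
arg q carrying F; in log(z₋/z₋(e₁)) it is a strip arg q' ≤ Im ≤ 0 carrying −G. The boundary
condition on e₁ matches them along the real axis; on e₂ it matches the two outer edges up to
translation by P = log q − log q'. Both are thus pieces of one P-periodic holomorphic function
(`exists_periodic_extension`). With l P = 2πi it is a function N of e^{lζ}, and a bound on its
derivative makes the singularity of N at 0 removable (`exists_factor_exp`). Hence u =
N((z₊/z₊(e₁))^l) − N((z₋/z₋(e₁))^l) near the corner (`exists_wedge_representation`), and the Taylor
series of N is the expansion: w_k is a Taylor coefficient times the difference of the k-th powers of
two functions of τ. These agree at τ = −α₋, where both are 1, and at τ = α₊, because l P = 2πi.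

The exponent is l = 2πi/P. Here b = σ ω √(1 − λ²)/λ with σ → 1 as ε → 0, so one edge ratio tends to
−α₊/α₋ and the other to 1. The sign of ε decides from which side of the branch cut the former is
approached, which produces the two limits of the exponent (`exists_slope`, `cornerExponent_isBigO`).
-/

/-! ### First order elliptic operators with constant coefficients -/

/-- The constant coefficient operator `p ∂₁ + q ∂₂`. -/
def dOp (p q : ℂ) (g : ℝ × ℝ → ℂ) (x : ℝ × ℝ) : ℂ := p * partial₁ g x + q * partial₂ g x

/-- The linear function `q x₁ - p x₂`, which is annihilated by `dOp p q`. -/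
def dLin (p q : ℂ) (x : ℝ × ℝ) : ℂ := q * x.1 - p * x.2

/-- Up to a constant factor, the fundamental solution of `dOp p q`. -/
def dKer (p q : ℂ) (x : ℝ × ℝ) : ℂ := (dLin p q x)⁻¹

/-- Multiplying by the conjugate of p or q and taking the imaginary part isolates x₁ or x₂, with the
factor Im(q p̄): ellipticity says exactly that p and q are independent over ℝ. -/
theorem dLin_lower_bound {p q : ℂ} (h : (q * (starRingEnd ℂ) p).im ≠ 0) :
    ∃ c > 0, ∀ x : ℝ × ℝ, c * ‖x‖ ≤ ‖dLin p q x‖ := by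
  set d := (q * (starRingEnd ℂ) p).im with hd
  have hM : 0 < ‖p‖ + ‖q‖ := by
    rcases eq_or_ne p 0 with rfl | hp
    · simp [hd] at h
    · have := norm_pos_iff.2 hp
      positivity
  refine ⟨|d| / (‖p‖ + ‖q‖), by positivity, fun x => ?_⟩
  have h1 : (dLin p q x * (starRingEnd ℂ) p).im = d * x.1 := by
    simp [dLin, hd]; ring
  have h2 : (dLin p q x * (starRingEnd ℂ) q).im = d * x.2 := by
    simp [dLin, hd]; ring
  have e1 : |d| * |x.1| ≤ ‖dLin p q x‖ * (‖p‖ + ‖q‖) := by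
    rw [← abs_mul, ← h1]
    refine (Complex.abs_im_le_norm _).trans ?_
    rw [norm_mul, RCLike.norm_conj]
    gcongr
    linarith [norm_nonneg q]
  have e2 : |d| * |x.2| ≤ ‖dLin p q x‖ * (‖p‖ + ‖q‖) := by
    rw [← abs_mul, ← h2]
    refine (Complex.abs_im_le_norm _).trans ?_
    rw [norm_mul, RCLike.norm_conj]
    gcongr
    linarith [norm_nonneg p]
  rw [div_mul_eq_mul_div, div_le_iff₀ hM, Prod.norm_def]
  rcases max_choice ‖x.1‖ ‖x.2‖ with h | h <;> rw [h] <;> assumption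

theorem dLin_ne_zero {p q : ℂ} (h : (q * (starRingEnd ℂ) p).im ≠ 0) {x : ℝ × ℝ} (hx : x ≠ 0) :
    dLin p q x ≠ 0 := by
  obtain ⟨c, hc, hb⟩ := dLin_lower_bound h
  have := hb x
  have h2 := norm_pos_iff.2 hx
  exact norm_pos_iff.1 (lt_of_lt_of_le (by positivity) this)

theorem continuous_dLin (p q : ℂ) : Continuous (dLin p q) := by
  unfold dLin; fun_prop

theorem contDiff_dLin (p q : ℂ) {n : WithTop ℕ∞} : ContDiff ℝ n (dLin p q) := by
  have h1 : ContDiff ℝ n (fun x : ℝ × ℝ => (x.1 : ℂ)) :=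
    Complex.ofRealCLM.contDiff.comp contDiff_fst
  have h2 : ContDiff ℝ n (fun x : ℝ × ℝ => (x.2 : ℂ)) :=
    Complex.ofRealCLM.contDiff.comp contDiff_snd
  exact (contDiff_const.mul h1).sub (contDiff_const.mul h2)

theorem measurable_dKer (p q : ℂ) : Measurable (dKer p q) :=
  (continuous_dLin p q).measurable.inv

theorem dKer_neg (p q : ℂ) (x : ℝ × ℝ) : dKer p q (-x) = - dKer p q x := by
  unfold dKer; rw [← inv_neg]; congr 1; simp [dLin]; ring

theorem norm_dKer_le {p q : ℂ} (h : (q * (starRingEnd ℂ) p).im ≠ 0) :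
    ∃ C > 0, ∀ x : ℝ × ℝ, ‖dKer p q x‖ ≤ C * ‖x‖⁻¹ := by
  obtain ⟨c, hc, hb⟩ := dLin_lower_bound h
  refine ⟨c⁻¹, by positivity, fun x => ?_⟩
  rcases eq_or_ne x 0 with rfl | hx
  · simp [dKer, dLin]
  · have h2 := norm_pos_iff.2 hx
    rw [dKer, norm_inv, ← mul_inv]
    exact inv_anti₀ (by positivity) (hb x)

/-- The kernel is at most of size 1/‖x‖, which the area element of the plane absorbs. -/
theorem locallyIntegrable_dKer {p q : ℂ} (h : (q * (starRingEnd ℂ) p).im ≠ 0) :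
    LocallyIntegrable (dKer p q) := by
  obtain ⟨C, hC, hb⟩ := norm_dKer_le h
  have key : ∀ R : ℝ, IntegrableOn (fun x : ℝ × ℝ => ‖x‖⁻¹) (Metric.ball 0 R) := by
    intro R
    rw [integrableOn_fun_norm_addHaar volume (f := fun t : ℝ => t⁻¹)]
    have : IntegrableOn (fun _ : ℝ => (1 : ℝ)) (Ioo 0 R) := by
      simp
    refine this.congr_fun ?_ measurableSet_Ioo
    intro y hy
    have : y ≠ 0 := hy.1.ne'
    simp [this]
  intro x
  refine ⟨Metric.ball 0 (‖x‖ + 1), Metric.isOpen_ball.mem_nhds (by simp), ?_⟩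
  refine ((key _).const_mul C).mono' (measurable_dKer p q).aestronglyMeasurable ?_
  exact Eventually.of_forall hb

/-- The constant in the Cauchy–Pompeiu formula for `dOp p q`. -/
def dConst (p q : ℂ) : ℂ :=
  ∫ θ in (-Real.pi)..Real.pi, (p * Real.cos θ + q * Real.sin θ) / (q * Real.cos θ - p * Real.sin θ)

theorem dLin_circle_ne_zero {p q : ℂ} (h : (q * (starRingEnd ℂ) p).im ≠ 0) (θ : ℝ) :
    q * Real.cos θ - p * Real.sin θ ≠ 0 := by
  refine dLin_ne_zero h (x := (Real.cos θ, Real.sin θ)) fun h0 => ?_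
  have h1 := congrArg Prod.fst h0
  have h2 := congrArg Prod.snd h0
  simp only [Prod.fst_zero, Prod.snd_zero] at h1 h2
  have := Real.sin_sq_add_cos_sq θ
  rw [h1, h2] at this
  norm_num at this

theorem continuous_circle_quotient {p q : ℂ} (h : (q * (starRingEnd ℂ) p).im ≠ 0) :
    Continuous fun θ : ℝ =>
      (p * Real.cos θ + q * Real.sin θ) / (q * Real.cos θ - p * Real.sin θ) := by
  refine Continuous.div (by fun_prop) (by fun_prop) (dLin_circle_ne_zero h)

/-- The imaginary part of the integrand is −Im(q p̄) over a positive quantity, so it has a constant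
sign. The value of the constant is never needed. -/
theorem dConst_ne_zero {p q : ℂ} (h : (q * (starRingEnd ℂ) p).im ≠ 0) : dConst p q ≠ 0 := by
  set d := (q * (starRingEnd ℂ) p).im with hd
  set Q : ℝ → ℂ := fun θ =>
    (p * Real.cos θ + q * Real.sin θ) / (q * Real.cos θ - p * Real.sin θ) with hQ
  have hc : Continuous Q := continuous_circle_quotient h
  have him : ∀ θ, (Q θ).im = -d / Complex.normSq (q * Real.cos θ - p * Real.sin θ) := by
    intro θ
    have hs := Real.sin_sq_add_cos_sq θ
    have hn : Complex.normSq (q * Real.cos θ - p * Real.sin θ) ≠ 0 := by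
      rw [Ne, Complex.normSq_eq_zero]; exact dLin_circle_ne_zero h θ
    simp only [hQ, Complex.div_im]
    rw [div_sub_div_same]
    congr 1
    simp [hd, -Complex.ofReal_cos, -Complex.ofReal_sin]
    linear_combination (p.im * q.re - p.re * q.im) * hs
  have hcim : Continuous fun θ => (Q θ).im := Complex.continuous_im.comp hc
  have hint : (dConst p q).im = ∫ θ in (-Real.pi)..Real.pi, (Q θ).im := by
    have := (Complex.imCLM.intervalIntegral_comp_comm
      (hc.intervalIntegrable (μ := volume) (-Real.pi) Real.pi))
    exact this.symm
  have hpos : 0 < ∫ θ in (-Real.pi)..Real.pi, -(d * (Q θ).im) := by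
    refine intervalIntegral.intervalIntegral_pos_of_pos ?_ ?_ (by linarith [Real.pi_pos])
    · exact ((continuous_const.mul hcim).neg).intervalIntegrable _ _
    · intro θ
      rw [him]
      have hn : 0 < Complex.normSq (q * Real.cos θ - p * Real.sin θ) := by
        rw [Complex.normSq_pos]; exact dLin_circle_ne_zero h θ
      have : 0 < d * d := mul_self_pos.2 h
      rw [show -(d * (-d / Complex.normSq (q * Real.cos θ - p * Real.sin θ))) =
        d * d / Complex.normSq (q * Real.cos θ - p * Real.sin θ) by ring]
      positivity
  intro h0
  rw [intervalIntegral.integral_neg, intervalIntegral.integral_const_mul, ← hint, h0] at hpos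
  simp at hpos

theorem hasCompactSupport_comp_radial {G : ℝ × ℝ → ℂ} (hG : HasCompactSupport G) (θ : ℝ) :
    HasCompactSupport fun ρ : ℝ => G (ρ * Real.cos θ, ρ * Real.sin θ) := by
  obtain ⟨R, hR⟩ := hG.isCompact.isBounded.exists_norm_le
  refine HasCompactSupport.of_support_subset_isCompact (isCompact_Icc (a := -(2 * |R|)) (b := 2 * |R|)) ?_
  intro ρ hρ
  have h1 := hR _ (subset_tsupport _ hρ)
  have h2 : |ρ * Real.cos θ| ≤ |R| := (norm_fst_le (ρ * Real.cos θ, ρ * Real.sin θ)).trans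
    (h1.trans (le_abs_self R))
  have h3 : |ρ * Real.sin θ| ≤ |R| := (norm_snd_le (ρ * Real.cos θ, ρ * Real.sin θ)).trans
    (h1.trans (le_abs_self R))
  have h4 : ρ ^ 2 ≤ (2 * |R|) ^ 2 := by
    have e1 := sq_le_sq.2 (h2.trans (le_abs_self |R|))
    have e2 := sq_le_sq.2 (h3.trans (le_abs_self |R|))
    have := Real.sin_sq_add_cos_sq θ
    nlinarith
  have := abs_le_of_sq_le_sq h4 (by positivity)
  exact abs_le.1 this

theorem hasDerivAt_radial {G : ℝ × ℝ → ℂ} (hG : ContDiff ℝ 1 G) (θ ρ : ℝ) :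
    HasDerivAt (fun ρ : ℝ => G (ρ * Real.cos θ, ρ * Real.sin θ))
      (Real.cos θ * partial₁ G (ρ * Real.cos θ, ρ * Real.sin θ)
        + Real.sin θ * partial₂ G (ρ * Real.cos θ, ρ * Real.sin θ)) ρ := by
  have h1 : HasDerivAt (fun ρ : ℝ => (ρ * Real.cos θ, ρ * Real.sin θ))
      (Real.cos θ, Real.sin θ) ρ := by
    have e1 := (hasDerivAt_id ρ).mul_const (Real.cos θ)
    have e2 := (hasDerivAt_id ρ).mul_const (Real.sin θ)
    simpa using e1.prodMk e2
  have h2 := ((hG.differentiable one_ne_zero _).hasFDerivAt).comp_hasDerivAt ρ h1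
  refine h2.congr_deriv ?_
  unfold partial₁ partial₂
  rw [show (Real.cos θ, Real.sin θ) = Real.cos θ • ((1 : ℝ), (0 : ℝ)) + Real.sin θ • ((0 : ℝ), (1 : ℝ)) by
    simp, map_add, map_smul, map_smul]
  simp

theorem hasDerivAt_angular {G : ℝ × ℝ → ℂ} (hG : ContDiff ℝ 1 G) (ρ θ : ℝ) :
    HasDerivAt (fun θ : ℝ => G (ρ * Real.cos θ, ρ * Real.sin θ))
      (ρ * (-Real.sin θ * partial₁ G (ρ * Real.cos θ, ρ * Real.sin θ)
        + Real.cos θ * partial₂ G (ρ * Real.cos θ, ρ * Real.sin θ))) θ := by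
  have h1 : HasDerivAt (fun θ : ℝ => (ρ * Real.cos θ, ρ * Real.sin θ))
      (ρ * -Real.sin θ, ρ * Real.cos θ) θ :=
    ((Real.hasDerivAt_cos θ).const_mul ρ).prodMk ((Real.hasDerivAt_sin θ).const_mul ρ)
  have h2 := ((hG.differentiable one_ne_zero _).hasFDerivAt).comp_hasDerivAt θ h1
  refine h2.congr_deriv ?_
  unfold partial₁ partial₂
  rw [show (ρ * -Real.sin θ, ρ * Real.cos θ) = (ρ * -Real.sin θ) • ((1 : ℝ), (0 : ℝ))
    + (ρ * Real.cos θ) • ((0 : ℝ), (1 : ℝ)) by simp, map_add, map_smul, map_smul]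
  simp
  ring

theorem continuous_partial₁ {G : ℝ × ℝ → ℂ} (hG : ContDiff ℝ 1 G) : Continuous (partial₁ G) :=
  (hG.continuous_fderiv one_ne_zero).clm_apply continuous_const

theorem continuous_partial₂ {G : ℝ × ℝ → ℂ} (hG : ContDiff ℝ 1 G) : Continuous (partial₂ G) :=
  (hG.continuous_fderiv one_ne_zero).clm_apply continuous_const

theorem hasCompactSupport_partial₁ {G : ℝ × ℝ → ℂ} (hG : HasCompactSupport G) :
    HasCompactSupport (partial₁ G) := hG.fderiv_apply ℝ _

theorem hasCompactSupport_partial₂ {G : ℝ × ℝ → ℂ} (hG : HasCompactSupport G) :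
    HasCompactSupport (partial₂ G) := hG.fderiv_apply ℝ _

/-- A bounded expression in polar coordinates that is a continuous function of the angle times
a continuous compactly supported function of the point is integrable. -/
theorem integrableOn_polar {g : ℝ × ℝ → ℂ} (hg : Continuous g) (hc : HasCompactSupport g)
    {a : ℝ → ℂ} (ha : Continuous a) :
    IntegrableOn (fun x : ℝ × ℝ => a x.2 * g (x.1 * Real.cos x.2, x.1 * Real.sin x.2))
      (Ioi 0 ×ˢ Ioo (-Real.pi) Real.pi) := by
  obtain ⟨R, hR⟩ := hc.isCompact.isBounded.exists_norm_le
  have hcont : Continuous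
      (fun x : ℝ × ℝ => a x.2 * g (x.1 * Real.cos x.2, x.1 * Real.sin x.2)) := by fun_prop
  have h1 : IntegrableOn (fun x : ℝ × ℝ => a x.2 * g (x.1 * Real.cos x.2, x.1 * Real.sin x.2))
      (Icc 0 (2 * |R|) ×ˢ Icc (-Real.pi) Real.pi) :=
    hcont.continuousOn.integrableOn_compact (isCompact_Icc.prod isCompact_Icc)
  have hsub : Ioi 0 ×ˢ Ioo (-Real.pi) Real.pi ⊆
      (Icc 0 (2 * |R|) ×ˢ Icc (-Real.pi) Real.pi) ∪
        (Ioi (2 * |R|) ×ˢ Ioo (-Real.pi) Real.pi) := by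
    rintro ⟨ρ, θ⟩ ⟨h1, h2⟩
    rcases le_or_gt ρ (2 * |R|) with h | h
    · exact Or.inl ⟨⟨le_of_lt h1, h⟩, Ioo_subset_Icc_self h2⟩
    · exact Or.inr ⟨h, h2⟩
  refine (h1.union ?_).mono_set hsub
  refine (integrableOn_zero (ε' := ℂ)).congr_fun ?_ (measurableSet_Ioi.prod measurableSet_Ioo)
  rintro ⟨ρ, θ⟩ ⟨h1, -⟩
  have hz : g (ρ * Real.cos θ, ρ * Real.sin θ) = 0 := by
    by_contra hne
    have h1' : 2 * |R| < ρ := h1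
    have h0 := hR _ (subset_tsupport _ hne)
    have h2 : |ρ * Real.cos θ| ≤ |R| := (norm_fst_le (ρ * Real.cos θ, ρ * Real.sin θ)).trans
      (h0.trans (le_abs_self R))
    have h3 : |ρ * Real.sin θ| ≤ |R| := (norm_snd_le (ρ * Real.cos θ, ρ * Real.sin θ)).trans
      (h0.trans (le_abs_self R))
    have e1 := sq_le_sq.2 (h2.trans (le_abs_self |R|))
    have e2 := sq_le_sq.2 (h3.trans (le_abs_self |R|))
    have h5 : ρ ^ 2 = (ρ * Real.cos θ) ^ 2 + (ρ * Real.sin θ) ^ 2 := by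
      linear_combination -ρ ^ 2 * Real.sin_sq_add_cos_sq θ
    have h6 : (2 * |R|) ^ 2 < ρ ^ 2 := pow_lt_pow_left₀ h1' (by positivity) two_ne_zero
    nlinarith [sq_nonneg |R|]
  simp [hz]

/-- The Cauchy–Pompeiu formula at the origin. -/
theorem integral_dKer_mul_dOp {p q : ℂ} (h : (q * (starRingEnd ℂ) p).im ≠ 0)
    {G : ℝ × ℝ → ℂ} (hG : ContDiff ℝ 1 G) (hc : HasCompactSupport G) :
    ∫ y, dKer p q y * dOp p q G y = -(dConst p q) * G 0 := by
  rw [← integral_comp_polarCoord_symm]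
  set Q : ℝ → ℂ := fun θ =>
    (p * Real.cos θ + q * Real.sin θ) / (q * Real.cos θ - p * Real.sin θ) with hQ
  have hQc : Continuous Q := continuous_circle_quotient h
  set X : ℝ × ℝ → ℝ × ℝ := fun x => (x.1 * Real.cos x.2, x.1 * Real.sin x.2) with hX
  -- The polar Jacobian cancels the pole of the kernel. What remains is `I₁`, a function of the
  -- angle times the radial derivative of G, and `I₂`, the angular derivative divided by the radius.
  -- The former integrates to −Q G(0) along each ray, the latter to zero around each circle.
  set I₁ : ℝ × ℝ → ℂ := fun x => Q x.2 * (Real.cos x.2 * partial₁ G (X x) +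
    Real.sin x.2 * partial₂ G (X x))
  set I₂ : ℝ × ℝ → ℂ := fun x => -Real.sin x.2 * partial₁ G (X x) +
    Real.cos x.2 * partial₂ G (X x)
  have hT : MeasurableSet (Ioi (0 : ℝ) ×ˢ Ioo (-Real.pi) Real.pi) :=
    measurableSet_Ioi.prod measurableSet_Ioo
  have hP1 := continuous_partial₁ hG
  have hP2 := continuous_partial₂ hG
  have hS1 := hasCompactSupport_partial₁ hc
  have hS2 := hasCompactSupport_partial₂ hc
  have hI₁ : IntegrableOn I₁ (Ioi 0 ×ˢ Ioo (-Real.pi) Real.pi) := by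
    have e1 := integrableOn_polar hP1 hS1 (a := fun θ => Q θ * Real.cos θ) (by fun_prop)
    have e2 := integrableOn_polar hP2 hS2 (a := fun θ => Q θ * Real.sin θ) (by fun_prop)
    refine (e1.add e2).congr_fun (fun x _ => ?_) hT
    simp only [I₁, Pi.add_apply, hX]; ring
  have hI₂ : IntegrableOn I₂ (Ioi 0 ×ˢ Ioo (-Real.pi) Real.pi) := by
    have e1 := integrableOn_polar hP1 hS1 (a := fun θ => -Real.sin θ) (by fun_prop)
    have e2 := integrableOn_polar hP2 hS2 (a := fun θ => Real.cos θ) (by fun_prop)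
    exact e1.add e2
  have hsplit : ∫ x in polarCoord.target,
      x.1 • (dKer p q (polarCoord.symm x) * dOp p q G (polarCoord.symm x)) =
      ∫ x in Ioi 0 ×ˢ Ioo (-Real.pi) Real.pi, (I₁ x + I₂ x) := by
    refine setIntegral_congr_fun hT ?_
    rintro ⟨ρ, θ⟩ ⟨hρ, -⟩
    have hρ' : (ρ : ℂ) ≠ 0 := by exact_mod_cast (ne_of_gt hρ)
    have hB := dLin_circle_ne_zero h θ
    have hs : (Real.sin θ : ℂ) ^ 2 + (Real.cos θ : ℂ) ^ 2 = 1 := by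
      exact_mod_cast Real.sin_sq_add_cos_sq θ
    simp only [polarCoord_symm_apply, I₁, I₂, hQ, dKer, dOp, dLin, hX, Complex.real_smul]
    set a := partial₁ G (ρ * Real.cos θ, ρ * Real.sin θ)
    set b := partial₂ G (ρ * Real.cos θ, ρ * Real.sin θ)
    rw [show q * ((ρ * Real.cos θ : ℝ) : ℂ) - p * ((ρ * Real.sin θ : ℝ) : ℂ) =
      ρ * (q * Real.cos θ - p * Real.sin θ) by push_cast; ring]
    field_simp
    linear_combination -(p * a + q * b) * hs
  rw [hsplit, integral_add hI₁ hI₂]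
  have hA : ∫ x in Ioi 0 ×ˢ Ioo (-Real.pi) Real.pi, I₁ x = -(dConst p q) * G 0 := by
    rw [Measure.volume_eq_prod, ← setIntegral_prod_swap,
      setIntegral_prod (fun z => I₁ z.swap) hI₁.swap]
    have : ∀ θ : ℝ, ∫ ρ in Ioi (0 : ℝ), I₁ (Prod.swap (θ, ρ)) = Q θ * (-G 0) := by
      intro θ
      simp only [I₁, Prod.swap, hX]
      rw [integral_const_mul]
      congr 1
      have hd := funext fun ρ => (hasDerivAt_radial hG θ ρ).deriv
      have := (hasCompactSupport_comp_radial hc θ).integral_Ioi_deriv_eq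
        (hG.comp ((contDiff_id.mul contDiff_const).prodMk (contDiff_id.mul contDiff_const))) 0
      simp only [Function.comp_def, id] at this
      rw [hd] at this
      rw [this]; simp [Prod.zero_eq_mk]
    simp only [this]
    rw [integral_mul_const, ← integral_Ioc_eq_integral_Ioo,
      ← intervalIntegral.integral_of_le (by linarith [Real.pi_pos])]
    simp only [dConst, hQ]; ring
  have hB : ∫ x in Ioi 0 ×ˢ Ioo (-Real.pi) Real.pi, I₂ x = 0 := by
    rw [Measure.volume_eq_prod, setIntegral_prod _ (by simpa [← Measure.volume_eq_prod] using hI₂)]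
    refine integral_eq_zero_of_ae ?_
    filter_upwards [self_mem_ae_restrict measurableSet_Ioi] with ρ hρ
    have hρ' : (ρ : ℂ) ≠ 0 := by exact_mod_cast (ne_of_gt hρ)
    rw [← integral_Ioc_eq_integral_Ioo,
      ← intervalIntegral.integral_of_le (by linarith [Real.pi_pos])]
    have := intervalIntegral.integral_eq_sub_of_hasDerivAt
      (fun θ _ => hasDerivAt_angular hG ρ θ) (a := -Real.pi) (b := Real.pi)
      (Continuous.intervalIntegrable (by fun_prop) _ _)
    rw [intervalIntegral.integral_const_mul] at this
    simp only [Real.cos_neg, Real.sin_neg, Real.sin_pi, neg_zero, sub_self, mul_eq_zero, hρ',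
      false_or] at this
    exact this
  rw [hA, hB, add_zero]

/-! ### Potentials and interior regularity for first order operators -/

open scoped Convolution

/-- The convolution of `g` with the kernel of `dOp p q`. -/
def dPot (p q : ℂ) (g : ℝ × ℝ → ℂ) (x : ℝ × ℝ) : ℂ := ∫ y, dKer p q y * g (x - y)

theorem dPot_eq_convolution (p q : ℂ) (g : ℝ × ℝ → ℂ) :
    dPot p q g = (dKer p q ⋆[ContinuousLinearMap.mul ℝ ℂ, volume] g) := by
  ext x; simp [dPot, convolution_def]

theorem dPot_eq_integral (p q : ℂ) (g : ℝ × ℝ → ℂ) (x : ℝ × ℝ) :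
    dPot p q g x = ∫ z, dKer p q (x - z) * g z := by
  rw [dPot, ← integral_sub_left_eq_self _ volume x]
  simp

theorem dOp_mul {p q : ℂ} {f g : ℝ × ℝ → ℂ} {x : ℝ × ℝ} (hf : DifferentiableAt ℝ f x)
    (hg : DifferentiableAt ℝ g x) :
    dOp p q (fun y => f y * g y) x = f x * dOp p q g x + g x * dOp p q f x := by
  simp only [dOp, partial₁, partial₂]
  rw [fderiv_fun_mul hf hg]
  simp
  ring

theorem continuous_dOp {p q : ℂ} {g : ℝ × ℝ → ℂ} (hg : ContDiff ℝ 1 g) :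
    Continuous (dOp p q g) :=
  (continuous_const.mul (continuous_partial₁ hg)).add (continuous_const.mul (continuous_partial₂ hg))

theorem tsupport_dOp_subset {p q : ℂ} {g : ℝ × ℝ → ℂ} : tsupport (dOp p q g) ⊆ tsupport g := by
  refine closure_minimal (fun x hx => ?_) (isClosed_tsupport g)
  by_contra h
  have : fderiv ℝ g x = 0 := by
    have := (notMem_tsupport_iff_eventuallyEq.1 h).fderiv_eq (𝕜 := ℝ)
    rw [this]; exact fderiv_const_apply _
  apply hx
  simp [dOp, partial₁, partial₂, this]

theorem hasCompactSupport_dOp {p q : ℂ} {g : ℝ × ℝ → ℂ} (hg : HasCompactSupport g) :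
    HasCompactSupport (dOp p q g) :=
  hg.isCompact.of_isClosed_subset (isClosed_tsupport _) tsupport_dOp_subset

/-- The Cauchy–Pompeiu formula. -/
theorem dPot_dOp {p q : ℂ} (h : (q * (starRingEnd ℂ) p).im ≠ 0) {g : ℝ × ℝ → ℂ}
    (hg : ContDiff ℝ 1 g) (hc : HasCompactSupport g) (x : ℝ × ℝ) :
    dPot p q (dOp p q g) x = dConst p q * g x := by
  have hG : ContDiff ℝ 1 (fun y => g (x - y)) := hg.comp (contDiff_const.sub contDiff_id)
  have hcG : HasCompactSupport (fun y => g (x - y)) :=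
    hc.comp_homeomorph (Homeomorph.subLeft x)
  have := integral_dKer_mul_dOp h hG hcG
  have hd : ∀ y, dOp p q (fun y => g (x - y)) y = - dOp p q g (x - y) := by
    intro y
    have h1 : HasFDerivAt (fun y => g (x - y))
        ((fderiv ℝ g (x - y)).comp (-ContinuousLinearMap.id ℝ (ℝ × ℝ))) y := by
      have e := ((hg.differentiable one_ne_zero) (x - y)).hasFDerivAt
      exact e.comp y ((hasFDerivAt_id y).const_sub x)
    simp only [dOp, partial₁, partial₂, h1.fderiv]
    simp
    ring
  simp only [hd, mul_neg, integral_neg, sub_zero] at this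
  rw [dPot]
  linear_combination -this

theorem contDiff_dPot {p q : ℂ} (h : (q * (starRingEnd ℂ) p).im ≠ 0) {n : ℕ∞} {g : ℝ × ℝ → ℂ}
    (hg : ContDiff ℝ n g) (hc : HasCompactSupport g) : ContDiff ℝ n (dPot p q g) := by
  rw [dPot_eq_convolution]
  exact hc.contDiff_convolution_right _ (locallyIntegrable_dKer h) hg

theorem fderiv_dPot {p q : ℂ} (h : (q * (starRingEnd ℂ) p).im ≠ 0) {g : ℝ × ℝ → ℂ}
    (hg : ContDiff ℝ 1 g) (hc : HasCompactSupport g) (x v : ℝ × ℝ) :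
    fderiv ℝ (dPot p q g) x v = dPot p q (fun y => fderiv ℝ g y v) x := by
  rw [dPot_eq_convolution, dPot_eq_convolution,
    (hc.hasFDerivAt_convolution_right _ (locallyIntegrable_dKer h) hg x).fderiv]
  exact convolution_precompR_apply _ (locallyIntegrable_dKer h) (hc.fderiv (𝕜 := ℝ))
    (hg.continuous_fderiv one_ne_zero) x v

theorem integrable_dKer_mul {p q : ℂ} (h : (q * (starRingEnd ℂ) p).im ≠ 0) {g : ℝ × ℝ → ℂ}
    (hg : Continuous g) (hc : HasCompactSupport g) (x : ℝ × ℝ) :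
    Integrable fun y => dKer p q y * g (x - y) := by
  have := (locallyIntegrable_dKer h).integrable_smul_left_of_hasCompactSupport
    (g := fun y => g (x - y)) (by fun_prop) (hc.comp_homeomorph (Homeomorph.subLeft x))
  simpa [mul_comm] using this

theorem dOp_dPot {p q : ℂ} (h : (q * (starRingEnd ℂ) p).im ≠ 0) {g : ℝ × ℝ → ℂ}
    (hg : ContDiff ℝ 1 g) (hc : HasCompactSupport g) (x : ℝ × ℝ) :
    dOp p q (dPot p q g) x = dConst p q * g x := by
  rw [← dPot_dOp h hg hc x]
  simp only [dOp, partial₁, partial₂]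
  rw [fderiv_dPot h hg hc, fderiv_dPot h hg hc]
  simp only [dPot]
  rw [← integral_const_mul, ← integral_const_mul, ← integral_add]
  · congr 1; ext y; simp only [dOp, partial₁, partial₂]; ring
  · exact (integrable_dKer_mul h (continuous_partial₁ hg) (hasCompactSupport_partial₁ hc) x).const_mul _
  · exact (integrable_dKer_mul h (continuous_partial₂ hg) (hasCompactSupport_partial₂ hc) x).const_mul _

/-- Fubini for the potential of a compactly supported integrable function. -/
theorem integral_dPot_mul {p q : ℂ} (h : (q * (starRingEnd ℂ) p).im ≠ 0) {k g : ℝ × ℝ → ℂ}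
    (hk : Integrable k) (hkc : HasCompactSupport k) (hg : Continuous g) (hc : HasCompactSupport g) :
    Integrable (fun x => g x * dPot p q k x) ∧
      ∫ x, g x * dPot p q k x = - ∫ x, k x * dPot p q g x := by
  obtain ⟨R₁, hR₁⟩ := hkc.isCompact.isBounded.exists_norm_le
  obtain ⟨R₂, hR₂⟩ := hc.isCompact.isBounded.exists_norm_le
  set B := Metric.closedBall (0 : ℝ × ℝ) (R₁ + R₂)
  -- Only differences of points of the two supports occur, so the kernel may be cut off to a ball;
  -- it is then integrable and Fubini applies.
  set k₁ : ℝ × ℝ → ℂ := B.indicator (dKer p q) with hk₁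
  have hi : Integrable k₁ :=
    ((locallyIntegrable_dKer h).integrableOn_isCompact
      (isCompact_closedBall (0 : ℝ × ℝ) (R₁ + R₂))).integrable_indicator
      Metric.isClosed_closedBall.measurableSet
  have heq : ∀ x z, g x * (dKer p q (x - z) * k z) = g x * (k z * k₁ (x - z)) := by
    intro x z
    by_cases hx : g x = 0
    · simp [hx]
    by_cases hz : k z = 0
    · simp [hz]
    have : x - z ∈ B := by
      rw [mem_closedBall_zero_iff]
      have e1 := hR₁ z (subset_tsupport _ hz)
      have e2 := hR₂ x (subset_tsupport _ hx)
      exact (norm_sub_le _ _).trans (by linarith)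
    rw [hk₁, indicator_of_mem this]; ring
  have hprod : Integrable (Function.uncurry fun x z => g x * (k z * k₁ (x - z)))
      (volume.prod volume) := by
    have e := Integrable.convolution_integrand (ContinuousLinearMap.mul ℝ ℂ) hk hi
    obtain ⟨C, hC⟩ := hg.bounded_above_of_compact_support hc
    exact e.bdd_mul (f := fun z => g z.1) (hg.comp continuous_fst).aestronglyMeasurable
      (Eventually.of_forall fun z => hC z.1)
  have hL : ∀ x, g x * dPot p q k x = ∫ z, g x * (k z * k₁ (x - z)) := by
    intro x
    rw [dPot_eq_integral, ← integral_const_mul]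
    congr 1; ext z; exact heq x z
  refine ⟨?_, ?_⟩
  · simp only [hL]
    exact hprod.integral_prod_left
  · simp only [hL]
    rw [integral_integral_swap hprod, ← integral_neg]
    congr 1; ext z
    rw [dPot_eq_integral, ← integral_const_mul, ← integral_neg]
    congr 1; ext x
    rw [← heq, ← neg_sub z x, dKer_neg]
    ring

theorem exists_bump_eq_one {S : Set (ℝ × ℝ)} (hS : IsCompact S) :
    ∃ θ : ℝ × ℝ → ℂ, ContDiff ℝ ∞ θ ∧ HasCompactSupport θ ∧ ∀ x ∈ S, θ =ᶠ[𝓝 x] fun _ => 1 := by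
  obtain ⟨R, hR⟩ := hS.isBounded.exists_norm_le
  let b : ContDiffBump (0 : ℝ × ℝ) := ⟨|R| + 1, |R| + 2, by positivity, by linarith⟩
  refine ⟨fun x => (b x : ℂ), Complex.ofRealCLM.contDiff.comp b.contDiff,
    b.hasCompactSupport.comp_left (g := fun t : ℝ => (t : ℂ)) (by simp), fun x hx => ?_⟩
  have : x ∈ Metric.ball (0 : ℝ × ℝ) (|R| + 1) := by
    rw [mem_ball_zero_iff]; linarith [hR x hx, le_abs_self R]
  filter_upwards [Metric.isOpen_ball.mem_nhds this] with y hy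
  rw [b.one_of_mem_closedBall (Metric.ball_subset_closedBall hy)]
  simp

theorem dOp_congr {p q : ℂ} {f g : ℝ × ℝ → ℂ} {x : ℝ × ℝ} (h : f =ᶠ[𝓝 x] g) :
    dOp p q f x = dOp p q g x := by
  simp [dOp, partial₁, partial₂, h.fderiv_eq]

/-- A compactly supported integrable function is recovered from its weak derivative. -/
theorem ae_eq_dPot_of_weak {p q : ℂ} (h : (q * (starRingEnd ℂ) p).im ≠ 0) {K k : ℝ × ℝ → ℂ}
    (hK : Integrable K) (hKc : HasCompactSupport K) (hk : Integrable k) (hkc : HasCompactSupport k)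
    (hw : ∀ ψ : ℝ × ℝ → ℂ, ContDiff ℝ ∞ ψ → HasCompactSupport ψ →
      ∫ x, K x * dOp p q ψ x = - ∫ x, k x * ψ x) :
    ∀ᵐ x, K x = (dConst p q)⁻¹ * dPot p q k x := by
  have hc0 := dConst_ne_zero h
  have hloc : LocallyIntegrable (dPot p q k) := by
    intro x
    obtain ⟨θ, hθ, hθc, hθ1⟩ := exists_bump_eq_one (isCompact_singleton (x := x))
    obtain ⟨U, hU, hxU⟩ := (hθ1 x rfl).exists_mem
    refine ⟨interior U, isOpen_interior.mem_nhds (mem_interior_iff_mem_nhds.2 hU), ?_⟩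
    refine ((integral_dPot_mul h hk hkc hθ.continuous hθc).1.integrableOn).congr_fun ?_
      isOpen_interior.measurableSet
    intro y hy
    simp [hxU (interior_subset hy)]
  refine ae_eq_of_integral_contDiff_smul_eq hK.locallyIntegrable (hloc.smul (dConst p q)⁻¹) ?_
  intro g hg hgc
  set E : ℝ × ℝ → ℂ := fun x => (g x : ℂ)
  have hE : ContDiff ℝ ∞ E := Complex.ofRealCLM.contDiff.comp hg
  have hEc : HasCompactSupport E := hgc.comp_left (g := fun t : ℝ => (t : ℂ)) (by simp)
  have hE1 : ContDiff ℝ 1 E := hE.of_le (by exact_mod_cast le_top)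
  -- The natural test function, the potential of E, is not compactly supported; multiplying by θ
  -- changes nothing on the supports of K and k.
  obtain ⟨θ, hθ, hθc, hθ1⟩ := exists_bump_eq_one (hKc.isCompact.union hkc.isCompact)
  have hP : ContDiff ℝ ∞ (dPot p q E) := contDiff_dPot h hE hEc
  have h1 := hw (fun x => θ x * dPot p q E x) (hθ.mul hP) hθc.mul_right
  have e1 : ∀ x, K x * dOp p q (fun x => θ x * dPot p q E x) x = K x * (dConst p q * E x) := by
    intro x
    by_cases hx : K x = 0
    · simp [hx]
    · rw [← dOp_dPot h hE1 hEc]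
      congr 1
      apply dOp_congr
      filter_upwards [hθ1 x (Or.inl (subset_tsupport _ hx))] with y hy
      simp [hy]
  have e2 : ∀ x, k x * (θ x * dPot p q E x) = k x * dPot p q E x := by
    intro x
    by_cases hx : k x = 0
    · simp [hx]
    · rw [(hθ1 x (Or.inr (subset_tsupport _ hx))).eq_of_nhds, one_mul]
  simp only [e1, e2] at h1
  have h2 := (integral_dPot_mul h hk hkc hE.continuous hEc).2
  have e3 : ∫ x, g x • K x = (dConst p q)⁻¹ * ∫ x, K x * (dConst p q * E x) := by
    rw [← integral_const_mul]
    congr 1; ext x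
    simp only [E, Complex.real_smul]; field_simp
  have e4 : ∫ x, g x • ((dConst p q)⁻¹ • dPot p q k x) =
      (dConst p q)⁻¹ * ∫ x, E x * dPot p q k x := by
    rw [← integral_const_mul]
    congr 1; ext x
    simp only [E, Complex.real_smul, smul_eq_mul]; ring
  refine e3.trans (Eq.trans ?_ e4.symm)
  rw [h1, h2]

theorem integrable_mul_of_tsupport_subset {O : Set (ℝ × ℝ)} {H g : ℝ × ℝ → ℂ}
    (hH : LocallyIntegrableOn H O) (hg : Continuous g) (hc : HasCompactSupport g)
    (hO : tsupport g ⊆ O) : Integrable fun x => H x * g x := by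
  rw [← integrableOn_iff_integrable_of_support_subset (s := tsupport g)]
  · exact (hH.integrableOn_compact_subset hO hc).mul_continuousOn hg.continuousOn hc
  · exact fun x hx => subset_tsupport _ (right_ne_zero_of_mul hx)

theorem contDiff_mul_of_tsupport_subset {O : Set (ℝ × ℝ)} (hO : IsOpen O) {n : WithTop ℕ∞}
    {g h : ℝ × ℝ → ℂ} (hg : ContDiff ℝ n g) (hs : tsupport g ⊆ O) (hh : ContDiffOn ℝ n h O) :
    ContDiff ℝ n fun x => g x * h x := by
  rw [contDiff_iff_contDiffAt]
  intro x
  by_cases hx : x ∈ tsupport g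
  · exact hg.contDiffAt.mul (hh.contDiffAt (hO.mem_nhds (hs hx)))
  · refine contDiffAt_const (c := (0 : ℂ)) |>.congr_of_eventuallyEq ?_
    filter_upwards [notMem_tsupport_iff_eventuallyEq.1 hx] with y hy
    simp [hy]

/-- A smooth compactly supported truncation of the kernel. -/
theorem exists_smooth_kernel {p q : ℂ} (h : (q * (starRingEnd ℂ) p).im ≠ 0) {r R : ℝ}
    (hr : 0 < r) (hR : 0 < R) :
    ∃ k : ℝ × ℝ → ℂ, ContDiff ℝ ∞ k ∧ HasCompactSupport k ∧
      ∀ x, r ≤ ‖x‖ → ‖x‖ ≤ R → k x = dKer p q x := by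
  let b : ContDiffBump (0 : ℝ × ℝ) := ⟨r / 2, r, by positivity, by linarith⟩
  let b' : ContDiffBump (0 : ℝ × ℝ) := ⟨R, R + 1, by positivity, by linarith⟩
  have hb : ContDiff ℝ ∞ (fun x => (b x : ℂ)) := Complex.ofRealCLM.contDiff.comp b.contDiff
  have hb' : ContDiff ℝ ∞ (fun x => (b' x : ℂ)) := Complex.ofRealCLM.contDiff.comp b'.contDiff
  have hbc : HasCompactSupport (fun x => (b' x : ℂ)) :=
    b'.hasCompactSupport.comp_left (g := fun t : ℝ => (t : ℂ)) (by simp)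
  refine ⟨fun x => (b' x : ℂ) * ((1 - (b x : ℂ)) * dKer p q x), ?_, hbc.mul_right, ?_⟩
  · refine hb'.mul ?_
    rw [contDiff_iff_contDiffAt]
    intro x
    rcases eq_or_ne x 0 with rfl | hx
    · refine contDiffAt_const (c := (0 : ℂ)) |>.congr_of_eventuallyEq ?_
      filter_upwards [Metric.closedBall_mem_nhds (0 : ℝ × ℝ) (show 0 < r / 2 by positivity)]
        with y hy
      rw [b.one_of_mem_closedBall hy]; simp
    · exact (contDiff_const.sub hb).contDiffAt.mul
        ((contDiff_dLin p q).contDiffAt.inv (dLin_ne_zero h hx))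
  · intro x h1 h2
    have e1 : b' x = 1 := b'.one_of_mem_closedBall (by simpa using h2)
    have e2 : b x = 0 := b.zero_of_le_dist (by simpa using h1)
    simp [e1, e2]

/-- Interior regularity for `dOp p q`. -/
theorem exists_contDiff_of_weak {p q : ℂ} (h : (q * (starRingEnd ℂ) p).im ≠ 0) {m : ℕ∞}
    {O : Set (ℝ × ℝ)} (hO : IsOpen O) {H f : ℝ × ℝ → ℂ} (hH : LocallyIntegrableOn H O)
    (hf : ContDiffOn ℝ m f O)
    (hw : ∀ ψ, IsTestFunction O ψ → ∫ x, H x * dOp p q ψ x = - ∫ x, f x * ψ x)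
    {x₀ : ℝ × ℝ} (hx₀ : x₀ ∈ O) :
    ∃ H' : ℝ × ℝ → ℂ, ContDiff ℝ m H' ∧ ∃ r > 0, Metric.ball x₀ r ⊆ O ∧
      ∀ᵐ x, x ∈ Metric.ball x₀ r → H x = H' x := by
  obtain ⟨ε, hε, hεO⟩ := Metric.isOpen_iff.1 hO x₀ hx₀
  set r := ε / 4 with hr
  have hr0 : 0 < r := by positivity
  let b : ContDiffBump x₀ := ⟨2 * r, 3 * r, by positivity, by linarith⟩
  set χ : ℝ × ℝ → ℂ := fun x => (b x : ℂ) with hχdef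
  have hχ : ContDiff ℝ ∞ χ := Complex.ofRealCLM.contDiff.comp b.contDiff
  have hχc : HasCompactSupport χ :=
    b.hasCompactSupport.comp_left (g := fun t : ℝ => (t : ℂ)) (by simp)
  have hts : tsupport χ ⊆ Metric.closedBall x₀ (3 * r) := by
    have := b.tsupport_eq
    refine (closure_mono ?_).trans this.subset
    intro x hx hx'
    exact hx (by simp [hχdef, hx'])
  have hχO : tsupport χ ⊆ O :=
    hts.trans ((Metric.closedBall_subset_ball (by linarith)).trans hεO)
  have hχ1 : ∀ x ∈ Metric.ball x₀ (2 * r), χ =ᶠ[𝓝 x] fun _ => 1 := by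
    intro x hx
    filter_upwards [Metric.isOpen_ball.mem_nhds hx] with y hy
    simp [hχdef, b.one_of_mem_closedBall (Metric.ball_subset_closedBall hy)]
  have hχd1 : ContDiff ℝ 1 χ := hχ.of_le (by exact_mod_cast le_top)
  -- The commutator with the cutoff: H is only locally integrable, but M vanishes on the ball of
  -- radius 2r, so its potential is smooth on the ball of radius r.
  set M : ℝ × ℝ → ℂ := fun x => H x * dOp p q χ x with hM
  have hMi : Integrable M := integrable_mul_of_tsupport_subset hH (continuous_dOp hχd1)
    (hasCompactSupport_dOp hχc) (tsupport_dOp_subset.trans hχO)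
  have hMc : HasCompactSupport M := (hasCompactSupport_dOp hχc).mul_left
  have hχfm : ContDiff ℝ m fun x => χ x * f x :=
    contDiff_mul_of_tsupport_subset hO (hχ.of_le (by exact_mod_cast le_top)) hχO hf
  have hχfc : HasCompactSupport fun x => χ x * f x := hχc.mul_right
  have hχfi : Integrable fun x => χ x * f x :=
    hχfm.continuous.integrable_of_hasCompactSupport hχfc
  have hχHi : Integrable fun x => H x * χ x :=
    integrable_mul_of_tsupport_subset hH hχ.continuous hχc hχO
  have key := ae_eq_dPot_of_weak h (K := fun x => H x * χ x)
    (k := fun x => χ x * f x + M x) hχHi hχc.mul_left (hχfi.add hMi)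
    (hχfc.add hMc) ?_
  swap
  · intro ψ hψ hψc
    have hψ1 : ContDiff ℝ 1 ψ := hψ.of_le (by exact_mod_cast le_top)
    have ht : IsTestFunction O fun x => χ x * ψ x :=
      ⟨hχ.mul hψ, hχc.mul_right, (tsupport_mul_subset_left).trans hχO⟩
    have h1 := hw _ ht
    have e1 : ∀ x, H x * dOp p q (fun x => χ x * ψ x) x =
        H x * χ x * dOp p q ψ x + M x * ψ x := by
      intro x
      rw [dOp_mul (hχd1.differentiable one_ne_zero x) (hψ1.differentiable one_ne_zero x), hM]
      ring
    have i1 : Integrable fun x => H x * χ x * dOp p q ψ x := by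
      obtain ⟨C, hC⟩ := (continuous_dOp hψ1 (p := p) (q := q)).bounded_above_of_compact_support
        (hasCompactSupport_dOp hψc)
      exact hχHi.mul_bdd (c := C) (continuous_dOp hψ1).aestronglyMeasurable (Eventually.of_forall hC)
    obtain ⟨C, hC⟩ := hψ.continuous.bounded_above_of_compact_support hψc
    have i2 : Integrable fun x => M x * ψ x :=
      hMi.mul_bdd (c := C) hψ.continuous.aestronglyMeasurable (Eventually.of_forall hC)
    have i3 : Integrable fun x => χ x * f x * ψ x :=
      hχfi.mul_bdd (c := C) hψ.continuous.aestronglyMeasurable (Eventually.of_forall hC)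
    simp only [e1] at h1
    rw [integral_add i1 i2] at h1
    have e2 : ∫ x, (χ x * f x + M x) * ψ x = (∫ x, χ x * f x * ψ x) + ∫ x, M x * ψ x := by
      rw [← integral_add i3 i2]; congr 1; ext x; ring
    have e3 : ∫ x, f x * (χ x * ψ x) = ∫ x, χ x * f x * ψ x := by
      congr 1; ext x; ring
    rw [e2, ← e3]
    linear_combination h1
  obtain ⟨R, hR⟩ := hMc.isCompact.isBounded.exists_norm_le
  set R' := |R| + ‖x₀‖ + r
  -- If x is within r of x₀ and M z ≠ 0, then r ≤ ‖x − z‖ ≤ R', so a smooth truncation replaces the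
  -- kernel.
  obtain ⟨k, hk, hkc, hkeq⟩ := exists_smooth_kernel h hr0 (show 0 < R' by positivity)
  refine ⟨fun x => (dConst p q)⁻¹ * (dPot p q (fun x => χ x * f x) x +
    (M ⋆[ContinuousLinearMap.mul ℝ ℂ, volume] k) x), ?_, r, hr0,
    (Metric.ball_subset_ball (by linarith)).trans hεO, ?_⟩
  · refine contDiff_const.mul ((contDiff_dPot h hχfm hχfc).add ?_)
    exact (hkc.contDiff_convolution_right _ hMi.locallyIntegrable hk).of_le
      (by exact_mod_cast le_top)
  · filter_upwards [key] with x hx hxr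
    have hx1 : χ x = 1 :=
      (hχ1 x (Metric.ball_subset_ball (by linarith) hxr)).eq_of_nhds
    rw [hx1, mul_one] at hx
    rw [hx]
    congr 1
    have hMk : ∀ z, dKer p q (x - z) * M z = M z * k (x - z) := by
      intro z
      by_cases hz : M z = 0
      · simp [hz]
      have hz1 : 2 * r ≤ dist z x₀ := by
        by_contra hlt
        apply hz
        have : dOp p q χ z = 0 := by
          rw [dOp_congr (hχ1 z (not_le.1 hlt))]
          simp [dOp, partial₁, partial₂]
        simp [hM, this]
      have hz2 := hR z (subset_tsupport _ hz)
      have hxr' : dist x x₀ < r := hxr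
      rw [hkeq, mul_comm]
      · rw [← dist_eq_norm]
        linarith [dist_triangle z x x₀, dist_comm z x]
      · have : ‖x‖ ≤ ‖x₀‖ + r := by
          have := norm_sub_norm_le x x₀
          rw [dist_eq_norm] at hxr'
          linarith
        exact (norm_sub_le _ _).trans (by
          simp only [R']; linarith [le_abs_self R])
    rw [dPot_eq_integral, dPot_eq_integral, convolution_def, ← integral_add]
    · congr 1; ext z
      rw [mul_add, hMk z]
      rfl
    · have := (integrable_dKer_mul h hχfm.continuous hχfc x).comp_sub_left x
      simpa using this
    · exact (hkc.convolutionExists_right _ hMi.locallyIntegrable hk.continuous) x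

/-- Cauchy–Schwarz by expanding the square of ‖W‖ minus its mean. The measure 4 is that of the unit
ball of ℝ × ℝ, a square in the sup norm. -/
theorem integral_norm_le_sqrt {W : ℝ × ℝ → ℂ} {B : Set (ℝ × ℝ)} (hB : volume B = 4)
    (hWi : IntegrableOn (fun y => ‖W y‖) B) (hW : IntegrableOn (fun y => ‖W y‖ ^ 2) B) :
    ∫ y in B, ‖W y‖ ≤ 2 * Real.sqrt (∫ y in B, ‖W y‖ ^ 2) := by
  set m := ∫ y in B, ‖W y‖ with hm
  have h0 : 0 ≤ ∫ y in B, (‖W y‖ - m / 4) ^ 2 := integral_nonneg fun y => sq_nonneg _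
  have h1 : ∫ y in B, (‖W y‖ - m / 4) ^ 2 =
      (∫ y in B, ‖W y‖ ^ 2) - m / 2 * m + 4 * (m / 4) ^ 2 := by
    have hc : IntegrableOn (fun _ : ℝ × ℝ => (m / 4) ^ 2) B := by
      rw [integrableOn_const_iff]; right; rw [hB]; norm_num
    have e : ∀ y, (‖W y‖ - m / 4) ^ 2 = ‖W y‖ ^ 2 - m / 2 * ‖W y‖ + (m / 4) ^ 2 :=
      fun y => by ring
    simp only [e]
    have hs : IntegrableOn (fun y => ‖W y‖ ^ 2 - m / 2 * ‖W y‖) B := hW.sub (hWi.const_mul _)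
    rw [integral_add hs hc, integral_sub hW (hWi.const_mul _),
      integral_const_mul, setIntegral_const, measureReal_def, hB]
    simp [hm]
  rw [h1] at h0
  have hm0 : 0 ≤ m := integral_nonneg fun y => norm_nonneg _
  rw [← Real.sqrt_sq (by norm_num : (0 : ℝ) ≤ 2), ← Real.sqrt_mul (by norm_num)]
  exact Real.le_sqrt_of_sq_le (by nlinarith)

theorem volume_ball_prod (x : ℝ × ℝ) (r : ℝ) :
    volume (Metric.ball x r) = ENNReal.ofReal (2 * r) * ENNReal.ofReal (2 * r) := by
  rw [← ball_prod_same, Measure.volume_eq_prod, Measure.prod_prod, Real.volume_ball,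
    Real.volume_ball]

/-- Interior estimate: the value of a solution of `dOp p q V = 0` at the centre of a ball is
controlled by its `L²` norm. -/
theorem exists_interior_estimate {p q : ℂ} (h : (q * (starRingEnd ℂ) p).im ≠ 0) :
    ∃ C > 0, ∀ (V : ℝ × ℝ → ℂ) (x : ℝ × ℝ) (ρ : ℝ), 0 < ρ → ContDiffOn ℝ 1 V (Metric.ball x ρ) →
      (∀ y ∈ Metric.ball x ρ, dOp p q V y = 0) →
      IntegrableOn (fun y => ‖V y‖ ^ 2) (Metric.ball x ρ) →
      ‖V x‖ ≤ C / ρ * Real.sqrt (∫ y in Metric.ball x ρ, ‖V y‖ ^ 2) := by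
  obtain ⟨C₀, hC₀, hker⟩ := norm_dKer_le h
  have hc0 := dConst_ne_zero h
  let b : ContDiffBump (0 : ℝ × ℝ) := ⟨1 / 2, 3 / 4, by norm_num, by norm_num⟩
  set χ : ℝ × ℝ → ℂ := fun x => (b x : ℂ) with hχdef
  have hχ : ContDiff ℝ 1 χ := Complex.ofRealCLM.contDiff.comp b.contDiff
  have hχc : HasCompactSupport χ :=
    b.hasCompactSupport.comp_left (g := fun t : ℝ => (t : ℂ)) (by simp)
  have hts : tsupport χ ⊆ Metric.ball 0 1 := by
    have := b.tsupport_eq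
    refine (closure_mono ?_).trans (this.subset.trans (Metric.closedBall_subset_ball (by norm_num)))
    intro x hx hx'
    exact hx (by simp [hχdef, hx'])
  obtain ⟨C₁, hC₁⟩ := (continuous_dOp hχ (p := p) (q := q)).bounded_above_of_compact_support
    (hasCompactSupport_dOp hχc)
  have hC₁0 : 0 ≤ C₁ := (norm_nonneg _).trans (hC₁ 0)
  -- The derivative of χ vanishes for ‖y‖ < 1/2, and the kernel is at most 2 C₀ elsewhere.
  set K := C₀ * 2 * C₁ with hK
  have hbound : ∀ y, ‖dKer p q y * dOp p q χ y‖ ≤ K := by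
    intro y
    rcases lt_or_ge ‖y‖ (1 / 2) with hy | hy
    · have : dOp p q χ y = 0 := by
        rw [dOp_congr (g := fun _ => 1)]
        · simp [dOp, partial₁, partial₂]
        · filter_upwards [Metric.isOpen_ball.mem_nhds (mem_ball_zero_iff.2 hy)] with z hz
          simp [hχdef, b.one_of_mem_closedBall (Metric.ball_subset_closedBall hz)]
      simp only [this, mul_zero, norm_zero]; positivity
    · rw [norm_mul]
      have : ‖y‖⁻¹ ≤ 2 := by
        rw [inv_le_comm₀ (by linarith) (by norm_num)]; linarith
      have h2 := hker y
      exact mul_le_mul (h2.trans (by gcongr)) (hC₁ y) (norm_nonneg _) (by positivity)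
  have hK0 : 0 ≤ K := by positivity
  refine ⟨(2 * K + 1) / ‖dConst p q‖, by positivity, fun V x ρ hρ hV hDV hVi => ?_⟩
  -- Rescaling to the unit ball keeps the homogeneous equation; the change of variables in the L²
  -- norm produces the factor 1/ρ.
  set W : ℝ × ℝ → ℂ := fun y => V (x + ρ • y) with hW
  have hmaps : ∀ y ∈ Metric.ball (0 : ℝ × ℝ) 1, x + ρ • y ∈ Metric.ball x ρ := by
    intro y hy
    rw [mem_ball_zero_iff] at hy
    rw [Metric.mem_ball, dist_eq_norm, add_sub_cancel_left, norm_smul, Real.norm_of_nonneg hρ.le]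
    nlinarith
  have hWd : ContDiffOn ℝ 1 W (Metric.ball 0 1) :=
    hV.comp (ContDiff.contDiffOn (by fun_prop)) hmaps
  have hDW : ∀ y ∈ Metric.ball (0 : ℝ × ℝ) 1, dOp p q W y = 0 := by
    intro y hy
    have h1 := ((hV.contDiffAt (Metric.isOpen_ball.mem_nhds (hmaps y hy))).differentiableAt
      one_ne_zero).hasFDerivAt
    have h2 : HasFDerivAt (fun y : ℝ × ℝ => x + ρ • y) (ρ • ContinuousLinearMap.id ℝ (ℝ × ℝ)) y :=
      ((hasFDerivAt_id y).const_smul ρ).const_add x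
    have h3 : HasFDerivAt W _ y := h1.comp y h2
    have h4 := hDV _ (hmaps y hy)
    simp only [dOp, partial₁, partial₂] at h4 ⊢
    rw [h3.fderiv]
    simp only [ContinuousLinearMap.comp_apply, _root_.smul_apply,
      ContinuousLinearMap.id_apply, map_smul, Complex.real_smul]
    linear_combination (ρ : ℂ) * h4
  have hg : ContDiff ℝ 1 fun y => χ y * W y :=
    contDiff_mul_of_tsupport_subset Metric.isOpen_ball hχ hts hWd
  have hP := integral_dKer_mul_dOp h hg hχc.mul_right
  have hdg : ∀ y, dOp p q (fun y => χ y * W y) y = W y * dOp p q χ y := by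
    intro y
    by_cases hy : y ∈ Metric.ball (0 : ℝ × ℝ) 1
    · rw [dOp_mul (hχ.differentiable one_ne_zero y)
        ((hWd.contDiffAt (Metric.isOpen_ball.mem_nhds hy)).differentiableAt one_ne_zero),
        hDW y hy]
      ring
    · have hy' : y ∉ tsupport χ := fun h => hy (hts h)
      rw [image_eq_zero_of_notMem_tsupport (fun h => hy' (tsupport_dOp_subset h)), mul_zero]
      refine image_eq_zero_of_notMem_tsupport fun h => hy' ?_
      exact tsupport_mul_subset_left (tsupport_dOp_subset h)
  have hχ0 : χ 0 = 1 := by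
    simp [hχdef, b.one_of_mem_closedBall (Metric.mem_closedBall_self (by norm_num [b]))]
  have hW0 : W 0 = V x := by simp [hW]
  simp only [hdg, hχ0, hW0, one_mul] at hP
  have hWsq : IntegrableOn (fun y => ‖W y‖ ^ 2) (Metric.ball 0 1) ∧
      ∫ y in Metric.ball 0 1, ‖W y‖ ^ 2 = (ρ ^ 2)⁻¹ * ∫ y in Metric.ball x ρ, ‖V y‖ ^ 2 := by
    set F : ℝ × ℝ → ℝ := (Metric.ball x ρ).indicator fun y => ‖V y‖ ^ 2
    have hF : Integrable F := hVi.integrable_indicator Metric.isOpen_ball.measurableSet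
    have hFW : (fun y => F (x + ρ • y)) = (Metric.ball 0 1).indicator fun y => ‖W y‖ ^ 2 := by
      ext y
      have : x + ρ • y ∈ Metric.ball x ρ ↔ y ∈ Metric.ball (0 : ℝ × ℝ) 1 := by
        rw [Metric.mem_ball, dist_eq_norm, add_sub_cancel_left, norm_smul,
          Real.norm_of_nonneg hρ.le, mem_ball_zero_iff]
        constructor <;> intro h <;> nlinarith
      by_cases hy : y ∈ Metric.ball (0 : ℝ × ℝ) 1
      · rw [indicator_of_mem hy]; exact indicator_of_mem (this.2 hy) _
      · rw [indicator_of_notMem hy]; exact indicator_of_notMem (fun h => hy (this.1 h)) _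
    have hFt : Integrable fun y => F (x + y) := hF.comp_add_left x
    have h1 : Integrable fun y => F (x + ρ • y) :=
      (integrable_comp_smul_iff volume (fun y => F (x + y)) hρ.ne').2 hFt
    refine ⟨?_, ?_⟩
    · rw [hFW] at h1
      exact (integrable_indicator_iff Metric.isOpen_ball.measurableSet).1 h1
    · rw [← integral_indicator Metric.isOpen_ball.measurableSet, ← hFW,
        Measure.integral_comp_smul volume (fun y => F (x + y)),
        integral_add_left_eq_self, integral_indicator Metric.isOpen_ball.measurableSet]
      simp [abs_of_pos hρ]
  have hWi : IntegrableOn (fun y => ‖W y‖) (Metric.ball 0 1) := by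
    have hfin : IntegrableOn (fun _ : ℝ × ℝ => (1 : ℝ)) (Metric.ball 0 1) := by
      rw [integrableOn_const_iff]; right; exact measure_ball_lt_top
    refine (hWsq.1.add hfin).mono' ?_ (Eventually.of_forall fun y => ?_)
    · exact (hWd.continuousOn.norm).aestronglyMeasurable Metric.isOpen_ball.measurableSet
    · simp only [Pi.add_apply, norm_norm]
      nlinarith [sq_nonneg (‖W y‖ - 1), norm_nonneg (W y)]
  have hint : ‖∫ y, dKer p q y * (W y * dOp p q χ y)‖ ≤ K * ∫ y in Metric.ball 0 1, ‖W y‖ := by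
    rw [← setIntegral_eq_integral_of_forall_compl_eq_zero (s := Metric.ball 0 1),
      ← integral_const_mul]
    · refine norm_integral_le_of_norm_le (hWi.const_mul K) (Eventually.of_forall fun y => ?_)
      rw [show dKer p q y * (W y * dOp p q χ y) = (dKer p q y * dOp p q χ y) * W y by ring,
        norm_mul]
      exact mul_le_mul_of_nonneg_right (hbound y) (norm_nonneg _)
    · intro y hy
      rw [image_eq_zero_of_notMem_tsupport (fun h => hy (hts (tsupport_dOp_subset h)))]
      simp
  have hvol : volume (Metric.ball (0 : ℝ × ℝ) 1) = 4 := by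
    rw [volume_ball_prod]; norm_num
  have h2 := integral_norm_le_sqrt hvol hWi hWsq.1
  rw [hP, norm_mul, norm_neg] at hint
  rw [hWsq.2, Real.sqrt_mul (by positivity), Real.sqrt_inv, Real.sqrt_sq hρ.le] at h2
  have hcn : 0 < ‖dConst p q‖ := norm_pos_iff.2 hc0
  rw [div_div, div_mul_eq_mul_div, le_div_iff₀ (by positivity)]
  set S := Real.sqrt (∫ y in Metric.ball x ρ, ‖V y‖ ^ 2)
  have hS : 0 ≤ S := Real.sqrt_nonneg _
  have h3 : ‖dConst p q‖ * ‖V x‖ ≤ K * (2 * (ρ⁻¹ * S)) :=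
    hint.trans (mul_le_mul_of_nonneg_left h2 hK0)
  calc ‖V x‖ * (‖dConst p q‖ * ρ) = (‖dConst p q‖ * ‖V x‖) * ρ := by ring
    _ ≤ K * (2 * (ρ⁻¹ * S)) * ρ := by gcongr
    _ = 2 * K * S := by field_simp
    _ ≤ (2 * K + 1) * S := by nlinarith

theorem integral_dOp_eq_zero {p q : ℂ} {g : ℝ × ℝ → ℂ} (hg : ContDiff ℝ 1 g)
    (hc : HasCompactSupport g) : ∫ x, dOp p q g x = 0 := by
  have key : ∀ v : ℝ × ℝ, ∫ x, fderiv ℝ g x v = 0 := by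
    intro v
    have i1 : Integrable fun x => fderiv ℝ g x v :=
      ((hg.continuous_fderiv one_ne_zero).clm_apply continuous_const).integrable_of_hasCompactSupport
        (hc.fderiv_apply ℝ v)
    have i2 : Integrable g := hg.continuous.integrable_of_hasCompactSupport hc
    have := integral_mul_fderiv_eq_neg_fderiv_mul_of_integrable (μ := volume) (𝕜 := ℂ)
      (f := fun _ : ℝ × ℝ => (1 : ℂ)) (g := g) (v := v) (by simp) (by simpa using i1)
      (by simpa using i2) (fun x _ => differentiableAt_const _)
      (fun x _ => hg.differentiable one_ne_zero x)
    simpa using this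
  simp only [dOp, partial₁, partial₂]
  rw [integral_add, integral_const_mul, integral_const_mul, key, key]
  · simp
  · exact ((continuous_partial₁ hg).integrable_of_hasCompactSupport
      (hasCompactSupport_partial₁ hc)).const_mul _
  · exact ((continuous_partial₂ hg).integrable_of_hasCompactSupport
      (hasCompactSupport_partial₂ hc)).const_mul _

/-- Integration by parts against a test function. -/
theorem integral_mul_dOp_of_contDiffOn {p q : ℂ} {O : Set (ℝ × ℝ)} (hO : IsOpen O)
    {H g : ℝ × ℝ → ℂ} (hH : ContDiffOn ℝ 1 H O) (hg : ContDiff ℝ 1 g) (hc : HasCompactSupport g)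
    (hs : tsupport g ⊆ O) :
    ∫ x, H x * dOp p q g x = - ∫ x, dOp p q H x * g x := by
  have hHl : LocallyIntegrableOn H O := hH.continuousOn.locallyIntegrableOn hO.measurableSet
  have hDc : ContinuousOn (dOp p q H) O := by
    have := hH.continuousOn_fderiv_of_isOpen hO le_rfl
    exact (continuousOn_const.mul (this.clm_apply continuousOn_const)).add
      (continuousOn_const.mul (this.clm_apply continuousOn_const))
  have hDl : LocallyIntegrableOn (dOp p q H) O := hDc.locallyIntegrableOn hO.measurableSet
  have h1 := integral_dOp_eq_zero (p := p) (q := q)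
    (contDiff_mul_of_tsupport_subset hO hg hs hH) hc.mul_right
  have h2 : ∀ x, dOp p q (fun y => g y * H y) x = H x * dOp p q g x + dOp p q H x * g x := by
    intro x
    by_cases hx : x ∈ tsupport g
    · rw [dOp_mul (hg.differentiable one_ne_zero x)
        ((hH.contDiffAt (hO.mem_nhds (hs hx))).differentiableAt one_ne_zero)]
      ring
    · rw [image_eq_zero_of_notMem_tsupport hx,
        image_eq_zero_of_notMem_tsupport (fun h => hx (tsupport_dOp_subset h)),
        image_eq_zero_of_notMem_tsupport
          (fun h => hx (tsupport_mul_subset_left (tsupport_dOp_subset h)))]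
      simp
  simp only [h2] at h1
  rw [integral_add (integrable_mul_of_tsupport_subset hHl (continuous_dOp hg)
      (hasCompactSupport_dOp hc) (tsupport_dOp_subset.trans hs))
    (integrable_mul_of_tsupport_subset hDl hg.continuous hc hs)] at h1
  linear_combination h1

/-! ### Gluing solutions across a line -/

/-- An even smooth function vanishing near `0` and equal to `1` far away. -/
theorem exists_even_cutoff : ∃ θ : ℝ → ℝ, ContDiff ℝ ∞ θ ∧ (∀ s, θ (-s) = θ s) ∧
    (∀ s, |s| ≤ 1 → θ s = 0) ∧ (∀ s, 2 ≤ |s| → θ s = 1) ∧ (∀ s, |θ s| ≤ 1) ∧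
    ∃ C, ∀ s, |deriv θ s| ≤ C ∧ (2 < |s| → deriv θ s = 0) ∧ deriv θ (-s) = - deriv θ s := by
  set θ : ℝ → ℝ := fun s => Real.smoothTransition (s ^ 2 - 1)
  have hθ : ContDiff ℝ ∞ θ := Real.smoothTransition.contDiff.comp (by fun_prop)
  have h1 : ∀ s, 2 ≤ |s| → θ s = 1 := fun s hs =>
    Real.smoothTransition.one_of_one_le (by nlinarith [sq_abs s, abs_nonneg s])
  have hd0 : ∀ s, 2 < |s| → deriv θ s = 0 := by
    intro s hs
    have : θ =ᶠ[𝓝 s] fun _ => 1 := by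
      filter_upwards [(isOpen_lt continuous_const continuous_abs).mem_nhds hs] with y hy
      exact h1 y hy.le
    rw [this.deriv_eq]; simp
  have hev : ∀ s, θ (-s) = θ s := fun s => by simp [θ]
  have hcont : Continuous (deriv θ) := hθ.continuous_deriv (by exact_mod_cast le_top)
  obtain ⟨C, hC⟩ := (isCompact_Icc (a := (-2 : ℝ)) (b := 2)).exists_bound_of_continuousOn
    hcont.continuousOn
  have hC0 : 0 ≤ C := (norm_nonneg _).trans (hC 0 (by norm_num))
  refine ⟨θ, hθ, hev, fun s hs => Real.smoothTransition.zero_of_nonpos (by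
      nlinarith [sq_abs s, abs_nonneg s]), h1, fun s => ?_, C, fun s => ⟨?_, hd0 s, ?_⟩⟩
  · rw [abs_of_nonneg (Real.smoothTransition.nonneg _)]
    exact Real.smoothTransition.le_one _
  · rcases le_or_gt |s| 2 with h | h
    · exact hC s (abs_le.1 h)
    · rw [hd0 s h]; simpa using hC0
  · have e1 : HasDerivAt θ (deriv θ (-s)) (-s) :=
      (hθ.differentiable (by simp) (-s)).hasDerivAt
    have e2 : HasDerivAt (fun s => θ (-s)) (deriv θ (-s) * -1) s := e1.comp s (hasDerivAt_neg s)
    have e3 : (fun s => θ (-s)) = θ := funext hev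
    rw [e3] at e2
    rw [e2.deriv]; ring

theorem measurePreserving_reflect :
    MeasurePreserving (fun x : ℝ × ℝ => (x.1, -x.2)) volume volume :=
  (MeasurePreserving.id volume).prod (Measure.measurePreserving_neg volume)

theorem integral_comp_reflect (g : ℝ × ℝ → ℂ) : ∫ x : ℝ × ℝ, g (x.1, -x.2) = ∫ x, g x := by
  have he : MeasurableEmbedding (fun x : ℝ × ℝ => (x.1, -x.2)) :=
    ((Homeomorph.refl ℝ).prodCongr (Homeomorph.neg ℝ)).measurableEmbedding
  exact measurePreserving_reflect.integral_comp he g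

/-- A function solving `(∂₁ + i ∂₂) H = f` off the line `x₂ = 0`, with no jump across the line,
solves the equation weakly across it. -/
theorem weak_of_glue {a b : ℝ} {H f : ℝ × ℝ → ℂ}
    (hH : ContDiffOn ℝ 1 H ((Ioo (-a) a ×ˢ Ioo (-b) b) ∩ {x | x.2 ≠ 0}))
    (heq : ∀ x ∈ Ioo (-a) a ×ˢ Ioo (-b) b, x.2 ≠ 0 → dOp 1 Complex.I H x = f x)
    (hf : ContinuousOn f (Ioo (-a) a ×ˢ Ioo (-b) b))
    (hHl : LocallyIntegrableOn H (Ioo (-a) a ×ˢ Ioo (-b) b))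
    (hjump : ∀ ε > 0, ∃ δ > 0, ∀ t ∈ Ioo (-a) a, ∀ s ∈ Ioo 0 δ,
      ‖H (t, s) - H (t, -s)‖ ≤ ε ∧ s * ‖H (t, s)‖ ≤ ε)
    (ψ : ℝ × ℝ → ℂ) (hψ : IsTestFunction (Ioo (-a) a ×ˢ Ioo (-b) b) ψ) :
    ∫ x, H x * dOp 1 Complex.I ψ x = - ∫ x, f x * ψ x := by
  set O := Ioo (-a) a ×ˢ Ioo (-b) b with hOdef
  have hO : IsOpen O := isOpen_Ioo.prod isOpen_Ioo
  have hne : IsOpen {x : ℝ × ℝ | x.2 ≠ 0} := isOpen_ne.preimage continuous_snd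
  obtain ⟨θ, hθ, hθe, hθ0, hθ1, hθb, C, hθd⟩ := exists_even_cutoff
  have hC0 : 0 ≤ C := (abs_nonneg _).trans (hθd 0).1
  have hψ1 : ContDiff ℝ 1 ψ := hψ.1.of_le (by exact_mod_cast le_top)
  have hflocal : LocallyIntegrableOn f O := hf.locallyIntegrableOn hO.measurableSet
  have i1 : Integrable fun x => H x * dOp 1 Complex.I ψ x :=
    integrable_mul_of_tsupport_subset hHl (continuous_dOp hψ1) (hasCompactSupport_dOp hψ.2)
      (tsupport_dOp_subset.trans hψ.3)
  have i2 : Integrable fun x => f x * ψ x :=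
    integrable_mul_of_tsupport_subset hflocal hψ.1.continuous hψ.2 hψ.3
  -- Testing with ψ cut off near the line leaves the error `A η`, which lives in |x₂| ≤ 2η and
  -- carries a factor of size 1/η.
  set T : ℝ → ℝ × ℝ → ℂ := fun η x => (θ (x.2 / η) : ℂ) with hT
  set A : ℝ → ℝ × ℝ → ℂ := fun η x => H x * ψ x * ((deriv θ (x.2 / η) / η : ℝ) : ℂ) with hA
  have hTd : ∀ η, ContDiff ℝ ∞ (T η) := by
    intro η
    exact Complex.ofRealCLM.contDiff.comp (hθ.comp (contDiff_snd.div_const η))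
  have hstep : ∀ η > 0, (∫ x, T η x * (H x * dOp 1 Complex.I ψ x + f x * ψ x)) =
      - (Complex.I * ∫ x, A η x) := by
    intro η hη
    have hg1 : ContDiff ℝ 1 fun x => T η x * ψ x :=
      ((hTd η).mul hψ.1).of_le (by exact_mod_cast le_top)
    have hgs : tsupport (fun x => T η x * ψ x) ⊆ O ∩ {x | x.2 ≠ 0} := by
      intro x hx
      refine ⟨hψ.3 (tsupport_mul_subset_right hx), fun h0 => ?_⟩
      have h1 := tsupport_mul_subset_left hx
      refine notMem_tsupport_iff_eventuallyEq.2 ?_ h1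
      have : {y : ℝ × ℝ | |y.2| < η} ∈ 𝓝 x :=
        (isOpen_lt (by fun_prop) continuous_const).mem_nhds (by
          simp only [mem_ofPred_eq]; rw [h0]; simpa using hη)
      filter_upwards [this] with y hy
      simp only [hT, Pi.zero_apply]
      rw [hθ0, Complex.ofReal_zero]
      rw [abs_div, abs_of_pos hη, div_le_one hη]
      exact le_of_lt hy
    have h1 := integral_mul_dOp_of_contDiffOn (p := 1) (q := Complex.I) (hO.inter hne) hH hg1
      hψ.2.mul_left hgs
    have h2 : ∀ x, dOp 1 Complex.I H x * (T η x * ψ x) = T η x * (f x * ψ x) := by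
      intro x
      by_cases hx : x ∈ tsupport fun x => T η x * ψ x
      · rw [heq x (hgs hx).1 (hgs hx).2]; ring
      · have := image_eq_zero_of_notMem_tsupport hx
        rw [this]
        linear_combination -f x * this
    have h3 : ∀ x, dOp 1 Complex.I (T η) x =
        Complex.I * ((deriv θ (x.2 / η) / η : ℝ) : ℂ) := by
      intro x
      have e1 : HasFDerivAt (fun y : ℝ × ℝ => y.2 / η)
          (η⁻¹ • ContinuousLinearMap.snd ℝ ℝ ℝ) x := by
        have := (hasFDerivAt_snd (𝕜 := ℝ) (p := x)).const_smul η⁻¹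
        refine this.congr_of_eventuallyEq (Eventually.of_forall fun y => ?_)
        simp [div_eq_inv_mul]
      have e2 := ((hθ.differentiable (by simp) (x.2 / η)).hasDerivAt.comp_hasFDerivAt x e1)
      have e3 := Complex.ofRealCLM.hasFDerivAt.comp x e2
      have e4 : fderiv ℝ (T η) x = _ := e3.fderiv
      simp only [dOp, partial₁, partial₂, e4]
      simp
      ring
    have h4 : ∀ x, H x * dOp 1 Complex.I (fun x => T η x * ψ x) x =
        T η x * (H x * dOp 1 Complex.I ψ x) + Complex.I * A η x := by
      intro x
      rw [dOp_mul ((hTd η).differentiable (by simp) x) (hψ1.differentiable one_ne_zero x), h3, hA]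
      ring
    have hTb : ∀ᵐ x : ℝ × ℝ, ‖T η x‖ ≤ 1 := Eventually.of_forall fun x => by
      simp only [hT, Complex.norm_real]; exact hθb _
    have j1 : Integrable fun x => T η x * (H x * dOp 1 Complex.I ψ x) :=
      i1.bdd_mul (hTd η).continuous.aestronglyMeasurable hTb
    have j2 : Integrable fun x => T η x * (f x * ψ x) :=
      i2.bdd_mul (hTd η).continuous.aestronglyMeasurable hTb
    have j3 : Integrable fun x => Complex.I * A η x := by
      refine Integrable.const_mul ?_ _
      refine (integrable_mul_of_tsupport_subset hHl hψ.1.continuous hψ.2 hψ.3).mul_bdd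
        (c := C / η) ?_ (Eventually.of_forall fun x => ?_)
      · have : Continuous (deriv θ) := hθ.continuous_deriv (by exact_mod_cast le_top)
        exact Continuous.aestronglyMeasurable (by fun_prop)
      · rw [Complex.norm_real, norm_div, Real.norm_of_nonneg hη.le]
        exact div_le_div_of_nonneg_right (hθd _).1 hη.le
    simp only [h2, h4] at h1
    rw [integral_add j1 j3, integral_const_mul] at h1
    simp only [mul_add]
    rw [integral_add j1 j2]
    linear_combination h1
  have hlim1 : Tendsto (fun n : ℕ => ∫ x, T (1 / ((n : ℝ) + 1)) x *
      (H x * dOp 1 Complex.I ψ x + f x * ψ x)) atTop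
      (𝓝 (∫ x, (H x * dOp 1 Complex.I ψ x + f x * ψ x))) := by
    refine tendsto_integral_of_dominated_convergence
      (fun x => ‖H x * dOp 1 Complex.I ψ x + f x * ψ x‖) ?_ (i1.add i2).norm ?_ ?_
    · intro n
      exact (hTd _).continuous.aestronglyMeasurable.mul (i1.add i2).aestronglyMeasurable
    · intro n
      refine Eventually.of_forall fun x => ?_
      rw [norm_mul]
      refine mul_le_of_le_one_left (norm_nonneg _) ?_
      simp only [hT, Complex.norm_real]; exact hθb _
    · have hae : ∀ᵐ x : ℝ × ℝ, x.2 ≠ 0 := by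
        have : volume ((univ : Set ℝ) ×ˢ ({0} : Set ℝ)) = 0 := by
          rw [Measure.volume_eq_prod, Measure.prod_prod]; simp
        refine measure_mono_null (fun x hx => ?_) this
        simp only [mem_compl_iff, mem_ofPred_eq, not_not] at hx
        exact ⟨mem_univ _, hx⟩
      filter_upwards [hae] with x hx
      refine tendsto_const_nhds.congr' ?_
      have hpos : 0 < |x.2| := abs_pos.2 hx
      obtain ⟨N, hN⟩ := exists_nat_gt (2 / |x.2|)
      filter_upwards [eventually_ge_atTop N] with n hn
      simp only [hT]
      rw [hθ1, Complex.ofReal_one, one_mul]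
      have hn' : (N : ℝ) ≤ n := by exact_mod_cast hn
      rw [div_div_eq_mul_div, div_one, abs_mul, abs_of_nonneg (by positivity : (0 : ℝ) ≤ n + 1)]
      rw [div_lt_iff₀ hpos] at hN
      nlinarith
  have hlim2 : Tendsto (fun n : ℕ => ∫ x, A (1 / ((n : ℝ) + 1)) x) atTop (𝓝 0) := by
    obtain ⟨M, hM⟩ := hψ.1.continuous.bounded_above_of_compact_support hψ.2
    obtain ⟨L, hL⟩ := hψ1.lipschitzWith_of_hasCompactSupport hψ.2 one_ne_zero
    have hM0 : 0 ≤ M := (norm_nonneg _).trans (hM 0)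
    have hmain : ∀ ε > 0, ∃ δ > 0, ∀ η, 0 < η → η < δ →
        ‖∫ x, A η x‖ ≤ 4 * |a| * ((2 * L + M) * C) * ε := by
      intro ε hε
      obtain ⟨δ, hδ, hj⟩ := hjump ε hε
      refine ⟨δ / 2, by positivity, fun η hη hηδ => ?_⟩
      -- The jump hypothesis handles the difference of H; the variation of ψ between mirror points
      -- is O(s), which the hypothesis on s‖H‖ absorbs.
      have hB1 : ∀ t s : ℝ, 0 < s → s < δ →
          ‖H (t, s) * ψ (t, s) - H (t, -s) * ψ (t, -s)‖ ≤ (2 * L + M) * ε := by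
        intro t s hs hsδ
        by_cases ht : t ∈ Ioo (-a) a
        · obtain ⟨g1, g2⟩ := hj t ht s ⟨hs, hsδ⟩
          have g3 : ‖ψ (t, s) - ψ (t, -s)‖ ≤ L * (2 * s) := by
            have := hL.dist_le_mul (t, s) (t, -s)
            rw [dist_eq_norm] at this
            refine this.trans (mul_le_mul_of_nonneg_left ?_ L.2)
            rw [Prod.dist_eq, dist_self, Real.dist_eq]
            simp only [sub_neg_eq_add]
            rw [abs_of_pos (by linarith)]
            exact max_le (by linarith) (by linarith)
          calc ‖H (t, s) * ψ (t, s) - H (t, -s) * ψ (t, -s)‖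
              = ‖H (t, s) * (ψ (t, s) - ψ (t, -s)) + (H (t, s) - H (t, -s)) * ψ (t, -s)‖ := by
                congr 1; ring
            _ ≤ ‖H (t, s)‖ * (L * (2 * s)) + ε * M := by
                refine (norm_add_le _ _).trans ?_
                rw [norm_mul, norm_mul]
                gcongr
                exact hM _
            _ = 2 * L * (s * ‖H (t, s)‖) + M * ε := by ring
            _ ≤ 2 * L * ε + M * ε := by gcongr
            _ = (2 * L + M) * ε := by ring
        · have hz : ∀ s', ψ (t, s') = 0 := fun s' =>
            image_eq_zero_of_notMem_tsupport fun h => ht (hψ.3 h).1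
          simp only [hz, mul_zero, sub_self, norm_zero]
          positivity
      have hB2 : ∀ x : ℝ × ℝ, |x.2| < δ →
          ‖H x * ψ x - H (x.1, -x.2) * ψ (x.1, -x.2)‖ ≤ (2 * L + M) * ε := by
        rintro ⟨t, s⟩ hs
        simp only at hs ⊢
        rcases lt_trichotomy s 0 with h | h | h
        · have := hB1 t (-s) (by linarith) (by rwa [abs_of_neg h] at hs)
          rw [neg_neg] at this
          rwa [norm_sub_rev]
        · subst h; simp only [neg_zero, sub_self, norm_zero]; positivity
        · exact hB1 t s h (by rwa [abs_of_pos h] at hs)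
      have hAi : Integrable (A η) := by
        refine (integrable_mul_of_tsupport_subset hHl hψ.1.continuous hψ.2 hψ.3).mul_bdd
          (c := C / η) ?_ (Eventually.of_forall fun x => ?_)
        · have : Continuous (deriv θ) := hθ.continuous_deriv (by exact_mod_cast le_top)
          exact Continuous.aestronglyMeasurable (by fun_prop)
        · rw [Complex.norm_real, norm_div, Real.norm_of_nonneg hη.le]
          exact div_le_div_of_nonneg_right (hθd _).1 hη.le
      have hAr : Integrable fun x : ℝ × ℝ => A η (x.1, -x.2) :=
        measurePreserving_reflect.integrable_comp_of_integrable hAi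
      -- As θ' is odd, averaging with the mirror image turns the error into differences of Hψ across
      -- the line: of size ε, times 1/η, over an area of order η.
      have hfold : ∫ x, A η x = (1 / 2 : ℂ) * ∫ x : ℝ × ℝ, (A η x + A η (x.1, -x.2)) := by
        rw [integral_add hAi hAr, integral_comp_reflect (A η)]; ring
      have hpt : ∀ x : ℝ × ℝ, A η x + A η (x.1, -x.2) =
          (H x * ψ x - H (x.1, -x.2) * ψ (x.1, -x.2)) * ((deriv θ (x.2 / η) / η : ℝ) : ℂ) := by
        intro x
        simp only [hA, neg_div, (hθd (x.2 / η)).2.2]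
        push_cast; ring
      set S := Icc (-|a|) |a| ×ˢ Icc (-(2 * η)) (2 * η) with hS
      have hvol : volume.real S = (2 * |a|) * (4 * η) := by
        rw [hS, measureReal_def, Measure.volume_eq_prod, Measure.prod_prod, Real.volume_Icc,
          Real.volume_Icc, ENNReal.toReal_mul, ENNReal.toReal_ofReal (by linarith [abs_nonneg a]),
          ENNReal.toReal_ofReal (by linarith)]
        ring
      have hrestr : ∫ x : ℝ × ℝ, (A η x + A η (x.1, -x.2)) =
          ∫ x in S, (A η x + A η (x.1, -x.2)) := by
        refine (setIntegral_eq_integral_of_forall_compl_eq_zero fun x hx => ?_).symm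
        rw [hpt]
        by_cases h2 : 2 < |x.2 / η|
        · rw [(hθd _).2.1 h2]; simp
        · have h3 : |x.2| ≤ 2 * η := by
            rw [not_lt, abs_div, abs_of_pos hη, div_le_iff₀ hη] at h2; exact h2
          have ht : x.1 ∉ Ioo (-a) a := by
            intro ht
            have ha : 0 < a := by linarith [ht.1, ht.2]
            refine hx ⟨?_, abs_le.1 h3⟩
            rw [abs_of_pos ha]; exact Ioo_subset_Icc_self ht
          have e1 : ψ x = 0 := image_eq_zero_of_notMem_tsupport fun h => ht (hψ.3 h).1
          have e2 : ψ (x.1, -x.2) = 0 := image_eq_zero_of_notMem_tsupport fun h => ht (hψ.3 h).1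
          simp [e1, e2]
      have hbd : ‖∫ x in S, (A η x + A η (x.1, -x.2))‖ ≤
          ((2 * L + M) * ε * (C / η)) * volume.real S := by
        refine norm_setIntegral_le_of_norm_le_const ?_ fun x hx => ?_
        · exact (isCompact_Icc.prod isCompact_Icc).measure_lt_top
        · rw [hpt, norm_mul]
          refine mul_le_mul (hB2 x ?_) ?_ (norm_nonneg _) (by positivity)
          · have := abs_le.2 hx.2; linarith
          · rw [Complex.norm_real, norm_div, Real.norm_of_nonneg hη.le]
            exact div_le_div_of_nonneg_right (hθd _).1 hη.le
      rw [hfold, hrestr, norm_mul]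
      rw [hvol] at hbd
      calc ‖(1 / 2 : ℂ)‖ * ‖∫ x in S, (A η x + A η (x.1, -x.2))‖
          ≤ 1 / 2 * (((2 * L + M) * ε * (C / η)) * ((2 * |a|) * (4 * η))) := by
            gcongr
            norm_num
        _ = 4 * |a| * ((2 * L + M) * C) * ε := by field_simp
    rw [Metric.tendsto_atTop]
    intro ε hε
    set Q := 4 * |a| * ((2 * L + M) * C) with hQ
    have hQ0 : 0 ≤ Q := by positivity
    obtain ⟨δ, hδ, hm⟩ := hmain (ε / (Q + 1)) (by positivity)
    obtain ⟨N, hN⟩ := exists_nat_one_div_lt hδ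
    refine ⟨N, fun n hn => ?_⟩
    have h1 : (1 : ℝ) / (n + 1) < δ := (one_div_le_one_div_of_le (by positivity)
      (by exact_mod_cast Nat.succ_le_succ hn)).trans_lt hN
    rw [dist_zero_right]
    refine (hm _ (by positivity) h1).trans_lt ?_
    rw [mul_div_assoc', div_lt_iff₀ (by positivity)]
    nlinarith
  have hlim3 : Tendsto (fun n : ℕ => ∫ x, T (1 / ((n : ℝ) + 1)) x *
      (H x * dOp 1 Complex.I ψ x + f x * ψ x)) atTop (𝓝 0) := by
    have := (hlim2.const_mul Complex.I).neg
    rw [mul_zero, neg_zero] at this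
    refine this.congr fun n => ?_
    rw [hstep _ (by positivity)]
  have := tendsto_nhds_unique hlim1 hlim3
  rw [integral_add i1 i2] at this
  linear_combination this

/-- The coordinates `(t, s) ↦ c + t + i s`. -/
def planeChart (c : ℂ) (x : ℝ × ℝ) : ℂ := c + x.1 + x.2 * Complex.I

theorem contDiff_planeChart (c : ℂ) {n : WithTop ℕ∞} : ContDiff ℝ n (planeChart c) := by
  have h1 : ContDiff ℝ n (fun x : ℝ × ℝ => (x.1 : ℂ)) :=
    Complex.ofRealCLM.contDiff.comp contDiff_fst
  have h2 : ContDiff ℝ n (fun x : ℝ × ℝ => (x.2 : ℂ)) :=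
    Complex.ofRealCLM.contDiff.comp contDiff_snd
  exact (contDiff_const.add h1).add (h2.mul contDiff_const)

theorem fderiv_planeChart (c : ℂ) (x v : ℝ × ℝ) :
    fderiv ℝ (planeChart c) x v = v.1 + v.2 * Complex.I := by
  have h1 : HasFDerivAt (fun x : ℝ × ℝ => (x.1 : ℂ))
      (Complex.ofRealCLM.comp (ContinuousLinearMap.fst ℝ ℝ ℝ)) x :=
    Complex.ofRealCLM.hasFDerivAt.comp x hasFDerivAt_fst
  have h2 : HasFDerivAt (fun x : ℝ × ℝ => (x.2 : ℂ))
      (Complex.ofRealCLM.comp (ContinuousLinearMap.snd ℝ ℝ ℝ)) x :=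
    Complex.ofRealCLM.hasFDerivAt.comp x hasFDerivAt_snd
  have h3 : HasFDerivAt (planeChart c) _ x := (h1.const_add c).add (h2.mul_const Complex.I)
  rw [h3.fderiv]
  simp [mul_comm]

theorem dOp_comp_of_differentiableAt {p q : ℂ} {g : ℂ → ℂ} {Z : ℝ × ℝ → ℂ} {x : ℝ × ℝ}
    (hg : DifferentiableAt ℂ g (Z x)) (hZ : DifferentiableAt ℝ Z x) :
    dOp p q (fun y => g (Z y)) x = deriv g (Z x) * dOp p q Z x := by
  have h1 : HasFDerivAt g _ (Z x) := hg.hasDerivAt.hasFDerivAt.restrictScalars ℝ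
  have h2 := h1.comp x hZ.hasFDerivAt
  simp only [dOp, partial₁, partial₂]
  have h3 : fderiv ℝ (fun y => g (Z y)) x = _ := h2.fderiv
  rw [h3]
  simp
  ring

theorem dOp_planeChart (c : ℂ) (x : ℝ × ℝ) : dOp 1 Complex.I (planeChart c) x = 0 := by
  simp only [dOp, partial₁, partial₂, fderiv_planeChart]
  simp

/-- A continuous function that is holomorphic off a horizontal line is holomorphic. -/
theorem differentiableAt_of_differentiableAt_off_line {g : ℂ → ℂ} {c : ℂ} {r : ℝ} (hr : 0 < r)
    (hg : ContinuousOn g (Metric.ball c r))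
    (hd : ∀ z ∈ Metric.ball c r, z.im ≠ c.im → DifferentiableAt ℂ g z) :
    DifferentiableAt ℂ g c := by
  set a := r / 4 with ha
  have ha0 : 0 < a := by positivity
  set O := Ioo (-a) a ×ˢ Ioo (-a) a with hO
  set H : ℝ × ℝ → ℂ := fun x => g (planeChart c x) with hHdef
  have hOo : IsOpen O := isOpen_Ioo.prod isOpen_Ioo
  have hmaps : ∀ x ∈ Icc (-a) a ×ˢ Icc (-a) a, planeChart c x ∈ Metric.ball c r := by
    intro x hx
    rw [Metric.mem_ball, dist_eq_norm]
    have : planeChart c x - c = x.1 + x.2 * Complex.I := by simp [planeChart]; ring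
    rw [this]
    refine (norm_add_le _ _).trans_lt ?_
    rw [norm_mul, Complex.norm_I, mul_one, Complex.norm_real, Complex.norm_real]
    have h1 := abs_le.2 hx.1
    have h2 := abs_le.2 hx.2
    simp only [Real.norm_eq_abs]
    linarith
  have hsub : O ⊆ Icc (-a) a ×ˢ Icc (-a) a := prod_mono Ioo_subset_Icc_self Ioo_subset_Icc_self
  have hHc : ContinuousOn H (Icc (-a) a ×ˢ Icc (-a) a) :=
    hg.comp (contDiff_planeChart c (n := 0)).continuous.continuousOn hmaps
  have him : ∀ x : ℝ × ℝ, (planeChart c x).im = c.im + x.2 := by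
    intro x; simp [planeChart]
  have hoff : ∀ x ∈ O, x.2 ≠ 0 → DifferentiableAt ℂ g (planeChart c x) := by
    intro x hx h0
    exact hd _ (hmaps x (hsub hx)) (by rw [him]; simpa using h0)
  have hne : IsOpen {x : ℝ × ℝ | x.2 ≠ 0} := isOpen_ne.preimage continuous_snd
  have hH1 : ContDiffOn ℝ 1 H (O ∩ {x | x.2 ≠ 0}) := by
    set W := planeChart c '' (O ∩ {x | x.2 ≠ 0}) with hW
    have hin : ∀ x ∈ O ∩ {x : ℝ × ℝ | x.2 ≠ 0}, ContDiffAt ℝ 1 g (planeChart c x) := by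
      intro x hx
      have hnb : {z ∈ Metric.ball c r | z.im ≠ c.im} ∈ 𝓝 (planeChart c x) := by
        refine (Metric.isOpen_ball.inter (isOpen_ne.preimage Complex.continuous_im)).mem_nhds
          ⟨hmaps x (hsub hx.1), ?_⟩
        have h0 : x.2 ≠ 0 := hx.2
        simp only [mem_preimage, mem_ofPred_eq, him]
        simpa using h0
      have : AnalyticAt ℂ g (planeChart c x) := by
        have hdo : DifferentiableOn ℂ g {z ∈ Metric.ball c r | z.im ≠ c.im} :=
          fun z hz => (hd z hz.1 hz.2).differentiableWithinAt
        exact hdo.analyticAt hnb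
      exact (this.contDiffAt (n := 1)).restrict_scalars ℝ
    intro x hx
    exact ((hin x hx).comp x (contDiff_planeChart c).contDiffAt).contDiffWithinAt
  have huc := (isCompact_Icc.prod isCompact_Icc).uniformContinuousOn_of_continuous hHc
  obtain ⟨M, hM⟩ := (isCompact_Icc.prod isCompact_Icc).exists_bound_of_continuousOn hHc
  have hM0 : 0 ≤ M := (norm_nonneg _).trans (hM 0 ⟨by simp [ha0.le], by simp [ha0.le]⟩)
  -- Continuity of g on a compact square gives the absence of a jump uniformly along the line.
  have hweak := weak_of_glue (a := a) (b := a) (H := H) (f := fun _ => 0) hH1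
    (fun x hx h0 => by
      rw [hHdef, dOp_comp_of_differentiableAt (hoff x hx h0)
        ((contDiff_planeChart c (n := 1)).differentiable one_ne_zero x), dOp_planeChart, mul_zero])
    continuousOn_const ((hHc.mono hsub).locallyIntegrableOn hOo.measurableSet)
    (by
      intro ε hε
      obtain ⟨δ, hδ, hu⟩ := Metric.uniformContinuousOn_iff.1 huc ε hε
      refine ⟨min (min (δ / 2) a) (ε / (M + 1)), by positivity, fun t ht s hs => ?_⟩
      have hs1 : s < δ / 2 := hs.2.trans_le ((min_le_left _ _).trans (min_le_left _ _))
      have hs2 : s < a := hs.2.trans_le ((min_le_left _ _).trans (min_le_right _ _))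
      have hs3 : s < ε / (M + 1) := hs.2.trans_le (min_le_right _ _)
      have hs0 := hs.1
      have m1 : ((t, s) : ℝ × ℝ) ∈ Icc (-a) a ×ˢ Icc (-a) a :=
        ⟨Ioo_subset_Icc_self ht, by constructor <;> simp <;> linarith⟩
      have m2 : ((t, -s) : ℝ × ℝ) ∈ Icc (-a) a ×ˢ Icc (-a) a :=
        ⟨Ioo_subset_Icc_self ht, by constructor <;> simp <;> linarith⟩
      refine ⟨?_, ?_⟩
      · rw [← dist_eq_norm]
        refine (hu _ m1 _ m2 ?_).le
        rw [Prod.dist_eq, dist_self, Real.dist_eq]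
        simp only [sub_neg_eq_add]
        rw [abs_of_pos (by linarith)]
        exact max_lt hδ (by linarith)
      · have := hM _ m1
        rw [lt_div_iff₀ (by positivity)] at hs3
        nlinarith [norm_nonneg (H (t, s))])
  have hw2 : ∀ ψ, IsTestFunction O ψ → ∫ x, H x * dOp 1 Complex.I ψ x = - ∫ x, (0 : ℂ) * ψ x :=
    hweak
  obtain ⟨H', hH', ρ, hρ, hρO, hae⟩ := exists_contDiff_of_weak (p := 1) (q := Complex.I) (m := 1)
    (by simp) hOo ((hHc.mono hsub).locallyIntegrableOn hOo.measurableSet)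
    (contDiffOn_const (c := (0 : ℂ))) hw2 (x₀ := 0) ⟨by simp [ha0], by simp [ha0]⟩
  have hHH' : EqOn H H' (Metric.ball 0 ρ) :=
    Measure.eqOn_open_of_ae_eq ((ae_restrict_iff' Metric.isOpen_ball.measurableSet).2 hae)
      Metric.isOpen_ball (hHc.mono (hρO.trans hsub)) hH'.continuous.continuousOn
  have hdH' : ∀ x ∈ Metric.ball (0 : ℝ × ℝ) ρ, x.2 ≠ 0 → dOp 1 Complex.I H' x = 0 := by
    intro x hx h0
    rw [← dOp_congr (hHH'.eventuallyEq_of_mem (Metric.isOpen_ball.mem_nhds hx)), hHdef,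
      dOp_comp_of_differentiableAt (hoff x (hρO hx) h0)
        ((contDiff_planeChart c (n := 1)).differentiable one_ne_zero x), dOp_planeChart, mul_zero]
  -- The Cauchy–Riemann equation at the centre, which lies on the line, is the limit of that at the
  -- points (0, 1/(n+1)) off the line.
  have hd0 : dOp 1 Complex.I H' 0 = 0 := by
    have ht : Tendsto (fun n : ℕ => ((0 : ℝ), (1 : ℝ) / (n + 1))) atTop (𝓝 (0 : ℝ × ℝ)) :=
      tendsto_const_nhds.prodMk_nhds tendsto_one_div_add_atTop_nhds_zero_nat
    have h1 := ((continuous_dOp (p := 1) (q := Complex.I) hH').tendsto 0).comp ht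
    refine tendsto_nhds_unique h1 (tendsto_const_nhds.congr' ?_)
    filter_upwards [ht (Metric.ball_mem_nhds 0 hρ)] with n hn
    exact (hdH' _ hn (by simp; positivity)).symm
  set e : ℂ → ℝ × ℝ := fun z => ((z - c).re, (z - c).im) with he
  have hec0 : e c = 0 := by simp [he]
  have hge : g =ᶠ[𝓝 c] fun z => H' (e z) := by
    have hec : Continuous e := by fun_prop
    have : e ⁻¹' Metric.ball 0 ρ ∈ 𝓝 c :=
      hec.continuousAt.preimage_mem_nhds (by rw [hec0]; exact Metric.ball_mem_nhds _ hρ)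
    filter_upwards [this] with z hz
    rw [← hHH' hz, hHdef]
    congr 1
    simp only [planeChart, he]
    rw [add_assoc, Complex.re_add_im]
    ring
  have hef : HasFDerivAt e (Complex.reCLM.prod Complex.imCLM) c := by
    have h1 := Complex.reCLM.hasFDerivAt.comp c ((hasFDerivAt_id (𝕜 := ℝ) c).sub_const c)
    have h2 := Complex.imCLM.hasFDerivAt.comp c ((hasFDerivAt_id (𝕜 := ℝ) c).sub_const c)
    exact h1.prodMk h2
  have hcomp : HasFDerivAt (fun z => H' (e z))
      ((fderiv ℝ H' 0).comp (Complex.reCLM.prod Complex.imCLM)) c := by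
    have := (hH'.differentiable one_ne_zero (e c)).hasFDerivAt.comp c hef
    rwa [hec0] at this
  refine DifferentiableAt.congr_of_eventuallyEq ?_ hge
  rw [differentiableAt_complex_iff_differentiableAt_real]
  refine ⟨hcomp.differentiableAt, ?_⟩
  rw [hcomp.fderiv]
  simp only [dOp, partial₁, partial₂] at hd0
  simp
  linear_combination -Complex.I * hd0 + (fderiv ℝ H' 0 (0, 1)) * Complex.I_sq

/-! ### Weak solutions: factorization and interior smoothness -/

/-- On a set of finite measure L² convergence implies L¹ convergence, and the bounded factor k
preserves it. This transfers integration by parts from test functions to H¹₀. -/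
theorem tendsto_integral_mul_of_eLpNorm {Ω : Set (ℝ × ℝ)} (hΩ : volume Ω ≠ ⊤)
    {h : ℕ → ℝ × ℝ → ℂ} {h₀ k : ℝ × ℝ → ℂ}
    (hm : ∀ n, MemLp (h n) 2 (volume.restrict Ω)) (hm₀ : MemLp h₀ 2 (volume.restrict Ω))
    (hk : Continuous k) (hkc : HasCompactSupport k)
    (ht : Tendsto (fun n => eLpNorm (fun x => h n x - h₀ x) 2 (volume.restrict Ω)) atTop (𝓝 0)) :
    Tendsto (fun n => ∫ x in Ω, h n x * k x) atTop (𝓝 (∫ x in Ω, h₀ x * k x)) := by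
  have : IsFiniteMeasure (volume.restrict Ω) := ⟨by
    rw [Measure.restrict_apply_univ]; exact hΩ.lt_top⟩
  obtain ⟨C, hC⟩ := hk.bounded_above_of_compact_support hkc
  have hint : ∀ g : ℝ × ℝ → ℂ, MemLp g 2 (volume.restrict Ω) →
      Integrable (fun x => g x * k x) (volume.restrict Ω) := fun g hg =>
    (hg.integrable one_le_two).mul_bdd (c := C) hk.aestronglyMeasurable (Eventually.of_forall hC)
  refine tendsto_integral_of_L1' _ (hint _ hm₀).aestronglyMeasurable (Eventually.of_forall fun n => hint _ (hm n)) ?_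
  have hle : ∀ n, eLpNorm ((fun x => h n x * k x) - fun x => h₀ x * k x) 1 (volume.restrict Ω) ≤
      ENNReal.ofReal C * (eLpNorm (fun x => h n x - h₀ x) 2 (volume.restrict Ω) *
        (volume.restrict Ω) univ ^ (1 / (1 : ENNReal).toReal - 1 / (2 : ENNReal).toReal)) := by
    intro n
    refine le_trans ?_ (mul_le_mul_right (eLpNorm_le_eLpNorm_mul_rpow_measure_univ one_le_two
      ((hm n).sub hm₀).aestronglyMeasurable) _)
    refine eLpNorm_le_mul_eLpNorm_of_ae_le_mul (Eventually.of_forall fun x => ?_) 1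
    simp only [Pi.sub_apply, ← sub_mul, norm_mul]
    rw [mul_comm]
    exact mul_le_mul_of_nonneg_right (hC x) (norm_nonneg _)
  refine tendsto_of_tendsto_of_tendsto_of_le_of_le tendsto_const_nhds ?_ (fun _ => zero_le) hle
  have h1 := ENNReal.Tendsto.mul_const (b := (volume.restrict Ω) univ ^
    (1 / (1 : ENNReal).toReal - 1 / (2 : ENNReal).toReal)) ht (Or.inr (by
      refine ENNReal.rpow_ne_top_of_nonneg (by norm_num) (measure_ne_top _ _)))
  have h2 := ENNReal.Tendsto.const_mul (a := ENNReal.ofReal C) h1 (Or.inr ENNReal.ofReal_ne_top)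
  simpa using h2

theorem IsTestFunction.contDiff_one {Ω : Set (ℝ × ℝ)} {φ : ℝ × ℝ → ℂ} (h : IsTestFunction Ω φ) :
    ContDiff ℝ 1 φ := h.1.of_le (by exact_mod_cast le_top)

theorem contDiff_fderiv_apply {φ : ℝ × ℝ → ℂ} (h : ContDiff ℝ ∞ φ) (v : ℝ × ℝ) :
    ContDiff ℝ ∞ fun x => fderiv ℝ φ x v :=
  (h.fderiv_right (m := ∞) (by simp)).clm_apply contDiff_const

theorem tsupport_fderiv_apply_subset {φ : ℝ × ℝ → ℂ} (v : ℝ × ℝ) :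
    tsupport (fun x => fderiv ℝ φ x v) ⊆ tsupport φ := by
  refine closure_minimal (fun x hx => ?_) (isClosed_tsupport _)
  by_contra h
  apply hx
  change fderiv ℝ φ x v = 0
  rw [(notMem_tsupport_iff_eventuallyEq.1 h).fderiv_eq]
  simp

theorem IsTestFunction.fderiv_apply {Ω : Set (ℝ × ℝ)} {φ : ℝ × ℝ → ℂ} (h : IsTestFunction Ω φ)
    (v : ℝ × ℝ) : IsTestFunction Ω fun x => fderiv ℝ φ x v :=
  ⟨contDiff_fderiv_apply h.1 v, h.2.fderiv_apply ℝ v, (tsupport_fderiv_apply_subset v).trans h.3⟩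

theorem setIntegral_mul_eq_integral {Ω : Set (ℝ × ℝ)} {g φ : ℝ × ℝ → ℂ} (hφ : tsupport φ ⊆ Ω) :
    ∫ x in Ω, g x * φ x = ∫ x, g x * φ x :=
  setIntegral_eq_integral_of_forall_compl_eq_zero fun x hx => by
    rw [image_eq_zero_of_notMem_tsupport (fun h => hx (hφ h)), mul_zero]

theorem IsTestFunction.memLp {Ω : Set (ℝ × ℝ)} {φ : ℝ × ℝ → ℂ} (h : IsTestFunction Ω φ)
    (μ : Measure (ℝ × ℝ)) [IsFiniteMeasureOnCompacts μ] : MemLp φ 2 μ :=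
  h.1.continuous.memLp_of_hasCompactSupport h.2

theorem dOp_one_zero (g : ℝ × ℝ → ℂ) : dOp 1 0 g = partial₁ g := by ext; simp [dOp]
theorem dOp_zero_one (g : ℝ × ℝ → ℂ) : dOp 0 1 g = partial₂ g := by ext; simp [dOp]

/-- The weak gradient of a function in `H¹₀`. -/
theorem IsH10.integral_mul_partial {Ω : Set (ℝ × ℝ)} (hΩ : volume Ω ≠ ⊤) {u g₁ g₂ : ℝ × ℝ → ℂ}
    (h : IsH10 Ω u g₁ g₂) {ψ : ℝ × ℝ → ℂ} (hψ : IsTestFunction Ω ψ) :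
    ∫ x, u x * partial₁ ψ x = - ∫ x, g₁ x * ψ x ∧ ∫ x, u x * partial₂ ψ x = - ∫ x, g₂ x * ψ x := by
  obtain ⟨φ, hφ, h0, h1, h2⟩ := h.approx
  have hmφ := fun n => (hφ n).memLp (volume.restrict Ω)
  have hm1 : ∀ n, MemLp (partial₁ (φ n)) 2 (volume.restrict Ω) :=
    fun n => ((hφ n).fderiv_apply (1, 0)).memLp _
  have hm2 : ∀ n, MemLp (partial₂ (φ n)) 2 (volume.restrict Ω) :=
    fun n => ((hφ n).fderiv_apply (0, 1)).memLp _
  have hψ1 : IsTestFunction Ω (partial₁ ψ) := hψ.fderiv_apply _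
  have hψ2 : IsTestFunction Ω (partial₂ ψ) := hψ.fderiv_apply _
  have ibp : ∀ p q : ℂ, ∀ n, ∫ x, φ n x * dOp p q ψ x = - ∫ x, dOp p q (φ n) x * ψ x := by
    intro p q n
    exact integral_mul_dOp_of_contDiffOn isOpen_univ (hφ n).contDiff_one.contDiffOn
      hψ.contDiff_one hψ.2 (subset_univ _)
  constructor
  · have l1 := tendsto_integral_mul_of_eLpNorm hΩ hmφ h.memLp hψ1.1.continuous hψ1.2 h0
    have l2 := (tendsto_integral_mul_of_eLpNorm hΩ hm1 h.memLp₁ hψ.1.continuous hψ.2 h1).neg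
    rw [setIntegral_mul_eq_integral hψ1.3] at l1
    rw [setIntegral_mul_eq_integral hψ.3] at l2
    refine tendsto_nhds_unique l1 (l2.congr fun n => ?_)
    rw [setIntegral_mul_eq_integral hψ.3, setIntegral_mul_eq_integral hψ1.3, ← dOp_one_zero,
      ← dOp_one_zero, ibp]
  · have l1 := tendsto_integral_mul_of_eLpNorm hΩ hmφ h.memLp hψ2.1.continuous hψ2.2 h0
    have l2 := (tendsto_integral_mul_of_eLpNorm hΩ hm2 h.memLp₂ hψ.1.continuous hψ.2 h2).neg
    rw [setIntegral_mul_eq_integral hψ2.3] at l1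
    rw [setIntegral_mul_eq_integral hψ.3] at l2
    refine tendsto_nhds_unique l1 (l2.congr fun n => ?_)
    rw [setIntegral_mul_eq_integral hψ.3, setIntegral_mul_eq_integral hψ2.3, ← dOp_zero_one,
      ← dOp_zero_one, ibp]

theorem fderiv_fderiv_apply_comm {φ : ℝ × ℝ → ℂ} {x : ℝ × ℝ} (h : ContDiffAt ℝ 2 φ x)
    (v w : ℝ × ℝ) :
    fderiv ℝ (fun y => fderiv ℝ φ y v) x w = fderiv ℝ (fun y => fderiv ℝ φ y w) x v := by
  have hd : DifferentiableAt ℝ (fderiv ℝ φ) x :=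
    (h.fderiv_right (m := 1) (by norm_num)).differentiableAt one_ne_zero
  have e : ∀ v w : ℝ × ℝ, fderiv ℝ (fun y => fderiv ℝ φ y v) x w = fderiv ℝ (fderiv ℝ φ) x w v := by
    intro v w
    rw [fderiv_clm_apply hd (differentiableAt_const v)]
    simp
  rw [e, e]
  exact (h.isSymmSndFDerivAt (by simp)).eq w v

/-- Local smooth representatives of a function on an open set glue together. -/
theorem exists_contDiffOn_of_local {Ω : Set (ℝ × ℝ)} {u : ℝ × ℝ → ℂ}
    (h : ∀ x ∈ Ω, ∃ U : ℝ × ℝ → ℂ, ContDiff ℝ ∞ U ∧ ∃ r > 0, Metric.ball x r ⊆ Ω ∧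
      ∀ᵐ y, y ∈ Metric.ball x r → u y = U y) :
    ∃ u' : ℝ × ℝ → ℂ, (∀ᵐ y, y ∈ Ω → u' y = u y) ∧ ContDiffOn ℝ ∞ u' Ω ∧ ∀ x ∉ Ω, u' x = 0 := by
  classical
  choose! U hU r hr hrΩ hae using h
  -- The diagonal of the family of local representatives. Two of them agree almost everywhere, hence
  -- by continuity everywhere, on the overlap of their balls, so near x the diagonal equals `U x`.
  refine ⟨fun x => if x ∈ Ω then U x x else 0, ?_⟩
  have heq : ∀ x ∈ Ω, ∀ y ∈ Metric.ball x (r x), (if y ∈ Ω then U y y else 0) = U x y := by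
    intro x hx y hy
    have hyΩ := hrΩ x hx hy
    rw [if_pos hyΩ]
    have hopen : IsOpen (Metric.ball x (r x) ∩ Metric.ball y (r y)) :=
      Metric.isOpen_ball.inter Metric.isOpen_ball
    refine Measure.eqOn_open_of_ae_eq (μ := volume)
      (U := Metric.ball x (r x) ∩ Metric.ball y (r y))
      ((ae_restrict_iff' hopen.measurableSet).2 ?_) hopen (hU y hyΩ).continuous.continuousOn
      (hU x hx).continuous.continuousOn ⟨hy, Metric.mem_ball_self (hr y hyΩ)⟩
    filter_upwards [hae x hx, hae y hyΩ] with z h1 h2 hz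
    rw [← h1 hz.1, ← h2 hz.2]
  refine ⟨?_, ?_, fun x hx => if_neg hx⟩
  · change volume {y | ¬ (y ∈ Ω → (if y ∈ Ω then U y y else 0) = u y)} = 0
    refine measure_null_of_locally_null _ fun x hx => ?_
    have hxΩ : x ∈ Ω := by
      by_contra h0
      exact hx fun h => absurd h h0
    refine ⟨_, mem_nhdsWithin_of_mem_nhds (Metric.ball_mem_nhds x (hr x hxΩ)) |>
      fun h => Filter.inter_mem h self_mem_nhdsWithin, ?_⟩
    refine measure_mono_null ?_ (hae x hxΩ)
    rintro y ⟨hy1, hy2⟩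
    simp only [mem_compl_iff, mem_ofPred_eq]
    intro h
    apply hy2
    intro _
    rw [heq x hxΩ y hy1, h hy1]
  · intro x hx
    refine ((hU x hx).contDiffAt.congr_of_eventuallyEq ?_).contDiffWithinAt
    filter_upwards [Metric.ball_mem_nhds x (hr x hx)] with y hy
    exact heq x hx y hy

theorem locallyIntegrableOn_of_memLp {Ω : Set (ℝ × ℝ)} (hΩ : volume Ω ≠ ⊤) {g : ℝ × ℝ → ℂ}
    (hg : MemLp g 2 (volume.restrict Ω)) : LocallyIntegrableOn g Ω := by
  have : IsFiniteMeasure (volume.restrict Ω) := ⟨by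
    rw [Measure.restrict_apply_univ]; exact hΩ.lt_top⟩
  exact IntegrableOn.locallyIntegrableOn (hg.integrable one_le_two)

/-- The factorized weak equation. -/
theorem weak_factor {Ω : Set (ℝ × ℝ)} (hΩ : volume Ω ≠ ⊤) {om b : ℂ} (hb : b ^ 2 = 1 - om ^ 2)
    {f u g₁ g₂ : ℝ × ℝ → ℂ} (h : IsH10 Ω u g₁ g₂)
    (hw : ∀ ψ : ℝ × ℝ → ℂ, IsTestFunction Ω ψ →
      ∫ x in Ω, (om ^ 2 * g₁ x * partial₁ ψ x - (1 - om ^ 2) * g₂ x * partial₂ ψ x) =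
        ∫ x in Ω, f x * ψ x) {ψ : ℝ × ℝ → ℂ} (hψ : IsTestFunction Ω ψ) :
    ∫ x, (om * g₁ x + b * g₂ x) * dOp (-om) b ψ x = - ∫ x, f x * ψ x := by
  have hψ1 : IsTestFunction Ω (partial₁ ψ) := hψ.fderiv_apply _
  have hψ2 : IsTestFunction Ω (partial₂ ψ) := hψ.fderiv_apply _
  have hl1 := locallyIntegrableOn_of_memLp hΩ h.memLp₁
  have hl2 := locallyIntegrableOn_of_memLp hΩ h.memLp₂
  have i11 := integrable_mul_of_tsupport_subset hl1 hψ1.1.continuous hψ1.2 hψ1.3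
  have i12 := integrable_mul_of_tsupport_subset hl1 hψ2.1.continuous hψ2.2 hψ2.3
  have i21 := integrable_mul_of_tsupport_subset hl2 hψ1.1.continuous hψ1.2 hψ1.3
  have i22 := integrable_mul_of_tsupport_subset hl2 hψ2.1.continuous hψ2.2 hψ2.3
  -- The cross terms of the product of the two factors cancel since a weak gradient is weakly curl
  -- free: both sides come from a mixed second derivative of ψ.
  have hcurl : ∫ x, g₁ x * partial₂ ψ x = ∫ x, g₂ x * partial₁ ψ x := by
    have e1 := (h.integral_mul_partial hΩ hψ2).1
    have e2 := (h.integral_mul_partial hΩ hψ1).2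
    have e3 : ∀ x, partial₁ (partial₂ ψ) x = partial₂ (partial₁ ψ) x := fun x =>
      fderiv_fderiv_apply_comm (hψ.1.contDiffAt.of_le (WithTop.coe_le_coe.2 le_top)) _ _
    simp only [e3] at e1
    linear_combination e1 - e2
  have h1 := hw ψ hψ
  rw [setIntegral_mul_eq_integral hψ.3, setIntegral_eq_integral_of_forall_compl_eq_zero] at h1
  swap
  · intro x hx
    rw [image_eq_zero_of_notMem_tsupport (fun h => hx (hψ1.3 h)),
      image_eq_zero_of_notMem_tsupport (fun h => hx (hψ2.3 h))]
    simp
  have e4 : ∫ x, (om ^ 2 * g₁ x * partial₁ ψ x - (1 - om ^ 2) * g₂ x * partial₂ ψ x) =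
      om ^ 2 * (∫ x, g₁ x * partial₁ ψ x) - (1 - om ^ 2) * ∫ x, g₂ x * partial₂ ψ x := by
    rw [← integral_const_mul, ← integral_const_mul,
      ← integral_sub (i11.const_mul _) (i22.const_mul _)]
    congr 1; ext x; ring
  have e5 : ∫ x, (om * g₁ x + b * g₂ x) * dOp (-om) b ψ x =
      (-om ^ 2 * (∫ x, g₁ x * partial₁ ψ x) + b ^ 2 * ∫ x, g₂ x * partial₂ ψ x) +
      (om * b * (∫ x, g₁ x * partial₂ ψ x) - om * b * ∫ x, g₂ x * partial₁ ψ x) := by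
    rw [← integral_const_mul, ← integral_const_mul, ← integral_const_mul, ← integral_const_mul,
      ← integral_add (i11.const_mul _) (i22.const_mul _),
      ← integral_sub (i12.const_mul _) (i21.const_mul _), ← integral_add]
    · congr 1; ext x; simp only [dOp]; ring
    · exact (i11.const_mul _).add (i22.const_mul _)
    · exact (i12.const_mul _).sub (i21.const_mul _)
  rw [e5, hcurl, hb, ← h1, e4]
  ring

theorem contDiffOn_dOp {p q : ℂ} {Ω : Set (ℝ × ℝ)} (hΩ : IsOpen Ω) {u : ℝ × ℝ → ℂ}
    (hu : ContDiffOn ℝ ∞ u Ω) : ContDiffOn ℝ ∞ (dOp p q u) Ω := by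
  have := hu.fderiv_of_isOpen hΩ (m := ∞) (by simp)
  exact (contDiffOn_const.mul (this.clm_apply contDiffOn_const)).add
    (contDiffOn_const.mul (this.clm_apply contDiffOn_const))

theorem ae_eq_of_weak_eq {Ω : Set (ℝ × ℝ)} (hΩ : IsOpen Ω) {g g' : ℝ × ℝ → ℂ}
    (hg : LocallyIntegrableOn g Ω) (hg' : LocallyIntegrableOn g' Ω)
    (h : ∀ ψ, IsTestFunction Ω ψ → ∫ x, g x * ψ x = ∫ x, g' x * ψ x) :
    ∀ᵐ x, x ∈ Ω → g x = g' x := by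
  have := hΩ.ae_eq_zero_of_integral_contDiff_smul_eq_zero (hg.sub hg') (μ := volume) ?_
  · filter_upwards [this] with x hx hxΩ
    exact sub_eq_zero.1 (hx hxΩ)
  intro ψ hψ hψc hψs
  set E : ℝ × ℝ → ℂ := fun x => (ψ x : ℂ)
  have hEs : tsupport E ⊆ Ω := by
    refine (closure_mono ?_).trans hψs
    intro x hx h0
    exact hx (by simp [E, h0])
  have hE : IsTestFunction Ω E := ⟨Complex.ofRealCLM.contDiff.comp hψ,
    hψc.comp_left (g := fun t : ℝ => (t : ℂ)) (by simp), hEs⟩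
  have e := h E hE
  have i1 := integrable_mul_of_tsupport_subset hg hE.1.continuous hE.2 hE.3
  have i2 := integrable_mul_of_tsupport_subset hg' hE.1.continuous hE.2 hE.3
  rw [← sub_eq_zero, ← integral_sub i1 i2] at e
  rw [← e]
  congr 1; ext x
  simp [E]; ring

/-- Interior regularity: a weak solution has a representative which is smooth in `Ω`, vanishes
outside `Ω`, and solves the factorized equations pointwise. -/
theorem exists_smooth_solution {Ω : Set (ℝ × ℝ)} (hΩo : IsOpen Ω) (hΩ : volume Ω ≠ ⊤) {om b : ℂ}
    (hb : b ^ 2 = 1 - om ^ 2) (hell : (b * (starRingEnd ℂ) om).im ≠ 0)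
    {f u : ℝ × ℝ → ℂ} (hf : IsTestFunction Ω f) (hu : IsDirichletSolution Ω om f u) :
    ∃ u' : ℝ × ℝ → ℂ, u' =ᵐ[volume.restrict Ω] u ∧ ContDiffOn ℝ ∞ u' Ω ∧ (∀ x ∉ Ω, u' x = 0) ∧
      IsH10 Ω u' (partial₁ u') (partial₂ u') ∧
      (∀ x ∈ Ω, dOp (-om) b (dOp om b u') x = f x) ∧
      ∀ x ∈ Ω, dOp om b (dOp (-om) b u') x = f x := by
  obtain ⟨g₁, g₂, hH, hw⟩ := hu
  have hl0 := locallyIntegrableOn_of_memLp hΩ hH.memLp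
  have hl1 := locallyIntegrableOn_of_memLp hΩ hH.memLp₁
  have hl2 := locallyIntegrableOn_of_memLp hΩ hH.memLp₂
  have hlv : ∀ a c : ℂ, LocallyIntegrableOn (fun x => a * g₁ x + c * g₂ x) Ω := fun a c =>
    (hl1.smul a).add (hl2.smul c)
  have hell' : (b * (starRingEnd ℂ) (-om)).im ≠ 0 := by
    rw [map_neg, mul_neg, Complex.neg_im]; exact neg_ne_zero.2 hell
  have hfac := fun ψ (hψ : IsTestFunction Ω ψ) => weak_factor hΩ hb hH hw hψ
  have huweak : ∀ a c : ℂ, ∀ ψ, IsTestFunction Ω ψ →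
      ∫ x, u x * dOp a c ψ x = - ∫ x, (a * g₁ x + c * g₂ x) * ψ x := by
    intro a c ψ hψ
    have hψ1 : IsTestFunction Ω (partial₁ ψ) := hψ.fderiv_apply _
    have hψ2 : IsTestFunction Ω (partial₂ ψ) := hψ.fderiv_apply _
    have e1 : ∫ x, u x * dOp a c ψ x =
        a * (∫ x, u x * partial₁ ψ x) + c * ∫ x, u x * partial₂ ψ x := by
      rw [← integral_const_mul, ← integral_const_mul, ← integral_add]
      · congr 1; ext x; simp only [dOp]; ring
      · exact (integrable_mul_of_tsupport_subset hl0 hψ1.1.continuous hψ1.2 hψ1.3).const_mul _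
      · exact (integrable_mul_of_tsupport_subset hl0 hψ2.1.continuous hψ2.2 hψ2.3).const_mul _
    have e2 : ∫ x, (a * g₁ x + c * g₂ x) * ψ x =
        a * (∫ x, g₁ x * ψ x) + c * ∫ x, g₂ x * ψ x := by
      rw [← integral_const_mul, ← integral_const_mul, ← integral_add]
      · congr 1; ext x; ring
      · exact (integrable_mul_of_tsupport_subset hl1 hψ.1.continuous hψ.2 hψ.3).const_mul _
      · exact (integrable_mul_of_tsupport_subset hl2 hψ.1.continuous hψ.2 hψ.3).const_mul _
    rw [e1, e2, (hH.integral_mul_partial hΩ hψ).1, (hH.integral_mul_partial hΩ hψ).2]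
    ring
  -- First order regularity twice: for ω g₁ + b g₂, whose image under the second factor is f, and
  -- then for u, whose image under the first factor is now known to be smooth.
  have hlocal : ∀ x ∈ Ω, ∃ U : ℝ × ℝ → ℂ, ContDiff ℝ ∞ U ∧ ∃ r > 0, Metric.ball x r ⊆ Ω ∧
      ∀ᵐ y, y ∈ Metric.ball x r → u y = U y := by
    intro x hx
    obtain ⟨V, hV, r, hr, hrΩ, hVae⟩ := exists_contDiff_of_weak (m := ⊤) hell' hΩo
      (hlv om b) hf.1.contDiffOn hfac hx
    obtain ⟨U, hU, r', hr', hrr', hUae⟩ := exists_contDiff_of_weak (m := ⊤) hell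
      (O := Metric.ball x r) (H := u) (f := V) Metric.isOpen_ball (hl0.mono_set hrΩ) hV.contDiffOn
      (by
        intro ψ hψ
        rw [huweak om b ψ ⟨hψ.1, hψ.2, hψ.3.trans hrΩ⟩]
        congr 1
        refine integral_congr_ae ?_
        filter_upwards [hVae] with y hy
        by_cases hyr : y ∈ Metric.ball x r
        · rw [hy hyr]
        · simp [image_eq_zero_of_notMem_tsupport (fun h => hyr (hψ.3 h))])
      (Metric.mem_ball_self hr)
    exact ⟨U, hU, r', hr', hrr'.trans hrΩ, hUae⟩
  obtain ⟨u', hae, hsm, hout⟩ := exists_contDiffOn_of_local hlocal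
  have hae' : u' =ᵐ[volume.restrict Ω] u := (ae_restrict_iff' hΩo.measurableSet).2 hae
  have hsm1 : ContDiffOn ℝ 1 u' Ω := hsm.of_le (by exact_mod_cast le_top)
  have hgrad : ∀ a c : ℂ, ∀ᵐ x, x ∈ Ω → a * g₁ x + c * g₂ x = dOp a c u' x := by
    intro a c
    have hcont : ContinuousOn (dOp a c u') Ω := (contDiffOn_dOp hΩo hsm).continuousOn
    refine ae_eq_of_weak_eq hΩo (hlv a c) (hcont.locallyIntegrableOn hΩo.measurableSet) ?_
    intro ψ hψ
    have e1 := huweak a c ψ hψ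
    have e2 := integral_mul_dOp_of_contDiffOn (p := a) (q := c) hΩo hsm1 hψ.contDiff_one hψ.2 hψ.3
    have e3 : ∫ x, u' x * dOp a c ψ x = ∫ x, u x * dOp a c ψ x := by
      refine integral_congr_ae ?_
      filter_upwards [hae] with x hx
      by_cases hxΩ : x ∈ Ω
      · rw [hx hxΩ]
      · simp [image_eq_zero_of_notMem_tsupport (fun h => hxΩ (hψ.3 (tsupport_dOp_subset h)))]
    rw [e3, e1] at e2
    linear_combination -e2
  -- Stated for an arbitrary coefficient since it is used for ω and for −ω, that is, for both orders
  -- of the factors.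
  have hfacpt : ∀ om : ℂ, (∀ ψ : ℝ × ℝ → ℂ, IsTestFunction Ω ψ →
      ∫ x, (om * g₁ x + b * g₂ x) * dOp (-om) b ψ x = - ∫ x, f x * ψ x) →
      ∀ x ∈ Ω, dOp (-om) b (dOp om b u') x = f x := by
    intro om hfac
    have hs1 : ContDiffOn ℝ ∞ (dOp om b u') Ω := contDiffOn_dOp hΩo hsm
    have hcont : ContinuousOn (dOp (-om) b (dOp om b u')) Ω := (contDiffOn_dOp hΩo hs1).continuousOn
    have key : ∀ᵐ x, x ∈ Ω → dOp (-om) b (dOp om b u') x = f x := by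
      refine ae_eq_of_weak_eq hΩo (hcont.locallyIntegrableOn hΩo.measurableSet)
        (hf.1.continuous.continuousOn.locallyIntegrableOn hΩo.measurableSet) ?_
      intro ψ hψ
      have e2 := integral_mul_dOp_of_contDiffOn (p := -om) (q := b) hΩo
        (hs1.of_le (by exact_mod_cast le_top)) hψ.contDiff_one hψ.2 hψ.3
      have e3 : ∫ x, dOp om b u' x * dOp (-om) b ψ x =
          ∫ x, (om * g₁ x + b * g₂ x) * dOp (-om) b ψ x := by
        refine integral_congr_ae ?_
        filter_upwards [hgrad om b] with x hx
        by_cases hxΩ : x ∈ Ω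
        · rw [hx hxΩ]
        · simp [image_eq_zero_of_notMem_tsupport (fun h => hxΩ (hψ.3 (tsupport_dOp_subset h)))]
      rw [e3, hfac ψ hψ] at e2
      linear_combination e2
    exact Measure.eqOn_open_of_ae_eq ((ae_restrict_iff' hΩo.measurableSet).2 key) hΩo hcont
      hf.1.continuous.continuousOn
  have hg1 : g₁ =ᵐ[volume.restrict Ω] partial₁ u' := by
    refine (ae_restrict_iff' hΩo.measurableSet).2 ?_
    filter_upwards [hgrad 1 0] with x hx hxΩ
    simpa [dOp] using hx hxΩ
  have hg2 : g₂ =ᵐ[volume.restrict Ω] partial₂ u' := by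
    refine (ae_restrict_iff' hΩo.measurableSet).2 ?_
    filter_upwards [hgrad 0 1] with x hx hxΩ
    simpa [dOp] using hx hxΩ
  refine ⟨u', hae', hsm, hout, ?_, hfacpt om hfac, ?_⟩
  · obtain ⟨φ, hφ, a0, a1, a2⟩ := hH.approx
    refine ⟨(memLp_congr_ae hae').2 hH.memLp, (memLp_congr_ae hg1).1 hH.memLp₁,
      (memLp_congr_ae hg2).1 hH.memLp₂, φ, hφ, ?_, ?_, ?_⟩
    · refine a0.congr fun n => eLpNorm_congr_ae ?_
      filter_upwards [hae'] with x hx; rw [hx]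
    · refine a1.congr fun n => eLpNorm_congr_ae ?_
      filter_upwards [hg1] with x hx; rw [hx]
    · refine a2.congr fun n => eLpNorm_congr_ae ?_
      filter_upwards [hg2] with x hx; rw [hx]
  · have := hfacpt (-om) fun ψ hψ => weak_factor hΩ (om := -om) (by rw [hb]; ring) hH
      (by simpa using hw) hψ
    simpa using this

/-! ### Energy estimates and decay at the boundary -/

/-- A function smooth in `Ω`, vanishing outside `Ω`, in `H¹₀(Ω)`, and solving pointwise the
factorized equation in `Ω`. -/
structure IsSmoothSolution (Ω : Set (ℝ × ℝ)) (om b : ℂ) (f u : ℝ × ℝ → ℂ) : Prop where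
  isOpen : IsOpen Ω
  volume_ne_top : volume Ω ≠ ⊤
  elliptic : (b * (starRingEnd ℂ) om).im ≠ 0
  test : IsTestFunction Ω f
  contDiffOn : ContDiffOn ℝ ∞ u Ω
  eq_zero : ∀ x ∉ Ω, u x = 0
  isH10 : IsH10 Ω u (partial₁ u) (partial₂ u)
  eq_plus : ∀ x ∈ Ω, dOp (-om) b (dOp om b u) x = f x
  eq_minus : ∀ x ∈ Ω, dOp om b (dOp (-om) b u) x = f x

theorem sqrt_integral_eq_eLpNorm {μ : Measure (ℝ × ℝ)} {V : ℝ × ℝ → ℂ} (hV : MemLp V 2 μ) :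
    Real.sqrt (∫ y, ‖V y‖ ^ 2 ∂μ) = (eLpNorm V 2 μ).toReal := by
  rw [hV.eLpNorm_eq_integral_rpow_norm two_ne_zero ENNReal.ofNat_ne_top,
    ENNReal.toReal_ofReal (by positivity), Real.sqrt_eq_rpow]
  norm_num

/-- The fundamental theorem of calculus along the segment from y to y + w, followed by
Cauchy–Schwarz on the unit interval. -/
theorem enorm_sq_segment_le {φ : ℝ × ℝ → ℂ} (hφ : ContDiff ℝ 1 φ) (y w : ℝ × ℝ)
    (h0 : φ (y + w) = 0) :
    ‖φ y‖ₑ ^ 2 ≤ ∫⁻ s in Icc (0 : ℝ) 1, ‖fderiv ℝ φ (y + s • w) w‖ₑ ^ 2 := by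
  set g : ℝ → ℂ := fun s => fderiv ℝ φ (y + s • w) w with hg
  have hgc : Continuous g :=
    ((hφ.continuous_fderiv one_ne_zero).comp (by fun_prop)).clm_apply continuous_const
  have hd : ∀ s : ℝ, HasDerivAt (fun s : ℝ => φ (y + s • w)) (g s) s := by
    intro s
    have h1 : HasDerivAt (fun s : ℝ => y + s • w) w s := by
      simpa using ((hasDerivAt_id s).smul_const w).const_add y
    exact (hφ.differentiable one_ne_zero (y + s • w)).hasFDerivAt.comp_hasDerivAt s h1
  have hint := intervalIntegral.integral_eq_sub_of_hasDerivAt (fun s _ => hd s)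
    (hgc.intervalIntegrable (μ := volume) 0 1)
  simp only [one_smul, zero_smul, add_zero, h0, zero_sub] at hint
  rw [intervalIntegral.integral_of_le zero_le_one, ← integral_Icc_eq_integral_Ioc] at hint
  have h2 : ‖φ y‖ₑ ≤ ∫⁻ s in Icc (0 : ℝ) 1, ‖g s‖ₑ := by
    rw [← enorm_neg, ← hint]
    exact enorm_integral_le_lintegral_enorm _
  have h3 := ENNReal.lintegral_mul_le_Lp_mul_Lq (volume.restrict (Icc (0 : ℝ) 1))
    (Real.HolderConjugate.two_two) (f := fun s => ‖g s‖ₑ) (g := fun _ => 1)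
    hgc.enorm.aemeasurable aemeasurable_const
  simp only [Pi.mul_apply, mul_one, ENNReal.one_rpow, lintegral_one, Measure.restrict_apply_univ,
    Real.volume_Icc, sub_zero, ENNReal.ofReal_one] at h3
  calc ‖φ y‖ₑ ^ 2 ≤ ((∫⁻ s in Icc (0 : ℝ) 1, ‖g s‖ₑ ^ (2 : ℝ)) ^ (1 / (2 : ℝ))) ^ 2 :=
        pow_le_pow_left' (h2.trans h3) 2
    _ = ∫⁻ s in Icc (0 : ℝ) 1, ‖g s‖ₑ ^ 2 := by
        rw [← ENNReal.rpow_natCast, ← ENNReal.rpow_mul]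
        norm_num

/-- Integrate the segment estimate over the ball and interchange the integrals: all balls swept out
by the translation lie in the ball of radius ρ + ‖w‖. -/
theorem lintegral_sq_le_of_translate {φ : ℝ × ℝ → ℂ} (hφ : ContDiff ℝ 1 φ)
    {x w : ℝ × ℝ} {ρ : ℝ} (h0 : ∀ y ∈ Metric.ball x ρ, φ (y + w) = 0) :
    ∫⁻ y in Metric.ball x ρ, ‖φ y‖ₑ ^ 2 ≤
      ∫⁻ y in Metric.ball x (ρ + ‖w‖), ‖fderiv ℝ φ y w‖ₑ ^ 2 := by
  have hc : Continuous fun y => fderiv ℝ φ y w :=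
    (hφ.continuous_fderiv one_ne_zero).clm_apply continuous_const
  calc ∫⁻ y in Metric.ball x ρ, ‖φ y‖ₑ ^ 2
      ≤ ∫⁻ y in Metric.ball x ρ, ∫⁻ s in Icc (0 : ℝ) 1, ‖fderiv ℝ φ (y + s • w) w‖ₑ ^ 2 :=
        setLIntegral_mono' Metric.isOpen_ball.measurableSet fun y hy =>
          enorm_sq_segment_le hφ y w (h0 y hy)
    _ = ∫⁻ s in Icc (0 : ℝ) 1, ∫⁻ y in Metric.ball x ρ, ‖fderiv ℝ φ (y + s • w) w‖ₑ ^ 2 := by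
        rw [lintegral_lintegral_swap]
        have : Continuous (Function.uncurry fun (y : ℝ × ℝ) (s : ℝ) =>
            ‖fderiv ℝ φ (y + s • w) w‖ₑ ^ 2) := by
          refine (ENNReal.continuous_pow 2).comp (continuous_enorm.comp (hc.comp ?_))
          fun_prop
        exact this.aemeasurable
    _ ≤ ∫⁻ s in Icc (0 : ℝ) 1, ∫⁻ y in Metric.ball x (ρ + ‖w‖), ‖fderiv ℝ φ y w‖ₑ ^ 2 := by
        refine setLIntegral_mono' measurableSet_Icc fun s hs => ?_
        rw [← lintegral_indicator Metric.isOpen_ball.measurableSet,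
          ← lintegral_indicator Metric.isOpen_ball.measurableSet,
          ← lintegral_add_right_eq_self
            ((Metric.ball x (ρ + ‖w‖)).indicator fun y => ‖fderiv ℝ φ y w‖ₑ ^ 2) (s • w)]
        refine lintegral_mono fun y => ?_
        by_cases hy : y ∈ Metric.ball x ρ
        · rw [indicator_of_mem hy, indicator_of_mem]
          rw [Metric.mem_ball, dist_eq_norm] at hy ⊢
          have : ‖s • w‖ ≤ ‖w‖ := by
            rw [norm_smul, Real.norm_of_nonneg hs.1]
            exact mul_le_of_le_one_left (norm_nonneg _) hs.2
          calc ‖y + s • w - x‖ = ‖(y - x) + s • w‖ := by congr 1; abel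
            _ ≤ ‖y - x‖ + ‖s • w‖ := norm_add_le _ _
            _ < ρ + ‖w‖ := by linarith
        · rw [indicator_of_notMem hy]; exact zero_le
    _ = ∫⁻ y in Metric.ball x (ρ + ‖w‖), ‖fderiv ℝ φ y w‖ₑ ^ 2 := by simp

theorem fderiv_apply_eq (φ : ℝ × ℝ → ℂ) (y w : ℝ × ℝ) :
    fderiv ℝ φ y w = w.1 * partial₁ φ y + w.2 * partial₂ φ y := by
  unfold partial₁ partial₂
  conv_lhs => rw [show w = w.1 • ((1 : ℝ), (0 : ℝ)) + w.2 • ((0 : ℝ), (1 : ℝ)) by simp, map_add,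
    map_smul, map_smul]
  simp

theorem eLpNorm_two_eq (μ : Measure (ℝ × ℝ)) (g : ℝ × ℝ → ℂ) :
    eLpNorm g 2 μ = (∫⁻ y, ‖g y‖ₑ ^ 2 ∂μ) ^ (1 / (2 : ℝ)) := by
  rw [eLpNorm_eq_lintegral_rpow_enorm_toReal two_ne_zero ENNReal.ofNat_ne_top]
  simp

theorem eLpNorm_le_of_translate {Ω : Set (ℝ × ℝ)} (hΩ : IsOpen Ω) {φ : ℝ × ℝ → ℂ}
    (hφ : IsTestFunction Ω φ)
    {x w : ℝ × ℝ} {ρ : ℝ} (h0 : ∀ y ∈ Metric.ball x ρ, y + w ∉ Ω) :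
    eLpNorm φ 2 (volume.restrict (Metric.ball x ρ)) ≤
      ‖w‖ₑ * (eLpNorm (partial₁ φ) 2 (volume.restrict (Ω ∩ Metric.ball x (ρ + ‖w‖))) +
        eLpNorm (partial₂ φ) 2 (volume.restrict (Ω ∩ Metric.ball x (ρ + ‖w‖)))) := by
  have h1 := lintegral_sq_le_of_translate hφ.contDiff_one (x := x) (w := w) (ρ := ρ) (by
    intro y hy
    exact image_eq_zero_of_notMem_tsupport fun h => h0 y hy (hφ.3 h))
  have hB : MeasurableSet (Metric.ball x (ρ + ‖w‖)) := Metric.isOpen_ball.measurableSet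
  have hw := hφ.fderiv_apply w
  have h2 : ∫⁻ y in Metric.ball x (ρ + ‖w‖), ‖fderiv ℝ φ y w‖ₑ ^ 2 =
      ∫⁻ y in Ω ∩ Metric.ball x (ρ + ‖w‖), ‖fderiv ℝ φ y w‖ₑ ^ 2 := by
    rw [← lintegral_indicator hB, ← lintegral_indicator (hΩ.measurableSet.inter hB)]
    refine lintegral_congr fun y => ?_
    classical
    by_cases hyΩ : y ∈ Ω
    · simp [indicator_apply, hyΩ]
    · have hz : fderiv ℝ φ y w = 0 := image_eq_zero_of_notMem_tsupport
        (f := fun y => fderiv ℝ φ y w) fun h => hyΩ (hw.3 h)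
      simp [indicator_apply, hz]
  set μ := volume.restrict (Ω ∩ Metric.ball x (ρ + ‖w‖))
  have h3 : eLpNorm φ 2 (volume.restrict (Metric.ball x ρ)) ≤
      eLpNorm (fun y => fderiv ℝ φ y w) 2 μ := by
    rw [eLpNorm_two_eq, eLpNorm_two_eq]
    exact ENNReal.rpow_le_rpow (h1.trans h2.le) (by norm_num)
  refine h3.trans ?_
  have e : (fun y => fderiv ℝ φ y w) =
      (fun y => (w.1 : ℂ) * partial₁ φ y) + fun y => (w.2 : ℂ) * partial₂ φ y := by
    ext y; simp [fderiv_apply_eq φ y w]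
  have m1 : AEStronglyMeasurable (partial₁ φ) μ :=
    (continuous_partial₁ hφ.contDiff_one).aestronglyMeasurable
  have m2 : AEStronglyMeasurable (partial₂ φ) μ :=
    (continuous_partial₂ hφ.contDiff_one).aestronglyMeasurable
  rw [e]
  refine (eLpNorm_add_le (m1.const_mul _) (m2.const_mul _) one_le_two).trans ?_
  rw [mul_add]
  have hn : ∀ c : ℝ, |c| ≤ ‖w‖ → ‖(c : ℂ)‖ₑ ≤ ‖w‖ₑ := by
    intro c hc
    rw [← ofReal_norm, ← ofReal_norm]
    refine ENNReal.ofReal_le_ofReal ?_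
    rw [Complex.norm_real]; exact hc
  refine add_le_add ?_ ?_
  · change eLpNorm ((w.1 : ℂ) • partial₁ φ) 2 μ ≤ _
    rw [eLpNorm_const_smul]
    exact mul_le_mul_left (hn _ (norm_fst_le w)) _
  · change eLpNorm ((w.2 : ℂ) • partial₂ φ) 2 μ ≤ _
    rw [eLpNorm_const_smul]
    exact mul_le_mul_left (hn _ (norm_snd_le w)) _

/-- A Poincaré inequality near the boundary. -/
theorem IsH10.eLpNorm_le_of_translate {Ω : Set (ℝ × ℝ)} (hΩ : IsOpen Ω) {u g₁ g₂ : ℝ × ℝ → ℂ}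
    (h : IsH10 Ω u g₁ g₂) {x w : ℝ × ℝ} {ρ : ℝ} (hρ : Metric.ball x ρ ⊆ Ω)
    (h0 : ∀ y ∈ Metric.ball x ρ, y + w ∉ Ω) :
    eLpNorm u 2 (volume.restrict (Metric.ball x ρ)) ≤
      ‖w‖ₑ * (eLpNorm g₁ 2 (volume.restrict (Ω ∩ Metric.ball x (ρ + ‖w‖))) +
        eLpNorm g₂ 2 (volume.restrict (Ω ∩ Metric.ball x (ρ + ‖w‖)))) := by
  obtain ⟨φ, hφ, a0, a1, a2⟩ := h.approx
  set B := Metric.ball x ρ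
  set S := Ω ∩ Metric.ball x (ρ + ‖w‖)
  have hS : S ⊆ Ω := inter_subset_left
  set A : ℕ → ENNReal := fun n =>
    eLpNorm (fun y => φ n y - u y) 2 (volume.restrict Ω) +
      ‖w‖ₑ * ((eLpNorm (fun y => partial₁ (φ n) y - g₁ y) 2 (volume.restrict Ω) +
        eLpNorm g₁ 2 (volume.restrict S)) +
        (eLpNorm (fun y => partial₂ (φ n) y - g₂ y) 2 (volume.restrict Ω) +
        eLpNorm g₂ 2 (volume.restrict S)))
  have hle : ∀ n, eLpNorm u 2 (volume.restrict B) ≤ A n := by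
    intro n
    have mφ : AEStronglyMeasurable (φ n) (volume.restrict B) :=
      (hφ n).1.continuous.aestronglyMeasurable
    have mu : AEStronglyMeasurable u (volume.restrict B) :=
      h.memLp.aestronglyMeasurable.mono_measure (Measure.restrict_mono hρ le_rfl)
    have e1 : eLpNorm u 2 (volume.restrict B) ≤
        eLpNorm (fun y => φ n y - u y) 2 (volume.restrict B) +
          eLpNorm (φ n) 2 (volume.restrict B) := by
      have : u = (fun y => u y - φ n y) + φ n := by ext y; simp
      conv_lhs => rw [this]
      refine (eLpNorm_add_le (mu.sub mφ) mφ one_le_two).trans (le_of_eq ?_)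
      congr 1
      exact eLpNorm_sub_comm u (φ n) 2 _
    have key : ∀ (g k : ℝ × ℝ → ℂ), AEStronglyMeasurable g (volume.restrict Ω) → Continuous k →
        eLpNorm k 2 (volume.restrict S) ≤ eLpNorm (fun y => k y - g y) 2 (volume.restrict Ω) +
          eLpNorm g 2 (volume.restrict S) := by
      intro g k hg hk
      have mg := hg.mono_measure (Measure.restrict_mono hS (le_refl volume))
      have : k = (fun y => k y - g y) + g := by ext y; simp
      conv_lhs => rw [this]
      refine (eLpNorm_add_le (hk.aestronglyMeasurable.sub mg) mg one_le_two).trans ?_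
      exact add_le_add_left (eLpNorm_mono_measure _ (Measure.restrict_mono hS le_rfl)) _
    refine e1.trans (add_le_add (eLpNorm_mono_measure _ (Measure.restrict_mono hρ le_rfl)) ?_)
    refine (InternalWaves.eLpNorm_le_of_translate hΩ (hφ n) h0).trans
      (mul_le_mul_right (add_le_add ?_ ?_) _)
    · exact key g₁ _ h.memLp₁.aestronglyMeasurable (continuous_partial₁ (hφ n).contDiff_one)
    · exact key g₂ _ h.memLp₂.aestronglyMeasurable (continuous_partial₂ (hφ n).contDiff_one)
  have hlim : Tendsto A atTop (𝓝 (0 + ‖w‖ₑ * ((0 + eLpNorm g₁ 2 (volume.restrict S)) +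
      (0 + eLpNorm g₂ 2 (volume.restrict S))))) := by
    refine a0.add (ENNReal.Tendsto.const_mul ?_ (Or.inr enorm_ne_top))
    exact (a1.add tendsto_const_nhds).add (a2.add tendsto_const_nhds)
  have := ge_of_tendsto' hlim hle
  simpa using this

theorem interior_estimate_eLpNorm {p q : ℂ} (h : (q * (starRingEnd ℂ) p).im ≠ 0) :
    ∃ C > 0, ∀ (V : ℝ × ℝ → ℂ) (x : ℝ × ℝ) (ρ : ℝ), 0 < ρ → ContDiffOn ℝ 1 V (Metric.ball x ρ) →
      (∀ y ∈ Metric.ball x ρ, dOp p q V y = 0) →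
      MemLp V 2 (volume.restrict (Metric.ball x ρ)) →
      ‖V x‖ ≤ C / ρ * (eLpNorm V 2 (volume.restrict (Metric.ball x ρ))).toReal := by
  obtain ⟨C, hC, hb⟩ := exists_interior_estimate h
  refine ⟨C, hC, fun V x ρ hρ h1 h2 h3 => ?_⟩
  rw [← sqrt_integral_eq_eLpNorm h3]
  exact hb V x ρ hρ h1 h2 ((memLp_two_iff_integrable_sq_norm h3.aestronglyMeasurable).1 h3)

theorem partial₁_eq_dOp {om b : ℂ} (hom : om ≠ 0) (u : ℝ × ℝ → ℂ) (x : ℝ × ℝ) :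
    partial₁ u x = (2 * om)⁻¹ * (dOp om b u x - dOp (-om) b u x) := by
  simp only [dOp]; field_simp; ring

theorem partial₂_eq_dOp {om b : ℂ} (hb : b ≠ 0) (u : ℝ × ℝ → ℂ) (x : ℝ × ℝ) :
    partial₂ u x = (2 * b)⁻¹ * (dOp om b u x + dOp (-om) b u x) := by
  simp only [dOp]; field_simp; ring

namespace IsSmoothSolution

variable {Ω : Set (ℝ × ℝ)} {om b : ℂ} {f u : ℝ × ℝ → ℂ}

theorem elliptic_neg (h : IsSmoothSolution Ω om b f u) :
    (b * (starRingEnd ℂ) (-om)).im ≠ 0 := by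
  rw [map_neg, mul_neg, Complex.neg_im]; exact neg_ne_zero.2 h.elliptic

theorem om_ne_zero (h : IsSmoothSolution Ω om b f u) : om ≠ 0 := by
  rintro rfl; exact h.elliptic (by simp)

theorem b_ne_zero (h : IsSmoothSolution Ω om b f u) : b ≠ 0 := by
  rintro rfl; exact h.elliptic (by simp)

/-- Replacing `om` by its negative exchanges the two factors of the operator. -/
theorem neg (h : IsSmoothSolution Ω om b f u) : IsSmoothSolution Ω (-om) b f u :=
  ⟨h.isOpen, h.volume_ne_top, h.elliptic_neg, h.test, h.contDiffOn, h.eq_zero, h.isH10,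
    by simpa using h.eq_minus, by simpa using h.eq_plus⟩

/-- Gradient bound by the energy in a ball. -/
theorem exists_gradient_estimate (h : IsSmoothSolution Ω om b f u) :
    ∃ C > 0, ∀ (x : ℝ × ℝ) (ρ ε : ℝ), 0 < ρ → 0 ≤ ε → Metric.ball x ρ ⊆ Ω →
      (∀ y ∈ Metric.ball x ρ, f y = 0) →
      eLpNorm (partial₁ u) 2 (volume.restrict (Metric.ball x ρ)) ≤ ENNReal.ofReal ε →
      eLpNorm (partial₂ u) 2 (volume.restrict (Metric.ball x ρ)) ≤ ENNReal.ofReal ε →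
      ‖partial₁ u x‖ ≤ C * ε / ρ ∧ ‖partial₂ u x‖ ≤ C * ε / ρ := by
  obtain ⟨C₁, hC₁, h₁⟩ := interior_estimate_eLpNorm h.elliptic_neg
  obtain ⟨C₂, hC₂, h₂⟩ := interior_estimate_eLpNorm h.elliptic
  have hom := norm_pos_iff.2 h.om_ne_zero
  have hb := norm_pos_iff.2 h.b_ne_zero
  set K := ‖om‖ + ‖b‖ with hK
  have hK0 : 0 < K := by positivity
  set M := (C₁ + C₂) * K with hM
  have hM0 : 0 < M := by positivity
  refine ⟨M * (‖om‖⁻¹ + ‖b‖⁻¹), by positivity, fun x ρ ε hρ hε hsub hf e1 e2 => ?_⟩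
  set μ := volume.restrict (Metric.ball x ρ)
  have hmono : μ ≤ volume.restrict Ω := Measure.restrict_mono hsub le_rfl
  have m1 : MemLp (partial₁ u) 2 μ := h.isH10.memLp₁.mono_measure hmono
  have m2 : MemLp (partial₂ u) 2 μ := h.isH10.memLp₂.mono_measure hmono
  have hd : ∀ a : ℂ, ‖a‖ = ‖om‖ → MemLp (dOp a b u) 2 μ ∧
      (eLpNorm (dOp a b u) 2 μ).toReal ≤ K * ε := by
    intro a ha
    refine ⟨(m1.const_mul a).add (m2.const_mul b), ?_⟩
    refine ENNReal.toReal_le_of_le_ofReal (by positivity) ?_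
    have : dOp a b u = (a • partial₁ u) + (b • partial₂ u) := by
      ext y; simp [dOp]
    rw [this]
    refine (eLpNorm_add_le (m1.const_smul a).aestronglyMeasurable
      (m2.const_smul b).aestronglyMeasurable one_le_two).trans ?_
    rw [eLpNorm_const_smul, eLpNorm_const_smul, hK, add_mul,
      ENNReal.ofReal_add (by positivity) (by positivity), ENNReal.ofReal_mul (norm_nonneg _),
      ENNReal.ofReal_mul (norm_nonneg _), ← ofReal_norm, ← ofReal_norm, ha]
    exact add_le_add (mul_le_mul_right e1 _) (mul_le_mul_right e2 _)
  have hs : ∀ a : ℂ, ContDiffOn ℝ 1 (dOp a b u) (Metric.ball x ρ) := fun a =>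
    ((contDiffOn_dOp h.isOpen h.contDiffOn).of_le (by exact_mod_cast le_top)).mono hsub
  -- Where f = 0, the image of u under one factor is annihilated by the other, so the interior
  -- estimate applies to both images, and these determine the gradient.
  have b1 : ‖dOp om b u x‖ ≤ C₁ / ρ * (K * ε) :=
    (h₁ _ x ρ hρ (hs om) (fun y hy => by rw [h.eq_plus y (hsub hy), hf y hy]) (hd om rfl).1).trans
      (mul_le_mul_of_nonneg_left (hd om rfl).2 (by positivity))
  have b2 : ‖dOp (-om) b u x‖ ≤ C₂ / ρ * (K * ε) :=
    (h₂ _ x ρ hρ (hs (-om)) (fun y hy => by rw [h.eq_minus y (hsub hy), hf y hy])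
      (hd (-om) (norm_neg _)).1).trans
      (mul_le_mul_of_nonneg_left (hd (-om) (norm_neg _)).2 (by positivity))
  have b3 : ‖dOp om b u x‖ + ‖dOp (-om) b u x‖ ≤ M * ε / ρ := by
    have : M * ε / ρ = C₁ / ρ * (K * ε) + C₂ / ρ * (K * ε) := by rw [hM]; field_simp
    linarith
  have hfin : ∀ (c z : ℂ), 0 < ‖c‖ → ‖c‖⁻¹ ≤ ‖om‖⁻¹ + ‖b‖⁻¹ →
      ‖z‖ ≤ M * ε / ρ → ‖(2 * c)⁻¹ * z‖ ≤ M * (‖om‖⁻¹ + ‖b‖⁻¹) * ε / ρ := by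
    intro c z hc hcb hz
    rw [norm_mul, norm_inv, norm_mul]
    have h2 : (‖(2 : ℂ)‖ * ‖c‖)⁻¹ ≤ ‖om‖⁻¹ + ‖b‖⁻¹ := by
      refine le_trans ?_ hcb
      refine inv_anti₀ hc ?_
      norm_num; linarith
    calc (‖(2 : ℂ)‖ * ‖c‖)⁻¹ * ‖z‖ ≤ (‖om‖⁻¹ + ‖b‖⁻¹) * (M * ε / ρ) := by gcongr
      _ = _ := by ring
  constructor
  · rw [partial₁_eq_dOp (b := b) h.om_ne_zero]
    exact hfin _ _ hom (by linarith [inv_pos.2 hb]) ((norm_sub_le _ _).trans b3)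
  · rw [partial₂_eq_dOp (om := om) h.b_ne_zero]
    exact hfin _ _ hb (by linarith [inv_pos.2 hom]) ((norm_add_le _ _).trans b3)

/-- Absolute continuity of the integral: a set of small measure carries little of the L² norm of the
gradient. -/
theorem exists_small_energy (h : IsSmoothSolution Ω om b f u) (C₀ ε : ℝ) (hC₀ : 0 < C₀)
    (hε : 0 < ε) :
    ∃ δ > 0, ∀ (x : ℝ × ℝ) (ρ : ℝ), 0 < ρ → ρ < δ → ∀ S ⊆ Metric.ball x (C₀ * ρ), S ⊆ Ω →
      MeasurableSet S →
      eLpNorm (partial₁ u) 2 (volume.restrict S) ≤ ENNReal.ofReal ε ∧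
      eLpNorm (partial₂ u) 2 (volume.restrict S) ≤ ENNReal.ofReal ε := by
  obtain ⟨δ₁, hδ₁, h₁⟩ := h.isH10.memLp₁.eLpNorm_indicator_le one_le_two ENNReal.ofNat_ne_top hε
  obtain ⟨δ₂, hδ₂, h₂⟩ := h.isH10.memLp₂.eLpNorm_indicator_le one_le_two ENNReal.ofNat_ne_top hε
  set δ := min (min δ₁ δ₂) 1 with hδ
  have hδ0 : 0 < δ := by positivity
  refine ⟨δ / (4 * C₀ ^ 2 + 4), by positivity, fun x ρ hρ hρδ S hS hSΩ hSm => ?_⟩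
  have hρ1 : ρ ≤ 1 := by
    have h1 : δ ≤ 1 := min_le_right _ _
    refine hρδ.le.trans ((div_le_one (by positivity)).2 ?_)
    nlinarith [sq_nonneg C₀]
  have hv : (volume.restrict Ω) S ≤ ENNReal.ofReal δ := by
    rw [Measure.restrict_apply hSm]
    refine (measure_mono (inter_subset_left.trans hS)).trans ?_
    rw [volume_ball_prod, ← ENNReal.ofReal_mul (by positivity)]
    refine ENNReal.ofReal_le_ofReal ?_
    rw [lt_div_iff₀ (by positivity)] at hρδ
    nlinarith [mul_pos hρ hC₀, sq_nonneg C₀]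
  have hr : (volume.restrict Ω).restrict S = volume.restrict S := by
    rw [Measure.restrict_restrict hSm, inter_eq_left.2 hSΩ]
  constructor
  · have := h₁ S hSm (hv.trans (ENNReal.ofReal_le_ofReal ((min_le_left _ _).trans (min_le_left _ _))))
    rwa [eLpNorm_indicator_eq_eLpNorm_restrict hSm, hr] at this
  · have := h₂ S hSm (hv.trans (ENNReal.ofReal_le_ofReal ((min_le_left _ _).trans (min_le_right _ _))))
    rwa [eLpNorm_indicator_eq_eLpNorm_restrict hSm, hr] at this

theorem norm_fderiv_apply_le (y w : ℝ × ℝ) {A : ℝ} (h1 : ‖partial₁ u y‖ ≤ A)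
    (h2 : ‖partial₂ u y‖ ≤ A) : ‖fderiv ℝ u y w‖ ≤ 2 * A * ‖w‖ := by
  have hA : 0 ≤ A := (norm_nonneg _).trans h1
  rw [fderiv_apply_eq]
  refine (norm_add_le _ _).trans ?_
  rw [norm_mul, norm_mul, Complex.norm_real, Complex.norm_real]
  have e1 := norm_fst_le w
  have e2 := norm_snd_le w
  have := mul_le_mul e1 h1 (norm_nonneg _) (norm_nonneg _)
  have := mul_le_mul e2 h2 (norm_nonneg _) (norm_nonneg _)
  linarith

/-- Near the boundary the solution is small, and its gradient is small compared with the inverse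
of the distance to the boundary. -/
theorem boundary_decay (h : IsSmoothSolution Ω om b f u) (C₀ ε : ℝ) (hC₀ : 0 < C₀) (hε : 0 < ε) :
    ∃ δ > 0, ∀ (x : ℝ × ℝ) (ρ : ℝ), 0 < ρ → ρ < δ → Metric.ball x ρ ⊆ Ω →
      (∀ y ∈ Metric.ball x ρ, f y = 0) →
      (‖partial₁ u x‖ ≤ ε / ρ ∧ ‖partial₂ u x‖ ≤ ε / ρ) ∧
      ∀ w, ‖w‖ ≤ C₀ * ρ → (∀ y ∈ Metric.ball x ρ, y + w ∉ Ω) → ‖u x‖ ≤ ε := by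
  obtain ⟨C, hC, hgrad⟩ := h.exists_gradient_estimate
  set η := ε / (2 * C + 2 * C₀ + C + 1) with hη
  have hη0 : 0 < η := by positivity
  obtain ⟨δ, hδ, hen⟩ := h.exists_small_energy (1 + C₀) η (by positivity) hη0
  refine ⟨δ, hδ, fun x ρ hρ hρδ hsub hf => ?_⟩
  have hballm : ∀ (z : ℝ × ℝ) (r : ℝ), MeasurableSet (Metric.ball z r) :=
    fun z r => Metric.isOpen_ball.measurableSet
  have hgen : ∀ (z : ℝ × ℝ) (r : ℝ), 0 < r → r ≤ ρ → Metric.ball z r ⊆ Metric.ball x ρ →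
      ‖partial₁ u z‖ ≤ C * η / r ∧ ‖partial₂ u z‖ ≤ C * η / r := by
    intro z r hr hrρ hzr
    obtain ⟨e1, e2⟩ := hen x ρ hρ hρδ (Metric.ball z r)
      (hzr.trans (Metric.ball_subset_ball (by nlinarith))) (hzr.trans hsub) (hballm _ _)
    exact hgrad z r η hr hη0.le (hzr.trans hsub) (fun y hy => hf y (hzr hy)) e1 e2
  refine ⟨?_, fun w hw hout => ?_⟩
  · obtain ⟨e1, e2⟩ := hgen x ρ hρ le_rfl subset_rfl
    have hle : C * η ≤ ε := by
      rw [hη, mul_div_assoc', div_le_iff₀ (by positivity)]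
      nlinarith [mul_pos hε hC, mul_pos hε hC₀]
    have : C * η / ρ ≤ ε / ρ := div_le_div_of_nonneg_right hle hρ.le
    exact ⟨e1.trans this, e2.trans this⟩
  -- If ‖u x‖ > ε, the gradient bound keeps ‖u‖ above (2C₀ + 1)η on the half ball, whose area is ρ².
  -- So the L² norm is at least (2C₀ + 1)ηρ, whereas the Poincaré inequality bounds it by 2C₀ηρ.
  · by_contra hcon
    rw [not_le] at hcon
    have hosc : ∀ y ∈ Metric.ball x (ρ / 2), (2 * C₀ + 1) * η ≤ ‖u y‖ := by
      intro y hy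
      have hb : ∀ z ∈ Metric.ball x (ρ / 2), ‖fderiv ℝ u z‖ ≤ 2 * (C * η / (ρ / 2)) := by
        intro z hz
        obtain ⟨e1, e2⟩ := hgen z (ρ / 2) (by positivity) (by linarith)
          (Metric.ball_subset_ball' (by linarith [Metric.mem_ball.1 hz]))
        exact ContinuousLinearMap.opNorm_le_bound _ (by positivity)
          fun v => norm_fderiv_apply_le z v e1 e2
      have hdiff : ∀ z ∈ Metric.ball x (ρ / 2), DifferentiableAt ℝ u z := fun z hz =>
        (h.contDiffOn.contDiffAt (h.isOpen.mem_nhds (hsub (Metric.ball_subset_ball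
          (by linarith) hz)))).differentiableAt (by simp)
      have := (convex_ball x (ρ / 2)).norm_image_sub_le_of_norm_fderiv_le hdiff hb hy
        (Metric.mem_ball_self (by positivity))
      have hd : ‖x - y‖ ≤ ρ / 2 := by
        rw [← dist_eq_norm, dist_comm]; exact (Metric.mem_ball.1 hy).le
      have h1 : ‖u x - u y‖ ≤ 2 * C * η := by
        refine this.trans ?_
        calc 2 * (C * η / (ρ / 2)) * ‖x - y‖ ≤ 2 * (C * η / (ρ / 2)) * (ρ / 2) := by gcongr
          _ = 2 * C * η := by field_simp
      have h2 := norm_sub_norm_le (u x) (u y)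
      have h3 : (2 * C + 2 * C₀ + C + 1) * η = ε := by rw [hη]; field_simp
      nlinarith [mul_pos hC hη0]
    have hP := h.isH10.eLpNorm_le_of_translate h.isOpen hsub hout
    obtain ⟨e1, e2⟩ := hen x ρ hρ hρδ (Ω ∩ Metric.ball x (ρ + ‖w‖))
      (inter_subset_right.trans (Metric.ball_subset_ball (by linarith))) inter_subset_left
      (h.isOpen.measurableSet.inter (hballm _ _))
    have hup : eLpNorm u 2 (volume.restrict (Metric.ball x ρ)) ≤
        ENNReal.ofReal (C₀ * ρ * (2 * η)) := by
      refine hP.trans ?_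
      rw [ENNReal.ofReal_mul (by positivity), two_mul, ENNReal.ofReal_add hη0.le hη0.le,
        ← ofReal_norm]
      exact mul_le_mul' (ENNReal.ofReal_le_ofReal hw) (add_le_add e1 e2)
    have hlow : ENNReal.ofReal ((2 * C₀ + 1) * η) * ENNReal.ofReal ρ ≤
        eLpNorm u 2 (volume.restrict (Metric.ball x ρ)) := by
      have hmono : volume.restrict (Metric.ball x (ρ / 2)) ≤ volume.restrict (Metric.ball x ρ) :=
        Measure.restrict_mono (Metric.ball_subset_ball (by linarith)) le_rfl
      refine le_trans ?_ (eLpNorm_mono_measure u hmono)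
      have hvol : volume (Metric.ball x (ρ / 2)) = ENNReal.ofReal ρ ^ 2 := by
        rw [volume_ball_prod, mul_div_cancel₀ _ two_ne_zero, sq]
      have hi : (ENNReal.ofReal ((2 * C₀ + 1) * η) * ENNReal.ofReal ρ) ^ 2 ≤
          ∫⁻ y in Metric.ball x (ρ / 2), ‖u y‖ₑ ^ 2 := by
        rw [mul_pow, ← hvol, ← setLIntegral_const]
        refine setLIntegral_mono' (hballm _ _) fun y hy => pow_le_pow_left' ?_ 2
        rw [← ofReal_norm]
        exact ENNReal.ofReal_le_ofReal (hosc y hy)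
      rw [eLpNorm_two_eq]
      refine le_trans (le_of_eq ?_) (ENNReal.rpow_le_rpow hi (by norm_num))
      rw [← ENNReal.rpow_natCast, ← ENNReal.rpow_mul]
      norm_num
    have hle := hlow.trans hup
    rw [← ENNReal.ofReal_mul (by positivity), ENNReal.ofReal_le_ofReal_iff (by positivity)] at hle
    nlinarith [mul_pos hη0 hρ]

end IsSmoothSolution

/-! ### Complex coordinates and the holomorphic factors of the gradient -/

/-- The linear function annihilated by an elliptic operator `dOp p q`, as a coordinate. -/
def dEquiv {p q : ℂ} (h : (q * (starRingEnd ℂ) p).im ≠ 0) : (ℝ × ℝ) ≃L[ℝ] ℂ :=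
  (LinearMap.linearEquivOfInjective
    ({ toFun := dLin p q
       map_add' := fun x y => by simp [dLin]; ring
       map_smul' := fun c x => by simp [dLin]; ring } : (ℝ × ℝ) →ₗ[ℝ] ℂ)
    ((injective_iff_map_eq_zero _).2 fun x hx => by
      by_contra hne; exact dLin_ne_zero h hne hx)
    (by simp)).toContinuousLinearEquiv

theorem dEquiv_apply {p q : ℂ} (h : (q * (starRingEnd ℂ) p).im ≠ 0) (x : ℝ × ℝ) :
    dEquiv h x = dLin p q x := rfl

/-- The equation determines ∂₂V from ∂₁V. Being a complex multiple of the linear coordinate is the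
Cauchy–Riemann equation with respect to it. -/
theorem fderiv_apply_eq_of_dOp_eq_zero {p q : ℂ} (hq : q ≠ 0) {V : ℝ × ℝ → ℂ} {x : ℝ × ℝ}
    (h : dOp p q V x = 0) (w : ℝ × ℝ) :
    fderiv ℝ V x w = partial₁ V x / q * dLin p q w := by
  rw [fderiv_apply_eq, dLin]
  have h2 : partial₂ V x = -p * partial₁ V x / q := by
    rw [dOp] at h
    field_simp
    linear_combination h
  rw [h2]; field_simp; ring

theorem differentiableAt_comp_dEquiv_symm {p q : ℂ} (h : (q * (starRingEnd ℂ) p).im ≠ 0)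
    {V : ℝ × ℝ → ℂ} {x : ℝ × ℝ} (hV : DifferentiableAt ℝ V x) (h0 : dOp p q V x = 0) :
    DifferentiableAt ℂ (fun z => V ((dEquiv h).symm z)) (dEquiv h x) := by
  have hq : q ≠ 0 := by rintro rfl; simp at h
  have h1 : HasFDerivAt (fun z => V ((dEquiv h).symm z))
      ((fderiv ℝ V x).comp ((dEquiv h).symm : ℂ →L[ℝ] ℝ × ℝ)) (dEquiv h x) := by
    refine HasFDerivAt.comp _ ?_ (dEquiv h).symm.hasFDerivAt
    rw [ContinuousLinearEquiv.symm_apply_apply]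
    exact hV.hasFDerivAt
  refine differentiableAt_complex_iff_differentiableAt_real.2 ⟨h1.differentiableAt, ?_⟩
  have key : ∀ ζ : ℂ, fderiv ℝ V x ((dEquiv h).symm ζ) = partial₁ V x / q * ζ := by
    intro ζ
    rw [fderiv_apply_eq_of_dOp_eq_zero hq h0, ← dEquiv_apply h,
      ContinuousLinearEquiv.apply_symm_apply]
  rw [h1.fderiv]
  simp only [ContinuousLinearMap.comp_apply, ContinuousLinearEquiv.coe_coe, key, smul_eq_mul]
  ring

/-- The pull-back of a holomorphic differential is closed, hence exact on convex sets. -/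
theorem exists_primitive_pullback {S : Set (ℝ × ℝ)} (hS : Convex ℝ S) (hSo : IsOpen S)
    {Z : ℝ × ℝ → ℂ} (hZ : ContDiffOn ℝ 2 Z S) {V : ℂ → ℂ}
    (hV : ∀ x ∈ S, DifferentiableAt ℂ V (Z x)) :
    ∃ H : ℝ × ℝ → ℂ, ∀ x ∈ S, HasFDerivAt H (V (Z x) • fderiv ℝ Z x) x := by
  have hd : ∀ x ∈ S, HasFDerivAt (fun x => V (Z x) • fderiv ℝ Z x)
      (V (Z x) • fderiv ℝ (fderiv ℝ Z) x +
        ((deriv V (Z x)) • fderiv ℝ Z x).smulRight (fderiv ℝ Z x)) x := by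
    intro x hx
    have hZx : ContDiffAt ℝ 2 Z x := hZ.contDiffAt (hSo.mem_nhds hx)
    have h1 : HasFDerivAt V _ (Z x) := (hV x hx).hasDerivAt.hasFDerivAt.restrictScalars ℝ
    have h2 := h1.comp x (hZx.differentiableAt (by norm_num)).hasFDerivAt
    have h3 : HasFDerivAt (fderiv ℝ Z) (fderiv ℝ (fderiv ℝ Z) x) x :=
      ((hZx.fderiv_right (m := 1) (by norm_num)).differentiableAt one_ne_zero).hasFDerivAt
    refine (h2.smul h3).congr_fderiv ?_
    ext <;> simp [mul_comm]
  refine hS.exists_forall_hasFDerivAt_of_fderiv_symmetric hSo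
    (fun x hx => (hd x hx).differentiableAt.differentiableWithinAt) fun x hx v w => ?_
  have hZx : ContDiffAt ℝ 2 Z x := hZ.contDiffAt (hSo.mem_nhds hx)
  have hsymm : fderiv ℝ (fderiv ℝ Z) x v w = fderiv ℝ (fderiv ℝ Z) x w v :=
    (hZx.isSymmSndFDerivAt (by simp)) v w
  rw [(hd x hx).fderiv]
  simp [hsymm]
  ring

namespace IsSmoothSolution

variable {Ω : Set (ℝ × ℝ)} {om b : ℂ} {f u : ℝ × ℝ → ℂ}

/-- The complex coordinate `b x₁ + om x₂`. -/
def coord (h : IsSmoothSolution Ω om b f u) : (ℝ × ℝ) ≃L[ℝ] ℂ := dEquiv h.elliptic_neg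

theorem coord_apply (h : IsSmoothSolution Ω om b f u) (x : ℝ × ℝ) :
    h.coord x = b * x.1 + om * x.2 := by
  rw [coord, dEquiv_apply, dLin]; ring

/-- The factor of the gradient of `u` which is holomorphic with respect to `h.coord`. -/
def hol (h : IsSmoothSolution Ω om b f u) (z : ℂ) : ℂ :=
  dOp om b u (h.coord.symm z) / (2 * om * b)

theorem hol_coord (h : IsSmoothSolution Ω om b f u) (x : ℝ × ℝ) :
    h.hol (h.coord x) = dOp om b u x / (2 * om * b) := by
  rw [hol, ContinuousLinearEquiv.symm_apply_apply]

/-- The splitting du = V₊(z₊) dz₊ + V₋(z₋) dz₋ on which everything below rests; the normalization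
2ωb in `hol` is chosen for it. -/
theorem fderiv_eq (h : IsSmoothSolution Ω om b f u) (x w : ℝ × ℝ) :
    fderiv ℝ u x w = h.hol (h.coord x) * h.coord w +
      h.neg.hol (h.neg.coord x) * h.neg.coord w := by
  rw [fderiv_apply_eq, hol_coord, hol_coord, coord_apply, coord_apply, dOp, dOp]
  have := h.om_ne_zero
  have := h.b_ne_zero
  field_simp
  ring

theorem differentiableAt (h : IsSmoothSolution Ω om b f u) {x : ℝ × ℝ} (hx : x ∈ Ω) :
    DifferentiableAt ℝ u x :=
  (h.contDiffOn.contDiffAt (h.isOpen.mem_nhds hx)).differentiableAt (by simp)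

theorem differentiableAt_hol (h : IsSmoothSolution Ω om b f u) {x : ℝ × ℝ} (hx : x ∈ Ω)
    (hf : f x = 0) : DifferentiableAt ℂ h.hol (h.coord x) := by
  refine (differentiableAt_comp_dEquiv_symm h.elliptic_neg ?_ ?_).div_const _
  · exact ((contDiffOn_dOp h.isOpen h.contDiffOn).contDiffAt
      (h.isOpen.mem_nhds hx)).differentiableAt (by simp)
  · rw [h.eq_plus x hx, hf]

/-- The gradient is at most of the order of the inverse distance to the boundary. -/
theorem exists_gradient_bound (h : IsSmoothSolution Ω om b f u) :
    ∃ C > 0, ∀ (x : ℝ × ℝ) (ρ : ℝ), 0 < ρ → Metric.ball x ρ ⊆ Ω →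
      (∀ y ∈ Metric.ball x ρ, f y = 0) →
      ‖partial₁ u x‖ ≤ C / ρ ∧ ‖partial₂ u x‖ ≤ C / ρ := by
  obtain ⟨C, hC, hb⟩ := h.exists_gradient_estimate
  set E₁ := (eLpNorm (partial₁ u) 2 (volume.restrict Ω)).toReal with hE₁
  set E₂ := (eLpNorm (partial₂ u) 2 (volume.restrict Ω)).toReal with hE₂
  have h1 : 0 ≤ E₁ := ENNReal.toReal_nonneg
  have h2 : 0 ≤ E₂ := ENNReal.toReal_nonneg
  refine ⟨C * (E₁ + E₂ + 1), by positivity, fun x ρ hρ hsub hf => ?_⟩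
  refine hb x ρ (E₁ + E₂ + 1) hρ (by positivity) hsub hf ?_ ?_
  · refine (eLpNorm_mono_measure _ (Measure.restrict_mono hsub le_rfl)).trans ?_
    rw [← ENNReal.ofReal_toReal h.isH10.memLp₁.eLpNorm_ne_top]
    exact ENNReal.ofReal_le_ofReal (by linarith)
  · refine (eLpNorm_mono_measure _ (Measure.restrict_mono hsub le_rfl)).trans ?_
    rw [← ENNReal.ofReal_toReal h.isH10.memLp₂.eLpNorm_ne_top]
    exact ENNReal.ofReal_le_ofReal (by linarith)

theorem norm_hol_le (h : IsSmoothSolution Ω om b f u) :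
    ∃ K > 0, ∀ (x : ℝ × ℝ) (A : ℝ), ‖partial₁ u x‖ ≤ A → ‖partial₂ u x‖ ≤ A →
      ‖h.hol (h.coord x)‖ ≤ K * A := by
  have h1 := norm_pos_iff.2 h.om_ne_zero
  have h2 := norm_pos_iff.2 h.b_ne_zero
  refine ⟨(‖om‖ + ‖b‖) / ‖2 * om * b‖, div_pos (by positivity) (by
    rw [norm_mul, norm_mul]; norm_num; positivity), fun x A hA hB => ?_⟩
  rw [hol_coord, norm_div, div_mul_eq_mul_div]
  refine div_le_div_of_nonneg_right ?_ (norm_nonneg _)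
  refine (norm_add_le _ _).trans ?_
  rw [norm_mul, norm_mul, add_mul]
  gcongr

/-- The image of the part of the domain near a point under the complex coordinate. -/
def locImage (h : IsSmoothSolution Ω om b f u) (p : ℝ × ℝ) (r : ℝ) : Set ℂ :=
  h.coord.symm ⁻¹' (Ω ∩ Metric.ball p r)

theorem isOpen_locImage (h : IsSmoothSolution Ω om b f u) (p : ℝ × ℝ) (r : ℝ) :
    IsOpen (h.locImage p r) :=
  (h.isOpen.inter Metric.isOpen_ball).preimage h.coord.symm.continuous

theorem coord_mem_locImage (h : IsSmoothSolution Ω om b f u) {p : ℝ × ℝ} {r : ℝ} {x : ℝ × ℝ} :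
    h.coord x ∈ h.locImage p r ↔ x ∈ Ω ∩ Metric.ball p r := by
  simp [locImage]

/-- The coordinate enlarges distances by a factor of at most N, so distance d from the complement of
the image leaves a ball of radius d/N in the domain, where the gradient bound applies. -/
theorem exists_hol_bound (h : IsSmoothSolution Ω om b f u) :
    ∃ C > 0, ∀ (p : ℝ × ℝ) (r : ℝ), (∀ y ∈ Metric.ball p r, f y = 0) →
      ∀ z ∈ h.locImage p r, ‖h.hol z‖ * Metric.infDist z (h.locImage p r)ᶜ ≤ C := by
  obtain ⟨C, hC, hb⟩ := h.exists_gradient_bound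
  obtain ⟨K, hK, hKb⟩ := h.norm_hol_le
  set N := ‖(h.coord : (ℝ × ℝ) →L[ℝ] ℂ)‖ + 1 with hN
  have hN0 : 0 < N := by positivity
  refine ⟨K * C * N, by positivity, fun p r hf z hz => ?_⟩
  set d := Metric.infDist z (h.locImage p r)ᶜ with hd
  rcases (Metric.infDist_nonneg (x := z) (s := (h.locImage p r)ᶜ)).eq_or_lt with h0 | hpos
  · rw [hd, ← h0, mul_zero]; positivity
  have hd0 : d ≠ 0 := hpos.ne'
  set x := h.coord.symm z with hx
  have hzx : h.coord x = z := h.coord.apply_symm_apply z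
  have hsub : Metric.ball x (d / N) ⊆ Ω ∩ Metric.ball p r := by
    intro y hy
    rw [← h.coord_mem_locImage]
    by_contra hout
    have h1 : d ≤ dist z (h.coord y) := Metric.infDist_le_dist_of_mem hout
    rw [← hzx, dist_eq_norm, ← map_sub] at h1
    have h2 := (h.coord : (ℝ × ℝ) →L[ℝ] ℂ).le_opNorm (x - y)
    rw [Metric.mem_ball, dist_comm, dist_eq_norm, lt_div_iff₀ hN0] at hy
    have h3 : ‖h.coord (x - y)‖ ≤ ‖(h.coord : (ℝ × ℝ) →L[ℝ] ℂ)‖ * ‖x - y‖ := h2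
    nlinarith [norm_nonneg (x - y)]
  obtain ⟨b1, b2⟩ := hb x (d / N) (by positivity) (hsub.trans inter_subset_left)
    fun y hy => hf y (hsub hy).2
  have := hKb x _ b1 b2
  rw [hzx] at this
  calc ‖h.hol z‖ * d ≤ K * (C / (d / N)) * d := by gcongr
    _ = K * C * N := by field_simp

end IsSmoothSolution

/-! ### Almost analytic extensions and flat functions -/

/-- The almost analytic extension of order `N` of a function on the real line. -/
def almostAnalytic (g : ℝ → ℂ) (N : ℕ) (x : ℝ × ℝ) : ℂ :=
  ∑ k ∈ Finset.range (N + 1), (Complex.I * x.2) ^ k / (k.factorial : ℂ) * iteratedDeriv k g x.1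

theorem almostAnalytic_zero_right (g : ℝ → ℂ) (N : ℕ) (t : ℝ) :
    almostAnalytic g N (t, 0) = g t := by
  rw [almostAnalytic, Finset.sum_range_succ']
  simp

theorem dOp_add {p q : ℂ} {f g : ℝ × ℝ → ℂ} {x : ℝ × ℝ} (hf : DifferentiableAt ℝ f x)
    (hg : DifferentiableAt ℝ g x) :
    dOp p q (fun y => f y + g y) x = dOp p q f x + dOp p q g x := by
  simp only [dOp, partial₁, partial₂, fderiv_fun_add hf hg, _root_.add_apply]
  ring

theorem contDiff_imag_pow (k : ℕ) {n : WithTop ℕ∞} :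
    ContDiff ℝ n fun x : ℝ × ℝ => (Complex.I * x.2) ^ k / (k.factorial : ℂ) := by
  have h2 : ContDiff ℝ n (fun x : ℝ × ℝ => (x.2 : ℂ)) :=
    Complex.ofRealCLM.contDiff.comp contDiff_snd
  exact ((contDiff_const.mul h2).pow k).div_const _

theorem contDiff_iteratedDeriv_fst {g : ℝ → ℂ} {n k : ℕ} (hg : ContDiff ℝ (n + k : ℕ) g) :
    ContDiff ℝ n fun x : ℝ × ℝ => iteratedDeriv k g x.1 := by
  refine ContDiff.comp (g := iteratedDeriv k g) ?_ contDiff_fst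
  exact ContDiff.iterate_deriv' n k (by exact_mod_cast hg) |> fun h => by
    rwa [← iteratedDeriv_eq_iterate] at h

theorem contDiff_almostAnalytic {g : ℝ → ℂ} {n N : ℕ} (hg : ContDiff ℝ (n + N : ℕ) g) :
    ContDiff ℝ n (almostAnalytic g N) := by
  refine ContDiff.sum fun k hk => (contDiff_imag_pow k).mul (contDiff_iteratedDeriv_fst ?_)
  exact hg.of_le (by exact_mod_cast Nat.add_le_add_left (Finset.mem_range_succ_iff.1 hk) n)

/-- The sum telescopes: ∂₁ of the k-th term cancels i∂₂ of the next one, so only ∂₁ of the last term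
survives, and it vanishes to order N on the axis. -/
theorem dOp_almostAnalytic {g : ℝ → ℂ} {N : ℕ} (hg : ContDiff ℝ (N + 1 : ℕ) g) (x : ℝ × ℝ) :
    dOp 1 Complex.I (almostAnalytic g N) x =
      (Complex.I * x.2) ^ N / (N.factorial : ℂ) * iteratedDeriv (N + 1) g x.1 := by
  have hterm : ∀ k : ℕ, k ≤ N → DifferentiableAt ℝ (fun y : ℝ × ℝ =>
        (Complex.I * y.2) ^ k / (k.factorial : ℂ) * iteratedDeriv k g y.1) x ∧
      dOp 1 Complex.I (fun y : ℝ × ℝ =>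
        (Complex.I * y.2) ^ k / (k.factorial : ℂ) * iteratedDeriv k g y.1) x =
      (Complex.I * x.2) ^ k / (k.factorial : ℂ) * iteratedDeriv (k + 1) g x.1 -
        k * (Complex.I * x.2) ^ (k - 1) / (k.factorial : ℂ) * iteratedDeriv k g x.1 := by
    intro k hk
    have h1 : HasDerivAt (iteratedDeriv k g) (iteratedDeriv (k + 1) g x.1) x.1 := by
      rw [iteratedDeriv_succ]
      exact (hg.differentiable_iteratedDeriv k (by exact_mod_cast Nat.lt_succ_of_le hk)
        x.1).hasDerivAt
    have h1' : HasFDerivAt (fun y : ℝ × ℝ => iteratedDeriv k g y.1) _ x :=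
      h1.hasFDerivAt.comp x hasFDerivAt_fst
    have h2 : HasFDerivAt (fun y : ℝ × ℝ => (y.2 : ℂ)) _ x :=
      Complex.ofRealCLM.hasFDerivAt.comp x hasFDerivAt_snd
    have h3 := ((h2.const_mul Complex.I).pow k).mul_const ((k.factorial : ℂ)⁻¹)
    have h4 := h3.mul h1'
    simp only [← div_eq_mul_inv] at h4
    refine ⟨h4.differentiableAt, ?_⟩
    simp only [dOp, partial₁, partial₂]
    erw [h4.fderiv]
    simp
    ring_nf
    simp
    ring
  have key : ∀ M ≤ N, DifferentiableAt ℝ (almostAnalytic g M) x ∧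
      dOp 1 Complex.I (almostAnalytic g M) x =
      (Complex.I * x.2) ^ M / (M.factorial : ℂ) * iteratedDeriv (M + 1) g x.1 := by
    intro M
    induction M with
    | zero =>
      intro _
      have := hterm 0 (Nat.zero_le _)
      have e : almostAnalytic g 0 = fun y : ℝ × ℝ =>
        (Complex.I * y.2) ^ 0 / (Nat.factorial 0 : ℂ) * iteratedDeriv 0 g y.1 := by
        ext y; simp [almostAnalytic]
      rw [e]
      refine ⟨this.1, this.2.trans ?_⟩
      simp
    | succ M ih =>
      intro hM
      obtain ⟨i1, i2⟩ := ih (by omega)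
      obtain ⟨t1, t2⟩ := hterm (M + 1) hM
      have e : almostAnalytic g (M + 1) = fun y => almostAnalytic g M y +
          (Complex.I * y.2) ^ (M + 1) / ((M + 1).factorial : ℂ) * iteratedDeriv (M + 1) g y.1 := by
        ext y; rw [almostAnalytic, Finset.sum_range_succ]; rfl
      rw [e]
      refine ⟨i1.add t1, ?_⟩
      rw [dOp_add i1 t1, i2, t2, Nat.factorial_succ]
      have : (M.factorial : ℂ) ≠ 0 := by exact_mod_cast M.factorial_ne_zero
      have : ((M : ℂ) + 1) ≠ 0 := by exact_mod_cast M.succ_ne_zero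
      rw [Nat.add_sub_cancel]
      push_cast
      field_simp
      ring
  exact (key N le_rfl).2

/-- Cauchy's estimate on the disc whose radius is half the distance to the complement: each
derivative costs one power of that distance. -/
theorem norm_deriv_mul_infDist_pow_le {W : Set ℂ} {V : ℂ → ℂ} {k : ℕ} {C : ℝ}
    (hV : DifferentiableOn ℂ V W) (hC : ∀ z ∈ W, ‖V z‖ * Metric.infDist z Wᶜ ^ k ≤ C)
    {z : ℂ} (hz : z ∈ W) :
    ‖deriv V z‖ * Metric.infDist z Wᶜ ^ (k + 1) ≤ C * 2 ^ (k + 1) := by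
  have hC0 : 0 ≤ C := (mul_nonneg (norm_nonneg _) (pow_nonneg Metric.infDist_nonneg _)).trans
    (hC z hz)
  set d := Metric.infDist z Wᶜ with hd
  rcases (Metric.infDist_nonneg (x := z) (s := Wᶜ)).eq_or_lt with h0 | hpos
  · rw [hd, ← h0, zero_pow (Nat.succ_ne_zero k), mul_zero]; positivity
  have hd0 : 0 < d := hpos
  have hfar : ∀ w ∈ Metric.closedBall z (d / 2), d / 2 ≤ Metric.infDist w Wᶜ := by
    intro w hw
    have := Metric.infDist_le_infDist_add_dist (s := Wᶜ) (x := z) (y := w)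
    rw [Metric.mem_closedBall, dist_comm] at hw
    linarith
  have hsub : Metric.closedBall z (d / 2) ⊆ W := by
    intro w hw
    by_contra hout
    have := hfar w hw
    rw [Metric.infDist_zero_of_mem (mem_compl hout)] at this
    linarith
  have hbound : ∀ w ∈ Metric.sphere z (d / 2), ‖V w‖ ≤ C / (d / 2) ^ k := by
    intro w hw
    have hw' := Metric.sphere_subset_closedBall hw
    rw [le_div_iff₀ (by positivity)]
    refine le_trans ?_ (hC w (hsub hw'))
    gcongr
    exact hfar w hw'
  have hdc : DiffContOnCl ℂ V (Metric.ball z (d / 2)) := by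
    refine DifferentiableOn.diffContOnCl (hV.mono ?_)
    rw [closure_ball z (by positivity)]
    exact hsub
  have := Complex.norm_deriv_le_of_forall_mem_sphere_norm_le (by positivity) hdc hbound
  calc ‖deriv V z‖ * d ^ (k + 1) ≤ C / (d / 2) ^ k / (d / 2) * d ^ (k + 1) := by gcongr
    _ = C * 2 ^ (k + 1) := by rw [div_pow, pow_succ, pow_succ]; field_simp

/-- A function which is flat at the line `x₂ = 0` and vanishes below it. -/
def flatFun (Z : ℝ × ℝ → ℂ) (j : ℕ) (V : ℂ → ℂ) (R : ℝ × ℝ → ℂ) (x : ℝ × ℝ) : ℂ :=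
  if 0 < x.2 then (x.2 : ℂ) ^ j * V (Z x) * R x else 0

section Flat

variable {W : Set ℂ} {B : Set (ℝ × ℝ)} {Z : ℝ × ℝ → ℂ} {c : ℝ}

/-- V is at most of the order of the k-th inverse power of the distance, which is at least c x₂; the
factor x₂^j beats it with i powers to spare. -/
theorem flatFun_bound (hc : 0 < c)
    (hW : ∀ x ∈ B, 0 < x.2 → Z x ∈ W ∧ c * x.2 ≤ Metric.infDist (Z x) Wᶜ)
    {k j i : ℕ} {V : ℂ → ℂ} {R : ℝ × ℝ → ℂ} {C : ℝ}
    (hC : ∀ z ∈ W, ‖V z‖ * Metric.infDist z Wᶜ ^ k ≤ C) (hR : Continuous R) (hj : k + i ≤ j)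
    {x₀ : ℝ × ℝ} (hx₀ : x₀.2 = 0) :
    ∃ M : ℝ, ∀ᶠ x in 𝓝 x₀, x ∈ B → ‖flatFun Z j V R x‖ ≤ M * |x.2| ^ i := by
  refine ⟨|C| / c ^ k * (‖R x₀‖ + 1), ?_⟩
  have h1 : ∀ᶠ x in 𝓝 x₀, ‖R x‖ < ‖R x₀‖ + 1 :=
    hR.norm.continuousAt.eventually (gt_mem_nhds (by linarith))
  have h2 : ∀ᶠ x : ℝ × ℝ in 𝓝 x₀, x.2 < 1 :=
    continuous_snd.continuousAt.eventually (gt_mem_nhds (by rw [hx₀]; norm_num))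
  filter_upwards [h1, h2] with x hR1 hx1 hxB
  rw [flatFun]
  split_ifs with hs
  · obtain ⟨hZ, hd⟩ := hW x hxB hs
    have hV : ‖V (Z x)‖ ≤ |C| / (c * x.2) ^ k := by
      rw [le_div_iff₀ (by positivity)]
      refine le_trans ?_ ((hC _ hZ).trans (le_abs_self C))
      gcongr
    rw [norm_mul, norm_mul, norm_pow, Complex.norm_real, Real.norm_of_nonneg hs.le,
      abs_of_pos hs]
    calc x.2 ^ j * ‖V (Z x)‖ * ‖R x‖
        ≤ x.2 ^ (k + i) * (|C| / (c * x.2) ^ k) * (‖R x₀‖ + 1) := by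
          gcongr ?_ * ?_ * ?_
          exact pow_le_pow_of_le_one hs.le hx1.le hj
      _ = |C| / c ^ k * (‖R x₀‖ + 1) * x.2 ^ i := by
          rw [pow_add, mul_pow]; field_simp
  · rw [norm_zero]; positivity

theorem flatFun_eventuallyEq_of_pos {j : ℕ} {V : ℂ → ℂ} {R : ℝ × ℝ → ℂ} {x : ℝ × ℝ}
    (hx : 0 < x.2) :
    flatFun Z j V R =ᶠ[𝓝 x] fun x => (x.2 : ℂ) ^ j * V (Z x) * R x := by
  filter_upwards [continuous_snd.continuousAt.eventually (lt_mem_nhds hx)] with y hy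
  simp [flatFun, hy]

theorem flatFun_eventuallyEq_of_neg {j : ℕ} {V : ℂ → ℂ} {R : ℝ × ℝ → ℂ} {x : ℝ × ℝ}
    (hx : x.2 < 0) : flatFun Z j V R =ᶠ[𝓝 x] fun _ => 0 := by
  filter_upwards [continuous_snd.continuousAt.eventually (gt_mem_nhds hx)] with y hy
  simp [flatFun, not_lt.2 (le_of_lt hy)]

/-- Induction on m. A derivative of a flat function is a sum of flat functions; either V is
differentiated and k grows by one, or the power of x₂ is and j drops by one. The budget k + m + 1 ≤
j survives because m drops too. -/
theorem contDiffOn_flatFun (hWo : IsOpen W) (hB : IsOpen B) (hc : 0 < c)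
    (hW : ∀ x ∈ B, 0 < x.2 → Z x ∈ W ∧ c * x.2 ≤ Metric.infDist (Z x) Wᶜ) :
    ∀ (m : ℕ), ContDiff ℝ m Z → ∀ {k j : ℕ} {V : ℂ → ℂ} {R : ℝ × ℝ → ℂ} {C : ℝ},
      DifferentiableOn ℂ V W → (∀ z ∈ W, ‖V z‖ * Metric.infDist z Wᶜ ^ k ≤ C) →
      ContDiff ℝ m R → k + m + 1 ≤ j → ContDiffOn ℝ m (flatFun Z j V R) B := by
  intro m
  induction m with
  | zero =>
    intro hZ k j V R C hV hC hR hj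
    simp only [Nat.cast_zero, contDiff_zero, contDiffOn_zero] at *
    intro x hx
    refine ContinuousAt.continuousWithinAt ?_
    rcases lt_trichotomy x.2 0 with h | h | h
    · exact continuousAt_const.congr (flatFun_eventuallyEq_of_neg h).symm
    · obtain ⟨M, hM⟩ := flatFun_bound (i := 1) hc hW hC hR (by omega) h
      have h0 : flatFun Z j V R x = 0 := by simp [flatFun, h]
      rw [ContinuousAt, h0]
      have hlim : Tendsto (fun y : ℝ × ℝ => M * |y.2| ^ 1) (𝓝 x) (𝓝 0) := by
        have : Continuous fun y : ℝ × ℝ => M * |y.2| ^ 1 := by fun_prop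
        have := this.tendsto x
        simpa [h] using this
      refine squeeze_zero_norm' ?_ hlim
      filter_upwards [hM, hB.mem_nhds hx] with y hy hyB using hy hyB
    · refine ContinuousAt.congr ?_ (flatFun_eventuallyEq_of_pos h).symm
      have hVc : ContinuousAt V (Z x) :=
        (hV.differentiableAt (hWo.mem_nhds (hW x hx h).1)).continuousAt
      exact ((Complex.continuous_ofReal.comp continuous_snd).continuousAt.pow j |>.mul
        (hVc.comp hZ.continuousAt)).mul hR.continuousAt
  | succ m ih =>
    intro hZ k j V R C hV hC hR hj
    have hZm : ContDiff ℝ m Z := hZ.of_le (by exact_mod_cast Nat.le_succ m)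
    have hRm : ContDiff ℝ m R := hR.of_le (by exact_mod_cast Nat.le_succ m)
    have hV' : DifferentiableOn ℂ (deriv V) W := hV.deriv hWo
    have hC' : ∀ z ∈ W, ‖deriv V z‖ * Metric.infDist z Wᶜ ^ (k + 1) ≤ C * 2 ^ (k + 1) :=
      fun z hz => norm_deriv_mul_infDist_pow_le hV hC hz
    have hpar : ∀ (g : ℝ × ℝ → ℂ) (v : ℝ × ℝ), ContDiff ℝ (m + 1 : ℕ) g →
        ContDiff ℝ m fun x => fderiv ℝ g x v := fun g v hg =>
      (hg.fderiv_right (m := m) (by norm_cast)).clm_apply contDiff_const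
    have hDv : ∀ v : ℝ × ℝ, ContDiffOn ℝ m (fun x =>
        flatFun Z j (deriv V) (fun x => fderiv ℝ Z x v * R x) x +
          flatFun Z j V (fun x => fderiv ℝ R x v) x +
          flatFun Z (j - 1) V (fun x => (j * v.2 : ℂ) * R x) x) B := by
      intro v
      refine ((ih hZm hV' hC' ((hpar Z v hZ).mul hRm) (by omega)).add
        (ih hZm hV hC (hpar R v hR) (by omega))).add
        (ih hZm hV hC (contDiff_const.mul hRm) (by omega))
    set D : ℝ × ℝ → ℝ × ℝ → ℂ := fun v x =>
        flatFun Z j (deriv V) (fun x => fderiv ℝ Z x v * R x) x +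
          flatFun Z j V (fun x => fderiv ℝ R x v) x +
          flatFun Z (j - 1) V (fun x => (j * v.2 : ℂ) * R x) x with hD
    have hder : ∀ x ∈ B, HasFDerivAt (flatFun Z j V R)
        (D (1, 0) x • Complex.ofRealCLM.comp (ContinuousLinearMap.fst ℝ ℝ ℝ) +
          D (0, 1) x • Complex.ofRealCLM.comp (ContinuousLinearMap.snd ℝ ℝ ℝ)) x := by
      intro x hx
      rcases lt_trichotomy x.2 0 with h | h | h
      · have hz : ∀ v, D v x = 0 := fun v => by
          simp [hD, flatFun, not_lt.2 h.le]
        refine HasFDerivAt.congr_fderiv (f' := 0) ?_ (by rw [hz, hz]; ext <;> simp)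
        exact (hasFDerivAt_const _ _).congr_of_eventuallyEq (flatFun_eventuallyEq_of_neg h)
      · have hz : ∀ v, D v x = 0 := fun v => by simp [hD, flatFun, h]
        refine HasFDerivAt.congr_fderiv (f' := 0) ?_ (by rw [hz, hz]; ext <;> simp)
        -- On the line the function is O(x₂²), so its differential vanishes there.
        obtain ⟨M, hM⟩ := flatFun_bound (k := k) (j := j) (i := 2) hc hW hC hR.continuous (by omega) h
        have h0 : flatFun Z j V R x = 0 := by simp [flatFun, h]
        refine HasFDerivAt.of_isLittleO ?_
        simp only [h0, sub_zero, _root_.zero_apply]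
        have hO : flatFun Z j V R =O[𝓝 x] fun y => ‖y - x‖ ^ 2 := by
          refine Asymptotics.IsBigO.of_bound |M| ?_
          filter_upwards [hM, hB.mem_nhds hx] with y hy hyB
          refine (hy hyB).trans ?_
          have h3 : |y.2| ≤ ‖y - x‖ := by
            have := norm_snd_le (y - x)
            rwa [Prod.snd_sub, h, sub_zero] at this
          rw [norm_pow, norm_norm]
          gcongr
          exact le_abs_self M
        refine hO.trans_isLittleO ?_
        exact Asymptotics.isLittleO_norm_pow_id one_lt_two |>.comp_tendsto
          (by simpa using (tendsto_id (x := 𝓝 x)).sub_const x)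
      · refine HasFDerivAt.congr_of_eventuallyEq ?_ (flatFun_eventuallyEq_of_pos h)
        have hVd : HasFDerivAt V _ (Z x) := ((hV.differentiableAt
          (hWo.mem_nhds (hW x hx h).1)).hasDerivAt.hasFDerivAt.restrictScalars ℝ)
        have hZd := (hZ.differentiable (by simp) x).hasFDerivAt
        have hRd := (hR.differentiable (by simp) x).hasFDerivAt
        have h2 : HasFDerivAt (fun y : ℝ × ℝ => (y.2 : ℂ)) _ x :=
          Complex.ofRealCLM.hasFDerivAt.comp x hasFDerivAt_snd
        have hall := ((h2.pow j).mul (hVd.comp x hZd)).mul hRd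
        refine hall.congr_fderiv ?_
        ext
        · simp [hD, flatFun, h]; ring
        · simp [hD, flatFun, h]; ring
    rw [show ((m + 1 : ℕ) : WithTop ℕ∞) = (m : WithTop ℕ∞) + 1 by norm_cast,
      contDiffOn_succ_iff_fderiv_of_isOpen hB]
    refine ⟨fun x hx => (hder x hx).differentiableAt.differentiableWithinAt, by simp, ?_⟩
    refine ContDiffOn.congr ?_ fun x hx => (hder x hx).fderiv
    exact ((hDv (1, 0)).smul contDiffOn_const).add ((hDv (0, 1)).smul contDiffOn_const)

end Flat

/-! ### Charts straightening a smooth boundary -/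

theorem exists_contDiff_eventuallyEq {E : Type*} [NormedAddCommGroup E] [NormedSpace ℝ E]
    {g : ℝ → E} {n : ℕ} (hg : ContDiffAt ℝ n g 0) :
    ∃ g' : ℝ → E, ContDiff ℝ n g' ∧ g' =ᶠ[𝓝 0] g := by
  obtain ⟨v, hv, hgv⟩ := hg.contDiffOn le_rfl (by simp)
  obtain ⟨r, hr, hrv⟩ := Metric.mem_nhds_iff.1 hv
  let χ : ContDiffBump (0 : ℝ) := ⟨r / 4, r / 2, by positivity, by linarith⟩
  refine ⟨fun t => χ t • g t, ?_, ?_⟩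
  · rw [contDiff_iff_contDiffAt]
    intro t
    by_cases ht : t ∈ Metric.ball (0 : ℝ) r
    · exact χ.contDiff.contDiffAt.smul
        (hgv.contDiffAt (mem_of_superset (Metric.isOpen_ball.mem_nhds ht) hrv))
    · have : (fun t => χ t • g t) =ᶠ[𝓝 t] fun _ => 0 := by
        have ho : t ∉ tsupport χ := by
          rw [χ.tsupport_eq]
          refine fun h => ht (Metric.closedBall_subset_ball ?_ h)
          change r / 2 < r
          linarith
        filter_upwards [notMem_tsupport_iff_eventuallyEq.1 ho] with y hy
        simp [hy]
      exact contDiffAt_const.congr_of_eventuallyEq this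
  · filter_upwards [χ.eventuallyEq_one] with t ht
    simp [ht]

/-- Local inverse of a map of the plane with injective differential. -/
theorem exists_local_inverse {X : ℝ × ℝ → ℝ × ℝ} {n : ℕ} (hn : n ≠ 0) {y₀ : ℝ × ℝ}
    (hX : ContDiffAt ℝ n X y₀) (hinj : ∀ v, fderiv ℝ X y₀ v = 0 → v = 0) :
    ∃ Y : ℝ × ℝ → ℝ × ℝ, ContDiffAt ℝ n Y (X y₀) ∧ Y (X y₀) = y₀ ∧
      (∀ᶠ x in 𝓝 (X y₀), X (Y x) = x) ∧ ∀ᶠ y in 𝓝 y₀, Y (X y) = y := by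
  have hn' : ((n : ℕ) : WithTop ℕ∞) ≠ 0 := by exact_mod_cast hn
  let e : (ℝ × ℝ) ≃L[ℝ] ℝ × ℝ := (LinearEquiv.ofInjectiveEndo
    (fderiv ℝ X y₀ : (ℝ × ℝ) →ₗ[ℝ] ℝ × ℝ)
    ((injective_iff_map_eq_zero _).2 hinj)).toContinuousLinearEquiv
  have he : HasFDerivAt X (e : (ℝ × ℝ) →L[ℝ] ℝ × ℝ) y₀ := by
    have h1 : (e : (ℝ × ℝ) →L[ℝ] ℝ × ℝ) = fderiv ℝ X y₀ := by ext <;> rfl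
    rw [h1]; exact (hX.differentiableAt hn').hasFDerivAt
  have hs : HasStrictFDerivAt X (e : (ℝ × ℝ) →L[ℝ] ℝ × ℝ) y₀ :=
    hX.hasStrictFDerivAt' he hn'
  refine ⟨hX.localInverse he hn', hX.to_localInverse he hn',
    hX.localInverse_apply_image he hn', ?_, ?_⟩
  · exact hs.eventually_right_inverse
  · exact hs.eventually_left_inverse

/-- The zero set of a function with nonvanishing differential contains a smooth curve. -/
theorem exists_boundary_curve {φ : ℝ × ℝ → ℝ} (hφ : ContDiff ℝ ∞ φ) {p : ℝ × ℝ} (h0 : φ p = 0)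
    (hd : fderiv ℝ φ p ≠ 0) (n : ℕ) :
    ∃ γ : ℝ → ℝ × ℝ, ContDiff ℝ (n + 1 : ℕ) γ ∧ γ 0 = p ∧ deriv γ 0 ≠ 0 ∧
      ∀ᶠ t in 𝓝 0, φ (γ t) = 0 := by
  set A := fderiv ℝ φ p (1, 0) with hA
  set B := fderiv ℝ φ p (0, 1) with hB
  have hdφ : ∀ v : ℝ × ℝ, fderiv ℝ φ p v = v.1 * A + v.2 * B := by
    intro v
    conv_lhs => rw [show v = v.1 • ((1 : ℝ), (0 : ℝ)) + v.2 • ((0 : ℝ), (1 : ℝ)) by simp, map_add,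
      map_smul, map_smul]
    simp [hA, hB]
  have hAB : A ^ 2 + B ^ 2 ≠ 0 := by
    intro h
    have h1 : A = 0 := by nlinarith [sq_nonneg A, sq_nonneg B]
    have h2 : B = 0 := by nlinarith [sq_nonneg A, sq_nonneg B]
    exact hd (by ext <;> simp [hdφ, h1, h2])
  -- The first component is linear with gradient perpendicular to that of φ, so Ψ is a local
  -- diffeomorphism at p and the curve is the inverse image of the horizontal axis.
  set Ψ : ℝ × ℝ → ℝ × ℝ := fun x => (B * (x.1 - p.1) - A * (x.2 - p.2), φ x) with hΨ
  have hφn : ContDiff ℝ (n + 1 : ℕ) φ := hφ.of_le (by exact_mod_cast le_top)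
  have hΨs : ContDiff ℝ (n + 1 : ℕ) Ψ := by
    refine ContDiff.prodMk ?_ hφn
    fun_prop
  have hΨp : Ψ p = 0 := by simp [hΨ, h0]
  have hder : ∀ v, fderiv ℝ Ψ p v = (B * v.1 - A * v.2, v.1 * A + v.2 * B) := by
    intro v
    have h1 : HasFDerivAt (fun x : ℝ × ℝ => B * (x.1 - p.1) - A * (x.2 - p.2))
        (B • ContinuousLinearMap.fst ℝ ℝ ℝ - A • ContinuousLinearMap.snd ℝ ℝ ℝ) p :=
      ((hasFDerivAt_fst.sub_const _).const_mul B).sub ((hasFDerivAt_snd.sub_const _).const_mul A)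
    have h2 := h1.prodMk (hφn.differentiable (by simp) p).hasFDerivAt
    rw [h2.fderiv]
    simp [hdφ]
  obtain ⟨Φ, hΦ, hΦ0, hr, -⟩ := exists_local_inverse (Nat.succ_ne_zero n) hΨs.contDiffAt
    (y₀ := p) (by
      intro v hv
      rw [hder, Prod.mk_eq_zero] at hv
      obtain ⟨e1, e2⟩ := hv
      have g1 : (A ^ 2 + B ^ 2) * v.1 = 0 := by linear_combination B * e1 + A * e2
      have g2 : (A ^ 2 + B ^ 2) * v.2 = 0 := by linear_combination -A * e1 + B * e2
      exact Prod.ext ((mul_eq_zero.1 g1).resolve_left hAB) ((mul_eq_zero.1 g2).resolve_left hAB))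
  rw [hΨp] at hΦ hΦ0 hr
  have hι : ContDiff ℝ (n + 1 : ℕ) fun t : ℝ => (t, (0 : ℝ)) := by fun_prop
  have hcomp : ContDiffAt ℝ (n + 1 : ℕ) (fun t : ℝ => Φ (t, 0)) 0 :=
    ContDiffAt.comp (0 : ℝ) (g := Φ) (f := fun t : ℝ => (t, (0 : ℝ))) hΦ hι.contDiffAt
  obtain ⟨γ, hγ, hγe⟩ := exists_contDiff_eventuallyEq hcomp
  have hr' : ∀ᶠ t : ℝ in 𝓝 0, Ψ (γ t) = (t, 0) := by
    have hc : Tendsto (fun t : ℝ => (t, (0 : ℝ))) (𝓝 0) (𝓝 0) := by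
      exact hι.continuous.tendsto' _ _ rfl
    filter_upwards [hγe, hc.eventually hr] with t h1 h2
    rw [h1, h2]
  have hγ0 : γ 0 = p := by rw [hγe.eq_of_nhds]; exact hΦ0
  refine ⟨γ, hγ, hγ0, ?_, ?_⟩
  · intro hz
    have h1 : HasDerivAt γ 0 0 := by
      rw [← hz]; exact (hγ.differentiable (by simp) 0).hasDerivAt
    have h2 : HasDerivAt (fun t => Ψ (γ t)) (fderiv ℝ Ψ p 0) 0 := by
      have h3 := (hΨs.differentiable (by simp) (γ 0)).hasFDerivAt.comp_hasDerivAt (0 : ℝ) h1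
      rw [hγ0] at h3; exact h3
    have h4 : HasDerivAt (fun t : ℝ => (t, (0 : ℝ))) (1, 0) 0 :=
      (hasDerivAt_id 0).prodMk (hasDerivAt_const 0 0)
    have := (h2.congr_of_eventuallyEq (hr'.mono fun t ht => ht.symm)).unique h4
    simp [Prod.ext_iff] at this
  · filter_upwards [hr'] with t ht
    exact (Prod.ext_iff.1 ht).2

/-- A chart of the plane sending the horizontal axis to the zero set of `φ`, and the upper half
plane to the positivity set of `φ`. -/
structure IsBoundaryChart (φ : ℝ × ℝ → ℝ) (p : ℝ × ℝ) (n : ℕ) (X : ℝ × ℝ → ℝ × ℝ) : Prop where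
  contDiff : ContDiff ℝ (n + 1 : ℕ) X
  apply_zero : X 0 = p
  map_axis : ∀ᶠ t : ℝ in 𝓝 0, φ (X (t, 0)) = 0
  tangent_ne_zero : fderiv ℝ X 0 (1, 0) ≠ 0
  normal_pos : 0 < fderiv ℝ φ p (fderiv ℝ X 0 (0, 1))

namespace IsBoundaryChart

variable {φ : ℝ × ℝ → ℝ} {p : ℝ × ℝ} {n : ℕ} {X : ℝ × ℝ → ℝ × ℝ}

theorem hasStrictFDerivAt (hX : IsBoundaryChart φ p n X) (y : ℝ × ℝ) :
    HasStrictFDerivAt X (fderiv ℝ X y) y :=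
  hX.contDiff.contDiffAt.hasStrictFDerivAt (by simp)

theorem hasStrictFDerivAt_comp (hX : IsBoundaryChart φ p n X) (hφ : ContDiff ℝ ∞ φ) :
    HasStrictFDerivAt (fun y => φ (X y)) ((fderiv ℝ φ p).comp (fderiv ℝ X 0)) 0 := by
  have h1 : HasStrictFDerivAt φ (fderiv ℝ φ p) (X 0) := by
    rw [hX.apply_zero]; exact hφ.contDiffAt.hasStrictFDerivAt (by simp)
  exact h1.comp 0 (hX.hasStrictFDerivAt 0)

theorem tangent (hX : IsBoundaryChart φ p n X) (hφ : ContDiff ℝ ∞ φ) :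
    fderiv ℝ φ p (fderiv ℝ X 0 (1, 0)) = 0 := by
  have h4 : HasDerivAt (fun t : ℝ => (t, (0 : ℝ))) (1, 0) 0 :=
    (hasDerivAt_id 0).prodMk (hasDerivAt_const 0 0)
  have h1 : HasDerivAt (fun t : ℝ => φ (X (t, 0))) _ 0 :=
    HasFDerivAt.comp_hasDerivAt (0 : ℝ) (f := fun t : ℝ => (t, (0 : ℝ)))
      (hX.hasStrictFDerivAt_comp hφ).hasFDerivAt h4
  have h2 : HasDerivAt (fun _ : ℝ => (0 : ℝ)) _ 0 :=
    h1.congr_of_eventuallyEq (hX.map_axis.mono fun t ht => ht.symm)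
  exact h2.unique (hasDerivAt_const _ _)

theorem exists_inverse (hX : IsBoundaryChart φ p n X) (hφ : ContDiff ℝ ∞ φ) :
    ∃ Y : ℝ × ℝ → ℝ × ℝ, ContDiffAt ℝ (n + 1 : ℕ) Y p ∧ Y p = 0 ∧
      (∀ᶠ x in 𝓝 p, X (Y x) = x) ∧ ∀ᶠ y in 𝓝 0, Y (X y) = y := by
  have := exists_local_inverse (Nat.succ_ne_zero n) hX.contDiff.contDiffAt (y₀ := 0) (by
    intro v hv
    have hv' : v = v.1 • ((1 : ℝ), (0 : ℝ)) + v.2 • ((0 : ℝ), (1 : ℝ)) := by simp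
    rw [hv', map_add, map_smul, map_smul] at hv
    have h1 : v.2 = 0 := by
      have h2 := congrArg (fderiv ℝ φ p) hv
      rw [map_add, map_smul, map_smul, hX.tangent hφ, map_zero, smul_zero, zero_add,
        smul_eq_mul] at h2
      exact (mul_eq_zero.1 h2).resolve_right hX.normal_pos.ne'
    rw [h1, zero_smul, add_zero] at hv
    exact Prod.ext ((smul_eq_zero.1 hv).resolve_right hX.tangent_ne_zero) h1)
  rwa [hX.apply_zero] at this

theorem tendsto_axis : Tendsto (fun y : ℝ × ℝ => ((y.1, 0) : ℝ × ℝ)) (𝓝 0) (𝓝 0) := by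
  have : Continuous fun y : ℝ × ℝ => ((y.1, 0) : ℝ × ℝ) := by fun_prop
  exact this.tendsto' _ _ rfl

/-- φ ∘ X vanishes on the axis and has a positive normal derivative at 0; strict differentiability
makes the first order expansion uniform nearby. The factor y.2 treats both sides of the axis at
once. -/
theorem exists_sign (hX : IsBoundaryChart φ p n X) (hφ : ContDiff ℝ ∞ φ) :
    ∃ c > 0, ∀ᶠ y in 𝓝 (0 : ℝ × ℝ), c * y.2 ^ 2 ≤ y.2 * φ (X y) := by
  set σ := fderiv ℝ φ p (fderiv ℝ X 0 (0, 1)) with hσ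
  have hσ0 : 0 < σ := hX.normal_pos
  refine ⟨σ / 2, by positivity, ?_⟩
  have h1 := (hX.hasStrictFDerivAt_comp hφ).isLittleO.def (c := σ / 2) (by positivity)
  have hpair : Tendsto (fun y : ℝ × ℝ => (y, ((y.1, 0) : ℝ × ℝ))) (𝓝 0) (𝓝 (0, 0)) := by
    exact tendsto_id.prodMk_nhds tendsto_axis
  have hax : ∀ᶠ y : ℝ × ℝ in 𝓝 0, φ (X (y.1, 0)) = 0 := by
    have : Tendsto (fun y : ℝ × ℝ => y.1) (𝓝 0) (𝓝 0) := continuous_fst.tendsto' _ _ rfl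
    exact this.eventually hX.map_axis
  filter_upwards [hpair.eventually h1, hax] with y hy h0
  simp only [h0, sub_zero] at hy
  have e1 : y - (y.1, 0) = y.2 • ((0 : ℝ), (1 : ℝ)) := by ext <;> simp
  have e2 : ‖y.2 • ((0 : ℝ), (1 : ℝ))‖ = |y.2| := by simp
  rw [e1, map_smul, e2, Real.norm_eq_abs] at hy
  have e3 : ((fderiv ℝ φ p).comp (fderiv ℝ X 0)) ((0 : ℝ), (1 : ℝ)) = σ := rfl
  rw [e3, smul_eq_mul] at hy
  have h5 : |y.2 * (φ (X y) - y.2 * σ)| ≤ |y.2| * (σ / 2 * |y.2|) := by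
    rw [abs_mul]; gcongr
  have h6 : |y.2| * (σ / 2 * |y.2|) = σ / 2 * y.2 ^ 2 := by
    rw [← sq_abs y.2]; ring
  rw [h6] at h5
  nlinarith [neg_abs_le (y.2 * (φ (X y) - y.2 * σ))]

end IsBoundaryChart

/-! ### Functions whose gradient is at most the inverse distance to a line -/

/-- Go from (0, b/2) horizontally and then vertically; in the variable log y.2 the vertical
derivative is bounded by C. -/
theorem norm_sub_le_log {a b C : ℝ} (ha : 0 < a) (hb : 0 < b) {H : ℝ × ℝ → ℂ}
    (hd : ∀ y ∈ Ioo (-a) a ×ˢ Ioo 0 b, DifferentiableAt ℝ H y ∧ ‖fderiv ℝ H y‖ ≤ C / y.2) :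
    ∃ M, ∀ y ∈ Ioo (-a) a ×ˢ Ioo 0 b, ‖H y‖ ≤ M + C * |Real.log y.2| := by
  have hC : 0 ≤ C := by
    have := (hd (0, b / 2) ⟨⟨by simpa, by simpa⟩, by constructor <;> simp <;> linarith⟩).2
    have h2 := (norm_nonneg _).trans this
    have h3 : (0 : ℝ) < b / 2 := by positivity
    by_contra hneg
    exact absurd h2 (not_le.2 (div_neg_of_neg_of_pos (not_le.1 hneg) h3))
  refine ⟨‖H (0, b / 2)‖ + C / (b / 2) * a + C * |Real.log (b / 2)|, fun y hy => ?_⟩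
  obtain ⟨hy1, hy2⟩ := hy
  have hb2 : b / 2 ∈ Ioo 0 b := ⟨by positivity, by linarith⟩
  have e1 : ‖H (y.1, b / 2) - H (0, b / 2)‖ ≤ C / (b / 2) * a := by
    have hder : ∀ t ∈ Ioo (-a) a, HasDerivWithinAt (fun t => H (t, b / 2))
        (fderiv ℝ H (t, b / 2) (1, 0)) (Ioo (-a) a) t := by
      intro t ht
      have h4 : HasDerivAt (fun t : ℝ => (t, b / 2)) (1, 0) t :=
        (hasDerivAt_id t).prodMk (hasDerivAt_const t _)
      exact (HasFDerivAt.comp_hasDerivAt t (f := fun t : ℝ => (t, b / 2))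
        (hd (t, b / 2) ⟨ht, hb2⟩).1.hasFDerivAt h4).hasDerivWithinAt
    have := (convex_Ioo (-a) a).norm_image_sub_le_of_norm_hasDerivWithin_le hder
      (C := C / (b / 2)) (fun t ht => by
        refine ((fderiv ℝ H (t, b / 2)).le_opNorm _).trans ?_
        simpa using (hd (t, b / 2) ⟨ht, hb2⟩).2) (show (0 : ℝ) ∈ Ioo (-a) a from
          ⟨by linarith, ha⟩) hy1
    refine this.trans ?_
    rw [sub_zero]
    gcongr
    exact (abs_lt.2 hy1).le
  have e2 : ‖H y - H (y.1, b / 2)‖ ≤ C * |Real.log y.2 - Real.log (b / 2)| := by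
    have hmem : ∀ σ ∈ Iio (Real.log b), Real.exp σ ∈ Ioo 0 b := fun σ hσ =>
      ⟨Real.exp_pos σ, (Real.lt_log_iff_exp_lt hb).1 hσ⟩
    have hder : ∀ σ ∈ Iio (Real.log b), HasDerivWithinAt (fun σ => H (y.1, Real.exp σ))
        (fderiv ℝ H (y.1, Real.exp σ) (0, Real.exp σ)) (Iio (Real.log b)) σ := by
      intro σ hσ
      have h4 : HasDerivAt (fun σ : ℝ => (y.1, Real.exp σ)) (0, Real.exp σ) σ :=
        (hasDerivAt_const σ _).prodMk (Real.hasDerivAt_exp σ)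
      exact (HasFDerivAt.comp_hasDerivAt σ (f := fun σ : ℝ => (y.1, Real.exp σ))
        (hd (y.1, Real.exp σ) ⟨hy1, hmem σ hσ⟩).1.hasFDerivAt h4).hasDerivWithinAt
    have := (convex_Iio (Real.log b)).norm_image_sub_le_of_norm_hasDerivWithin_le hder
      (C := C) (fun σ hσ => by
        refine ((fderiv ℝ H (y.1, Real.exp σ)).le_opNorm _).trans ?_
        have hn : ‖((0 : ℝ), Real.exp σ)‖ = Real.exp σ := by
          simp [Prod.norm_def, abs_of_pos (Real.exp_pos σ), (Real.exp_pos σ).le]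
        rw [hn]
        calc _ ≤ C / Real.exp σ * Real.exp σ := by
              gcongr; exact (hd (y.1, Real.exp σ) ⟨hy1, hmem σ hσ⟩).2
          _ = C := by field_simp)
      (show Real.log (b / 2) ∈ Iio (Real.log b) from Real.log_lt_log hb2.1 hb2.2)
      (show Real.log y.2 ∈ Iio (Real.log b) from Real.log_lt_log hy2.1 hy2.2)
    simpa only [Real.exp_log hy2.1, Real.exp_log hb2.1, Prod.mk.eta, Real.norm_eq_abs] using this
  have e3 : |Real.log y.2 - Real.log (b / 2)| ≤ |Real.log y.2| + |Real.log (b / 2)| :=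
    abs_sub _ _
  have e4 : ‖H y‖ ≤ ‖H y - H (y.1, b / 2)‖ + ‖H (y.1, b / 2) - H (0, b / 2)‖ + ‖H (0, b / 2)‖ := by
    have : H y = (H y - H (y.1, b / 2)) + (H (y.1, b / 2) - H (0, b / 2)) + H (0, b / 2) := by ring
    conv_lhs => rw [this]
    exact norm_add₃_le
  nlinarith [mul_le_mul_of_nonneg_left e3 hC]

theorem exists_log_bound {a b C : ℝ} (ha : 0 < a) (hb : 0 < b) {H : ℝ × ℝ → ℂ}
    (hd : ∀ y ∈ Ioo (-a) a ×ˢ Ioo (-b) b, y.2 ≠ 0 →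
      DifferentiableAt ℝ H y ∧ ‖fderiv ℝ H y‖ ≤ C / |y.2|) :
    ∃ M, ∀ y ∈ Ioo (-a) a ×ˢ Ioo (-b) b, y.2 ≠ 0 → ‖H y‖ ≤ M + C * |Real.log y.2| := by
  obtain ⟨M₁, h₁⟩ := norm_sub_le_log (C := C) ha hb (H := H) fun y hy => by
    have := hd y ⟨hy.1, by linarith [hy.2.1], hy.2.2⟩ hy.2.1.ne'
    rwa [abs_of_pos hy.2.1] at this
  let ρ : (ℝ × ℝ) ≃L[ℝ] (ℝ × ℝ) :=
    (ContinuousLinearEquiv.refl ℝ ℝ).prodCongr (ContinuousLinearEquiv.neg ℝ)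
  have hρ : ∀ y : ℝ × ℝ, ρ y = (y.1, -y.2) := fun y => rfl
  obtain ⟨M₂, h₂⟩ := norm_sub_le_log (C := C) ha hb (H := H ∘ ρ) fun y hy => by
    have h1 := hd (ρ y) ⟨hy.1, by rw [hρ]; constructor <;> simp <;> linarith [hy.2.1, hy.2.2]⟩
      (by rw [hρ]; simpa using hy.2.1.ne')
    refine ⟨h1.1.comp y ρ.differentiableAt, ?_⟩
    rw [ρ.comp_right_fderiv]
    refine (ContinuousLinearMap.opNorm_comp_le _ _).trans ?_
    have h3 : ‖(ρ : (ℝ × ℝ) →L[ℝ] ℝ × ℝ)‖ ≤ 1 :=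
      ContinuousLinearMap.opNorm_le_bound _ zero_le_one fun v => by
        change ‖ρ v‖ ≤ _
        rw [hρ, one_mul, Prod.norm_def, Prod.norm_def]; simp
    have h4 := h1.2
    rw [hρ, abs_neg, abs_of_pos hy.2.1] at h4
    rw [hρ]
    calc _ ≤ ‖fderiv ℝ H (y.1, -y.2)‖ * 1 := by gcongr
      _ ≤ _ := by rwa [mul_one]
  refine ⟨max M₁ M₂, fun y hy hne => ?_⟩
  rcases lt_or_gt_of_ne hne with hneg | hpos
  · have := h₂ (y.1, -y.2) ⟨hy.1, by constructor <;> simp <;> linarith [hy.2.1]⟩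
    simp only [Function.comp_apply, hρ, neg_neg, Prod.mk.eta, Real.log_neg_eq_log] at this
    linarith [le_max_right M₁ M₂]
  · linarith [le_max_left M₁ M₂, h₁ y ⟨hy.1, hpos, hy.2.2⟩]

theorem integrableOn_of_log_bound {a b C M : ℝ} {H : ℝ × ℝ → ℂ} (hb : 0 < b)
    (hc : ContinuousOn H ((Ioo (-a) a ×ˢ Ioo (-b) b) ∩ {y | y.2 ≠ 0}))
    (hM : ∀ y ∈ Ioo (-a) a ×ˢ Ioo (-b) b, y.2 ≠ 0 → ‖H y‖ ≤ M + C * |Real.log y.2|) :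
    IntegrableOn H (Ioo (-a) a ×ˢ Ioo (-b) b) := by
  set O := Ioo (-a) a ×ˢ Ioo (-b) b with hO
  have hOo : IsOpen O := isOpen_Ioo.prod isOpen_Ioo
  have hne : IsOpen {x : ℝ × ℝ | x.2 ≠ 0} := isOpen_ne.preimage continuous_snd
  have hnull : ∀ᵐ y : ℝ × ℝ, y.2 ≠ 0 := by
    have h1 : {y : ℝ × ℝ | ¬ y.2 ≠ 0} = univ ×ˢ {(0 : ℝ)} := by ext y; simp
    rw [ae_iff, h1, Measure.volume_eq_prod, Measure.prod_prod]
    simp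
  have hset : (O ∩ {y | y.2 ≠ 0} : Set (ℝ × ℝ)) =ᵐ[volume] O := by
    filter_upwards [hnull] with y hy
    exact propext ⟨fun h => h.1, fun h => ⟨h, hy⟩⟩
  have hmeas : AEStronglyMeasurable H (volume.restrict O) := by
    rw [← Measure.restrict_congr_set hset]
    exact hc.aestronglyMeasurable (hOo.inter hne).measurableSet
  have hlog : IntegrableOn (fun s : ℝ => M + C * |Real.log s|) (Ioo (-b) b) := by
    have h1 : IntegrableOn Real.log (Ioo (-b) b) := by
      have := (intervalIntegral.intervalIntegrable_log' (a := -b) (b := b))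
      rw [intervalIntegrable_iff_integrableOn_Ioo_of_le (by linarith)] at this
      exact this
    exact (integrableOn_const (by simp)).add (h1.abs.const_mul C)
  have hint : IntegrableOn (fun y : ℝ × ℝ => M + C * |Real.log y.2|) O := by
    rw [IntegrableOn, hO, Measure.volume_eq_prod, ← Measure.prod_restrict]
    have h1 : Integrable (fun _ : ℝ => (1 : ℝ)) (volume.restrict (Ioo (-a) a)) :=
      integrableOn_const (by simp)
    simpa using h1.mul_prod hlog
  refine hint.mono' hmeas ?_
  filter_upwards [ae_restrict_mem hOo.measurableSet, ae_restrict_of_ae hnull] with y hy h0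
  exact hM y hy h0

theorem exists_mul_log_le {C M ε : ℝ} (hε : 0 < ε) :
    ∃ δ > 0, ∀ s ∈ Ioo 0 δ, s * (M + C * |Real.log s|) ≤ ε := by
  have hcont : Continuous fun s : ℝ => s * M + C * |s * Real.log s| := by
    have := Real.continuous_mul_log
    fun_prop
  have h0 : Tendsto (fun s : ℝ => s * M + C * |s * Real.log s|) (𝓝 0) (𝓝 0) :=
    hcont.tendsto' _ _ (by simp)
  obtain ⟨δ, hδ, hb⟩ := Metric.eventually_nhds_iff.1 (h0.eventually (gt_mem_nhds hε))
  refine ⟨δ, hδ, fun s hs => ?_⟩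
  have := hb (y := s) (by simpa [abs_of_pos hs.1] using hs.2)
  rw [abs_mul, abs_of_pos hs.1] at this
  linarith

/-! ### Defining functions and distance to the boundary -/

/-- `φ` is a defining function of `Ω` near the boundary point `p`. -/
structure IsDefiningFunction (Ω : Set (ℝ × ℝ)) (φ : ℝ × ℝ → ℝ) (p : ℝ × ℝ) : Prop where
  contDiff : ContDiff ℝ ∞ φ
  apply_eq_zero : φ p = 0
  fderiv_ne_zero : fderiv ℝ φ p ≠ 0
  mem_iff : ∀ᶠ y in 𝓝 p, (y ∈ Ω ↔ 0 < φ y)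

theorem IsSmoothBoundaryPoint.exists_isDefiningFunction {Ω : Set (ℝ × ℝ)} (hΩ : IsOpen Ω)
    {p : ℝ × ℝ} (hp : IsSmoothBoundaryPoint Ω p) : ∃ φ, IsDefiningFunction Ω φ p := by
  obtain ⟨hf, φ, hφ, hd, U, hU, he⟩ := hp
  have hiff : ∀ y ∈ U, (y ∈ Ω ↔ 0 < φ y) := fun y hy =>
    ⟨fun h => ((he ▸ (⟨h, hy⟩ : y ∈ Ω ∩ U) : y ∈ {y | 0 < φ y} ∩ U)).1,
      fun h => ((he.symm ▸ (⟨h, hy⟩ : y ∈ {y | 0 < φ y} ∩ U) : y ∈ Ω ∩ U)).1⟩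
  refine ⟨φ, hφ, le_antisymm ?_ ?_, hd, mem_of_superset hU hiff⟩
  · by_contra hpos
    have h1 := (hiff p (mem_of_mem_nhds hU)).2 (not_le.1 hpos)
    rw [hΩ.frontier_eq] at hf
    exact hf.2 h1
  · by_contra hneg
    have h1 : ∀ᶠ y in 𝓝 p, φ y < 0 :=
      hφ.continuous.continuousAt.eventually (gt_mem_nhds (not_le.1 hneg))
    obtain ⟨y, ⟨hy1, hy2⟩, hyΩ⟩ := mem_closure_iff_nhds.1 (frontier_subset_closure hf) _
      (inter_mem h1 hU)
    have := (hiff y hy2).1 hyΩ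
    exact absurd hy1 (not_lt.2 this.le)

namespace IsDefiningFunction

variable {Ω : Set (ℝ × ℝ)} {φ : ℝ × ℝ → ℝ} {p : ℝ × ℝ}

theorem notMem (hd : IsDefiningFunction Ω φ p) : p ∉ Ω := fun h => by
  have := (hd.mem_iff.self_of_nhds).1 h
  rw [hd.apply_eq_zero] at this
  exact lt_irrefl _ this

theorem hasStrictFDerivAt (hd : IsDefiningFunction Ω φ p) :
    HasStrictFDerivAt φ (fderiv ℝ φ p) p := hd.contDiff.contDiffAt.hasStrictFDerivAt (by simp)

theorem exists_linear_approx (hd : IsDefiningFunction Ω φ p) {η : ℝ} (hη : 0 < η) :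
    ∃ r > 0, ∀ x ∈ Metric.ball p r, ∀ y ∈ Metric.ball p r,
      |φ x - φ y - fderiv ℝ φ p (x - y)| ≤ η * ‖x - y‖ := by
  have h := hd.hasStrictFDerivAt.isLittleO.def hη
  rw [nhds_prod_eq] at h
  obtain ⟨s, hs, t, ht, hst⟩ := eventually_prod_iff.1 h
  obtain ⟨r, hr, hrb⟩ := Metric.mem_nhds_iff.1 (inter_mem hs ht)
  exact ⟨r, hr, fun x hx y hy => hst (hrb hx).1 (hrb hy).2⟩

theorem exists_lipschitz (hd : IsDefiningFunction Ω φ p) :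
    ∃ K > 0, ∃ r > 0, ∀ x ∈ Metric.ball p r, ∀ y ∈ Metric.ball p r,
      |φ x - φ y| ≤ K * ‖x - y‖ := by
  obtain ⟨r, hr, hb⟩ := hd.exists_linear_approx one_pos
  refine ⟨‖fderiv ℝ φ p‖ + 1, by positivity, r, hr, fun x hx y hy => ?_⟩
  have h1 := hb x hx y hy
  have h2 := (fderiv ℝ φ p).le_opNorm (x - y)
  rw [Real.norm_eq_abs] at h2
  have h3 : φ x - φ y = (φ x - φ y - fderiv ℝ φ p (x - y)) + fderiv ℝ φ p (x - y) := by ring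
  rw [h3]
  refine (abs_add_le _ _).trans ?_
  linarith

end IsDefiningFunction

theorem IsSmoothSolution.eventually_eq_zero {Ω : Set (ℝ × ℝ)} {om b : ℂ} {f u : ℝ × ℝ → ℂ}
    (h : IsSmoothSolution Ω om b f u) {p : ℝ × ℝ} (hp : p ∉ Ω) : ∀ᶠ x in 𝓝 p, f x = 0 :=
  notMem_tsupport_iff_eventuallyEq.1 fun hx => hp (h.test.tsupport_subset hx)

/-- Decay of the solution and of its gradient in terms of a defining function. -/
theorem IsSmoothSolution.decay_near {Ω : Set (ℝ × ℝ)} {om b : ℂ} {f u : ℝ × ℝ → ℂ}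
    (h : IsSmoothSolution Ω om b f u) {φ : ℝ × ℝ → ℝ} {p : ℝ × ℝ}
    (hd : IsDefiningFunction Ω φ p) :
    ∃ r > 0, ∀ ε > 0, ∃ δ > 0, ∀ x ∈ Metric.ball p r, 0 < φ x → φ x < δ →
      ‖partial₁ u x‖ ≤ ε / φ x ∧ ‖partial₂ u x‖ ≤ ε / φ x ∧ ‖u x‖ ≤ ε := by
  obtain ⟨v, hv⟩ : ∃ v, fderiv ℝ φ p v = 1 := by
    obtain ⟨v, hv⟩ := ContinuousLinearMap.exists_ne_zero hd.fderiv_ne_zero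
    exact ⟨(fderiv ℝ φ p v)⁻¹ • v, by rw [map_smul, smul_eq_mul, inv_mul_cancel₀ hv]⟩
  obtain ⟨K, hK, r₁, hr₁, hlip⟩ := hd.exists_lipschitz
  obtain ⟨r₂, hr₂, happ⟩ := hd.exists_linear_approx (η := (2 * (‖v‖ + 1))⁻¹) (by positivity)
  obtain ⟨r₃, hr₃, hmem⟩ := Metric.mem_nhds_iff.1 (inter_mem hd.mem_iff
    (h.eventually_eq_zero hd.notMem))
  set r := min r₁ (min r₂ r₃) with hr
  have hr0 : 0 < r := by positivity
  have hrr₁ : Metric.ball p r ⊆ Metric.ball p r₁ := Metric.ball_subset_ball (min_le_left _ _)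
  have hrr₂ : Metric.ball p r ⊆ Metric.ball p r₂ :=
    Metric.ball_subset_ball ((min_le_right _ _).trans (min_le_left _ _))
  have hrr₃ : Metric.ball p r ⊆ Metric.ball p r₃ :=
    Metric.ball_subset_ball ((min_le_right _ _).trans (min_le_right _ _))
  -- Moving against v decreases φ at rate at least 1/2.
  have hexit : ∀ y ∈ Metric.ball p r, ∀ τ ≥ 0, y + (-τ) • v ∈ Metric.ball p r →
      φ (y + (-τ) • v) ≤ φ y - τ / 2 := by
    intro y hy τ hτ hy'
    have h1 := happ _ (hrr₂ hy') _ (hrr₂ hy)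
    rw [add_sub_cancel_left, map_smul, hv, norm_smul, norm_neg, Real.norm_of_nonneg hτ] at h1
    have h2 : (2 * (‖v‖ + 1))⁻¹ * (τ * ‖v‖) ≤ τ / 2 := by
      rw [inv_mul_eq_div, div_le_div_iff₀ (by positivity) (by positivity)]
      nlinarith [norm_nonneg v]
    have h3 := (abs_le.1 (h1.trans h2)).2
    simp only [smul_eq_mul, mul_one] at h3
    linarith
  refine ⟨r / 4, by positivity, fun ε hε => ?_⟩
  obtain ⟨δ, hδ, hdec⟩ := h.boundary_decay (8 * (K + 1) * ‖v‖ + 1) (ε / (2 * (K + 1)))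
    (by positivity) (by positivity)
  refine ⟨min δ (r / (16 * (‖v‖ + 1))), by positivity, fun x hx hpos hlt => ?_⟩
  -- On the ball of this radius φ stays within φ(x)/2 of φ(x). So the ball lies in Ω, and the
  -- translation by −4φ(x)v brings φ down to at most 3φ(x)/2 − 2φ(x) < 0, that is, out of Ω.
  set ρ := φ x / (2 * (K + 1)) with hρ
  have hρ0 : 0 < ρ := by positivity
  have hφρ : φ x = 2 * (K + 1) * ρ := by rw [hρ]; field_simp
  have hlt1 : φ x < δ := hlt.trans_le (min_le_left _ _)
  have hlt2 : φ x * (16 * (‖v‖ + 1)) < r := by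
    rw [← lt_div_iff₀ (by positivity)]; exact hlt.trans_le (min_le_right _ _)
  have hρφ : ρ ≤ φ x / 2 := by
    rw [hφρ]; nlinarith
  have hρr : ρ < r / 4 := by nlinarith [norm_nonneg v, mul_nonneg hpos.le (norm_nonneg v)]
  have hyr : ∀ y ∈ Metric.ball x ρ, y ∈ Metric.ball p (r / 2) := fun y hy =>
    Metric.ball_subset_ball' (by linarith [Metric.mem_ball.1 hx]) hy
  have hyr' : ∀ y ∈ Metric.ball x ρ, y ∈ Metric.ball p r := fun y hy =>
    Metric.ball_subset_ball (by linarith) (hyr y hy)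
  have hxr : x ∈ Metric.ball p r := hyr' x (Metric.mem_ball_self hρ0)
  have hφy : ∀ y ∈ Metric.ball x ρ, |φ y - φ x| ≤ φ x / 2 := by
    intro y hy
    refine (hlip y (hrr₁ (hyr' y hy)) x (hrr₁ hxr)).trans ?_
    rw [← dist_eq_norm]
    have := (Metric.mem_ball.1 hy).le
    calc K * dist y x ≤ (K + 1) * ρ := by gcongr; linarith
      _ = φ x / 2 := by rw [hφρ]; ring
  obtain ⟨⟨g1, g2⟩, g3⟩ := hdec x ρ hρ0 (by linarith)
    (fun y hy => ((hmem (hrr₃ (hyr' y hy))).1).2 (by linarith [(abs_le.1 (hφy y hy)).1]))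
    (fun y hy => (hmem (hrr₃ (hyr' y hy))).2)
  have he : ε / (2 * (K + 1)) / ρ = ε / φ x := by rw [hφρ]; field_simp
  rw [he] at g1 g2
  refine ⟨g1, g2, (g3 ((-(4 * φ x)) • v) ?_ ?_).trans ?_⟩
  · rw [norm_smul, norm_neg, Real.norm_of_nonneg (by positivity), hφρ]
    nlinarith [norm_nonneg v]
  · intro y hy hout
    have hin : y + (-(4 * φ x)) • v ∈ Metric.ball p r := by
      rw [Metric.mem_ball]
      have h1 := Metric.mem_ball.1 (hyr y hy)
      have h2 : dist (y + (-(4 * φ x)) • v) y = 4 * φ x * ‖v‖ := by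
        rw [dist_eq_norm, add_sub_cancel_left, norm_smul, norm_neg,
          Real.norm_of_nonneg (by positivity)]
      have h3 := dist_triangle (y + (-(4 * φ x)) • v) y p
      nlinarith
    have h1 := hexit y (hyr' y hy) (4 * φ x) (by positivity) hin
    have h2 := ((hmem (hrr₃ hin)).1).1 hout
    linarith [(abs_le.1 (hφy y hy)).2]
  · rw [div_le_iff₀ (by positivity)]; nlinarith

namespace IsBoundaryChart

variable {Ω : Set (ℝ × ℝ)} {φ : ℝ × ℝ → ℝ} {p : ℝ × ℝ} {n : ℕ} {X Y : ℝ × ℝ → ℝ × ℝ}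

theorem tendsto (hX : IsBoundaryChart φ p n X) : Tendsto X (𝓝 0) (𝓝 p) := by
  have := hX.contDiff.continuous.tendsto 0
  rwa [hX.apply_zero] at this

theorem exists_norm_sub_le (hX : IsBoundaryChart φ p n X) :
    ∃ K > 0, ∀ᶠ y in 𝓝 (0 : ℝ × ℝ), ‖X y - X (y.1, 0)‖ ≤ K * |y.2| := by
  obtain ⟨K, s, hs, hK⟩ := (hX.hasStrictFDerivAt 0).exists_lipschitzOnWith
  refine ⟨K + 1, by positivity, ?_⟩
  filter_upwards [hs, tendsto_axis.eventually hs] with y h1 h2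
  have := hK.dist_le_mul y h1 (y.1, 0) h2
  rw [dist_eq_norm, dist_eq_norm] at this
  have e1 : y - (y.1, 0) = (0, y.2) := by ext <;> simp
  have e2 : ‖((0 : ℝ), y.2)‖ = |y.2| := by simp [Prod.norm_def]
  rw [e1, e2] at this
  nlinarith [abs_nonneg y.2]

/-- The segment between corresponding points of two charts stays away from the boundary. -/
theorem exists_segment_bounds (hd : IsDefiningFunction Ω φ p) (hX : IsBoundaryChart φ p n X)
    (hY : IsBoundaryChart φ p n Y) (hXY : ∀ t, X (t, 0) = Y (t, 0)) {r : ℝ} (hr : 0 < r) :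
    ∃ c > 0, ∃ C > 0, ∀ᶠ y in 𝓝 (0 : ℝ × ℝ), 0 < y.2 → ∀ z ∈ segment ℝ (X y) (Y y),
      z ∈ Metric.ball p r ∧ c * y.2 ≤ φ z ∧ φ z ≤ C * y.2 := by
  obtain ⟨c₁, hc₁, hs₁⟩ := hX.exists_sign hd.contDiff
  obtain ⟨c₂, hc₂, hs₂⟩ := hY.exists_sign hd.contDiff
  obtain ⟨K₁, hK₁, hl₁⟩ := hX.exists_norm_sub_le
  obtain ⟨K₂, hK₂, hl₂⟩ := hY.exists_norm_sub_le
  obtain ⟨K, hK, r₀, hr₀, hlip⟩ := hd.exists_lipschitz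
  set c := min c₁ c₂ with hc
  have hc0 : 0 < c := by positivity
  set A := K₁ + K₂ with hA
  have hA0 : 0 < A := by positivity
  -- Along a segment of length at most A y.2 this tolerance keeps φ above its linear interpolation
  -- minus c y.2/4, which leaves more than half of the lower bound c y.2 valid at the end points.
  obtain ⟨r₁, hr₁, happ⟩ := hd.exists_linear_approx (η := c / (8 * A)) (by positivity)
  set R := min r (min r₀ r₁) with hR
  have hR0 : 0 < R := by positivity
  refine ⟨c / 2, by positivity, K * A, by positivity, ?_⟩
  have hball : Metric.ball p R ∈ 𝓝 p := Metric.ball_mem_nhds p hR0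
  have hax : ∀ᶠ y : ℝ × ℝ in 𝓝 0, φ (X (y.1, 0)) = 0 := by
    have : Tendsto (fun y : ℝ × ℝ => y.1) (𝓝 0) (𝓝 0) := continuous_fst.tendsto' _ _ rfl
    exact this.eventually hX.map_axis
  filter_upwards [hs₁, hs₂, hl₁, hl₂, hX.tendsto.eventually hball, hY.tendsto.eventually hball,
    (hX.tendsto.comp tendsto_axis).eventually hball, hax]
    with y h1 h2 h3 h4 h5 h6 h7 h8 hy z hz
  rw [← hXY] at h4
  rw [abs_of_pos hy] at h3 h4
  simp only [Function.comp_apply] at h7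
  have hzR : z ∈ Metric.ball p R := (convex_ball p R).segment_subset h5 h6 hz
  have hR₀ : Metric.ball p R ⊆ Metric.ball p r₀ :=
    Metric.ball_subset_ball ((min_le_right _ _).trans (min_le_left _ _))
  have hR₁ : Metric.ball p R ⊆ Metric.ball p r₁ :=
    Metric.ball_subset_ball ((min_le_right _ _).trans (min_le_right _ _))
  refine ⟨Metric.ball_subset_ball (min_le_left _ _) hzR, ?_, ?_⟩
  · have hφX : c * y.2 ≤ φ (X y) := by
      have : c₁ * y.2 ≤ φ (X y) := by
        refine le_of_mul_le_mul_left ?_ hy; linarith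
      exact (mul_le_mul_of_nonneg_right (min_le_left _ _) hy.le).trans this
    have hφY : c * y.2 ≤ φ (Y y) := by
      have : c₂ * y.2 ≤ φ (Y y) := by
        refine le_of_mul_le_mul_left ?_ hy; linarith
      exact (mul_le_mul_of_nonneg_right (min_le_right _ _) hy.le).trans this
    obtain ⟨θ, hθ, rfl⟩ := (segment_eq_image' ℝ (X y) (Y y)).subset hz
    obtain ⟨hθ0, hθ1⟩ := hθ
    have e1 := happ _ (hR₁ hzR) _ (hR₁ h5)
    have e2 := happ _ (hR₁ h6) _ (hR₁ h5)
    simp only [add_sub_cancel_left, map_smul, smul_eq_mul, norm_smul,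
      Real.norm_of_nonneg hθ0] at e1
    have hXYn : ‖Y y - X y‖ ≤ A * y.2 := by
      have : Y y - X y = (Y y - X (y.1, 0)) - (X y - X (y.1, 0)) := by abel
      rw [this]
      refine (norm_sub_le _ _).trans ?_
      rw [hA]; linarith
    have e3 : c / (8 * A) * ‖Y y - X y‖ ≤ c / 8 * y.2 := by
      calc c / (8 * A) * ‖Y y - X y‖ ≤ c / (8 * A) * (A * y.2) := by gcongr
        _ = c / 8 * y.2 := by field_simp
    have e3' : c / (8 * A) * (θ * ‖Y y - X y‖) ≤ c / 8 * y.2 := by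
      refine le_trans ?_ e3
      gcongr
      exact mul_le_of_le_one_left (norm_nonneg _) hθ1
    have e4 := (abs_le.1 (e1.trans e3')).1
    have e5 := (abs_le.1 (e2.trans e3)).2
    have e6 : θ * (φ (Y y) - φ (X y) - fderiv ℝ φ p (Y y - X y)) ≤ c / 8 * y.2 := by
      have := mul_le_mul_of_nonneg_left e5 hθ0
      have h9 : θ * (c / 8 * y.2) ≤ c / 8 * y.2 := mul_le_of_le_one_left (by positivity) hθ1
      linarith
    change c / 2 * y.2 ≤ φ (X y + θ • (Y y - X y))
    nlinarith [mul_nonneg hθ0 (sub_nonneg.2 hφY), mul_nonneg (sub_nonneg.2 hθ1)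
      (sub_nonneg.2 hφX)]
  · have hzn : ‖z - X (y.1, 0)‖ ≤ A * y.2 := by
      have b1 : X y ∈ Metric.closedBall (X (y.1, 0)) (A * y.2) := by
        rw [Metric.mem_closedBall, dist_eq_norm]; nlinarith
      have b2 : Y y ∈ Metric.closedBall (X (y.1, 0)) (A * y.2) := by
        rw [Metric.mem_closedBall, dist_eq_norm]; nlinarith
      have := (convex_closedBall (X (y.1, 0)) (A * y.2)).segment_subset b1 b2 hz
      rwa [Metric.mem_closedBall, dist_eq_norm] at this
    have := hlip z (hR₀ hzR) _ (hR₀ h7)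
    rw [h8, sub_zero] at this
    calc φ z ≤ K * ‖z - X (y.1, 0)‖ := (le_abs_self _).trans this
      _ ≤ K * (A * y.2) := by gcongr
      _ = K * A * y.2 := by ring

end IsBoundaryChart

/-- Distance to the boundary in the complex coordinate. -/
theorem IsSmoothSolution.exists_infDist_lower_bound {Ω : Set (ℝ × ℝ)} {om b : ℂ}
    {f u : ℝ × ℝ → ℂ} (h : IsSmoothSolution Ω om b f u) {φ : ℝ × ℝ → ℝ} {p : ℝ × ℝ}
    (hd : IsDefiningFunction Ω φ p) {n : ℕ} {X : ℝ × ℝ → ℝ × ℝ} (hX : IsBoundaryChart φ p n X)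
    {r : ℝ} (hr : 0 < r) :
    ∃ c > 0, ∀ᶠ y in 𝓝 (0 : ℝ × ℝ), 0 < y.2 → h.coord (X y) ∈ h.locImage p r ∧
      c * y.2 ≤ Metric.infDist (h.coord (X y)) (h.locImage p r)ᶜ := by
  obtain ⟨c, hc, C, hC, hseg⟩ := IsBoundaryChart.exists_segment_bounds hd hX hX (fun _ => rfl) hr
  obtain ⟨K, hK, r₀, hr₀, hlip⟩ := hd.exists_lipschitz
  obtain ⟨k, hk, hlow⟩ := dLin_lower_bound h.elliptic_neg
  obtain ⟨r₁, hr₁, hmem⟩ := Metric.mem_nhds_iff.1 hd.mem_iff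
  set R := min r (min r₀ r₁) with hR
  have hR0 : 0 < R := by positivity
  have hball : Metric.ball p (R / 2) ∈ 𝓝 p := Metric.ball_mem_nhds p (by positivity)
  have hsmall : ∀ᶠ y : ℝ × ℝ in 𝓝 0, y.2 < 1 :=
    continuous_snd.continuousAt.eventually (gt_mem_nhds (by norm_num))
  refine ⟨k * min (c / K) (R / 2), by positivity, ?_⟩
  filter_upwards [hseg, hX.tendsto.eventually hball, hsmall] with y h1 h2 h3 hy
  obtain ⟨-, hφ, -⟩ := h1 hy (X y) (left_mem_segment ℝ _ _)
  have hRr : R ≤ r := min_le_left _ _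
  have hRr₀ : R ≤ r₀ := (min_le_right _ _).trans (min_le_left _ _)
  have hRr₁ : R ≤ r₁ := (min_le_right _ _).trans (min_le_right _ _)
  have hφ0 : 0 < φ (X y) := lt_of_lt_of_le (by positivity) hφ
  have hXR := Metric.mem_ball.1 h2
  constructor
  · rw [h.coord_mem_locImage]
    exact ⟨(hmem (Metric.mem_ball.2 (by linarith))).2 hφ0, Metric.mem_ball.2 (by linarith)⟩
  · refine (Metric.le_infDist ⟨h.coord p, ?_⟩).2 ?_
    · rw [mem_compl_iff, h.coord_mem_locImage]
      exact fun hh => hd.notMem hh.1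
    · intro z hz
      obtain ⟨x, rfl⟩ := h.coord.surjective z
      rw [mem_compl_iff, h.coord_mem_locImage] at hz
      rw [dist_eq_norm, ← map_sub, mul_assoc]
      refine le_trans ?_ (hlow (X y - x))
      refine mul_le_mul_of_nonneg_left ?_ hk.le
      -- A point outside the local image and close to p has φ ≤ 0, so by the Lipschitz bound it is
      -- at distance at least c y.2/K from X y; a point far from p is at distance at least R/2.
      by_cases hx : x ∈ Metric.ball p R
      · have hxφ : φ x ≤ 0 := by
          by_contra hpos
          exact hz ⟨(hmem (Metric.ball_subset_ball hRr₁ hx)).2 (not_le.1 hpos),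
            Metric.ball_subset_ball hRr hx⟩
        have h5 := hlip (X y) (Metric.mem_ball.2 (by linarith)) x
          (Metric.ball_subset_ball hRr₀ hx)
        have h6 : c * y.2 ≤ K * ‖X y - x‖ := by
          have := (le_abs_self _).trans h5
          linarith
        calc min (c / K) (R / 2) * y.2 ≤ c / K * y.2 := by gcongr; exact min_le_left _ _
          _ = c * y.2 / K := by ring
          _ ≤ ‖X y - x‖ := by rw [div_le_iff₀ hK]; linarith
      · have h5 : R ≤ dist x p := not_lt.1 hx
        have h6 := dist_triangle x (X y) p
        rw [dist_comm x (X y), dist_eq_norm (X y) x] at h6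
        calc min (c / K) (R / 2) * y.2 ≤ R / 2 * 1 := by
              gcongr; exact min_le_right _ _
          _ ≤ ‖X y - x‖ := by linarith

/-! ### Almost analytic charts along the boundary -/

/-- The chart of the plane obtained by almost analytic extension of a curve with respect to a
complex coordinate. -/
def aaChart (L : (ℝ × ℝ) ≃L[ℝ] ℂ) (γ : ℝ → ℝ × ℝ) (N : ℕ) (y : ℝ × ℝ) : ℝ × ℝ :=
  L.symm (almostAnalytic (fun t => L (γ t)) N y)

section Chart

variable {L : (ℝ × ℝ) ≃L[ℝ] ℂ} {γ : ℝ → ℝ × ℝ} {N : ℕ}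

theorem apply_aaChart (y : ℝ × ℝ) :
    L (aaChart L γ N y) = almostAnalytic (fun t => L (γ t)) N y := L.apply_symm_apply _

theorem aaChart_axis (t : ℝ) : aaChart L γ N (t, 0) = γ t := by
  rw [aaChart, almostAnalytic_zero_right, L.symm_apply_apply]

theorem contDiff_aaChart {n : ℕ} (hγ : ContDiff ℝ (n + N : ℕ) γ) :
    ContDiff ℝ n (aaChart L γ N) :=
  L.symm.contDiff.comp (contDiff_almostAnalytic (L.contDiff.comp hγ))

theorem fderiv_aaChart_tangent (hγ : ContDiff ℝ (1 + N : ℕ) γ) :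
    fderiv ℝ (aaChart L γ N) 0 (1, 0) = deriv γ 0 := by
  have h1 := ((contDiff_aaChart (n := 1) (L := L) hγ).differentiable one_ne_zero 0).hasFDerivAt
  have h4 : HasDerivAt (fun t : ℝ => (t, (0 : ℝ))) (1, 0) 0 :=
    (hasDerivAt_id 0).prodMk (hasDerivAt_const 0 0)
  have h2 := HasFDerivAt.comp_hasDerivAt (0 : ℝ) (f := fun t : ℝ => (t, (0 : ℝ))) h1 h4
  have h3 : (aaChart L γ N ∘ fun t : ℝ => (t, (0 : ℝ))) = γ := funext fun t => aaChart_axis t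
  rw [h3] at h2
  exact h2.deriv.symm

/-- For N ≠ 0 the extension satisfies the Cauchy–Riemann equation exactly at 0, so the normal
derivative is the tangent multiplied by i in the coordinate L. -/
theorem fderiv_aaChart_normal (hγ : ContDiff ℝ (1 + N : ℕ) γ) (hN : N ≠ 0) :
    fderiv ℝ (aaChart L γ N) 0 (0, 1) = L.symm (Complex.I * L (deriv γ 0)) := by
  have hX := (contDiff_aaChart (n := 1) (L := L) hγ).differentiable one_ne_zero 0
  have hg : ContDiff ℝ (N + 1 : ℕ) fun t => L (γ t) := by
    rw [add_comm]; exact L.contDiff.comp hγ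
  have hZ : almostAnalytic (fun t => L (γ t)) N = fun y => L (aaChart L γ N y) :=
    funext fun y => (apply_aaChart y).symm
  have hf : ∀ v, fderiv ℝ (almostAnalytic (fun t => L (γ t)) N) 0 v =
      L (fderiv ℝ (aaChart L γ N) 0 v) := by
    intro v
    rw [hZ]
    have h5 : HasFDerivAt (fun y => L (aaChart L γ N y)) _ 0 :=
      L.hasFDerivAt.comp 0 hX.hasFDerivAt
    rw [h5.fderiv]
    rfl
  have h0 := dOp_almostAnalytic hg 0
  simp only [Prod.snd_zero, Complex.ofReal_zero, mul_zero, zero_pow hN, zero_div, zero_mul, dOp,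
    partial₁, partial₂, one_mul, hf] at h0
  rw [fderiv_aaChart_tangent hγ] at h0
  refine L.injective ?_
  rw [L.apply_symm_apply]
  linear_combination (-Complex.I) * h0 + L (fderiv ℝ (aaChart L γ N) 0 (0, 1)) * Complex.I_mul_I

end Chart

/-- The image of the normal vector obtained by rotating a vector with respect to a complex
coordinate. -/
theorem apply_rotate {p q : ℂ} (h : (q * (starRingEnd ℂ) p).im ≠ 0) (l : (ℝ × ℝ) →L[ℝ] ℝ)
    {v : ℝ × ℝ} (hv : l v = 0) :
    (q * (starRingEnd ℂ) p).im * l ((dEquiv h).symm (Complex.I * dEquiv h v)) *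
      (v.1 ^ 2 + v.2 ^ 2) = (v.1 * l (0, 1) - v.2 * l (1, 0)) * Complex.normSq (dEquiv h v) := by
  have hl : ∀ w : ℝ × ℝ, l w = w.1 * l (1, 0) + w.2 * l (0, 1) := by
    intro w
    conv_lhs => rw [show w = w.1 • ((1 : ℝ), (0 : ℝ)) + w.2 • ((0 : ℝ), (1 : ℝ)) by simp, map_add,
      map_smul, map_smul]
    simp
  rw [hl] at hv
  set x := (dEquiv h).symm (Complex.I * dEquiv h v) with hx
  have hxe : dEquiv h x = Complex.I * dEquiv h v := (dEquiv h).apply_symm_apply _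
  rw [dEquiv_apply, dEquiv_apply, dLin, dLin] at hxe
  rw [hl x, dEquiv_apply, dLin]
  set A := l (1, 0)
  set B := l (0, 1)
  have e1 := congrArg Complex.re hxe
  have e2 := congrArg Complex.im hxe
  simp only [Complex.sub_re, Complex.sub_im, Complex.mul_re, Complex.mul_im, Complex.I_re,
    Complex.I_im, Complex.ofReal_re, Complex.ofReal_im, mul_zero, sub_zero, zero_mul,
    one_mul, zero_sub, zero_add] at e1 e2
  simp only [Complex.normSq_apply, Complex.sub_re, Complex.sub_im, Complex.mul_re, Complex.mul_im,
    Complex.ofReal_re, Complex.ofReal_im, Complex.conj_re, Complex.conj_im, mul_zero, sub_zero,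
    zero_add]
  have d1 : (q.im * p.re - q.re * p.im) * x.1 = (q.re * p.re + q.im * p.im) * v.1 -
      (p.re ^ 2 + p.im ^ 2) * v.2 := by
    linear_combination p.re * e2 - p.im * e1
  have d2 : (q.im * p.re - q.re * p.im) * x.2 = (q.re ^ 2 + q.im ^ 2) * v.1 -
      (q.re * p.re + q.im * p.im) * v.2 := by
    linear_combination q.re * e2 - q.im * e1
  linear_combination (A * (v.1 ^ 2 + v.2 ^ 2)) * d1 + (B * (v.1 ^ 2 + v.2 ^ 2)) * d2 +
    ((v.1 * ((q.re * p.re + q.im * p.im) * v.1 - (p.re ^ 2 + p.im ^ 2) * v.2)) +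
     v.2 * ((q.re ^ 2 + q.im ^ 2) * v.1 - (q.re * p.re + q.im * p.im) * v.2)) * hv

/-- The side to which multiplication by i turns a tangent vector depends on the sign of Im(q p̄).
This sign is opposite for the two coordinates of the equation, so they turn it to opposite sides;
this is what makes gluing possible. -/
theorem apply_rotate_pos {p q : ℂ} (h : (q * (starRingEnd ℂ) p).im ≠ 0) (l : (ℝ × ℝ) →L[ℝ] ℝ)
    {v : ℝ × ℝ} (hv : l v = 0) (hv0 : v ≠ 0) :
    0 < l ((dEquiv h).symm (Complex.I * dEquiv h v)) *
      ((v.1 * l (0, 1) - v.2 * l (1, 0)) * (q * (starRingEnd ℂ) p).im) ↔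
      v.1 * l (0, 1) - v.2 * l (1, 0) ≠ 0 := by
  have key := apply_rotate h l hv
  set d := (q * (starRingEnd ℂ) p).im
  set c := v.1 * l (0, 1) - v.2 * l (1, 0)
  set y := l ((dEquiv h).symm (Complex.I * dEquiv h v))
  have hv2 : 0 < v.1 ^ 2 + v.2 ^ 2 := by
    rcases eq_or_ne v.1 0 with h1 | h1
    · rcases eq_or_ne v.2 0 with h2 | h2
      · exact absurd (Prod.ext h1 h2) hv0
      · positivity
    · positivity
  have hpos : 0 < Complex.normSq (dEquiv h v) := by
    rw [Complex.normSq_pos]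
    exact fun hz => hv0 ((dEquiv h).map_eq_zero_iff.1 hz)
  constructor
  · intro h1 h2
    rw [h2] at h1; simp at h1
  · intro hc
    have h1 : y * (c * d) * (v.1 ^ 2 + v.2 ^ 2) = c ^ 2 * Complex.normSq (dEquiv h v) := by
      linear_combination c * key
    have h2 : 0 < c ^ 2 * Complex.normSq (dEquiv h v) := by positivity
    rw [← h1] at h2
    exact (pos_iff_pos_of_mul_pos h2).2 hv2

theorem reflect_hasFDerivAt (y : ℝ × ℝ) :
    HasFDerivAt (fun y : ℝ × ℝ => (y.1, -y.2))
      ((ContinuousLinearMap.fst ℝ ℝ ℝ).prod (-ContinuousLinearMap.snd ℝ ℝ ℝ)) y :=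
  hasFDerivAt_fst.prodMk hasFDerivAt_snd.neg

/-- Almost analytic charts for the two complex coordinates of the equation, based on the same
boundary curve, which lies between the images of the domain under them. -/
theorem IsSmoothSolution.exists_charts {Ω : Set (ℝ × ℝ)} {om b : ℂ}
    {f u : ℝ × ℝ → ℂ} (h : IsSmoothSolution Ω om b f u) {φ : ℝ × ℝ → ℝ} {p : ℝ × ℝ}
    (hd : IsDefiningFunction Ω φ p) (n N : ℕ) (hN : N ≠ 0) :
    ∃ γ : ℝ → ℝ × ℝ, ContDiff ℝ (n + 1 + N : ℕ) γ ∧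
      IsBoundaryChart φ p n (aaChart h.coord γ N) ∧
      IsBoundaryChart φ p n (fun y => aaChart h.neg.coord γ N (y.1, -y.2)) := by
  obtain ⟨γ₀, hγ₀, h0, hne, hax⟩ := exists_boundary_curve hd.contDiff hd.apply_eq_zero
    hd.fderiv_ne_zero (n + N)
  have htan : fderiv ℝ φ p (deriv γ₀ 0) = 0 := by
    have h1 : HasDerivAt (fun t => φ (γ₀ t)) (fderiv ℝ φ p (deriv γ₀ 0)) 0 := by
      have h2 := (hd.contDiff.differentiable (by simp) (γ₀ 0)).hasFDerivAt.comp_hasDerivAt (0 : ℝ)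
        (hγ₀.differentiable (by simp) 0).hasDerivAt
      rw [h0] at h2; exact h2
    exact (h1.congr_of_eventuallyEq (hax.mono fun t ht => ht.symm)).unique (hasDerivAt_const _ _)
  set d := (b * (starRingEnd ℂ) (-om)).im with hdd
  have hd' : (b * (starRingEnd ℂ) (- -om)).im = -d := by simp [hdd]
  have hd0 : d ≠ 0 := h.elliptic_neg
  set cr : ℝ × ℝ → ℝ := fun v => v.1 * fderiv ℝ φ p (0, 1) - v.2 * fderiv ℝ φ p (1, 0) with hcr
  have hcrne : cr (deriv γ₀ 0) ≠ 0 := by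
    intro hz
    set v := deriv γ₀ 0
    have hl : ∀ w : ℝ × ℝ, fderiv ℝ φ p w =
        w.1 * fderiv ℝ φ p (1, 0) + w.2 * fderiv ℝ φ p (0, 1) := by
      intro w
      conv_lhs => rw [show w = w.1 • ((1 : ℝ), (0 : ℝ)) + w.2 • ((0 : ℝ), (1 : ℝ)) by simp,
        map_add, map_smul, map_smul]
      simp
    rw [hl] at htan
    simp only [hcr] at hz
    have hv : v.1 ^ 2 + v.2 ^ 2 ≠ 0 := by
      intro hv
      have h1 : v.1 = 0 := by nlinarith [sq_nonneg v.1, sq_nonneg v.2]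
      have h2 : v.2 = 0 := by nlinarith [sq_nonneg v.1, sq_nonneg v.2]
      exact hne (Prod.ext h1 h2)
    have hA : fderiv ℝ φ p (1, 0) = 0 := by
      refine (mul_eq_zero.1 ?_).resolve_left hv
      linear_combination v.1 * htan - v.2 * hz
    have hB : fderiv ℝ φ p (0, 1) = 0 := by
      refine (mul_eq_zero.1 ?_).resolve_left hv
      linear_combination v.2 * htan + v.1 * hz
    exact hd.fderiv_ne_zero (by ext <;> simp [hA, hB])
  -- The curve is reversed if necessary, so that the rotated tangent points into Ω for the first
  -- coordinate; for the second one it then points outwards, and reflection in the axis corrects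
  -- this.
  obtain ⟨γ, hγ, hγ0, hγne, hγax, hγtan, hγcr⟩ : ∃ γ : ℝ → ℝ × ℝ, ContDiff ℝ (n + N + 1 : ℕ) γ ∧
      γ 0 = p ∧ deriv γ 0 ≠ 0 ∧ (∀ᶠ t in 𝓝 0, φ (γ t) = 0) ∧
      fderiv ℝ φ p (deriv γ 0) = 0 ∧ 0 < cr (deriv γ 0) * d := by
    rcases lt_or_gt_of_ne (mul_ne_zero hcrne hd0) with hlt | hgt
    · have hder : deriv (fun t => γ₀ (-t)) 0 = -deriv γ₀ 0 := by
        rw [deriv_comp_neg, neg_zero]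
      refine ⟨fun t => γ₀ (-t), hγ₀.comp contDiff_neg, by simpa using h0, ?_, ?_, ?_, ?_⟩
      · rw [hder]; exact neg_ne_zero.2 hne
      · have : Tendsto (fun t : ℝ => -t) (𝓝 0) (𝓝 0) := continuous_neg.tendsto' _ _ neg_zero
        exact this.eventually hax
      · rw [hder, map_neg, htan, neg_zero]
      · rw [hder]
        have : cr (-deriv γ₀ 0) = -cr (deriv γ₀ 0) := by simp [hcr]; ring
        rw [this]; linarith
    · exact ⟨γ₀, hγ₀, h0, hne, hax, htan, hgt⟩
  have hγ' : ContDiff ℝ (n + 1 + N : ℕ) γ := by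
    rw [show n + 1 + N = n + N + 1 by ring]; exact hγ
  have hγ1 : ContDiff ℝ (1 + N : ℕ) γ := hγ'.of_le (by norm_cast; omega)
  have hrefl : ∀ v : ℝ × ℝ, fderiv ℝ (fun y : ℝ × ℝ => aaChart h.neg.coord γ N (y.1, -y.2)) 0 v =
      fderiv ℝ (aaChart h.neg.coord γ N) 0 (v.1, -v.2) := by
    intro v
    have h1 : HasFDerivAt (aaChart h.neg.coord γ N) (fderiv ℝ (aaChart h.neg.coord γ N) 0)
        ((fun y : ℝ × ℝ => (y.1, -y.2)) 0) := by
      have : (fun y : ℝ × ℝ => (y.1, -y.2)) 0 = 0 := by simp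
      rw [this]
      exact ((contDiff_aaChart (n := 1) hγ1).differentiable one_ne_zero 0).hasFDerivAt
    have h2 := HasFDerivAt.comp (0 : ℝ × ℝ) h1 (reflect_hasFDerivAt 0)
    change fderiv ℝ (aaChart h.neg.coord γ N ∘ fun y : ℝ × ℝ => (y.1, -y.2)) 0 v = _
    rw [h2.fderiv]
    rfl
  refine ⟨γ, hγ', ⟨contDiff_aaChart hγ', ?_, ?_, ?_, ?_⟩, ⟨?_, ?_, ?_, ?_, ?_⟩⟩
  · rw [show (0 : ℝ × ℝ) = (0, 0) from rfl, aaChart_axis, hγ0]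
  · simpa only [aaChart_axis] using hγax
  · rw [fderiv_aaChart_tangent hγ1]; exact hγne
  · rw [fderiv_aaChart_normal hγ1 hN]
    have := (apply_rotate_pos h.elliptic_neg (fderiv ℝ φ p) hγtan hγne).2
      (left_ne_zero_of_mul hγcr.ne')
    exact (pos_iff_pos_of_mul_pos this).2 hγcr
  · exact (contDiff_aaChart hγ').comp (by fun_prop)
  · simp only [Prod.fst_zero, Prod.snd_zero, neg_zero, aaChart_axis, hγ0]
  · simpa only [neg_zero, aaChart_axis] using hγax
  · rw [hrefl]
    simp only [neg_zero]
    rw [fderiv_aaChart_tangent hγ1]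
    exact hγne
  · rw [hrefl, show ((0 : ℝ), -(1 : ℝ)) = -((0 : ℝ), (1 : ℝ)) by simp, map_neg, map_neg,
      fderiv_aaChart_normal hγ1 hN]
    have := (apply_rotate_pos h.neg.elliptic_neg (fderiv ℝ φ p) hγtan hγne).2
      (left_ne_zero_of_mul hγcr.ne')
    rw [hd', mul_neg, mul_neg, ← neg_mul] at this
    exact (pos_iff_pos_of_mul_pos this).2 hγcr

/-! ### Primitives, gluing across the boundary and boundary regularity -/

/-- `F` is a primitive of the holomorphic factor `h.hol` of the gradient near the boundary point
`p`. -/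
def IsSmoothSolution.IsPrimitiveAt {Ω : Set (ℝ × ℝ)} {om b : ℂ} {f u : ℝ × ℝ → ℂ}
    (h : IsSmoothSolution Ω om b f u) (F : ℝ × ℝ → ℂ) (x : ℝ × ℝ) : Prop :=
  HasFDerivAt F (h.hol (h.coord x) • (h.coord : (ℝ × ℝ) →L[ℝ] ℂ)) x

namespace IsSmoothSolution

variable {Ω : Set (ℝ × ℝ)} {om b : ℂ} {f u : ℝ × ℝ → ℂ}

theorem IsPrimitiveAt.sub {h : IsSmoothSolution Ω om b f u} {F : ℝ × ℝ → ℂ} {x : ℝ × ℝ}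
    (hF : h.IsPrimitiveAt F x) (hx : x ∈ Ω) : h.neg.IsPrimitiveAt (fun y => u y - F y) x := by
  refine ((h.differentiableAt hx).hasFDerivAt.sub hF).congr_fderiv ?_
  ext <;> simp [h.fderiv_eq]

theorem IsPrimitiveAt.comp_aaChart {h : IsSmoothSolution Ω om b f u} {F : ℝ × ℝ → ℂ}
    {γ : ℝ → ℝ × ℝ} {N : ℕ} {y : ℝ × ℝ} (hF : h.IsPrimitiveAt F (aaChart h.coord γ N y))
    (hγ : ContDiff ℝ (1 + N : ℕ) γ) :
    HasFDerivAt (fun y => F (aaChart h.coord γ N y))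
      (h.hol (almostAnalytic (fun t => h.coord (γ t)) N y) •
        fderiv ℝ (almostAnalytic (fun t => h.coord (γ t)) N) y) y := by
  have hX := ((contDiff_aaChart (n := 1) (L := h.coord) hγ).differentiable one_ne_zero
    y).hasFDerivAt
  have hZ : almostAnalytic (fun t => h.coord (γ t)) N = fun y => h.coord (aaChart h.coord γ N y) :=
    funext fun y => (apply_aaChart y).symm
  have h1 : HasFDerivAt (almostAnalytic (fun t => h.coord (γ t)) N)
      ((h.coord : (ℝ × ℝ) →L[ℝ] ℂ).comp (fderiv ℝ (aaChart h.coord γ N) y)) y := by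
    rw [hZ]; exact h.coord.hasFDerivAt.comp y hX
  have h2 := HasFDerivAt.comp y hF hX
  rw [h1.fderiv, ← apply_aaChart]
  exact h2

/-- The two primitives differ by little near the boundary. -/
theorem exists_jump_bound (h : IsSmoothSolution Ω om b f u) {φ : ℝ × ℝ → ℝ} {p : ℝ × ℝ}
    (hd : IsDefiningFunction Ω φ p) {n : ℕ} {X Y : ℝ × ℝ → ℝ × ℝ}
    (hX : IsBoundaryChart φ p n X) (hY : IsBoundaryChart φ p n Y)
    (hXY : ∀ t, X (t, 0) = Y (t, 0)) {G : ℝ × ℝ → ℂ}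
    (hG : ∀ᶠ x in 𝓝 p, x ∈ Ω → h.IsPrimitiveAt G x) :
    ∃ a > 0, ∀ ε > 0, ∃ δ > 0, ∀ y ∈ Metric.ball (0 : ℝ × ℝ) a, 0 < y.2 → y.2 < δ →
      ‖u (X y)‖ ≤ ε ∧ ‖G (Y y) - G (X y)‖ ≤ ε := by
  obtain ⟨r₁, hr₁, hdec⟩ := h.decay_near hd
  obtain ⟨r₂, hr₂, hmem⟩ := Metric.mem_nhds_iff.1 (inter_mem hd.mem_iff hG)
  obtain ⟨c, hc, C, hC, hseg⟩ := IsBoundaryChart.exists_segment_bounds hd hX hY hXY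
    (r := min r₁ r₂) (by positivity)
  obtain ⟨K₁, hK₁, hl₁⟩ := hX.exists_norm_sub_le
  obtain ⟨K₂, hK₂, hl₂⟩ := hY.exists_norm_sub_le
  obtain ⟨K, hK, hhol⟩ := h.norm_hol_le
  set B := ‖(h.coord : (ℝ × ℝ) →L[ℝ] ℂ)‖ with hB
  obtain ⟨a, ha, hball⟩ := Metric.mem_nhds_iff.1 (inter_mem hseg (inter_mem hl₁ hl₂))
  refine ⟨a, ha, fun ε hε => ?_⟩
  -- On the segment the gradient of G is small compared with 1/y.2, and the segment has length
  -- O(y.2); T collects the constants of this product.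
  set T := K * B * (K₁ + K₂) / c with hT
  have hT0 : 0 ≤ T := by positivity
  obtain ⟨δ, hδ, hb⟩ := hdec (ε / (1 + T)) (by positivity)
  refine ⟨δ / C, by positivity, fun y hy hpos hlt => ?_⟩
  obtain ⟨e1, e2, e3⟩ := hball hy
  have e1 := e1 hpos
  have e2 : ‖X y - X (y.1, 0)‖ ≤ K₁ * |y.2| := e2
  have e3 : ‖Y y - Y (y.1, 0)‖ ≤ K₂ * |y.2| := e3
  rw [abs_of_pos hpos] at e2 e3
  rw [← hXY] at e3
  have hz : ∀ z ∈ segment ℝ (X y) (Y y), 0 < φ z ∧ φ z < δ ∧ z ∈ Metric.ball p r₁ ∧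
      z ∈ Metric.ball p r₂ := by
    intro z hz
    obtain ⟨z1, z2, z3⟩ := e1 z hz
    refine ⟨lt_of_lt_of_le (by positivity) z2, lt_of_le_of_lt z3 ?_,
      Metric.ball_subset_ball (min_le_left _ _) z1, Metric.ball_subset_ball (min_le_right _ _) z1⟩
    rw [lt_div_iff₀ hC] at hlt; linarith
  constructor
  · obtain ⟨z1, z2, z3, -⟩ := hz (X y) (left_mem_segment ℝ _ _)
    refine (hb _ z3 z1 z2).2.2.trans (div_le_self hε.le (by linarith))
  · have hder : ∀ z ∈ segment ℝ (X y) (Y y), HasFDerivWithinAt G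
        (h.hol (h.coord z) • (h.coord : (ℝ × ℝ) →L[ℝ] ℂ)) (segment ℝ (X y) (Y y)) z := by
      intro z hzs
      obtain ⟨z1, z2, z3, z4⟩ := hz z hzs
      exact ((hmem z4).2 ((hmem z4).1.2 z1)).hasFDerivWithinAt
    have hbd : ∀ z ∈ segment ℝ (X y) (Y y),
        ‖h.hol (h.coord z) • (h.coord : (ℝ × ℝ) →L[ℝ] ℂ)‖ ≤ K * (ε / (1 + T) / (c * y.2)) * B := by
      intro z hzs
      obtain ⟨z1, z2, z3, z4⟩ := hz z hzs
      obtain ⟨g1, g2, -⟩ := hb z z3 z1 z2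
      have hle : ε / (1 + T) / φ z ≤ ε / (1 + T) / (c * y.2) :=
        div_le_div_of_nonneg_left (by positivity) (by positivity) (e1 z hzs).2.1
      rw [norm_smul]
      gcongr
      exact hhol z _ (g1.trans hle) (g2.trans hle)
    have := (convex_segment (𝕜 := ℝ) (X y) (Y y)).norm_image_sub_le_of_norm_hasFDerivWithin_le
      hder hbd (left_mem_segment ℝ _ _) (right_mem_segment ℝ _ _)
    refine this.trans ?_
    have hXYn : ‖Y y - X y‖ ≤ (K₁ + K₂) * y.2 := by
      have : Y y - X y = (Y y - X (y.1, 0)) - (X y - X (y.1, 0)) := by abel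
      rw [this]
      refine (norm_sub_le _ _).trans ?_
      linarith
    calc K * (ε / (1 + T) / (c * y.2)) * B * ‖Y y - X y‖
        ≤ K * (ε / (1 + T) / (c * y.2)) * B * ((K₁ + K₂) * y.2) := by gcongr
      _ = ε * (T / (1 + T)) := by rw [hT]; field_simp
      _ ≤ ε := by
        refine mul_le_of_le_one_right hε.le ?_
        rw [div_le_one (by positivity)]; linarith

/-- Gradient bound in an almost analytic chart. -/
theorem exists_chart_bound (h : IsSmoothSolution Ω om b f u) {φ : ℝ × ℝ → ℝ} {p : ℝ × ℝ}
    (hd : IsDefiningFunction Ω φ p) {n : ℕ} {X : ℝ × ℝ → ℝ × ℝ} (hX : IsBoundaryChart φ p n X) :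
    ∃ r > 0, (∀ y ∈ Metric.ball p r, f y = 0) ∧ ∃ c > 0, ∃ C > 0, (∀ z ∈ h.locImage p r,
      ‖h.hol z‖ * Metric.infDist z (h.locImage p r)ᶜ ^ 1 ≤ C) ∧
      ∀ᶠ y in 𝓝 (0 : ℝ × ℝ), 0 < y.2 → (h.coord (X y) ∈ h.locImage p r ∧
      c * y.2 ≤ Metric.infDist (h.coord (X y)) (h.locImage p r)ᶜ) ∧
      ‖h.hol (h.coord (X y))‖ ≤ C / c / y.2 := by
  obtain ⟨r, hr, hf⟩ := Metric.mem_nhds_iff.1 (h.eventually_eq_zero hd.notMem)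
  obtain ⟨c, hc, hlow⟩ := h.exists_infDist_lower_bound hd hX hr
  obtain ⟨C, hC, hbound⟩ := h.exists_hol_bound
  refine ⟨r, hr, fun y hy => hf hy, c, hc, C, hC, fun z hz => ?_, ?_⟩
  · rw [pow_one]; exact hbound p r (fun y hy => hf hy) z hz
  · filter_upwards [hlow] with y h1 hy
    refine ⟨h1 hy, ?_⟩
    rw [div_div, le_div_iff₀ (by positivity)]
    refine le_trans ?_ (hbound p r (fun y hy => hf hy) _ (h1 hy).1)
    exact mul_le_mul_of_nonneg_left (h1 hy).2 (norm_nonneg _)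

theorem differentiableOn_hol (h : IsSmoothSolution Ω om b f u) {p : ℝ × ℝ} {r : ℝ}
    (hf : ∀ y ∈ Metric.ball p r, f y = 0) : DifferentiableOn ℂ h.hol (h.locImage p r) := by
  intro z hz
  obtain ⟨x, rfl⟩ := h.coord.surjective z
  rw [h.coord_mem_locImage] at hz
  exact (h.differentiableAt_hol hz.1 (hf x hz.2)).differentiableWithinAt

end IsSmoothSolution

theorem dOp_eq_of_hasFDerivAt_smul {p q c : ℂ} {H Z : ℝ × ℝ → ℂ} {y : ℝ × ℝ}
    (h : HasFDerivAt H (c • fderiv ℝ Z y) y) : dOp p q H y = c * dOp p q Z y := by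
  simp only [dOp, partial₁, partial₂, h.fderiv, _root_.smul_apply, smul_eq_mul]
  ring

theorem ball_zero_eq (a : ℝ) : Metric.ball (0 : ℝ × ℝ) a = Ioo (-a) a ×ˢ Ioo (-a) a := by
  ext y
  rw [Metric.mem_ball, dist_zero_right, Prod.norm_def, max_lt_iff, Real.norm_eq_abs,
    Real.norm_eq_abs, abs_lt, abs_lt]
  rfl

theorem contDiffOn_one_of_hasFDerivAt {H : ℝ × ℝ → ℂ} {H' : ℝ × ℝ → (ℝ × ℝ) →L[ℝ] ℂ}
    {O : Set (ℝ × ℝ)} (hO : IsOpen O) (hH : ∀ y ∈ O, HasFDerivAt H (H' y) y)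
    (hc : ContinuousOn H' O) : ContDiffOn ℝ 1 H O := by
  rw [show (1 : WithTop ℕ∞) = 0 + 1 by norm_num, contDiffOn_succ_iff_fderiv_of_isOpen hO]
  exact ⟨fun y hy => (hH y hy).differentiableAt.differentiableWithinAt, by simp,
    contDiffOn_zero.2 (hc.congr fun y hy => (hH y hy).fderiv)⟩

theorem IsBoundaryChart.snd_pos_of_pos {φ : ℝ × ℝ → ℝ} {X : ℝ × ℝ → ℝ × ℝ} {c : ℝ} (hc : 0 < c)
    {y : ℝ × ℝ} (h : c * y.2 ^ 2 ≤ y.2 * φ (X y)) (hax : φ (X (y.1, 0)) = 0)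
    (hpos : 0 < φ (X y)) : 0 < y.2 := by
  rcases lt_trichotomy y.2 0 with h1 | h1 | h1
  · nlinarith [mul_neg_of_neg_of_pos h1 hpos, sq_nonneg y.2]
  · have : y = (y.1, 0) := Prod.ext rfl h1
    rw [this, hax] at hpos
    exact absurd hpos (lt_irrefl _)
  · exact h1

theorem IsBoundaryChart.snd_eq_zero_of_eq_zero {φ : ℝ × ℝ → ℝ} {X : ℝ × ℝ → ℝ × ℝ} {c : ℝ}
    (hc : 0 < c) {y : ℝ × ℝ} (h : c * y.2 ^ 2 ≤ y.2 * φ (X y)) (h0 : φ (X y) = 0) : y.2 = 0 := by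
  rw [h0, mul_zero] at h
  have : y.2 ^ 2 = 0 := le_antisymm (by nlinarith [sq_nonneg y.2]) (sq_nonneg _)
  exact pow_eq_zero_iff two_ne_zero |>.1 this

/-- Regularity up to the boundary in almost analytic charts: the two primitives, glued along the
boundary, form a function which is smooth across it. -/
theorem IsSmoothSolution.exists_glued {Ω : Set (ℝ × ℝ)} {om b : ℂ} {f u : ℝ × ℝ → ℂ}
    (h : IsSmoothSolution Ω om b f u) {φ : ℝ × ℝ → ℝ} {p : ℝ × ℝ}
    (hd : IsDefiningFunction Ω φ p) {F : ℝ × ℝ → ℂ}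
    (hF : ∀ᶠ x in 𝓝 p, x ∈ Ω → h.IsPrimitiveAt F x) {m : ℕ} {γ : ℝ → ℝ × ℝ}
    (hγ : ContDiff ℝ (m + 1 + (m + 2) : ℕ) γ)
    (hX : IsBoundaryChart φ p m (aaChart h.coord γ (m + 2)))
    (hY : IsBoundaryChart φ p m (fun y => aaChart h.neg.coord γ (m + 2) (y.1, -y.2))) :
    ∃ H : ℝ × ℝ → ℂ, ContDiff ℝ m H ∧ ∀ᶠ y in 𝓝 (0 : ℝ × ℝ), 0 < y.2 →
      F (aaChart h.coord γ (m + 2) y) = H y ∧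
      u (aaChart h.neg.coord γ (m + 2) (y.1, -y.2)) -
        F (aaChart h.neg.coord γ (m + 2) (y.1, -y.2)) = - H (y.1, -y.2) := by
  -- The holomorphic factors blow up like the first inverse power of the distance, so
  -- `contDiffOn_flatFun` with k = 1 needs order 1 + m + 1.
  set N := m + 2 with hN
  set X := aaChart h.coord γ N with hXdef
  set Xm := aaChart h.neg.coord γ N with hXm
  set Z := almostAnalytic (fun t => h.coord (γ t)) N with hZ
  set Zm := almostAnalytic (fun t => h.neg.coord (γ t)) N with hZm
  set G : ℝ × ℝ → ℂ := fun x => u x - F x with hG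
  have hγ1 : ContDiff ℝ (1 + N : ℕ) γ := hγ.of_le (by norm_cast; omega)
  have hGp : ∀ᶠ x in 𝓝 p, x ∈ Ω → h.neg.IsPrimitiveAt G x := by
    filter_upwards [hF] with x hx hxΩ using (hx hxΩ).sub hxΩ
  have hXY : ∀ t, X (t, 0) = Xm (t, -0) := fun t => by
    rw [neg_zero, hXdef, hXm, aaChart_axis, aaChart_axis]
  obtain ⟨r₁, hr₁, hf₁, c₁, hc₁, C₁, hC₁, hW₁, hE₁⟩ := h.exists_chart_bound hd hX
  obtain ⟨r₂, hr₂, hf₂, c₂, hc₂, C₂, hC₂, hW₂, hE₂⟩ := h.neg.exists_chart_bound hd hY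
  obtain ⟨a₁, ha₁, hjump⟩ := h.neg.exists_jump_bound hd hX hY hXY hGp
  have hZs : ContDiff ℝ (m + 1 : ℕ) Z := contDiff_almostAnalytic (h.coord.contDiff.comp hγ)
  have hZms : ContDiff ℝ (m + 1 : ℕ) Zm := contDiff_almostAnalytic (h.neg.coord.contDiff.comp hγ)
  have hLX : ∀ y, h.coord (X y) = Z y := fun y => apply_aaChart y
  have hLXm : ∀ y, h.neg.coord (Xm y) = Zm y := fun y => apply_aaChart y
  have hone : ((m + 1 : ℕ) : WithTop ℕ∞) ≠ 0 := by simp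
  have hbZ : ∀ᶠ y in 𝓝 (0 : ℝ × ℝ), ‖fderiv ℝ Z y‖ < ‖fderiv ℝ Z 0‖ + 1 :=
    (hZs.continuous_fderiv hone).norm.continuousAt.eventually (gt_mem_nhds (by linarith))
  have hbZm : ∀ᶠ y in 𝓝 (0 : ℝ × ℝ), ‖fderiv ℝ Zm y‖ < ‖fderiv ℝ Zm 0‖ + 1 :=
    (hZms.continuous_fderiv hone).norm.continuousAt.eventually (gt_mem_nhds (by linarith))
  obtain ⟨a₂, ha₂, hev⟩ := Metric.mem_nhds_iff.1 (inter_mem (inter_mem hE₁ hE₂) (inter_mem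
    (inter_mem hbZ hbZm) (inter_mem (hX.tendsto.eventually hF) (hY.tendsto.eventually hGp))))
  set a := min a₁ a₂ with ha
  have ha0 : 0 < a := by positivity
  set O := Ioo (-a) a ×ˢ Ioo (-a) a with hO
  have hOo : IsOpen O := isOpen_Ioo.prod isOpen_Ioo
  have hOb : O = Metric.ball (0 : ℝ × ℝ) a := (ball_zero_eq a).symm
  have hOev : ∀ y ∈ O, _ := fun y hy =>
    hev (Metric.ball_subset_ball (min_le_right _ _) (hOb ▸ hy))
  have hOrefl : ∀ y ∈ O, (y.1, -y.2) ∈ O := fun y hy =>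
    ⟨hy.1, by constructor <;> simp <;> linarith [hy.2.1, hy.2.2]⟩
  -- the derivative on both sides
  have hup : ∀ y ∈ O, 0 < y.2 → HasFDerivAt (fun y => F (X y)) (h.hol (Z y) • fderiv ℝ Z y) y ∧
      Z y ∈ h.locImage p r₁ ∧
      ‖h.hol (Z y) • fderiv ℝ Z y‖ ≤ C₁ / c₁ * (‖fderiv ℝ Z 0‖ + 1) / |y.2| := by
    intro y hy hpos
    obtain ⟨⟨e1, -⟩, ⟨e3, -⟩, e5, -⟩ := hOev y hy
    obtain ⟨⟨i1, -⟩, i2⟩ := e1 hpos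
    rw [hLX] at i1 i2
    have hmem := i1
    rw [← hLX, h.coord_mem_locImage] at hmem
    refine ⟨(e5 hmem.1).comp_aaChart hγ1, i1, ?_⟩
    rw [norm_smul, abs_of_pos hpos]
    calc ‖h.hol (Z y)‖ * ‖fderiv ℝ Z y‖ ≤ C₁ / c₁ / y.2 * (‖fderiv ℝ Z 0‖ + 1) :=
          mul_le_mul i2 (le_of_lt e3) (norm_nonneg _) (by positivity)
      _ = _ := by ring
  have hdn : ∀ y ∈ O, y.2 < 0 →
      HasFDerivAt (fun y => -G (Xm y)) (-(h.neg.hol (Zm y)) • fderiv ℝ Zm y) y ∧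
      Zm y ∈ h.neg.locImage p r₂ ∧
      ‖-(h.neg.hol (Zm y)) • fderiv ℝ Zm y‖ ≤ C₂ / c₂ * (‖fderiv ℝ Zm 0‖ + 1) / |y.2| := by
    intro y hy hneg
    obtain ⟨⟨-, e1⟩, -, -, e6⟩ := hOev _ (hOrefl y hy)
    obtain ⟨-, ⟨-, e3⟩, -⟩ := hOev y hy
    obtain ⟨⟨i1, -⟩, i2⟩ := e1 (by simpa using hneg)
    simp only [neg_neg, Prod.mk.eta] at i1 i2
    have hmem := i1
    rw [h.neg.coord_mem_locImage] at hmem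
    have e7 : h.neg.IsPrimitiveAt G (Xm y) := by
      have : Xm ((y.1, -y.2).1, -(y.1, -y.2).2) = Xm y := by simp
      have e6 := e6 (by rw [this]; exact hmem.1)
      rwa [this] at e6
    change h.neg.coord (Xm y) ∈ _ at i1
    change ‖h.neg.hol (h.neg.coord (Xm y))‖ ≤ _ at i2
    rw [hLXm] at i1 i2
    refine ⟨(e7.comp_aaChart hγ1).neg.congr_fderiv (neg_smul _ _).symm, i1, ?_⟩
    rw [norm_smul, norm_neg, abs_of_neg hneg]
    calc ‖h.neg.hol (Zm y)‖ * ‖fderiv ℝ Zm y‖ ≤ C₂ / c₂ / -y.2 * (‖fderiv ℝ Zm 0‖ + 1) :=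
          mul_le_mul i2 (le_of_lt e3) (norm_nonneg _)
            (div_nonneg (by positivity) (by linarith))
      _ = _ := by ring
  -- F + G = u tends to zero at the boundary, so F above the axis and −G below it match there.
  set H : ℝ × ℝ → ℂ := fun y => if 0 < y.2 then F (X y) else -G (Xm y) with hH
  set H' : ℝ × ℝ → (ℝ × ℝ) →L[ℝ] ℂ := fun y => if 0 < y.2 then h.hol (Z y) • fderiv ℝ Z y else
    -(h.neg.hol (Zm y)) • fderiv ℝ Zm y with hH'
  have hposN : ∀ y : ℝ × ℝ, 0 < y.2 → ∀ᶠ x : ℝ × ℝ in 𝓝 y, 0 < x.2 := fun y hy =>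
    continuous_snd.continuousAt.eventually (lt_mem_nhds hy)
  have hnegN : ∀ y : ℝ × ℝ, y.2 < 0 → ∀ᶠ x : ℝ × ℝ in 𝓝 y, ¬ 0 < x.2 := fun y hy =>
    (continuous_snd.continuousAt.eventually (gt_mem_nhds hy)).mono fun x hx => not_lt.2 (le_of_lt hx)
  have hder : ∀ y ∈ O ∩ {y | y.2 ≠ 0}, HasFDerivAt H (H' y) y := by
    rintro y ⟨hy, hne⟩
    rcases lt_or_gt_of_ne hne with hneg | hpos
    · have e : H' y = -(h.neg.hol (Zm y)) • fderiv ℝ Zm y := if_neg (not_lt.2 hneg.le)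
      rw [e]
      refine (hdn y hy hneg).1.congr_of_eventuallyEq ?_
      filter_upwards [hnegN y hneg] with x hx using if_neg hx
    · have e : H' y = h.hol (Z y) • fderiv ℝ Z y := if_pos hpos
      rw [e]
      refine (hup y hy hpos).1.congr_of_eventuallyEq ?_
      filter_upwards [hposN y hpos] with x hx using if_pos hx
  have hne : IsOpen {x : ℝ × ℝ | x.2 ≠ 0} := isOpen_ne.preimage continuous_snd
  have hcont : ContinuousOn H' (O ∩ {y | y.2 ≠ 0}) := by
    rintro y ⟨hy, hne⟩
    refine ContinuousAt.continuousWithinAt ?_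
    rcases lt_or_gt_of_ne hne with hneg | hpos
    · have hc : ContinuousAt h.neg.hol (Zm y) := ((h.neg.differentiableOn_hol hf₂).differentiableAt
        ((h.neg.isOpen_locImage p r₂).mem_nhds (hdn y hy hneg).2.1)).continuousAt
      refine ContinuousAt.congr ((hc.comp hZms.continuous.continuousAt).neg.smul
        (hZms.continuous_fderiv hone).continuousAt) ?_
      filter_upwards [hnegN y hneg] with x hx using (if_neg hx).symm
    · have hc : ContinuousAt h.hol (Z y) := ((h.differentiableOn_hol hf₁).differentiableAt
        ((h.isOpen_locImage p r₁).mem_nhds (hup y hy hpos).2.1)).continuousAt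
      refine ContinuousAt.congr ((hc.comp hZs.continuous.continuousAt).smul
        (hZs.continuous_fderiv hone).continuousAt) ?_
      filter_upwards [hposN y hpos] with x hx using (if_pos hx).symm
  have hH1 : ContDiffOn ℝ 1 H (O ∩ {y | y.2 ≠ 0}) :=
    contDiffOn_one_of_hasFDerivAt (hOo.inter hne) hder hcont
  -- the right-hand side
  set R : ℝ × ℝ → ℂ := fun y => Complex.I ^ N / (N.factorial : ℂ) *
    iteratedDeriv (N + 1) (fun t => h.coord (γ t)) y.1 with hR
  -- Flat functions live above the axis, so the lower half is treated after reflection; the sign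
  -- compensates the power of −x₂.
  set Rm : ℝ × ℝ → ℂ := fun y => (-1) ^ N * (Complex.I ^ N / (N.factorial : ℂ) *
    iteratedDeriv (N + 1) (fun t => h.neg.coord (γ t)) y.1) with hRm
  have hγN : ContDiff ℝ (m + (N + 1) : ℕ) γ := by
    rw [show m + (N + 1) = m + 1 + N by ring]; exact hγ
  have hRs : ContDiff ℝ m R := contDiff_const.mul (contDiff_iteratedDeriv_fst
    (h.coord.contDiff.comp hγN))
  have hRms : ContDiff ℝ m Rm := contDiff_const.mul (contDiff_const.mul
    (contDiff_iteratedDeriv_fst (h.neg.coord.contDiff.comp hγN)))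
  have hrefl : ContDiff ℝ m fun y : ℝ × ℝ => (y.1, -y.2) := by fun_prop
  have hmm : ((m : ℕ) : WithTop ℕ∞) ≤ ((m + 1 : ℕ) : WithTop ℕ∞) := by
    exact_mod_cast Nat.le_succ m
  have hfl₁ : ContDiffOn ℝ m (flatFun Z N h.hol R) O := by
    refine contDiffOn_flatFun (h.isOpen_locImage p r₁) hOo hc₁ (fun y hy hpos => ?_) m
      (hZs.of_le hmm) (h.differentiableOn_hol hf₁) hW₁ hRs (by omega)
    rw [← hLX]
    exact ((hOev y hy).1.1 hpos).1
  have hfl₂ : ContDiffOn ℝ m (flatFun (fun y => Zm (y.1, -y.2)) N h.neg.hol Rm) O := by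
    refine contDiffOn_flatFun (h.neg.isOpen_locImage p r₂) hOo hc₂ (fun y hy hpos => ?_) m
      ((hZms.of_le hmm).comp hrefl) (h.neg.differentiableOn_hol hf₂) hW₂ hRms (by omega)
    change Zm (y.1, -y.2) ∈ _ ∧ c₂ * y.2 ≤ Metric.infDist (Zm (y.1, -y.2)) _
    rw [← hLXm]
    exact ((hOev y hy).1.2 hpos).1
  set k : ℝ × ℝ → ℂ := fun y => flatFun Z N h.hol R y -
    flatFun (fun y => Zm (y.1, -y.2)) N h.neg.hol Rm (y.1, -y.2) with hk
  have hks : ContDiffOn ℝ m k O := by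
    refine hfl₁.sub ?_
    exact hfl₂.comp (g := flatFun (fun y => Zm (y.1, -y.2)) N h.neg.hol Rm)
      (f := fun y : ℝ × ℝ => (y.1, -y.2)) hrefl.contDiffOn hOrefl
  have heq : ∀ y ∈ O, y.2 ≠ 0 → dOp 1 Complex.I H y = k y := by
    intro y hy hne
    have hγN1 : ContDiff ℝ (N + 1 : ℕ) γ := hγ.of_le (by norm_cast; omega)
    have hsplit := hder y ⟨hy, hne⟩
    rcases lt_or_gt_of_ne hne with hneg | hpos
    · have e : H' y = -(h.neg.hol (Zm y)) • fderiv ℝ Zm y := if_neg (not_lt.2 hneg.le)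
      rw [e] at hsplit
      rw [dOp_eq_of_hasFDerivAt_smul hsplit, hZm,
        dOp_almostAnalytic (g := fun t => h.neg.coord (γ t)) (h.neg.coord.contDiff.comp hγN1)]
      simp only [hk, flatFun, not_lt.2 hneg.le, if_false, Left.neg_pos_iff, hneg, if_true, neg_neg,
        Prod.mk.eta, hRm, zero_sub, mul_pow, Complex.ofReal_neg]
      rw [neg_pow (y.2 : ℂ)]
      have hs : ((-1 : ℂ) ^ N) * (-1) ^ N = 1 := by rw [← mul_pow]; norm_num
      linear_combination (h.neg.hol (almostAnalytic (fun t => h.neg.coord (γ t)) N y) *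
        (Complex.I ^ N * y.2 ^ N / (N.factorial : ℂ) *
        iteratedDeriv (N + 1) (fun t => h.neg.coord (γ t)) y.1)) * hs
    · have e : H' y = h.hol (Z y) • fderiv ℝ Z y := if_pos hpos
      rw [e] at hsplit
      rw [dOp_eq_of_hasFDerivAt_smul hsplit, hZ,
        dOp_almostAnalytic (g := fun t => h.coord (γ t)) (h.coord.contDiff.comp hγN1)]
      simp only [hk, flatFun, hpos, if_true, Left.neg_pos_iff, not_lt.2 hpos.le, if_false, hR,
        sub_zero, mul_pow]
      ring
  -- growth, integrability and jump
  set C := max (C₁ / c₁ * (‖fderiv ℝ Z 0‖ + 1)) (C₂ / c₂ * (‖fderiv ℝ Zm 0‖ + 1)) with hCdef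
  obtain ⟨M, hM⟩ := exists_log_bound (C := C) ha0 ha0 (H := H) (fun y hy hne => by
    have hs := hder y ⟨hy, hne⟩
    refine ⟨hs.differentiableAt, ?_⟩
    rw [hs.fderiv]
    rcases lt_or_gt_of_ne hne with hneg | hpos
    · have e : H' y = -(h.neg.hol (Zm y)) • fderiv ℝ Zm y := if_neg (not_lt.2 hneg.le)
      rw [e]
      exact (hdn y hy hneg).2.2.trans (div_le_div_of_nonneg_right (le_max_right _ _)
        (abs_nonneg _))
    · have e : H' y = h.hol (Z y) • fderiv ℝ Z y := if_pos hpos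
      rw [e]
      exact (hup y hy hpos).2.2.trans (div_le_div_of_nonneg_right (le_max_left _ _)
        (abs_nonneg _)))
  have hint : LocallyIntegrableOn H O :=
    (integrableOn_of_log_bound ha0 hH1.continuousOn hM).locallyIntegrableOn
  have hj : ∀ ε > 0, ∃ δ > 0, ∀ t ∈ Ioo (-a) a, ∀ s ∈ Ioo 0 δ,
      ‖H (t, s) - H (t, -s)‖ ≤ ε ∧ s * ‖H (t, s)‖ ≤ ε := by
    intro ε hε
    obtain ⟨δ₁, hδ₁, h₁⟩ := hjump (ε / 2) (by positivity)
    obtain ⟨δ₂, hδ₂, h₂⟩ := exists_mul_log_le (C := C) (M := M) hε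
    refine ⟨min (min δ₁ δ₂) a, by positivity, fun t ht s hs => ?_⟩
    have hsa : s < a := hs.2.trans_le (min_le_right _ _)
    have hyO : ((t, s) : ℝ × ℝ) ∈ O := ⟨ht, by linarith [hs.1], hsa⟩
    have e1 : H (t, s) = F (X (t, s)) := if_pos hs.1
    have e2 : H (t, -s) = -G (Xm (t, -s)) := if_neg (by simpa using hs.1.le)
    constructor
    · obtain ⟨j1, j2⟩ := h₁ (t, s) (Metric.ball_subset_ball (min_le_left _ _) (hOb ▸ hyO)) hs.1
        (hs.2.trans_le ((min_le_left _ _).trans (min_le_left _ _)))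
      -- The mirror points correspond to two different points of Ω, one for each chart: the jump is
      -- u at one of them plus the variation of G between them.
      have e3 : H (t, s) - H (t, -s) = u (X (t, s)) + (G (Xm (t, -s)) - G (X (t, s))) := by
        rw [e1, e2]; simp only [hG]; ring
      rw [e3]
      refine (norm_add_le _ _).trans ?_
      have j2 : ‖G (Xm (t, -s)) - G (X (t, s))‖ ≤ ε / 2 := j2
      linarith
    · have hb := hM (t, s) hyO hs.1.ne'
      exact (mul_le_mul_of_nonneg_left hb hs.1.le).trans
        (h₂ s ⟨hs.1, hs.2.trans_le ((min_le_left _ _).trans (min_le_right _ _))⟩)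
  have hell : (Complex.I * (starRingEnd ℂ) (1 : ℂ)).im ≠ 0 := by simp
  have h0O : (0 : ℝ × ℝ) ∈ O := by rw [hOb]; exact Metric.mem_ball_self ha0
  obtain ⟨H₀, hH₀, r, hr, hrO, hae⟩ := exists_contDiff_of_weak hell (m := (m : ℕ∞)) hOo hint hks
    (fun ψ hψ => weak_of_glue hH1 heq hks.continuousOn hint hj ψ hψ) h0O
  -- Nothing is claimed on the axis, where H is not yet known to be continuous.
  have heqon : EqOn H H₀ (Metric.ball 0 r ∩ {y | y.2 ≠ 0}) := by
    refine Measure.eqOn_open_of_ae_eq (μ := volume) ?_ (Metric.isOpen_ball.inter hne)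
      (hH1.continuousOn.mono (inter_subset_inter_left _ hrO)) hH₀.continuous.continuousOn
    rw [EventuallyEq, ae_restrict_iff' (Metric.isOpen_ball.inter hne).measurableSet]
    filter_upwards [hae] with y hy hyb using hy hyb.1
  refine ⟨H₀, hH₀, ?_⟩
  filter_upwards [Metric.ball_mem_nhds (0 : ℝ × ℝ) hr] with y hy hpos
  constructor
  · rw [← heqon ⟨hy, hpos.ne'⟩]
    exact (if_pos hpos).symm
  · have hy' : ((y.1, -y.2) : ℝ × ℝ) ∈ Metric.ball (0 : ℝ × ℝ) r := by
      rw [ball_zero_eq] at hy ⊢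
      exact ⟨hy.1, by constructor <;> simp <;> linarith [hy.2.1, hy.2.2]⟩
    rw [← heqon ⟨hy', by simpa using hpos.ne'⟩]
    have e2 : H (y.1, -y.2) = -G (Xm (y.1, -y.2)) := if_neg (by simpa using hpos.le)
    rw [e2, neg_neg]

/-- Near a smooth boundary point, a primitive of the holomorphic factor of the gradient extends
smoothly up to the boundary. -/
theorem IsSmoothSolution.exists_extension {Ω : Set (ℝ × ℝ)} {om b : ℂ} {f u : ℝ × ℝ → ℂ}
    (h : IsSmoothSolution Ω om b f u) {φ : ℝ × ℝ → ℝ} {p : ℝ × ℝ}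
    (hd : IsDefiningFunction Ω φ p) {F : ℝ × ℝ → ℂ}
    (hF : ∀ᶠ x in 𝓝 p, x ∈ Ω → h.IsPrimitiveAt F x) (m : ℕ) :
    ∃ F' G' : ℝ × ℝ → ℂ, ContDiffAt ℝ m F' p ∧ ContDiffAt ℝ m G' p ∧
      ∀ᶠ x in 𝓝 p, (x ∈ Ω → F x = F' x ∧ u x - F x = G' x) ∧ (φ x = 0 → F' x + G' x = 0) := by
  obtain ⟨γ, hγ, hX, hY⟩ := h.exists_charts hd m (m + 2) (by omega)
  obtain ⟨H, hH, hev⟩ := h.exists_glued hd hF hγ hX hY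
  obtain ⟨Xi, hXi, hXi0, hXr, hXl⟩ := hX.exists_inverse hd.contDiff
  obtain ⟨Yi, hYi, hYi0, hYr, hYl⟩ := hY.exists_inverse hd.contDiff
  obtain ⟨c₁, hc₁, hs₁⟩ := hX.exists_sign hd.contDiff
  obtain ⟨c₂, hc₂, hs₂⟩ := hY.exists_sign hd.contDiff
  set X := aaChart h.coord γ (m + 2) with hXdef
  set Xm := aaChart h.neg.coord γ (m + 2) with hXmdef
  have hmm : ((m : ℕ) : WithTop ℕ∞) ≤ ((m + 1 : ℕ) : WithTop ℕ∞) := by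
    exact_mod_cast Nat.le_succ m
  have hXit : Tendsto Xi (𝓝 p) (𝓝 0) := hXi0 ▸ hXi.continuousAt.tendsto
  have hYit : Tendsto Yi (𝓝 p) (𝓝 0) := hYi0 ▸ hYi.continuousAt.tendsto
  have hax : ∀ᶠ y : ℝ × ℝ in 𝓝 0, φ (γ y.1) = 0 := by
    have h1 : Tendsto (fun y : ℝ × ℝ => y.1) (𝓝 0) (𝓝 0) := continuous_fst.tendsto' _ _ rfl
    have h2 := h1.eventually hX.map_axis
    simpa only [hXdef, aaChart_axis] using h2
  refine ⟨fun x => H (Xi x), fun x => -H ((Yi x).1, -(Yi x).2),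
    hH.contDiffAt.comp p (hXi.of_le hmm), ?_, ?_⟩
  · have hY' := hYi.of_le hmm
    exact (hH.contDiffAt.comp p (hY'.fst.prodMk hY'.snd.neg)).neg
  · filter_upwards [hXr, hYr, hXit.eventually hs₁, hYit.eventually hs₂, hXit.eventually hev,
      hYit.eventually hev, hXit.eventually hax, hYit.eventually hax, hd.mem_iff,
      hYit.eventually hXl] with x x1 x2 x3 x4 x5 x6 x7 x8 x9 x10
    refine ⟨fun hx => ?_, fun hx => ?_⟩
    · have hφx := x9.1 hx
      rw [x1] at x3
      have p1 : 0 < (Xi x).2 := by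
        refine IsBoundaryChart.snd_pos_of_pos (φ := φ) (X := X) hc₁ (by rw [x1]; exact x3) ?_
          (by rw [x1]; exact hφx)
        rw [hXdef, aaChart_axis]; exact x7
      have p2 : 0 < (Yi x).2 := by
        refine IsBoundaryChart.snd_pos_of_pos (φ := φ) (X := fun y => Xm (y.1, -y.2)) hc₂ x4 ?_
          (by rw [x2]; exact hφx)
        simp only [neg_zero]
        rw [hXmdef, aaChart_axis]; exact x8
      obtain ⟨q1, -⟩ := x5 p1
      obtain ⟨-, q2⟩ := x6 p2
      rw [x1] at q1
      rw [x2] at q2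
      exact ⟨q1, q2⟩
    -- Both charts restrict to γ on the axis, so a boundary point has the same preimage under both,
    -- and there the two extensions are H and −H at one point.
    · have p1 : (Yi x).2 = 0 := IsBoundaryChart.snd_eq_zero_of_eq_zero (φ := φ)
        (X := fun y => Xm (y.1, -y.2)) hc₂ x4 (by rw [x2]; exact hx)
      have hyi : Yi x = ((Yi x).1, 0) := Prod.ext rfl p1
      have p2 : X (Yi x) = x := by
        conv_rhs => rw [← x2]
        rw [hyi]
        simp only [neg_zero]
        rw [hXdef, hXmdef, aaChart_axis, aaChart_axis]
      have p3 : Xi x = Yi x := by rw [p2] at x10; exact x10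
      rw [p3, p1, neg_zero, ← hyi]
      ring

theorem IsDefiningFunction.eventually_closure {Ω : Set (ℝ × ℝ)} {φ : ℝ × ℝ → ℝ} {p : ℝ × ℝ}
    (hd : IsDefiningFunction Ω φ p) :
    ∀ᶠ y in 𝓝 p, y ∈ closure Ω → y ∉ Ω → φ y = 0 := by
  filter_upwards [hd.mem_iff.eventually_nhds] with y hy hcl hout
  refine le_antisymm ?_ ?_
  · by_contra hpos
    exact hout (hy.self_of_nhds.2 (not_le.1 hpos))
  · by_contra hneg
    have h1 : ∀ᶠ z in 𝓝 y, φ z < 0 :=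
      hd.contDiff.continuous.continuousAt.eventually (gt_mem_nhds (not_le.1 hneg))
    obtain ⟨z, hz, hz1, hz2⟩ := ((mem_closure_iff_frequently.1 hcl).and_eventually
      (hy.and h1)).exists
    exact absurd (hz1.1 hz) (not_lt.2 hz2.le)

namespace IsSmoothSolution

variable {Ω : Set (ℝ × ℝ)} {om b : ℂ} {f u : ℝ × ℝ → ℂ}

/-- Existence of primitives near a smooth boundary point. -/
theorem exists_isPrimitiveAt (h : IsSmoothSolution Ω om b f u) {φ : ℝ × ℝ → ℝ} {p : ℝ × ℝ}
    (hd : IsDefiningFunction Ω φ p) :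
    ∃ F : ℝ × ℝ → ℂ, ∀ᶠ x in 𝓝 p, x ∈ Ω → h.IsPrimitiveAt F x := by
  obtain ⟨γ, hγ, hX, -⟩ := h.exists_charts hd 1 1 one_ne_zero
  obtain ⟨Xi, hXi, hXi0, hXr, -⟩ := hX.exists_inverse hd.contDiff
  obtain ⟨c, hc, hs⟩ := hX.exists_sign hd.contDiff
  set X := aaChart h.coord γ 1 with hXdef
  have hXit : Tendsto Xi (𝓝 p) (𝓝 0) := hXi0 ▸ hXi.continuousAt.tendsto
  obtain ⟨r, hr, hf, c', hc', C, -, -, hE⟩ := h.exists_chart_bound hd hX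
  obtain ⟨a, ha, hball⟩ := Metric.mem_nhds_iff.1 hE
  -- In the chart Ω becomes a half ball, which is convex, so the closed form has a primitive there;
  -- the inverse chart carries it back.
  set T : Set (ℝ × ℝ) := Metric.ball 0 a ∩ {y | 0 < y.2} with hT
  have hTo : IsOpen T := Metric.isOpen_ball.inter (isOpen_lt continuous_const continuous_snd)
  have hTc : Convex ℝ T := (convex_ball _ _).inter
    (convex_halfSpace_gt (LinearMap.snd ℝ ℝ ℝ).isLinear 0)
  have hZ2 : ContDiff ℝ 2 fun y => h.coord (X y) := h.coord.contDiff.comp hX.contDiff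
  obtain ⟨H, hH⟩ := exists_primitive_pullback hTc hTo (Z := fun y => h.coord (X y)) (V := h.hol)
    hZ2.contDiffOn (fun y hy =>
      (h.differentiableOn_hol hf).differentiableAt ((h.isOpen_locImage p r).mem_nhds
        (hball hy.1 hy.2).1.1))
  have hax : ∀ᶠ y : ℝ × ℝ in 𝓝 0, φ (X (y.1, 0)) = 0 := by
    have h1 : Tendsto (fun y : ℝ × ℝ => y.1) (𝓝 0) (𝓝 0) := continuous_fst.tendsto' _ _ rfl
    exact h1.eventually hX.map_axis
  refine ⟨fun x => H (Xi x), ?_⟩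
  filter_upwards [hXr.eventually_nhds, hXit.eventually hs, hXit.eventually hax, hd.mem_iff,
    hXit.eventually (Metric.ball_mem_nhds _ ha), hXi.eventually (by simp)]
    with x x1 x2 x3 x4 x5 x6 hx
  have hxx : X (Xi x) = x := x1.self_of_nhds
  have hpos : 0 < (Xi x).2 := IsBoundaryChart.snd_pos_of_pos (φ := φ) (X := X) hc x2 x3
    (by rw [hxx]; exact x4.1 hx)
  have d1 := hH (Xi x) ⟨x5, hpos⟩
  have d2 : HasFDerivAt Xi (fderiv ℝ Xi x) x := (x6.differentiableAt (by simp)).hasFDerivAt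
  have d3 := d1.comp x d2
  have d4 : (fderiv ℝ (fun y => h.coord (X y)) (Xi x)).comp (fderiv ℝ Xi x) =
      (h.coord : (ℝ × ℝ) →L[ℝ] ℂ) := by
    have e1 := ((hZ2.differentiable (by norm_num) (Xi x)).hasFDerivAt).comp x d2
    have e2 : (fun y => h.coord (X y)) ∘ Xi =ᶠ[𝓝 x] h.coord := by
      filter_upwards [x1] with z hz
      simp [hz]
    exact (e1.congr_of_eventuallyEq e2.symm).unique h.coord.hasFDerivAt
  refine d3.congr_fderiv ?_
  rw [ContinuousLinearMap.smul_comp, d4, hxx]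

/-- Solutions are smooth up to the smooth part of the boundary. -/
theorem contDiffOn_closure (h : IsSmoothSolution Ω om b f u) :
    ContDiffOn ℝ ∞ u (closure Ω \ corners Ω) := by
  intro x hx
  by_cases hxΩ : x ∈ Ω
  · exact (h.contDiffOn.contDiffAt (h.isOpen.mem_nhds hxΩ)).contDiffWithinAt
  have hfr : x ∈ frontier Ω := by rw [h.isOpen.frontier_eq]; exact ⟨hx.1, hxΩ⟩
  have hsm : IsSmoothBoundaryPoint Ω x := by
    by_contra hns
    exact hx.2 ⟨hfr, hns⟩
  obtain ⟨φ, hd⟩ := hsm.exists_isDefiningFunction h.isOpen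
  obtain ⟨F, hF⟩ := h.exists_isPrimitiveAt hd
  rw [contDiffWithinAt_infty]
  intro m
  obtain ⟨F', G', hF', hG', hev⟩ := h.exists_extension hd hF m
  -- F' + G' equals u inside Ω and vanishes on the boundary, where u is zero by normalization.
  refine (hF'.add hG').contDiffWithinAt.congr_of_eventuallyEq_of_mem ?_ hx
  rw [eventuallyEq_nhdsWithin_iff]
  filter_upwards [hev, hd.eventually_closure] with y hy1 hy2 hy
  by_cases hyΩ : y ∈ Ω
  · obtain ⟨e1, e2⟩ := hy1.1 hyΩ
    rw [← e1, ← e2]; ring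
  · rw [h.eq_zero y hyΩ]
    exact (hy1.2 (hy2 hy.1 hyΩ)).symm

end IsSmoothSolution

/-! ### Periodic holomorphic functions glued from strips -/

/-- On this circle a² = w w̄, so the difference is w(w − w̄): the polynomial measures the distance
to the real diameter. -/
theorem norm_sq_sub_sq_of_norm_eq {w : ℂ} {a : ℝ} (hw : ‖w‖ = a) :
    ‖w ^ 2 - (a : ℂ) ^ 2‖ = 2 * a * |w.im| := by
  have h1 : w ^ 2 - (a : ℂ) ^ 2 = w * ((2 * w.im : ℝ) * Complex.I) := by
    have h2 : (a : ℂ) ^ 2 = w * (starRingEnd ℂ) w := by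
      rw [Complex.mul_conj, Complex.normSq_eq_norm_sq, hw]; push_cast; rfl
    rw [h2, ← Complex.sub_conj]; ring
  rw [h1, norm_mul, norm_mul, Complex.norm_I, hw, Complex.norm_real, Real.norm_eq_abs, abs_mul]
  simp; ring

/-- A holomorphic function whose size at the boundary of a disc is controlled by the inverse
distance to a diameter is bounded near the centre. -/
theorem norm_le_of_norm_mul_im_le {g : ℂ → ℂ} {c : ℂ} {a C : ℝ} (ha : 0 < a)
    (hg : DifferentiableOn ℂ g (Metric.ball c (2 * a)))
    (hC : ∀ z ∈ Metric.ball c (2 * a), ‖g z‖ * |(z - c).im| ≤ C) {z : ℂ}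
    (hz : ‖z - c‖ ≤ a / 2) : ‖g z‖ ≤ 3 * C / a := by
  have hsub : Metric.closedBall c a ⊆ Metric.ball c (2 * a) :=
    Metric.closedBall_subset_ball (by linarith)
  have hC0 : 0 ≤ C := by
    have := hC c (Metric.mem_ball_self (by linarith)); simpa using this
  -- The bound on g degenerates only at the two ends of the diameter, where the polynomial vanishes
  -- at the right rate; the maximum principle then bounds the product in the disc.
  set G : ℂ → ℂ := fun z => g z * ((z - c) ^ 2 - (a : ℂ) ^ 2) with hG
  have hGd : DiffContOnCl ℂ G (Metric.ball c a) := by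
    apply DifferentiableOn.diffContOnCl
    rw [closure_ball _ ha.ne']
    exact (hg.mono hsub).mul (by fun_prop)
  have h1 : ‖G z‖ ≤ 2 * a * C := by
    refine Complex.norm_le_of_forall_mem_frontier_norm_le Metric.isBounded_ball hGd ?_
      (by rw [closure_ball _ ha.ne']; simpa [dist_eq_norm] using (by linarith : ‖z - c‖ ≤ a))
    intro w hw
    rw [frontier_ball _ ha.ne'] at hw
    have hw' : ‖w - c‖ = a := by simpa [dist_eq_norm] using hw
    rw [hG, norm_mul, norm_sq_sub_sq_of_norm_eq hw']
    have := hC w (hsub (Metric.sphere_subset_closedBall hw))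
    nlinarith
  have h2 : 3 / 4 * a ^ 2 ≤ ‖(z - c) ^ 2 - (a : ℂ) ^ 2‖ := by
    have h3 := norm_sub_norm_le ((a : ℂ) ^ 2) ((z - c) ^ 2)
    rw [norm_sub_rev ((a : ℂ) ^ 2), norm_pow, norm_pow, Complex.norm_real,
      Real.norm_of_nonneg ha.le] at h3
    nlinarith [norm_nonneg (z - c)]
  rw [hG, norm_mul] at h1
  rw [le_div_iff₀ ha]
  have h4 : ‖g z‖ * (3 / 4 * a ^ 2) ≤ 2 * a * C :=
    (mul_le_mul_of_nonneg_left h2 (norm_nonneg _)).trans h1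
  have h5 : a * (‖g z‖ * a * (3 / 4)) ≤ a * (2 * C) := by linarith
  have h6 := le_of_mul_le_mul_left h5 ha
  linarith

theorem continuousOn_of_continuousOn_halves {f : ℂ → ℂ} {c : ℂ} {S : Set ℂ}
    (hU : ContinuousOn f (S ∩ {z | c.im ≤ z.im})) (hL : ContinuousOn f (S ∩ {z | z.im ≤ c.im})) :
    ContinuousOn f S := by
  have hS : S = (S ∩ {z | c.im ≤ z.im}) ∪ (S ∩ {z | z.im ≤ c.im}) := by
    ext z; simp only [mem_union, mem_inter_iff, mem_ofPred_eq]
    rcases le_total c.im z.im with h | h <;> tauto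
  intro z hz
  rw [hS]
  refine ContinuousWithinAt.union ?_ ?_
  · by_cases h : c.im ≤ z.im
    · exact hU z ⟨hz, h⟩
    · refine continuousWithinAt_of_notMem_closure fun hcl => h ?_
      exact closure_minimal inter_subset_right
        (isClosed_le continuous_const Complex.continuous_im) hcl
  · by_cases h : z.im ≤ c.im
    · exact hL z ⟨hz, h⟩
    · refine continuousWithinAt_of_notMem_closure fun hcl => h ?_
      exact closure_minimal inter_subset_right
        (isClosed_le Complex.continuous_im continuous_const) hcl

/-- Two holomorphic functions on the halves of a disc which agree along the diameter glue. -/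
theorem differentiableOn_and_norm_deriv_le_of_halves {f U L : ℂ → ℂ} {c : ℂ} {a C : ℝ} (ha : 0 < a)
    (hfU : ∀ z ∈ Metric.ball c (2 * a), c.im ≤ z.im → f z = U z)
    (hfL : ∀ z ∈ Metric.ball c (2 * a), z.im ≤ c.im → f z = L z)
    (hU : ContinuousOn U (Metric.ball c (2 * a) ∩ {z | c.im ≤ z.im}))
    (hL : ContinuousOn L (Metric.ball c (2 * a) ∩ {z | z.im ≤ c.im}))
    (hUd : ∀ z ∈ Metric.ball c (2 * a), c.im < z.im →
      DifferentiableAt ℂ U z ∧ ‖deriv U z‖ * |(z - c).im| ≤ C)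
    (hLd : ∀ z ∈ Metric.ball c (2 * a), z.im < c.im →
      DifferentiableAt ℂ L z ∧ ‖deriv L z‖ * |(z - c).im| ≤ C) (hC : 0 ≤ C) :
    DifferentiableOn ℂ f (Metric.ball c (2 * a)) ∧
      ∀ z, ‖z - c‖ ≤ a / 2 → ‖deriv f z‖ ≤ 3 * C / a := by
  have hcont : ContinuousOn f (Metric.ball c (2 * a)) :=
    continuousOn_of_continuousOn_halves (c := c)
      (hU.congr fun z hz => hfU z hz.1 hz.2) (hL.congr fun z hz => hfL z hz.1 hz.2)
  have hoff : ∀ z ∈ Metric.ball c (2 * a), z.im ≠ c.im →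
      DifferentiableAt ℂ f z ∧ ‖deriv f z‖ * |(z - c).im| ≤ C := by
    intro z hz hne
    rcases lt_or_gt_of_ne hne with h | h
    · have he : f =ᶠ[𝓝 z] L := by
        filter_upwards [Metric.isOpen_ball.mem_nhds hz,
          (isOpen_lt Complex.continuous_im continuous_const).mem_nhds h] with y hy hy'
        exact hfL y hy (le_of_lt hy')
      rw [he.deriv_eq]
      exact ⟨he.differentiableAt_iff.2 (hLd z hz h).1, (hLd z hz h).2⟩
    · have he : f =ᶠ[𝓝 z] U := by
        filter_upwards [Metric.isOpen_ball.mem_nhds hz,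
          (isOpen_lt continuous_const Complex.continuous_im).mem_nhds h] with y hy hy'
        exact hfU y hy (le_of_lt hy')
      rw [he.deriv_eq]
      exact ⟨he.differentiableAt_iff.2 (hUd z hz h).1, (hUd z hz h).2⟩
  have hd : DifferentiableOn ℂ f (Metric.ball c (2 * a)) := by
    intro z hz
    refine DifferentiableAt.differentiableWithinAt ?_
    by_cases h : z.im = c.im
    · obtain ⟨r, hr, hrs⟩ := Metric.isOpen_ball.mem_nhds_iff.2 hz |> Metric.mem_nhds_iff.1
      exact differentiableAt_of_differentiableAt_off_line hr (hcont.mono hrs)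
        fun y hy hne => (hoff y (hrs hy) (h ▸ hne)).1
    · exact (hoff z hz h).1
  -- Once f is holomorphic across the diameter, the loss in the bound on its derivative near the
  -- diameter disappears.
  refine ⟨hd, fun z hz => norm_le_of_norm_mul_im_le ha (hd.deriv Metric.isOpen_ball) ?_ hz⟩
  intro y hy
  by_cases h : y.im = c.im
  · simpa [h] using hC
  · exact (hoff y hy h).2

/-- Holomorphic functions on two adjacent strips whose boundary values match up to the
translation by `P` come from a single `P`-periodic function. -/
theorem exists_periodic_extension {A B : ℂ → ℂ} {P l : ℂ} {θa θb R C : ℝ} (hθa : 0 < θa)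
    (hθb : 0 < θb) (hP : P.im = θa + θb) (hl : (l * P).re = 0) (hC : 0 ≤ C)
    (hA : ContinuousOn A {z | (0 ≤ z.im ∧ z.im ≤ θa) ∧ (l * z).re < -R})
    (hB : ContinuousOn B {z | (-θb ≤ z.im ∧ z.im ≤ 0) ∧ (l * z).re < -R})
    (hAB : ∀ z : ℂ, z.im = 0 → (l * z).re < -R → A z = B z)
    (hAB' : ∀ z : ℂ, z.im = θa → (l * z).re < -R → A z = B (z - P))
    (hAd : ∀ z : ℂ, 0 < z.im → z.im < θa → (l * z).re < -R →
      DifferentiableAt ℂ A z ∧ ‖deriv A z‖ * min z.im (θa - z.im) ≤ C)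
    (hBd : ∀ z : ℂ, -θb < z.im → z.im < 0 → (l * z).re < -R →
      DifferentiableAt ℂ B z ∧ ‖deriv B z‖ * min (-z.im) (θb + z.im) ≤ C) :
    ∃ (M : ℂ → ℂ) (R' C' : ℝ), (∀ z, M (z + P) = M z) ∧
      (∀ z : ℂ, 0 ≤ z.im → z.im ≤ θa → (l * z).re < -R' → A z = M z) ∧
      (∀ z : ℂ, -θb ≤ z.im → z.im ≤ 0 → (l * z).re < -R' → B z = M z) ∧
      ∀ z : ℂ, (l * z).re < -R' → DifferentiableAt ℂ M z ∧ ‖deriv M z‖ ≤ C' := by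
  have hp : 0 < θa + θb := by linarith
  -- The number of periods separating z from the fundamental strip −θb ≤ Im < θa. Since l P is
  -- purely imaginary, translation by P preserves Re(l z) and hence the half plane.
  set n : ℂ → ℤ := fun z => toIcoDiv hp (-θb) z.im with hn
  set M0 : ℂ → ℂ := fun z => if 0 ≤ z.im then A z else B z with hM0
  set M : ℂ → ℂ := fun z => M0 (z - n z * P) with hM
  have hper : ∀ z, M (z + P) = M z := by
    intro z
    have : n (z + P) = n z + 1 := by
      simp only [hn, Complex.add_im, hP, toIcoDiv_add_right]
    simp only [hM, this]; congr 1; push_cast; ring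
  have hn0 : ∀ z : ℂ, -θb ≤ z.im → z.im < θa → n z = 0 := by
    intro z h1 h2
    refine toIcoDiv_eq_of_sub_zsmul_mem_Ico hp ⟨by simpa using h1, by simp; linarith⟩
  have hMA : ∀ z : ℂ, 0 ≤ z.im → z.im < θa → M z = A z := by
    intro z h1 h2
    simp [hM, hM0, hn0 z (by linarith) h2, h1]
  have hMB' : ∀ z : ℂ, -θb ≤ z.im → z.im < 0 → M z = B z := by
    intro z h1 h2
    simp [hM, hM0, hn0 z h1 (by linarith), h2]
  have hre : ∀ z, (l * (z - P)).re = (l * z).re := by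
    intro z; rw [mul_sub, Complex.sub_re, hl, sub_zero]
  have hre' : ∀ z, (l * (z + P)).re = (l * z).re := by
    intro z; rw [mul_add, Complex.add_re, hl, add_zero]
  have hMB : ∀ z : ℂ, -θb ≤ z.im → z.im ≤ 0 → (l * z).re < -R → M z = B z := by
    intro z h1 h2 h3
    rcases h2.lt_or_eq with h2 | h2
    · exact hMB' z h1 h2
    · rw [hMA z h2.ge (by linarith), hAB z h2 h3]
  have hMA2 : ∀ z : ℂ, 0 ≤ z.im → z.im ≤ θa → (l * z).re < -R → M z = A z := by
    intro z h1 h2 h3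
    rcases h2.lt_or_eq with h2 | h2
    · exact hMA z h1 h2
    · rw [hAB' z h2 h3, ← hMB (z - P) (by simp [hP, h2]) (by simp [hP, h2]; linarith)
        (by rwa [hre]), ← hper (z - P), sub_add_cancel]
  -- A disc of radius 2a centred on one seam meets no other seam.
  set a : ℝ := min θa θb / 4 with ha
  have ha0 : 0 < a := by have := lt_min hθa hθb; positivity
  have haA : 4 * a ≤ θa := by have := min_le_left θa θb; rw [ha]; linarith
  have haB : 4 * a ≤ θb := by have := min_le_right θa θb; rw [ha]; linarith
  have hball : ∀ c z : ℂ, z ∈ Metric.ball c (2 * a) → |z.im - c.im| < 2 * a := fun c z hz => by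
    rw [← Complex.sub_im]
    exact (Complex.abs_im_le_norm _).trans_lt (by simpa [dist_eq_norm] using hz)
  have hballre : ∀ c z : ℂ, z ∈ Metric.ball c (2 * a) → (l * c).re < -(R + ‖l‖ * (2 * a)) →
      (l * z).re < -R := fun c z hz hc => by
    have h1 : (l * z).re = (l * c).re + (l * (z - c)).re := by rw [← Complex.add_re]; congr 1; ring
    have h2 : (l * (z - c)).re ≤ ‖l‖ * (2 * a) := by
      refine (Complex.re_le_norm _).trans ?_
      rw [norm_mul]
      exact mul_le_mul_of_nonneg_left (by simpa [dist_eq_norm] using (Metric.mem_ball.1 hz).le)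
        (norm_nonneg _)
    linarith
  have hseam0 : ∀ c : ℂ, c.im = 0 → (l * c).re < -(R + ‖l‖ * (2 * a)) →
      DifferentiableOn ℂ M (Metric.ball c (2 * a)) ∧
      ∀ z, ‖z - c‖ ≤ a / 2 → ‖deriv M z‖ ≤ 3 * C / a := by
    intro c hc hcR
    refine differentiableOn_and_norm_deriv_le_of_halves ha0 (U := A) (L := B)
      (fun z hz h => ?_) (fun z hz h => ?_) (hA.mono ?_) (hB.mono ?_) (fun z hz h => ?_)
      (fun z hz h => ?_) hC
    · have := abs_lt.1 (hball c z hz)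
      exact hMA z (by linarith) (by linarith)
    · have := abs_lt.1 (hball c z hz)
      exact hMB z (by linarith) (by linarith) (hballre c z hz hcR)
    · rintro z ⟨hz, h⟩
      have := abs_lt.1 (hball c z hz)
      have h' : c.im ≤ z.im := h
      exact ⟨⟨by linarith, by linarith⟩, hballre c z hz hcR⟩
    · rintro z ⟨hz, h⟩
      have := abs_lt.1 (hball c z hz)
      have h' : z.im ≤ c.im := h
      exact ⟨⟨by linarith, by linarith⟩, hballre c z hz hcR⟩
    · have := abs_lt.1 (hball c z hz)
      have h2 := hAd z (by linarith) (by linarith) (hballre c z hz hcR)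
      rwa [min_eq_left (by linarith), ← abs_of_pos (a := z.im) (by linarith),
        show z.im = (z - c).im by simp [hc]] at h2
    · have := abs_lt.1 (hball c z hz)
      have h2 := hBd z (by linarith) (by linarith) (hballre c z hz hcR)
      rwa [min_eq_left (by linarith), ← abs_of_neg (a := z.im) (by linarith),
        show z.im = (z - c).im by simp [hc]] at h2
  have hseam1 : ∀ c : ℂ, c.im = -θb → (l * c).re < -(R + ‖l‖ * (2 * a)) →
      DifferentiableOn ℂ M (Metric.ball c (2 * a)) ∧
      ∀ z, ‖z - c‖ ≤ a / 2 → ‖deriv M z‖ ≤ 3 * C / a := by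
    intro c hc hcR
    refine differentiableOn_and_norm_deriv_le_of_halves ha0 (U := B) (L := fun z => A (z + P))
      (fun z hz h => ?_) (fun z hz h => ?_) (hB.mono ?_) (hA.comp (by fun_prop) ?_)
      (fun z hz h => ?_) (fun z hz h => ?_) hC
    · have := abs_lt.1 (hball c z hz)
      exact hMB' z (by linarith) (by linarith)
    · have := abs_lt.1 (hball c z hz)
      rw [← hper, hMA2 _ (by simp [hP]; linarith) (by simp [hP]; linarith)
        (by rw [hre']; exact hballre c z hz hcR)]
    · rintro z ⟨hz, h⟩
      have := abs_lt.1 (hball c z hz)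
      have h' : c.im ≤ z.im := h
      exact ⟨⟨by linarith, by linarith⟩, hballre c z hz hcR⟩
    · rintro z ⟨hz, h⟩
      have := abs_lt.1 (hball c z hz)
      have h' : z.im ≤ c.im := h
      exact ⟨⟨by simp [hP]; linarith, by simp [hP]; linarith⟩,
        by rw [hre']; exact hballre c z hz hcR⟩
    · have := abs_lt.1 (hball c z hz)
      have h2 := hBd z (by linarith) (by linarith) (hballre c z hz hcR)
      rwa [min_eq_right (by linarith), ← abs_of_pos (a := θb + z.im) (by linarith),
        show θb + z.im = (z - c).im by simp [hc]; ring] at h2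
    · have := abs_lt.1 (hball c z hz)
      have h2 := hAd (z + P) (by simp [hP]; linarith) (by simp [hP]; linarith)
        (by rw [hre']; exact hballre c z hz hcR)
      rw [min_eq_right (by simp [hP]; linarith),
        show θa - (z + P).im = -(z - c).im by simp [hP, hc]; ring,
        ← abs_of_neg (a := (z - c).im) (by simp [hc]; linarith)] at h2
      rw [deriv_comp_add_const]
      exact ⟨h2.1.comp (g := A) z (by fun_prop), h2.2⟩
  -- Points within a/2 of a seam are covered by the discs about it, the seam at height θa being a
  -- translate of that at −θb; at all others the given weighted bound on the derivative already
  -- suffices.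
  have hfund : ∀ z : ℂ, -θb ≤ z.im → z.im < θa → (l * z).re < -(R + ‖l‖ * (4 * a)) →
      DifferentiableAt ℂ M z ∧ ‖deriv M z‖ ≤ 3 * C / a := by
    intro z h1 h2 h3
    have hl0 : 0 ≤ ‖l‖ * a := by positivity
    have hin : ∀ c : ℂ, |z.im - c.im| ≤ a / 2 → z.re = c.re →
        (DifferentiableOn ℂ M (Metric.ball c (2 * a)) ∧
          ∀ z, ‖z - c‖ ≤ a / 2 → ‖deriv M z‖ ≤ 3 * C / a) →
        DifferentiableAt ℂ M z ∧ ‖deriv M z‖ ≤ 3 * C / a := by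
      intro c hc hre hs
      have hn : ‖z - c‖ ≤ a / 2 := by
        have : z - c = ((z.im - c.im : ℝ) : ℂ) * Complex.I := by
          apply Complex.ext <;> simp [hre]
        rw [this, norm_mul, Complex.norm_I, mul_one, Complex.norm_real]; exact hc
      refine ⟨hs.1.differentiableAt (Metric.isOpen_ball.mem_nhds ?_), hs.2 z hn⟩
      simpa [dist_eq_norm] using (by linarith : ‖z - c‖ < 2 * a)
    have hcre : ∀ c : ℂ, |z.im - c.im| ≤ a / 2 → z.re = c.re →
        (l * c).re < -(R + ‖l‖ * (2 * a)) := by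
      intro c hc hre
      have hn : ‖c - z‖ ≤ a / 2 := by
        have : z - c = ((z.im - c.im : ℝ) : ℂ) * Complex.I := by
          apply Complex.ext <;> simp [hre]
        rw [norm_sub_rev, this, norm_mul, Complex.norm_I, mul_one, Complex.norm_real]; exact hc
      have h4 : (l * c).re = (l * z).re + (l * (c - z)).re := by
        rw [← Complex.add_re]; congr 1; ring
      have h5 : (l * (c - z)).re ≤ ‖l‖ * (a / 2) := by
        refine (Complex.re_le_norm _).trans ?_
        rw [norm_mul]; exact mul_le_mul_of_nonneg_left hn (norm_nonneg _)
      nlinarith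
    have hCa : ∀ d m : ℝ, 0 ≤ d → a / 2 ≤ m → d * m ≤ C → d ≤ 3 * C / a := by
      intro d m hd hm hdm
      rw [le_div_iff₀ ha0]
      nlinarith
    have hzR : (l * z).re < -R := by nlinarith
    rcases le_or_gt |z.im| (a / 2) with h4 | h4
    · exact hin z.re (by simpa using h4) (by simp)
        (hseam0 _ (by simp) (hcre _ (by simpa using h4) (by simp)))
    rcases le_or_gt |z.im - (-θb)| (a / 2) with h5 | h5
    · exact hin ⟨z.re, -θb⟩ h5 rfl (hseam1 _ rfl (hcre _ h5 rfl))
    rcases le_or_gt |z.im - θa| (a / 2) with h6 | h6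
    · have h7 : |(z - P).im - (-θb)| ≤ a / 2 := by
        rwa [Complex.sub_im, hP, show z.im - (θa + θb) - -θb = z.im - θa by ring]
      have hs := hseam1 ⟨(z - P).re, -θb⟩ rfl (by
        have h8 : (l * (⟨z.re, θa⟩ - P)).re < -(R + ‖l‖ * (2 * a)) := by
          rw [hre]; exact hcre ⟨z.re, θa⟩ h6 rfl
        convert h8 using 3
        apply Complex.ext <;> simp [hP])
      have hn : ‖(z - P) - ⟨(z - P).re, -θb⟩‖ ≤ a / 2 := by
        have : (z - P) - ⟨(z - P).re, -θb⟩ = (((z - P).im - (-θb) : ℝ) : ℂ) * Complex.I := by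
          apply Complex.ext <;> simp
        rw [this, norm_mul, Complex.norm_I, mul_one, Complex.norm_real]; exact h7
      have hd : DifferentiableAt ℂ M (z - P) := hs.1.differentiableAt (Metric.isOpen_ball.mem_nhds
        (by rw [Metric.mem_ball, dist_eq_norm]; linarith))
      have he : M = fun y => M (y - P) := by
        funext y; rw [← hper (y - P), sub_add_cancel]
      rw [he, deriv_comp_sub_const]
      exact ⟨hd.comp (g := M) z (by fun_prop), hs.2 _ hn⟩
    rcases lt_or_ge z.im 0 with h7 | h7
    · rw [abs_of_neg h7] at h4
      rw [abs_of_nonneg (by linarith)] at h5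
      have he : M =ᶠ[𝓝 z] B := by
        filter_upwards [(isOpen_lt continuous_const Complex.continuous_im).mem_nhds
          (show -θb < z.im by linarith),
          (isOpen_lt Complex.continuous_im continuous_const).mem_nhds h7] with y hy hy'
        exact hMB' y (le_of_lt hy) hy'
      have := hBd z (by linarith) h7 hzR
      rw [he.deriv_eq]
      exact ⟨he.differentiableAt_iff.2 this.1, hCa _ _ (norm_nonneg _)
        (le_min (by linarith) (by linarith)) this.2⟩
    · rw [abs_of_nonneg h7] at h4
      rw [abs_of_neg (by linarith)] at h6
      have he : M =ᶠ[𝓝 z] A := by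
        filter_upwards [(isOpen_lt continuous_const Complex.continuous_im).mem_nhds
          (show 0 < z.im by linarith),
          (isOpen_lt Complex.continuous_im continuous_const).mem_nhds h2] with y hy hy'
        exact hMA y (le_of_lt hy) hy'
      have := hAd z (by linarith) h2 hzR
      rw [he.deriv_eq]
      exact ⟨he.differentiableAt_iff.2 this.1, hCa _ _ (norm_nonneg _)
        (le_min (by linarith) (by linarith)) this.2⟩
  have hl0 : 0 ≤ ‖l‖ * a := by positivity
  refine ⟨M, R + ‖l‖ * (4 * a), 3 * C / a, hper,
    fun z h1 h2 h3 => (hMA2 z h1 h2 (by nlinarith)).symm,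
    fun z h1 h2 h3 => (hMB z h1 h2 (by nlinarith)).symm, fun z hz => ?_⟩
  have hperZ : ∀ y : ℂ, ∀ k : ℤ, M (y - k * P) = M y := by
    have hq : Function.Periodic M P := hper
    intro y k
    rw [← hq.int_mul k (y - k * P), sub_add_cancel]
  have hmem := sub_toIcoDiv_zsmul_mem_Ico hp (-θb) z.im
  have himz : (z - n z * P).im = z.im - toIcoDiv hp (-θb) z.im • (θa + θb) := by
    rw [Complex.sub_im, ← Complex.ofReal_intCast, Complex.im_ofReal_mul, hP, zsmul_eq_mul]
  have hrez : (l * (z - n z * P)).re = (l * z).re := by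
    have : l * (z - n z * P) = l * z - ((n z : ℝ) : ℂ) * (l * P) := by push_cast; ring
    rw [this, Complex.sub_re, Complex.re_ofReal_mul, hl]; ring
  obtain ⟨h1, h2⟩ := hfund (z - n z * P) (by rw [himz]; exact hmem.1)
    (by rw [himz]; linarith [hmem.2]) (by rwa [hrez])
  have he : M = fun y => M (y - n z * P) := by funext y; rw [hperZ]
  rw [he, deriv_comp_sub_const]
  exact ⟨h1.comp (g := M) z (by fun_prop), h2⟩

/-- A periodic holomorphic function with bounded derivative on a half-plane is a holomorphic
function of the exponential. -/
theorem exists_factor_exp {M : ℂ → ℂ} {P l : ℂ} {R C : ℝ} (hlP : l * P = 2 * Real.pi * Complex.I)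
    (hper : ∀ z, M (z + P) = M z)
    (hM : ∀ z : ℂ, (l * z).re < -R → DifferentiableAt ℂ M z ∧ ‖deriv M z‖ ≤ C) :
    ∃ (N : ℂ → ℂ) (δ : ℝ), 0 < δ ∧ DifferentiableOn ℂ N (Metric.ball 0 δ) ∧ δ ≤ Real.exp (-R) ∧
      ∀ z, (l * z).re < Real.log δ → M z = N (Complex.exp (l * z)) := by
  have hl0 : l ≠ 0 := by
    rintro rfl; simp [Real.pi_ne_zero] at hlP
  -- Normalized to period 1, so that the variable of the cusp function is e^{lz}.
  set f : ℂ → ℂ := fun w => M (P * w) with hf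
  have hfp : Function.Periodic f ((1 : ℝ) : ℂ) := fun w => by
    simp only [hf]; rw [← hper (P * w)]; congr 1; push_cast; ring
  have hP0 : P ≠ 0 := by
    rintro rfl; simp [Real.pi_ne_zero] at hlP
  have hlPw : ∀ w, 2 * Real.pi * Complex.I * w / ((1 : ℝ) : ℂ) = l * (P * w) := fun w => by
    rw [← hlP]; push_cast; ring
  set F := Function.Periodic.cuspFunction 1 f with hF
  have hFM : ∀ z, F (Complex.exp (l * z)) = M z := fun z => by
    have := Function.Periodic.eq_cuspFunction (h := 1) one_ne_zero hfp (z / P)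
    rw [Function.Periodic.qParam, hlPw, mul_div_cancel₀ _ hP0] at this
    rw [hF, this, hf]; simp [mul_div_cancel₀ _ hP0]
  have hFl : ∀ ξ : ℂ, ξ ≠ 0 → F ξ = M (Complex.log ξ / l) := fun ξ hξ => by
    rw [← hFM, mul_div_cancel₀ _ hl0, Complex.exp_log hξ]
  set δ := Real.exp (-R) with hδ
  have hδ0 : 0 < δ := Real.exp_pos _
  have hrelog : ∀ ξ : ℂ, ξ ≠ 0 → ‖ξ‖ < δ → (l * (Complex.log ξ / l)).re < -R := by
    intro ξ h0 h
    rw [mul_div_cancel₀ _ hl0, Complex.log_re]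
    rw [Real.log_lt_iff_lt_exp (norm_pos_iff.2 h0)]; exact h
  have hFd : DifferentiableOn ℂ F (Metric.ball 0 δ \ {0}) := by
    rintro ξ ⟨hξ, h0⟩
    have h0' : ξ ≠ 0 := h0
    have h1 := hM _ (hrelog ξ h0' (by simpa using hξ))
    have h2 : DifferentiableAt ℂ f (Complex.log ξ / l / P) := by
      refine DifferentiableAt.comp (g := M) _ ?_ (by fun_prop)
      rw [mul_div_cancel₀ _ hP0]; exact h1.1
    have h3 := Function.Periodic.differentiableAt_cuspFunction (h := 1) one_ne_zero hfp h2
    rw [Function.Periodic.qParam, hlPw, mul_div_cancel₀ _ hP0, mul_div_cancel₀ _ hl0,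
      Complex.exp_log h0'] at h3
    exact h3.differentiableWithinAt
  set ξ0 : ℂ := ((δ / 2 : ℝ) : ℂ) with hξ0
  have hξ00 : ξ0 ≠ 0 := by rw [hξ0]; exact_mod_cast (by positivity : δ / 2 ≠ 0)
  have hξ0δ : ‖ξ0‖ < δ := by
    rw [hξ0, Complex.norm_real, Real.norm_of_nonneg (by positivity)]; linarith
  have hconv : Convex ℝ {z : ℂ | (l * z).re < -R} := by
    have : {z : ℂ | (l * z).re < -R} = (fun z : ℂ => l * z) ⁻¹' {z | z.re < -R} := rfl
    rw [this]
    exact (convex_halfSpace_re_lt (-R)).linear_preimage (LinearMap.mulLeft ℝ l)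
  have hgrow : ∀ ξ : ℂ, ξ ≠ 0 → ‖ξ‖ < δ →
      ‖F ξ - F ξ0‖ ≤ C * ‖Complex.log ξ / l - Complex.log ξ0 / l‖ := by
    intro ξ h0 h
    rw [hFl ξ h0, hFl ξ0 hξ00]
    exact hconv.norm_image_sub_le_of_norm_deriv_le (𝕜 := ℂ) (fun z hz => (hM z hz).1)
      (fun z hz => (hM z hz).2) (hrelog ξ0 hξ00 hξ0δ) (hrelog ξ h0 h)
  have hC : 0 ≤ C := by
    have := (hM _ (hrelog ξ0 hξ00 hξ0δ)).2
    exact (norm_nonneg _).trans this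
  -- A bounded derivative in z means at most logarithmic growth in e^{lz}, which is weaker than a
  -- pole: the singularity is removable.
  have ho : (fun z => F z - F 0) =o[𝓝[≠] 0] fun z => (z - 0)⁻¹ := by
    have hlin : (fun z : ℂ => (1 : ℝ)) =o[𝓝[≠] (0 : ℂ)] fun z => (z - 0)⁻¹ := by
      simp only [sub_zero]
      rw [Asymptotics.isLittleO_const_left]
      refine Or.inr ?_
      exact tendsto_norm_cobounded_atTop.comp (tendsto_inv₀_nhdsNE_zero (α := ℂ))
    have hlog : (fun z : ℂ => Real.log ‖z‖) =o[𝓝[≠] (0 : ℂ)] fun z => (z - 0)⁻¹ := by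
      have h1 := isLittleO_log_rpow_nhdsGT_zero (r := -1) (by norm_num)
      have h2 := h1.comp_tendsto (tendsto_norm_nhdsNE_zero (E := ℂ))
      refine h2.trans_isBigO ?_
      refine Asymptotics.isBigO_of_le _ fun z => ?_
      simp only [Function.comp, sub_zero, Real.rpow_neg_one]
      simp
    have hbig : (fun z => F z - F 0) =O[𝓝[≠] 0] fun z : ℂ => |Real.log ‖z‖| + 1 := by
      refine Asymptotics.IsBigO.of_bound
        (C * ‖l‖⁻¹ + (C * ‖l‖⁻¹ * Real.pi + C * ‖Complex.log ξ0 / l‖ + ‖F ξ0 - F 0‖)) ?_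
      filter_upwards [self_mem_nhdsWithin,
        mem_nhdsWithin_of_mem_nhds (Metric.ball_mem_nhds (0 : ℂ) hδ0)] with z hz hzδ
      have hz0 : z ≠ 0 := hz
      have h1 := hgrow z hz0 (by simpa using hzδ)
      have h2 : ‖Complex.log z‖ ≤ |Real.log ‖z‖| + Real.pi := by
        refine (Complex.norm_le_abs_re_add_abs_im _).trans ?_
        rw [Complex.log_re]
        exact add_le_add le_rfl (by rw [Complex.log_im]; exact Complex.abs_arg_le_pi z)
      have h3 : ‖F z - F 0‖ ≤ ‖F z - F ξ0‖ + ‖F ξ0 - F 0‖ := norm_sub_le_norm_sub_add_norm_sub _ _ _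
      have h4 : ‖Complex.log z / l - Complex.log ξ0 / l‖ ≤
          ‖l‖⁻¹ * (|Real.log ‖z‖| + Real.pi) + ‖Complex.log ξ0 / l‖ := by
        refine (norm_sub_le _ _).trans (add_le_add ?_ le_rfl)
        rw [norm_div, div_eq_inv_mul]
        exact mul_le_mul_of_nonneg_left h2 (by positivity)
      have h5 := mul_le_mul_of_nonneg_left h4 hC
      rw [Real.norm_of_nonneg (by positivity)]
      set t := |Real.log ‖z‖|
      have ht : 0 ≤ t := abs_nonneg _
      have hk1 : 0 ≤ C * ‖l‖⁻¹ := by positivity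
      have hk2 : 0 ≤ C * ‖l‖⁻¹ * Real.pi + C * ‖Complex.log ξ0 / l‖ + ‖F ξ0 - F 0‖ := by positivity
      nlinarith [mul_nonneg hk2 ht]
    exact hbig.trans_isLittleO (hlog.norm_left.add hlin)
  have hupd := Complex.differentiableOn_update_limUnder_of_isLittleO
    (Metric.ball_mem_nhds (0 : ℂ) hδ0) hFd ho
  refine ⟨_, δ, hδ0, hupd, le_rfl, fun z _ => ?_⟩
  rw [Function.update_of_ne (Complex.exp_ne_zero _), hFM]

/-! ### Sectors and the splitting of the solution -/

/-- Near `κ`, the set `Ω` is the open sector spanned by `e₁` and `e₂`; the linear forms `s₁`, `s₂`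
are dual to `e₁`, `e₂`. -/
structure IsWedgeAt (Ω : Set (ℝ × ℝ)) (κ e₁ e₂ : ℝ × ℝ) (s₁ s₂ : (ℝ × ℝ) →L[ℝ] ℝ) (δ : ℝ) :
    Prop where
  pos : 0 < δ
  decomp : ∀ x, s₁ x • e₁ + s₂ x • e₂ = x
  s₁_e₁ : s₁ e₁ = 1
  s₁_e₂ : s₁ e₂ = 0
  s₂_e₁ : s₂ e₁ = 0
  s₂_e₂ : s₂ e₂ = 1
  mem_iff : ∀ x, ‖x‖ < δ → (κ + x ∈ Ω ↔ 0 < s₁ x ∧ 0 < s₂ x)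

namespace IsWedgeAt

variable {Ω : Set (ℝ × ℝ)} {κ e₁ e₂ : ℝ × ℝ} {s₁ s₂ : (ℝ × ℝ) →L[ℝ] ℝ} {δ : ℝ}

theorem swap (w : IsWedgeAt Ω κ e₁ e₂ s₁ s₂ δ) : IsWedgeAt Ω κ e₂ e₁ s₂ s₁ δ :=
  ⟨w.pos, fun x => by rw [add_comm]; exact w.decomp x, w.s₂_e₂, w.s₂_e₁, w.s₁_e₂, w.s₁_e₁,
    fun x hx => (w.mem_iff x hx).trans and_comm⟩

theorem mono (w : IsWedgeAt Ω κ e₁ e₂ s₁ s₂ δ) {δ' : ℝ} (h0 : 0 < δ') (h : δ' ≤ δ) :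
    IsWedgeAt Ω κ e₁ e₂ s₁ s₂ δ' :=
  { w with pos := h0, mem_iff := fun x hx => w.mem_iff x (hx.trans_le h) }

theorem isDefiningFunction (w : IsWedgeAt Ω κ e₁ e₂ s₁ s₂ δ) {x : ℝ × ℝ} (hx : ‖x‖ < δ)
    (h1 : 0 < s₁ x) (h2 : s₂ x = 0) : IsDefiningFunction Ω (fun y => s₂ (y - κ)) (κ + x) where
  contDiff := s₂.contDiff.comp (contDiff_id.sub contDiff_const)
  apply_eq_zero := by simpa using h2
  fderiv_ne_zero := by
    have : HasFDerivAt (fun y => s₂ (y - κ)) s₂ (κ + x) := by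
      simpa only [map_sub] using s₂.hasFDerivAt.sub_const (s₂ κ)
    rw [this.fderiv]
    intro h0
    have := w.s₂_e₂
    simp [h0] at this
  mem_iff := by
    have hc : Tendsto (fun y : ℝ × ℝ => y - κ) (𝓝 (κ + x)) (𝓝 x) :=
      Continuous.tendsto' (by fun_prop) _ _ (by simp)
    filter_upwards [hc.eventually ((isOpen_lt continuous_norm continuous_const).mem_nhds hx),
      hc.eventually ((isOpen_lt continuous_const s₁.continuous).mem_nhds h1)] with y hy1 hy2
    have := w.mem_iff _ hy1
    rw [add_sub_cancel] at this
    rw [this]; exact and_iff_right hy2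

theorem mem_closure (w : IsWedgeAt Ω κ e₁ e₂ s₁ s₂ δ) {x : ℝ × ℝ} (hx : ‖x‖ < δ)
    (h1 : 0 ≤ s₁ x) (h2 : 0 ≤ s₂ x) : κ + x ∈ closure Ω := by
  have hc : Tendsto (fun t : ℝ => x + t • (e₁ + e₂)) (𝓝[>] 0) (𝓝 x) :=
    (Continuous.tendsto' (by fun_prop) _ _ (by simp)).mono_left nhdsWithin_le_nhds
  refine mem_closure_of_tendsto (f := fun t : ℝ => κ + (x + t • (e₁ + e₂))) (b := 𝓝[>] 0)
    (tendsto_const_nhds.add hc) ?_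
  filter_upwards [hc.eventually ((isOpen_lt continuous_norm continuous_const).mem_nhds hx),
    self_mem_nhdsWithin] with t ht ht0
  have ht0' : 0 < t := ht0
  rw [w.mem_iff _ ht]
  simp only [map_add, map_smul, w.s₁_e₁, w.s₁_e₂, w.s₂_e₁, w.s₂_e₂, smul_eq_mul]
  constructor <;> linarith

end IsWedgeAt

namespace IsSmoothSolution

variable {Ω : Set (ℝ × ℝ)} {om b : ℂ} {f u : ℝ × ℝ → ℂ} {κ e₁ e₂ : ℝ × ℝ}
  {s₁ s₂ : (ℝ × ℝ) →L[ℝ] ℝ} {δ : ℝ}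

/-- The case m = 0 of `exists_extension`: at the edges of a sector only continuity and cancellation
of the boundary values are needed. -/
theorem exists_tendsto_of_isDefiningFunction (h : IsSmoothSolution Ω om b f u) {φ : ℝ × ℝ → ℝ}
    {p : ℝ × ℝ} (hd : IsDefiningFunction Ω φ p) {F : ℝ × ℝ → ℂ}
    (hF : ∀ᶠ x in 𝓝 p, x ∈ Ω → h.IsPrimitiveAt F x) :
    ∃ y z, Tendsto F (𝓝[Ω] p) (𝓝 y) ∧ Tendsto (fun x => u x - F x) (𝓝[Ω] p) (𝓝 z) ∧
      y + z = 0 := by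
  obtain ⟨F', G', hF', hG', hev⟩ := h.exists_extension hd hF 0
  have hev' := eventually_nhdsWithin_iff.2 (hev.mono fun x hx => hx.1)
  refine ⟨F' p, G' p, ?_, ?_, hev.self_of_nhds.2 hd.apply_eq_zero⟩
  · refine (hF'.continuousAt.tendsto.mono_left nhdsWithin_le_nhds).congr' ?_
    filter_upwards [hev'] with x hx using hx.1.symm
  · refine (hG'.continuousAt.tendsto.mono_left nhdsWithin_le_nhds).congr' ?_
    filter_upwards [hev'] with x hx using hx.2.symm

/-- In a sector, the solution splits into the two factors, continuously up to the edges. -/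
theorem exists_wedge_splitting (h : IsSmoothSolution Ω om b f u)
    (w : IsWedgeAt Ω κ e₁ e₂ s₁ s₂ δ) :
    ∃ δ' : ℝ, ∃ F G : ℝ × ℝ → ℂ, IsWedgeAt Ω κ e₁ e₂ s₁ s₂ δ' ∧
      (∀ x, ‖x‖ < δ' → f (κ + x) = 0) ∧
      ContinuousOn (fun x => F (κ + x)) {x | ‖x‖ < δ' ∧ x ≠ 0 ∧ 0 ≤ s₁ x ∧ 0 ≤ s₂ x} ∧
      ContinuousOn (fun x => G (κ + x)) {x | ‖x‖ < δ' ∧ x ≠ 0 ∧ 0 ≤ s₁ x ∧ 0 ≤ s₂ x} ∧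
      (∀ x, ‖x‖ < δ' → κ + x ∈ Ω → h.IsPrimitiveAt F (κ + x) ∧ h.neg.IsPrimitiveAt G (κ + x)) ∧
      ∀ x, ‖x‖ < δ' → x ≠ 0 → 0 ≤ s₁ x → 0 ≤ s₂ x → F (κ + x) + G (κ + x) = u (κ + x) := by
  have hκ : κ ∉ Ω := by
    have := w.mem_iff 0 (by simpa using w.pos)
    simpa using this
  obtain ⟨δ₁, hδ₁, hf⟩ := Metric.eventually_nhds_iff.1 (h.eventually_eq_zero hκ)
  set δ' := min δ δ₁ with hδ'
  have hδ'0 : 0 < δ' := lt_min w.pos hδ₁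
  have w' := w.mono hδ'0 (min_le_left _ _)
  have hf' : ∀ x, ‖x‖ < δ' → f (κ + x) = 0 := fun x hx =>
    hf (by simpa [dist_eq_norm] using hx.trans_le (min_le_right _ _))
  set S : Set (ℝ × ℝ) := Metric.ball κ δ' ∩ ((fun y => y - κ) ⁻¹' ({x | 0 < s₁ x} ∩ {x | 0 < s₂ x}))
    with hS
  have hSo : IsOpen S := Metric.isOpen_ball.inter
    (((isOpen_lt continuous_const s₁.continuous).inter
      (isOpen_lt continuous_const s₂.continuous)).preimage (by fun_prop))
  have hSc : Convex ℝ S := by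
    refine (convex_ball _ _).inter ?_
    have : Convex ℝ ({x | 0 < s₁ x} ∩ {x | 0 < s₂ x}) :=
      (convex_halfSpace_gt s₁.isLinear 0).inter (convex_halfSpace_gt s₂.isLinear 0)
    simpa [sub_eq_add_neg] using this.translate_preimage_left (-κ)
  have hSΩ : ∀ x, ‖x‖ < δ' → (κ + x ∈ S ↔ κ + x ∈ Ω) := fun x hx => by
    rw [w'.mem_iff x hx]; simp [hS, hx]
  have hSmem : ∀ y ∈ S, y ∈ Ω ∧ f y = 0 := fun y hy => by
    have hn : ‖y - κ‖ < δ' := by simpa [dist_eq_norm] using hy.1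
    have := hSΩ (y - κ) hn
    rw [add_sub_cancel] at this
    exact ⟨this.1 hy, by simpa using hf' _ hn⟩
  obtain ⟨F, hF⟩ := exists_primitive_pullback hSc hSo (Z := h.coord) (V := h.hol)
    h.coord.contDiff.contDiffOn (fun y hy => h.differentiableAt_hol (hSmem y hy).1 (hSmem y hy).2)
  have hFp : ∀ y ∈ S, h.IsPrimitiveAt F y := fun y hy => by
    have := hF y hy
    rwa [h.coord.fderiv] at this
  have hlim : ∀ x, ‖x‖ < δ' → x ≠ 0 → 0 ≤ s₁ x → 0 ≤ s₂ x →
      ∃ y z, Tendsto F (𝓝[Ω] (κ + x)) (𝓝 y) ∧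
        Tendsto (fun x => u x - F x) (𝓝[Ω] (κ + x)) (𝓝 z) ∧ y + z = u (κ + x) := by
    intro x hx hx0 h1 h2
    have hFev : ∀ᶠ y in 𝓝 (κ + x), y ∈ Ω → h.IsPrimitiveAt F y := by
      have hmem : κ + x ∈ Metric.ball κ δ' := by simpa [dist_eq_norm] using hx
      filter_upwards [Metric.isOpen_ball.mem_nhds hmem] with y hy hyΩ
      refine hFp y ?_
      have := hSΩ (y - κ) (by simpa [dist_eq_norm] using hy)
      rw [add_sub_cancel] at this
      exact this.2 hyΩ
    rcases h1.eq_or_lt with h1 | h1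
    · have h2' : 0 < s₂ x := by
        refine h2.lt_of_ne fun h0 => hx0 ?_
        rw [← w.decomp x, ← h1, ← h0]; simp
      obtain ⟨y, z, hy, hz, hyz⟩ := h.exists_tendsto_of_isDefiningFunction
        (w'.swap.isDefiningFunction hx h2' h1.symm) hFev
      refine ⟨y, z, hy, hz, ?_⟩
      rw [hyz, h.eq_zero]
      rw [w'.mem_iff x hx, ← h1]; simp
    rcases h2.eq_or_lt with h2 | h2
    · obtain ⟨y, z, hy, hz, hyz⟩ := h.exists_tendsto_of_isDefiningFunction
        (w'.isDefiningFunction hx h1 h2.symm) hFev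
      refine ⟨y, z, hy, hz, ?_⟩
      rw [hyz, h.eq_zero]
      rw [w'.mem_iff x hx, ← h2]; simp
    · have hΩ : κ + x ∈ Ω := (w'.mem_iff x hx).2 ⟨h1, h2⟩
      have hc1 : ContinuousAt F (κ + x) := (hFev.self_of_nhds hΩ : HasFDerivAt _ _ _).continuousAt
      have hc2 : ContinuousAt u (κ + x) := (h.differentiableAt hΩ).continuousAt
      exact ⟨F (κ + x), u (κ + x) - F (κ + x), hc1.tendsto.mono_left nhdsWithin_le_nhds,
        (hc2.sub hc1).tendsto.mono_left nhdsWithin_le_nhds, by ring⟩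
  have hWc : MapsTo (fun x => κ + x) {x | ‖x‖ < δ' ∧ x ≠ 0 ∧ 0 ≤ s₁ x ∧ 0 ≤ s₂ x}
      ((fun x => κ + x) '' {x | ‖x‖ < δ' ∧ x ≠ 0 ∧ 0 ≤ s₁ x ∧ 0 ≤ s₂ x}) := mapsTo_image _ _
  have hWcl : (fun x => κ + x) '' {x | ‖x‖ < δ' ∧ x ≠ 0 ∧ 0 ≤ s₁ x ∧ 0 ≤ s₂ x} ⊆ closure Ω := by
    rintro _ ⟨x, ⟨h1, -, h3, h4⟩, rfl⟩
    exact w'.mem_closure h1 h3 h4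
  have hext : ∀ x, ‖x‖ < δ' → κ + x ∈ Ω →
      extendFrom Ω F (κ + x) = F (κ + x) ∧
      extendFrom Ω (fun x => u x - F x) (κ + x) = u (κ + x) - F (κ + x) := by
    intro x hx hΩ
    have hc1 : ContinuousAt F (κ + x) :=
      (hFp _ ((hSΩ x hx).2 hΩ) : HasFDerivAt _ _ _).continuousAt
    have hc2 : ContinuousAt u (κ + x) := (h.differentiableAt hΩ).continuousAt
    exact ⟨extendFrom_eq (subset_closure hΩ) (hc1.tendsto.mono_left nhdsWithin_le_nhds),
      extendFrom_eq (subset_closure hΩ) ((hc2.sub hc1).tendsto.mono_left nhdsWithin_le_nhds)⟩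
  -- The primitives carry no information on the edges; `extendFrom` gives them their limits from
  -- inside.
  refine ⟨δ', extendFrom Ω F, extendFrom Ω (fun x => u x - F x), w', hf', ?_, ?_, ?_, ?_⟩
  · refine (continuousOn_extendFrom hWcl ?_).comp (by fun_prop) hWc
    rintro _ ⟨x, ⟨h1, h2, h3, h4⟩, rfl⟩
    obtain ⟨y, z, hy, hz, -⟩ := hlim x h1 h2 h3 h4
    exact ⟨y, hy⟩
  · refine (continuousOn_extendFrom hWcl ?_).comp (by fun_prop) hWc
    rintro _ ⟨x, ⟨h1, h2, h3, h4⟩, rfl⟩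
    obtain ⟨y, z, hy, hz, -⟩ := hlim x h1 h2 h3 h4
    exact ⟨z, hz⟩
  · intro x hx hΩ
    have hp := hFp _ ((hSΩ x hx).2 hΩ)
    have hev : ∀ᶠ y in 𝓝 (κ + x), y ∈ Ω ∧ ‖y - κ‖ < δ' := by
      refine Filter.Eventually.and (h.isOpen.mem_nhds hΩ) ?_
      have hc : Tendsto (fun y : ℝ × ℝ => ‖y - κ‖) (𝓝 (κ + x)) (𝓝 ‖x‖) :=
        Continuous.tendsto' (by fun_prop) _ _ (by simp)
      exact hc.eventually_lt_const hx
    constructor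
    · refine HasFDerivAt.congr_of_eventuallyEq hp ?_
      filter_upwards [hev] with y hy
      simpa using (hext (y - κ) hy.2 (by simpa using hy.1)).1
    · refine HasFDerivAt.congr_of_eventuallyEq (hp.sub hΩ) ?_
      filter_upwards [hev] with y hy
      simpa using (hext (y - κ) hy.2 (by simpa using hy.1)).2
  · intro x hx hx0 h1 h2
    obtain ⟨y, z, hy, hz, hyz⟩ := hlim x hx hx0 h1 h2
    rw [extendFrom_eq (w'.mem_closure hx h1 h2) hy, extendFrom_eq (w'.mem_closure hx h1 h2) hz,
      hyz]

end IsSmoothSolution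

/-! ### Logarithmic coordinates in a sector -/

/-- Concavity: the sine lies above its chord over [0, θ]. -/
theorem exists_mul_le_sin {θ : ℝ} (h0 : 0 < θ) (h1 : θ < Real.pi) :
    ∃ c > 0, ∀ t, 0 ≤ t → t ≤ θ → c * t ≤ Real.sin t := by
  refine ⟨Real.sin θ / θ, div_pos (Real.sin_pos_of_pos_of_lt_pi h0 h1) h0, fun t ht0 ht1 => ?_⟩
  have := strictConcaveOn_sin_Icc.concaveOn.2 (⟨le_rfl, Real.pi_pos.le⟩ : (0 : ℝ) ∈ Icc 0 Real.pi)
    (⟨h0.le, h1.le⟩ : θ ∈ Icc 0 Real.pi) (show 0 ≤ 1 - t / θ by rw [sub_nonneg, div_le_one h0]; exact ht1)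
    (show 0 ≤ t / θ by positivity) (by ring)
  simp only [smul_eq_mul, Real.sin_zero, mul_zero, zero_add, div_mul_cancel₀ _ h0.ne'] at this
  calc Real.sin θ / θ * t = t / θ * Real.sin θ := by ring
    _ ≤ _ := this

/-- The real coordinates of `exp ζ` in the basis `1, q` of the complex plane. -/
theorem eq_of_add_mul_eq_exp {q ζ : ℂ} {a c : ℝ} (h : a + c * q = Complex.exp ζ) :
    c * q.im = Real.exp ζ.re * Real.sin ζ.im ∧
      a * q.im = ‖q‖ * (Real.exp ζ.re * Real.sin (q.arg - ζ.im)) := by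
  have h1 : c * q.im = Real.exp ζ.re * Real.sin ζ.im := by
    have := congrArg Complex.im h
    simpa [Complex.exp_im] using this
  have h2 : a + c * q.re = Real.exp ζ.re * Real.cos ζ.im := by
    have := congrArg Complex.re h
    simpa [Complex.exp_re] using this
  refine ⟨h1, ?_⟩
  rw [Real.sin_sub]
  have h3 : ‖q‖ * Real.cos q.arg = q.re := Complex.norm_mul_cos_arg q
  have h4 : ‖q‖ * Real.sin q.arg = q.im := Complex.norm_mul_sin_arg q
  linear_combination q.im * h2 - q.re * h1 +
    (Real.exp ζ.re) * (Real.sin ζ.im * h3 - Real.cos ζ.im * h4)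

/-- By `eq_of_add_mul_eq_exp`, a has the sign of the sine of the difference of the arguments, so an
argument beyond that of q would make a negative. -/
theorem arg_add_mul_mem {q : ℂ} (hq : 0 < q.im) {a c : ℝ} (ha : 0 ≤ a) (hc : 0 ≤ c)
    (h0 : (a : ℂ) + c * q ≠ 0) : ((a : ℂ) + c * q).arg ∈ Icc 0 q.arg := by
  have he := Complex.exp_log h0
  obtain ⟨h1, h2⟩ := eq_of_add_mul_eq_exp he.symm
  rw [Complex.log_im] at h2
  have h3 : 0 ≤ ((a : ℂ) + c * q).arg := by
    rw [Complex.arg_nonneg_iff]; simpa using mul_nonneg hc hq.le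
  refine ⟨h3, ?_⟩
  by_contra hlt
  push Not at hlt
  have hq0 : 0 ≤ q.arg := Complex.arg_nonneg_iff.2 hq.le
  have h5 : q.arg ≠ 0 := fun h => hq.ne' (Complex.arg_eq_zero_iff.1 h).2
  have h4 : Real.sin (q.arg - ((a : ℂ) + c * q).arg) < 0 :=
    Real.sin_neg_of_neg_of_neg_pi_lt (by linarith)
      (by have := Complex.arg_le_pi ((a : ℂ) + c * q)
          have := hq0.lt_of_ne h5.symm
          linarith)
  have h6 : 0 < ‖q‖ := norm_pos_iff.2 (by rintro rfl; simp at hq)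
  have h7 : 0 ≤ a * q.im := mul_nonneg ha hq.le
  have h8 : 0 < ‖q‖ * Real.exp (Complex.log ((a : ℂ) + c * q)).re := by positivity
  nlinarith

namespace IsSmoothSolution

variable {Ω : Set (ℝ × ℝ)} {om b : ℂ} {f u : ℝ × ℝ → ℂ} {κ e₁ e₂ : ℝ × ℝ}
  {s₁ s₂ : (ℝ × ℝ) →L[ℝ] ℝ} {δ : ℝ}

/-- The logarithmic coordinate in a sector, with respect to `h.coord`. -/
def logChart (h : IsSmoothSolution Ω om b f u) (e : ℝ × ℝ) (ζ : ℂ) : ℝ × ℝ :=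
  h.coord.symm (h.coord e * Complex.exp ζ)

theorem coord_logChart (h : IsSmoothSolution Ω om b f u) (e : ℝ × ℝ) (ζ : ℂ) :
    h.coord (h.logChart e ζ) = h.coord e * Complex.exp ζ := by
  simp [logChart]

theorem coord_ne_zero (h : IsSmoothSolution Ω om b f u) (w : IsWedgeAt Ω κ e₁ e₂ s₁ s₂ δ) :
    h.coord e₁ ≠ 0 := by
  intro h0
  have h1 : e₁ = 0 := by simpa using h0
  have := w.s₁_e₁
  simp [h1] at this

theorem coord_eq (h : IsSmoothSolution Ω om b f u) (w : IsWedgeAt Ω κ e₁ e₂ s₁ s₂ δ) {q : ℂ}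
    (hq : h.coord e₂ = q * h.coord e₁) (x : ℝ × ℝ) :
    h.coord x = h.coord e₁ * (s₁ x + s₂ x * q) := by
  conv_lhs => rw [← w.decomp x]
  rw [map_add, map_smul, map_smul, hq, Complex.real_smul, Complex.real_smul]; ring

theorem logChart_coords (h : IsSmoothSolution Ω om b f u) (w : IsWedgeAt Ω κ e₁ e₂ s₁ s₂ δ) {q : ℂ}
    (hq : h.coord e₂ = q * h.coord e₁) (ζ : ℂ) :
    (s₁ (h.logChart e₁ ζ) : ℂ) + s₂ (h.logChart e₁ ζ) * q = Complex.exp ζ := by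
  have := h.coord_eq w hq (h.logChart e₁ ζ)
  rw [coord_logChart] at this
  exact (mul_left_cancel₀ (h.coord_ne_zero w) this).symm

theorem hasDerivAt_logChart (h : IsSmoothSolution Ω om b f u) {F : ℝ × ℝ → ℂ} {ζ : ℂ}
    (hF : h.IsPrimitiveAt F (κ + h.logChart e₁ ζ)) :
    HasDerivAt (fun ζ => F (κ + h.logChart e₁ ζ))
      (h.hol (h.coord (κ + h.logChart e₁ ζ)) * (h.coord e₁ * Complex.exp ζ)) ζ := by
  have h1 : HasFDerivAt (fun ζ : ℂ => h.coord e₁ * Complex.exp ζ)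
      ((h.coord e₁ * Complex.exp ζ) • (1 : ℂ →L[ℝ] ℂ)) ζ := by
    have := ((Complex.hasDerivAt_exp ζ).const_mul (h.coord e₁)).hasFDerivAt.restrictScalars ℝ
    refine this.congr_fderiv ?_
    ext; simp [mul_comm]
  have h2 : HasFDerivAt (fun ζ => κ + h.logChart e₁ ζ)
      ((h.coord.symm : ℂ →L[ℝ] ℝ × ℝ).comp ((h.coord e₁ * Complex.exp ζ) • (1 : ℂ →L[ℝ] ℂ))) ζ :=
    (h.coord.symm.hasFDerivAt.comp ζ h1).const_add κ
  have hF' : HasFDerivAt F _ ((fun ζ => κ + h.logChart e₁ ζ) ζ) := hF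
  have h3 := HasFDerivAt.comp ζ hF' h2
  refine (hasFDerivAt_of_restrictScalars ℝ h3 ?_ :
    HasFDerivAt _ (ContinuousLinearMap.toSpanSingleton ℂ
      (h.hol (h.coord (κ + h.logChart e₁ ζ)) * (h.coord e₁ * Complex.exp ζ))) ζ)
  ext; simp; ring

/-- The distance to the edges is at least of the order of e^{Re ζ} times the distance of ζ to the
edges of the strip. The gradient is bounded by its inverse, and the derivative of the exponential
chart contributes e^{Re ζ}, so the exponentials cancel and the constant is uniform along the strip.
-/
theorem exists_strip_bound (h : IsSmoothSolution Ω om b f u) (w : IsWedgeAt Ω κ e₁ e₂ s₁ s₂ δ)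
    {F : ℝ × ℝ → ℂ} (hf : ∀ x, ‖x‖ < δ → f (κ + x) = 0)
    (hFc : ContinuousOn (fun x => F (κ + x)) {x | ‖x‖ < δ ∧ x ≠ 0 ∧ 0 ≤ s₁ x ∧ 0 ≤ s₂ x})
    (hFp : ∀ x, ‖x‖ < δ → κ + x ∈ Ω → h.IsPrimitiveAt F (κ + x)) {q : ℂ}
    (hq : h.coord e₂ = q * h.coord e₁) (hqim : 0 < q.im) :
    ∃ X C : ℝ, 0 ≤ C ∧
      (∀ ζ : ℂ, 0 ≤ ζ.im → ζ.im ≤ q.arg → ζ.re < X →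
        ‖h.logChart e₁ ζ‖ < δ ∧ h.logChart e₁ ζ ≠ 0 ∧ 0 ≤ s₁ (h.logChart e₁ ζ) ∧
          0 ≤ s₂ (h.logChart e₁ ζ)) ∧
      ContinuousOn (fun ζ => F (κ + h.logChart e₁ ζ))
        {ζ | (0 ≤ ζ.im ∧ ζ.im ≤ q.arg) ∧ ζ.re < X} ∧
      ∀ ζ : ℂ, 0 < ζ.im → ζ.im < q.arg → ζ.re < X →
        DifferentiableAt ℂ (fun ζ => F (κ + h.logChart e₁ ζ)) ζ ∧
          ‖deriv (fun ζ => F (κ + h.logChart e₁ ζ)) ζ‖ * min ζ.im (q.arg - ζ.im) ≤ C := by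
  obtain ⟨C₀, hC₀, hgrad⟩ := h.exists_gradient_bound
  obtain ⟨K, hK, hhol⟩ := h.norm_hol_le
  have hq0 : q ≠ 0 := by rintro rfl; simp at hqim
  have hθ1 : q.arg < Real.pi := (Complex.arg_le_pi q).lt_of_ne fun hπ =>
    hqim.ne' (Complex.arg_eq_pi_iff.1 hπ).2
  have hθ0 : 0 < q.arg := (Complex.arg_nonneg_iff.2 hqim.le).lt_of_ne fun h0 =>
    hqim.ne' (Complex.arg_eq_zero_iff.1 h0.symm).2
  obtain ⟨c, hc, hsin⟩ := exists_mul_le_sin hθ0 hθ1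
  have hc1 := h.coord_ne_zero w
  set D := ‖(h.coord.symm : ℂ →L[ℝ] ℝ × ℝ)‖ * ‖h.coord e₁‖ + 1 with hD
  have hD0 : 0 < D := by positivity
  have hxn : ∀ ζ : ℂ, ‖h.logChart e₁ ζ‖ ≤ D * Real.exp ζ.re := by
    intro ζ
    have h1 : ‖h.logChart e₁ ζ‖ ≤ ‖(h.coord.symm : ℂ →L[ℝ] ℝ × ℝ)‖ * ‖h.coord e₁ * Complex.exp ζ‖ :=
      (h.coord.symm : ℂ →L[ℝ] ℝ × ℝ).le_opNorm _
    rw [norm_mul, Complex.norm_exp] at h1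
    rw [hD]; nlinarith [Real.exp_pos ζ.re]
  -- The factor 2 leaves room for a ball around the point of radius at most its norm.
  set X := Real.log (δ / (2 * D)) with hX
  have hxδ : ∀ ζ : ℂ, ζ.re < X → 2 * ‖h.logChart e₁ ζ‖ < δ := by
    intro ζ hζ
    have h1 : Real.exp ζ.re < δ / (2 * D) := by
      rw [← Real.lt_log_iff_exp_lt (div_pos w.pos (by positivity))]; exact hζ
    rw [lt_div_iff₀ (by positivity)] at h1
    linarith [hxn ζ]
  have hx0 : ∀ ζ : ℂ, h.logChart e₁ ζ ≠ 0 := by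
    intro ζ h0
    have := h.coord_logChart e₁ ζ
    rw [h0, map_zero] at this
    exact mul_ne_zero hc1 (Complex.exp_ne_zero ζ) this.symm
  have hcl : ∀ ζ : ℂ, 0 ≤ ζ.im → ζ.im ≤ q.arg → ζ.re < X →
      ‖h.logChart e₁ ζ‖ < δ ∧ h.logChart e₁ ζ ≠ 0 ∧ 0 ≤ s₁ (h.logChart e₁ ζ) ∧
        0 ≤ s₂ (h.logChart e₁ ζ) := by
    intro ζ h1 h2 h3
    obtain ⟨e1, e2⟩ := eq_of_add_mul_eq_exp (h.logChart_coords w hq ζ)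
    refine ⟨by linarith [hxδ ζ h3, norm_nonneg (h.logChart e₁ ζ)], hx0 ζ, ?_, ?_⟩
    · refine nonneg_of_mul_nonneg_left (b := q.im) ?_ hqim
      rw [e2]
      have := Real.sin_nonneg_of_nonneg_of_le_pi (x := q.arg - ζ.im) (by linarith) (by linarith)
      positivity
    · refine nonneg_of_mul_nonneg_left (b := q.im) ?_ hqim
      rw [e1]
      have := Real.sin_nonneg_of_nonneg_of_le_pi (x := ζ.im) (by linarith) (by linarith)
      positivity
  set L := ‖s₁‖ + ‖s₂‖ + 1 with hL
  have hL0 : 0 < L := by positivity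
  set c' := c * min ‖q‖ 1 / q.im with hc'
  have hc'0 : 0 < c' := by
    have := lt_min (norm_pos_iff.2 hq0) one_pos
    positivity
  refine ⟨X, K * C₀ * L * ‖h.coord e₁‖ / c', by positivity, hcl, ?_, ?_⟩
  · refine hFc.comp ?_ fun ζ hζ => hcl ζ hζ.1.1 hζ.1.2 hζ.2
    refine Continuous.continuousOn ?_
    exact h.coord.symm.continuous.comp (continuous_const.mul Complex.continuous_exp)
  · intro ζ h1 h2 h3
    obtain ⟨e1, e2⟩ := eq_of_add_mul_eq_exp (h.logChart_coords w hq ζ)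
    set x := h.logChart e₁ ζ with hx
    set m := min ζ.im (q.arg - ζ.im) with hm
    have hm0 : 0 < m := lt_min h1 (by linarith)
    have hE := Real.exp_pos ζ.re
    have hs1 : c' * (Real.exp ζ.re * m) ≤ s₁ x := by
      have hs := hsin (q.arg - ζ.im) (by linarith) (by linarith)
      have hmm : c * m ≤ Real.sin (q.arg - ζ.im) :=
        (mul_le_mul_of_nonneg_left (min_le_right _ _) hc.le).trans hs
      have : c * min ‖q‖ 1 * (Real.exp ζ.re * m) ≤ s₁ x * q.im := by
        rw [e2]
        calc c * min ‖q‖ 1 * (Real.exp ζ.re * m) = min ‖q‖ 1 * (Real.exp ζ.re * (c * m)) := by ring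
          _ ≤ ‖q‖ * (Real.exp ζ.re * Real.sin (q.arg - ζ.im)) := by
            refine mul_le_mul (min_le_left _ _) (mul_le_mul_of_nonneg_left hmm hE.le)
              (by positivity) (norm_nonneg _)
      rw [hc', div_mul_eq_mul_div, div_le_iff₀ hqim]; exact this
    have hs2 : c' * (Real.exp ζ.re * m) ≤ s₂ x := by
      have hs := hsin ζ.im (by linarith) (by linarith)
      have hmm : c * m ≤ Real.sin ζ.im :=
        (mul_le_mul_of_nonneg_left (min_le_left _ _) hc.le).trans hs
      have : c * min ‖q‖ 1 * (Real.exp ζ.re * m) ≤ s₂ x * q.im := by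
        rw [e1]
        calc c * min ‖q‖ 1 * (Real.exp ζ.re * m) = min ‖q‖ 1 * (Real.exp ζ.re * (c * m)) := by ring
          _ ≤ 1 * (Real.exp ζ.re * Real.sin ζ.im) := by
            refine mul_le_mul (min_le_right _ _) (mul_le_mul_of_nonneg_left hmm hE.le)
              (by positivity) zero_le_one
          _ = _ := one_mul _
      rw [hc', div_mul_eq_mul_div, div_le_iff₀ hqim]; exact this
    -- L dominates the norms of `s₁` and `s₂`, so both stay positive on the ball of this radius.
    set ρ := c' * (Real.exp ζ.re * m) / L with hρ
    have hρ0 : 0 < ρ := by positivity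
    have hxδ' := hxδ ζ h3
    have hρL : ρ * L = c' * (Real.exp ζ.re * m) := div_mul_cancel₀ _ hL0.ne'
    have hρx : ρ ≤ ‖x‖ := by
      have h5 : s₁ x ≤ ‖s₁‖ * ‖x‖ := (le_abs_self _).trans (s₁.le_opNorm x)
      have h6 : ρ * L ≤ ‖x‖ * L := by
        rw [hρL]
        have : ‖s₁‖ ≤ L := by rw [hL]; linarith [norm_nonneg s₂]
        nlinarith [norm_nonneg x]
      exact le_of_mul_le_mul_right h6 hL0
    have hball : ∀ y ∈ Metric.ball (κ + x) ρ, y ∈ Ω ∧ f y = 0 := by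
      intro y hy
      have hyd : ‖(y - κ) - x‖ < ρ := by
        rw [sub_sub]; simpa [dist_eq_norm] using hy
      have hyn : ‖y - κ‖ < δ := by
        have := norm_le_norm_add_norm_sub' (y - κ) x
        linarith
      have hlow : ∀ s : (ℝ × ℝ) →L[ℝ] ℝ, ‖s‖ ≤ L → ρ * L ≤ s x → 0 < s (y - κ) := by
        intro s hsL hsx
        have h5 : |s ((y - κ) - x)| ≤ ‖s‖ * ‖(y - κ) - x‖ := s.le_opNorm _
        have h6 : s (y - κ) = s x + s ((y - κ) - x) := by rw [← map_add]; congr 1; abel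
        have h7 : ‖s‖ * ‖(y - κ) - x‖ < ρ * L := by
          calc ‖s‖ * ‖(y - κ) - x‖ ≤ L * ‖(y - κ) - x‖ :=
                mul_le_mul_of_nonneg_right hsL (norm_nonneg _)
            _ < L * ρ := mul_lt_mul_of_pos_left hyd hL0
            _ = ρ * L := mul_comm _ _
        linarith [neg_abs_le (s ((y - κ) - x))]
      have hmem := (w.mem_iff (y - κ) hyn).2
        ⟨hlow s₁ (by rw [hL]; linarith [norm_nonneg s₂]) (hρL ▸ hs1),
          hlow s₂ (by rw [hL]; linarith [norm_nonneg s₁]) (hρL ▸ hs2)⟩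
      have hfy := hf (y - κ) hyn
      rw [add_sub_cancel] at hmem hfy
      exact ⟨hmem, hfy⟩
    have hg := hgrad (κ + x) ρ hρ0 (fun y hy => (hball y hy).1) (fun y hy => (hball y hy).2)
    have hh := hhol (κ + x) _ hg.1 hg.2
    have hder := h.hasDerivAt_logChart (hFp x (by linarith [norm_nonneg x])
      (hball _ (Metric.mem_ball_self hρ0)).1)
    refine ⟨hder.differentiableAt, ?_⟩
    rw [hder.deriv, norm_mul, norm_mul, Complex.norm_exp]
    calc ‖h.hol (h.coord (κ + x))‖ * (‖h.coord e₁‖ * Real.exp ζ.re) * m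
        ≤ K * (C₀ / ρ) * (‖h.coord e₁‖ * Real.exp ζ.re) * m := by
          gcongr
      _ = K * C₀ * L * ‖h.coord e₁‖ / c' := by
          rw [hρ]; field_simp

end IsSmoothSolution

/-! ### One holomorphic function for both characteristic coordinates -/

theorem add_mul_ne_zero_of_im_ne_zero {q : ℂ} (hq : q.im ≠ 0) {a c : ℝ} (h : 0 < a + c) :
    (a : ℂ) + c * q ≠ 0 := by
  intro h0
  have h1 : c * q.im = 0 := by simpa using congrArg Complex.im h0
  have h2 : c = 0 := (mul_eq_zero.1 h1).resolve_right hq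
  have h3 : a = 0 := by simpa [h2] using congrArg Complex.re h0
  linarith

/-- Re(l log z) = Re l · log|z| − Im l · arg z; the second term is bounded by π|Im l| and the first
tends to −∞ at the corner. -/
theorem exists_re_mul_log_lt {l q : ℂ} (hl : 0 < l.re) (hq : q.im ≠ 0) (T : ℝ) :
    ∃ δ > 0, ∀ a c : ℝ, 0 ≤ a → 0 ≤ c → 0 < a + c → a + c < δ →
      (l * Complex.log (a + c * q)).re < T := by
  refine ⟨Real.exp ((T - |l.im| * Real.pi) / l.re) / (1 + ‖q‖), by positivity,
    fun a c ha hc h0 h => ?_⟩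
  have hz := add_mul_ne_zero_of_im_ne_zero hq h0
  have h1 : ‖(a : ℂ) + c * q‖ < Real.exp ((T - |l.im| * Real.pi) / l.re) := by
    rw [lt_div_iff₀ (by positivity)] at h
    refine lt_of_le_of_lt ?_ h
    refine (norm_add_le _ _).trans ?_
    rw [norm_mul, Complex.norm_real, Complex.norm_real, Real.norm_of_nonneg ha,
      Real.norm_of_nonneg hc]
    nlinarith [norm_nonneg q]
  have h2 : Real.log ‖(a : ℂ) + c * q‖ < (T - |l.im| * Real.pi) / l.re := by
    rwa [Real.log_lt_iff_lt_exp (norm_pos_iff.2 hz)]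
  rw [lt_div_iff₀ hl] at h2
  rw [Complex.mul_re, Complex.log_re, Complex.log_im]
  have h3 : |l.im * ((a : ℂ) + c * q).arg| ≤ |l.im| * Real.pi := by
    rw [abs_mul]
    exact mul_le_mul_of_nonneg_left (Complex.abs_arg_le_pi _) (abs_nonneg _)
  linarith [neg_abs_le (l.im * ((a : ℂ) + c * q).arg)]

theorem arg_add_mul_mem_of_im_neg {q : ℂ} (hq : q.im < 0) {a c : ℝ} (ha : 0 ≤ a) (hc : 0 ≤ c)
    (h0 : 0 < a + c) : ((a : ℂ) + c * q).arg ∈ Icc q.arg 0 := by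
  have hq' : 0 < ((starRingEnd ℂ) q).im := by simpa using hq
  have h1 := arg_add_mul_mem hq' ha hc (add_mul_ne_zero_of_im_ne_zero hq'.ne' h0)
  have h2 : (a : ℂ) + c * (starRingEnd ℂ) q = (starRingEnd ℂ) (a + c * q) := by simp
  rw [h2, Complex.arg_conj, Complex.arg_conj] at h1
  have h3 : ((a : ℂ) + c * q).arg ≠ Real.pi := fun h => by
    have h4 := (Complex.arg_nonneg_iff (z := (a : ℂ) + c * q)).1 (h ▸ Real.pi_pos.le)
    have h5 := (Complex.arg_eq_pi_iff.1 h).2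
    have h6 : c * q.im = 0 := by simpa using h5
    have h7 : c = 0 := (mul_eq_zero.1 h6).resolve_right hq.ne
    have h8 := (Complex.arg_eq_pi_iff.1 h).1
    simp [h7] at h8
    linarith
  have h4 : q.arg ≠ Real.pi := fun h => hq.ne (Complex.arg_eq_pi_iff.1 h).2
  rw [if_neg h3, if_neg h4] at h1
  exact ⟨by linarith [h1.2], by linarith [h1.1]⟩

namespace IsSmoothSolution

variable {Ω : Set (ℝ × ℝ)} {om b : ℂ} {f u : ℝ × ℝ → ℂ} {κ e₁ e₂ : ℝ × ℝ}
  {s₁ s₂ : (ℝ × ℝ) →L[ℝ] ℝ} {δ : ℝ}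

theorem logChart_eq (h : IsSmoothSolution Ω om b f u) {q ζ : ℂ}
    (hq : h.coord e₂ = q * h.coord e₁) {a c : ℝ} (hζ : Complex.exp ζ = a + c * q) :
    h.logChart e₁ ζ = a • e₁ + c • e₂ := by
  rw [logChart, hζ, ContinuousLinearEquiv.symm_apply_eq, map_add, map_smul, map_smul, hq,
    Complex.real_smul, Complex.real_smul]
  ring

/-- In a sector the solution is the difference of the values of one holomorphic function at
complex powers of the two characteristic coordinates. -/
theorem exists_wedge_representation (h : IsSmoothSolution Ω om b f u)
    (w : IsWedgeAt Ω κ e₁ e₂ s₁ s₂ δ) {q q' l : ℂ} (hq : h.coord e₂ = q * h.coord e₁)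
    (hqim : 0 < q.im) (hq' : h.neg.coord e₂ = q' * h.neg.coord e₁) (hqim' : q'.im < 0)
    (hl : l * (Complex.log q - Complex.log q') = 2 * Real.pi * Complex.I) (hlre : 0 < l.re) :
    ∃ (N : ℂ → ℂ) (η δ' : ℝ), 0 < η ∧ 0 < δ' ∧ DifferentiableOn ℂ N (Metric.ball 0 η) ∧
      ∀ a c : ℝ, 0 ≤ a → 0 ≤ c → 0 < a + c → a + c < δ' →
        u (κ + (a • e₁ + c • e₂)) = N (Complex.exp (l * Complex.log (a + c * q))) -
          N (Complex.exp (l * Complex.log (a + c * q'))) := by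
  obtain ⟨δ₁, F, G, w₁, hf, hFc, hGc, hp, hsum⟩ := h.exists_wedge_splitting w
  have hq0 : q ≠ 0 := by rintro rfl; simp at hqim
  have hq0' : q' ≠ 0 := by rintro rfl; simp at hqim'
  -- The second coordinate reverses orientation, so its strip is built from e₂; the ratio is then
  -- q'⁻¹, with positive imaginary part.
  have hqi : h.neg.coord e₁ = q'⁻¹ * h.neg.coord e₂ := by rw [hq', inv_mul_cancel_left₀ hq0']
  have hqim'' : 0 < (q'⁻¹).im := by
    rw [Complex.inv_im]
    exact div_pos (by linarith) (Complex.normSq_pos.2 hq0')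
  obtain ⟨X₁, C₁, hC₁, hin₁, hc₁, hd₁⟩ := h.exists_strip_bound w₁ hf hFc
    (fun x hx hΩ => (hp x hx hΩ).1) hq hqim
  obtain ⟨X₂, C₂, hC₂, hin₂, hc₂, hd₂⟩ := h.neg.exists_strip_bound (e₁ := e₂) (e₂ := e₁) w₁.swap hf
    (by convert hGc using 4; tauto)
    (fun x hx hΩ => (hp x hx hΩ).2) hqi hqim''
  have hargb : (q'⁻¹).arg = -q'.arg := by
    rw [Complex.arg_inv, if_neg fun h => hqim'.ne (Complex.arg_eq_pi_iff.1 h).2]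
  have hchart : ∀ ζ, h.neg.logChart e₂ (ζ - Complex.log q') = h.neg.logChart e₁ ζ := by
    intro ζ
    rw [logChart, logChart, hq', Complex.exp_sub, Complex.exp_log hq0']
    congr 1; field_simp
  set θa := q.arg with hθa
  set θb := -q'.arg with hθb
  have hθa0 : 0 < θa := (Complex.arg_nonneg_iff.2 hqim.le).lt_of_ne fun h0 =>
    hqim.ne' (Complex.arg_eq_zero_iff.1 h0.symm).2
  have hθb0 : 0 < θb := by
    have := Complex.arg_neg_iff.2 hqim'
    rw [hθb]; linarith
  rw [hargb] at hin₂ hc₂ hd₂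
  set P := Complex.log q - Complex.log q' with hP
  set A : ℂ → ℂ := fun ζ => F (κ + h.logChart e₁ ζ) with hA
  set B₂ : ℂ → ℂ := fun ζ => G (κ + h.neg.logChart e₂ ζ) with hB₂
  -- The shift passes from the logarithmic coordinate based at e₂ to the one based at e₁.
  set B : ℂ → ℂ := fun ζ => -B₂ (ζ - Complex.log q') with hB
  have hBe : ∀ ζ, B ζ = -G (κ + h.neg.logChart e₁ ζ) := fun ζ => by
    simp only [hB, hB₂, hchart]
  have hPim : P.im = θa + θb := by
    rw [hP, Complex.sub_im, Complex.log_im, Complex.log_im]; ring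
  set X := min X₁ (X₂ + Real.log ‖q'‖) with hX
  -- Within the strips, Re(l z) < −R forces Re z < X, where both charts land in the sector.
  set R := |l.im| * (θa + θb) - l.re * X with hR
  have hstrip : ∀ z : ℂ, -θb ≤ z.im → z.im ≤ θa → (l * z).re < -R → z.re < X := by
    intro z h1 h2 h3
    rw [Complex.mul_re] at h3
    have h4 : |l.im * z.im| ≤ |l.im| * (θa + θb) := by
      rw [abs_mul]
      exact mul_le_mul_of_nonneg_left (abs_le.2 ⟨by linarith, by linarith⟩) (abs_nonneg _)
    have h5 : l.re * z.re < l.re * X := by linarith [le_abs_self (l.im * z.im)]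
    exact lt_of_mul_lt_mul_left h5 hlre.le
  have himB : ∀ z : ℂ, (z - Complex.log q').im = z.im + θb := fun z => by
    rw [Complex.sub_im, Complex.log_im]; ring
  have hreB : ∀ z : ℂ, z.re < X → (z - Complex.log q').re < X₂ := fun z hz => by
    rw [Complex.sub_re, Complex.log_re]
    linarith [hz.trans_le (min_le_right _ _)]
  have hzero : ∀ x : ℝ × ℝ, ‖x‖ < δ₁ → x ≠ 0 → 0 ≤ s₁ x → 0 ≤ s₂ x → (s₁ x = 0 ∨ s₂ x = 0) →
      F (κ + x) = -G (κ + x) := by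
    intro x h1 h2 h3 h4 h5
    rw [eq_neg_iff_add_eq_zero, hsum x h1 h2 h3 h4, h.eq_zero]
    rw [w₁.mem_iff x h1]
    rintro ⟨h6, h7⟩
    rcases h5 with h5 | h5 <;> linarith
  obtain ⟨M, R', C', hper, hMA, hMB, hMd⟩ := exists_periodic_extension (A := A) (B := B) (P := P)
    (l := l) (R := R) (C := max C₁ C₂) hθa0 hθb0 hPim (by rw [hl]; simp)
    (hC₁.trans (le_max_left _ _))
    (hc₁.mono fun z hz => ⟨hz.1, (hstrip z (by linarith [hz.1.1]) hz.1.2 hz.2).trans_le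
      (min_le_left _ _)⟩)
    ((hc₂.comp (by fun_prop : ContinuousOn (fun z : ℂ => z - Complex.log q') _)
      (fun z hz => ⟨⟨by rw [himB]; linarith [hz.1.1], by rw [himB]; linarith [hz.1.2]⟩,
        hreB z (hstrip z hz.1.1 (by linarith [hz.1.2]) hz.2)⟩)).neg)
    (by
      intro z hz hzR
      have hzX := hstrip z (by linarith) (by linarith) hzR
      -- On the real axis both charts give the same point of the edge e₁.
      have he : Complex.exp z = (Real.exp z.re : ℝ) + (0 : ℝ) * q := by
        have : z = (z.re : ℂ) := Complex.ext (by simp) (by simp [hz])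
        rw [this]; simp
      have he' : Complex.exp z = (Real.exp z.re : ℝ) + (0 : ℝ) * q' := by rw [he]; simp
      have hin := hin₁ z hz.ge (by linarith) (hzX.trans_le (min_le_left _ _))
      rw [hBe, hA]
      simp only
      rw [h.neg.logChart_eq hq' he', ← h.logChart_eq hq he]
      refine hzero _ hin.1 hin.2.1 hin.2.2.1 hin.2.2.2 (Or.inr ?_)
      rw [h.logChart_eq hq he]; simp [w₁.s₂_e₁])
    (by
      intro z hz hzR
      have hzX := hstrip z (by linarith) (by linarith) hzR
      have hqe : q = ‖q‖ * Complex.exp (θa * Complex.I) := (Complex.norm_mul_exp_arg_mul_I q).symm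
      have hqn : (‖q‖ : ℂ) ≠ 0 := by simpa using hq0
      -- At height arg q the first chart gives a point of the edge e₂, and the second chart gives
      -- the same point after translation by P.
      have he : Complex.exp z = (0 : ℝ) + (Real.exp z.re / ‖q‖ : ℝ) * q := by
        have : Complex.exp z = Real.exp z.re * Complex.exp (θa * Complex.I) := by
          rw [Complex.ofReal_exp, ← Complex.exp_add, ← hz, Complex.re_add_im]
        rw [this]
        conv_rhs => rw [hqe]
        push_cast
        rw [norm_mul, Complex.norm_exp_ofReal_mul_I]
        simp
        field_simp
      have he' : Complex.exp (z - P) = (0 : ℝ) + (Real.exp z.re / ‖q‖ : ℝ) * q' := by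
        rw [hP, Complex.exp_sub, Complex.exp_sub, Complex.exp_log hq0, Complex.exp_log hq0', he]
        field_simp
        simp only [Complex.ofReal_zero, zero_add]
        ring
      have hin := hin₁ z (by linarith) hz.le (hzX.trans_le (min_le_left _ _))
      rw [hBe, hA]
      simp only
      rw [h.neg.logChart_eq hq' he', ← h.logChart_eq hq he]
      refine hzero _ hin.1 hin.2.1 hin.2.2.1 hin.2.2.2 (Or.inl ?_)
      rw [h.logChart_eq hq he]; simp [w₁.s₁_e₂])
    (by
      intro z h1 h2 h3
      have := hd₁ z h1 h2 ((hstrip z (by linarith) h2.le h3).trans_le (min_le_left _ _))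
      exact ⟨this.1, this.2.trans (le_max_left _ _)⟩)
    (by
      intro z h1 h2 h3
      have := hd₂ (z - Complex.log q') (by rw [himB]; linarith) (by rw [himB]; linarith)
        (hreB z (hstrip z h1.le (by linarith) h3))
      rw [himB] at this
      have hder : deriv B z = -deriv B₂ (z - Complex.log q') := by
        rw [hB, deriv.fun_neg, deriv_comp_sub_const]
      refine ⟨(this.1.comp (g := B₂) z (by fun_prop)).neg, ?_⟩
      rw [hder, norm_neg]
      refine le_trans (le_of_eq ?_) (this.2.trans (le_max_right _ _))
      rw [min_comm, add_comm θb, show θb - (z.im + θb) = -z.im by ring])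
  obtain ⟨N, η, hη, hN, hηR, hMN⟩ := exists_factor_exp hl hper hMd
  have hlogη : Real.log η ≤ -R' := (Real.log_le_iff_le_exp hη).2 hηR
  obtain ⟨δa, hδa, hLa⟩ := exists_re_mul_log_lt hlre hqim.ne' (Real.log η)
  obtain ⟨δb, hδb, hLb⟩ := exists_re_mul_log_lt hlre hqim'.ne (Real.log η)
  have hw1 := w₁.pos
  refine ⟨N, η, min (min δa δb) (δ₁ / (‖e₁‖ + ‖e₂‖ + 1)), hη, by positivity, hN,
    fun a c ha hc h0 hlt => ?_⟩
  have h1 : a + c < δa := hlt.trans_le ((min_le_left _ _).trans (min_le_left _ _))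
  have h2 : a + c < δb := hlt.trans_le ((min_le_left _ _).trans (min_le_right _ _))
  have h3 : a + c < δ₁ / (‖e₁‖ + ‖e₂‖ + 1) := hlt.trans_le (min_le_right _ _)
  have hza := add_mul_ne_zero_of_im_ne_zero hqim.ne' h0
  have hzb := add_mul_ne_zero_of_im_ne_zero hqim'.ne h0
  have hxn : ‖a • e₁ + c • e₂‖ < δ₁ := by
    rw [lt_div_iff₀ (by positivity)] at h3
    refine lt_of_le_of_lt ?_ h3
    refine (norm_add_le _ _).trans ?_
    rw [norm_smul, norm_smul, Real.norm_of_nonneg ha, Real.norm_of_nonneg hc]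
    nlinarith [norm_nonneg e₁, norm_nonneg e₂]
  have hs1 : s₁ (a • e₁ + c • e₂) = a := by simp [w.s₁_e₁, w.s₁_e₂]
  have hs2 : s₂ (a • e₁ + c • e₂) = c := by simp [w.s₂_e₁, w.s₂_e₂]
  have hx0 : a • e₁ + c • e₂ ≠ 0 := by
    intro hx
    rw [hx, map_zero] at hs1 hs2
    linarith
  have hLA := hLa a c ha hc h0 h1
  have hLB := hLb a c ha hc h0 h2
  have hargA := arg_add_mul_mem hqim ha hc hza
  have hargB := arg_add_mul_mem_of_im_neg hqim' ha hc h0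
  have eA := hMA _ (by rw [Complex.log_im]; exact hargA.1) (by rw [Complex.log_im]; exact hargA.2)
    (hLA.trans_le hlogη)
  have eB := hMB _ (by rw [Complex.log_im]; linarith [hargB.1])
    (by rw [Complex.log_im]; exact hargB.2) (hLB.trans_le hlogη)
  rw [hMN _ hLA] at eA
  rw [hMN _ hLB] at eB
  rw [← eA, ← eB, hBe, hA]
  simp only
  rw [h.logChart_eq hq (Complex.exp_log hza), h.neg.logChart_eq hq' (Complex.exp_log hzb),
    sub_neg_eq_add, hsum _ hxn hx0 (by rwa [hs1]) (by rwa [hs2])]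

end IsSmoothSolution

/-! ### Geometry of a corner of type (μ, ν) -/

/-- The linear form `ell s lam`. -/
def ellCLM (s : ℤˣ) (lam : ℝ) : (ℝ × ℝ) →L[ℝ] ℝ :=
  (((s : ℤ) : ℝ) / lam) • ContinuousLinearMap.fst ℝ ℝ ℝ +
    (Real.sqrt (1 - lam ^ 2))⁻¹ • ContinuousLinearMap.snd ℝ ℝ ℝ

theorem ellCLM_apply (s : ℤˣ) (lam : ℝ) (x : ℝ × ℝ) : ellCLM s lam x = ell s lam x := by
  simp [ellCLM, ell]; ring

/-- The direction with blown-up coordinates `r = 1` and the given `τ`. -/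
def cornerDir (lam : ℝ) (μ ν : ℤˣ) (τ : ℝ) : ℝ × ℝ :=
  (((ν : ℤ) : ℝ) * ((μ : ℤ) : ℝ) * lam * (τ - 1) / 2,
    ((μ : ℤ) : ℝ) * Real.sqrt (1 - lam ^ 2) * (τ + 1) / 2)

theorem blowdown_eq (lam : ℝ) (κ : ℝ × ℝ) (μ ν : ℤˣ) (r τ : ℝ) :
    blowdown lam κ μ ν (r, τ) = κ + r • cornerDir lam μ ν τ := by
  simp only [blowdown, cornerDir, Prod.smul_mk, smul_eq_mul]
  congr 2 <;> ring

theorem sign_mul_self (μ : ℤˣ) : ((μ : ℤ) : ℝ) * ((μ : ℤ) : ℝ) = 1 := by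
  rcases Int.units_eq_one_or μ with rfl | rfl <;> simp

theorem ell_neg_cornerDir {lam : ℝ} (h0 : 0 < lam) (h1 : lam < 1) (μ ν : ℤˣ) (τ : ℝ) :
    ((μ : ℤ) : ℝ) * ell (-ν) lam (cornerDir lam μ ν τ) = 1 := by
  have := ell_neg_blowdown h0 h1 0 μ ν 1 τ
  rwa [blowdown_eq, one_smul, zero_add, sub_zero] at this

theorem ell_cornerDir {lam : ℝ} (h0 : 0 < lam) (h1 : lam < 1) (μ ν : ℤˣ) (τ : ℝ) :
    ((μ : ℤ) : ℝ) * ell ν lam (cornerDir lam μ ν τ) = τ := by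
  have := ell_blowdown h0 h1 0 μ ν 1 τ
  rw [blowdown_eq, one_smul, zero_add, sub_zero] at this
  rw [this, mul_left_comm, ell_neg_cornerDir h0 h1, mul_one]

theorem cornerDir_eq {αm αp : ℝ} (hαm : 0 < αm) (hαp : 0 < αp) (lam : ℝ) (μ ν : ℤˣ) (τ : ℝ) :
    cornerDir lam μ ν τ = ((αp - τ) / (αp + αm)) • cornerDir lam μ ν (-αm) +
      ((τ + αm) / (αp + αm)) • cornerDir lam μ ν αp := by
  have : αp + αm ≠ 0 := by positivity
  simp only [cornerDir, Prod.smul_mk, smul_eq_mul, Prod.mk_add_mk]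
  congr 1 <;> field_simp <;> ring

theorem eq_of_ell_eq {lam : ℝ} (h0 : 0 < lam) (h1 : lam < 1) (ν : ℤˣ) {x y : ℝ × ℝ}
    (hx : ell ν lam x = ell ν lam y) (hy : ell (-ν) lam x = ell (-ν) lam y) : x = y := by
  have hs : Real.sqrt (1 - lam ^ 2) ≠ 0 := (Real.sqrt_pos.2 (by nlinarith)).ne'
  have key : x.1 / lam = y.1 / lam ∧
      x.2 / Real.sqrt (1 - lam ^ 2) = y.2 / Real.sqrt (1 - lam ^ 2) := by
    rcases Int.units_eq_one_or ν with rfl | rfl <;> simp [ell] at hx hy <;>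
      constructor <;> linarith
  exact Prod.ext ((div_left_inj' h0.ne').1 key.1) ((div_left_inj' hs).1 key.2)

/-- Near a corner of type `(μ, ν)` the domain is a sector. -/
theorem IsCornerOfType.exists_isWedgeAt {Ω : Set (ℝ × ℝ)} (hΩ : IsOpen Ω) {lam : ℝ} (h0 : 0 < lam)
    (h1 : lam < 1) {κ : ℝ × ℝ} {μ ν : ℤˣ} {αm αp : ℝ} (hκ : IsCornerOfType Ω lam κ μ ν αm αp) :
    ∃ (s₁ s₂ : (ℝ × ℝ) →L[ℝ] ℝ) (δ : ℝ),
      IsWedgeAt Ω κ (cornerDir lam μ ν (-αm)) (cornerDir lam μ ν αp) s₁ s₂ δ := by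
  have hαm := hκ.αm_pos
  have hαp := hκ.αp_pos
  have hα : 0 < αp + αm := by positivity
  set m : ℝ := ((μ : ℤ) : ℝ) with hm
  have hmm : m * m = 1 := sign_mul_self μ
  set rr : (ℝ × ℝ) →L[ℝ] ℝ := m • ellCLM (-ν) lam with hrr
  set ss : (ℝ × ℝ) →L[ℝ] ℝ := m • ellCLM ν lam with hss
  have rr_apply : ∀ x, rr x = m * ell (-ν) lam x := fun x => by
    rw [hrr, _root_.smul_apply, ellCLM_apply, smul_eq_mul]
  have ss_apply : ∀ x, ss x = m * ell ν lam x := fun x => by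
    rw [hss, _root_.smul_apply, ellCLM_apply, smul_eq_mul]
  -- With rr = r and ss = rτ, the edges τ = α₊ and τ = −α₋ are cut out by the vanishing of s₁ and
  -- s₂.
  set s₁ : (ℝ × ℝ) →L[ℝ] ℝ := (αp + αm)⁻¹ • (αp • rr - ss) with hs₁
  set s₂ : (ℝ × ℝ) →L[ℝ] ℝ := (αp + αm)⁻¹ • (ss + αm • rr) with hs₂
  have s₁_apply : ∀ x, s₁ x = (αp + αm)⁻¹ * (αp * rr x - ss x) := fun x => by simp [hs₁]
  have s₂_apply : ∀ x, s₂ x = (αp + αm)⁻¹ * (ss x + αm * rr x) := fun x => by simp [hs₂, mul_add]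
  have hrd : ∀ τ, rr (cornerDir lam μ ν τ) = 1 := fun τ => by
    rw [rr_apply, ell_neg_cornerDir h0 h1]
  have hsd : ∀ τ, ss (cornerDir lam μ ν τ) = τ := fun τ => by rw [ss_apply, ell_cornerDir h0 h1]
  have hrs : ∀ x, rr x = s₁ x + s₂ x := fun x => by
    rw [s₁_apply, s₂_apply]; field_simp; ring
  have hss' : ∀ x, ss x = αp * s₂ x - αm * s₁ x := fun x => by
    rw [s₁_apply, s₂_apply]; field_simp; ring
  obtain ⟨U, hU, δ, hδ, hbd⟩ := hκ.boundary
  obtain ⟨ρ₁, hρ₁, hUball⟩ := Metric.mem_nhds_iff.1 hU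
  obtain ⟨ρ₂, hρ₂, hsball⟩ := Metric.eventually_nhds_iff.1
    ((ss.continuous.norm.tendsto' 0 0 (by simp)).eventually_lt_const hδ)
  set ρ := min ρ₁ ρ₂ with hρ
  have hρ0 : 0 < ρ := lt_min hρ₁ hρ₂
  -- In a small ball |ss| < δ holds automatically, so the two boundary pieces become rays.
  have hfr : ∀ x, ‖x‖ < ρ → (κ + x ∈ frontier Ω ↔
      (s₂ x = 0 ∧ 0 ≤ s₁ x) ∨ (s₁ x = 0 ∧ 0 ≤ s₂ x)) := by
    intro x hx
    have hxU : κ + x ∈ U := hUball (by simpa [dist_eq_norm] using hx.trans_le (min_le_left _ _))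
    have hsδ := hsball (y := x) (by simpa [dist_eq_norm] using hx.trans_le (min_le_right _ _))
    rw [Real.norm_eq_abs, abs_lt] at hsδ
    have h2 : κ + x ∈ frontier Ω ↔ κ + x ∈ U ∩ frontier Ω := by simp [hxU]
    rw [h2, hbd]
    simp only [mem_union, mem_ofPred_eq, add_sub_cancel_left, mem_Ioc, mem_Ico, ← hm, ← ss_apply]
    have e1 : ell ν lam x = m * ss x := by rw [ss_apply, ← mul_assoc, hmm, one_mul]
    have e2 : ell (-ν) lam x = m * rr x := by rw [rr_apply, ← mul_assoc, hmm, one_mul]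
    have hm0 : m ≠ 0 := fun h => by simp [h] at hmm
    have e3 : ell ν lam x = -αm * ell (-ν) lam x ↔ s₂ x = 0 := by
      rw [e1, e2, mul_left_comm, mul_right_inj' hm0, hss', hrs]
      constructor
      · intro h; have : (αp + αm) * s₂ x = 0 := by linarith
        exact (mul_eq_zero.1 this).resolve_left hα.ne'
      · intro h; rw [h]; ring
    have e4 : ell ν lam x = αp * ell (-ν) lam x ↔ s₁ x = 0 := by
      rw [e1, e2, mul_left_comm, mul_right_inj' hm0, hss', hrs]
      constructor
      · intro h; have : (αp + αm) * s₁ x = 0 := by linarith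
        exact (mul_eq_zero.1 this).resolve_left hα.ne'
      · intro h; rw [h]; ring
    rw [e3, e4]
    refine or_congr (and_congr_right fun h => ?_) (and_congr_right fun h => ?_)
    · have : ss x = -(αm * s₁ x) := by rw [hss', h]; ring
      constructor
      · intro h'
        have : 0 ≤ αm * s₁ x := by linarith [h'.2]
        exact nonneg_of_mul_nonneg_right this hαm
      · intro h'
        exact ⟨hsδ.1, by rw [this]; linarith [mul_nonneg hαm.le h']⟩
    · have : ss x = αp * s₂ x := by rw [hss', h]; ring
      constructor
      · intro h'
        exact nonneg_of_mul_nonneg_right (by linarith [h'.1] : 0 ≤ αp * s₂ x) hαp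
      · intro h'
        exact ⟨by rw [this]; exact mul_nonneg hαp.le h', hsδ.2⟩
  have hside : ∀ x, κ + x ∈ Ω → 0 ≤ rr x := fun x hx => by
    rw [rr_apply]; simpa using hκ.side _ hx
  have hκfr : κ ∈ frontier Ω := hκ.mem_corners.1
  -- A convex, hence connected, set that misses the boundary lies entirely inside Ω or entirely
  -- outside.
  have hconn : ∀ S : Set (ℝ × ℝ), Convex ℝ S → (∀ x ∈ S, κ + x ∉ frontier Ω) →
      (∃ x ∈ S, κ + x ∈ Ω) → ∀ x ∈ S, κ + x ∈ Ω := by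
    rintro S hS hSf ⟨y, hy, hyΩ⟩ x hx
    have hout : ∀ z ∈ S, κ + z ∉ Ω → κ + z ∈ (closure Ω)ᶜ := fun z hz hzΩ hcl =>
      hSf z hz (hΩ.frontier_eq ▸ ⟨hcl, hzΩ⟩)
    by_contra hxΩ
    obtain ⟨z, -, hz1, hz2⟩ := (hS.translate κ).isPreconnected Ω (closure Ω)ᶜ hΩ
      isClosed_closure.isOpen_compl
      (by rintro _ ⟨z, hz, rfl⟩; by_cases h : κ + z ∈ Ω
          · exact Or.inl h
          · exact Or.inr (hout z hz h))
      ⟨_, ⟨y, hy, rfl⟩, hyΩ⟩ ⟨_, ⟨x, hx, rfl⟩, hout x hx hxΩ⟩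
    exact hz2 (subset_closure hz1)
  have hballc : Convex ℝ {x : ℝ × ℝ | ‖x‖ < ρ} := by
    have : {x : ℝ × ℝ | ‖x‖ < ρ} = Metric.ball 0 ρ := by ext; simp
    rw [this]; exact convex_ball _ _
  have hsmall : ∀ v : ℝ × ℝ, ∃ t : ℝ, 0 < t ∧ ‖-(t • v)‖ < ρ := fun v => by
    refine ⟨ρ / (‖v‖ + 1) / 2, by positivity, ?_⟩
    rw [norm_neg, norm_smul, Real.norm_of_nonneg (by positivity), div_div, div_mul_eq_mul_div,
      div_lt_iff₀ (by positivity)]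
    nlinarith [norm_nonneg v]
  have s11 : s₁ (cornerDir lam μ ν (-αm)) = 1 := by
    rw [s₁_apply, hrd, hsd]; field_simp; ring
  have s12 : s₁ (cornerDir lam μ ν αp) = 0 := by rw [s₁_apply, hrd, hsd]; ring
  have s21 : s₂ (cornerDir lam μ ν (-αm)) = 0 := by rw [s₂_apply, hrd, hsd]; ring
  have s22 : s₂ (cornerDir lam μ ν αp) = 1 := by
    rw [s₂_apply, hrd, hsd]; field_simp
  -- If Ω met the half disc s₁ < 0, it would contain all of it, including points opposite to the
  -- edge, where r < 0; the one-sidedness of the corner forbids that.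
  have hD1 : ∀ x, ‖x‖ < ρ → s₁ x < 0 → κ + x ∉ Ω := by
    intro x hx hx1 hxΩ
    obtain ⟨t, ht, htρ⟩ := hsmall (cornerDir lam μ ν (-αm))
    have := hconn ({x | ‖x‖ < ρ} ∩ {x | s₁ x < 0})
      (hballc.inter (convex_halfSpace_lt s₁.isLinear 0)) (fun y hy => by
        rw [hfr y hy.1]
        have h2 : s₁ y < 0 := hy.2
        rintro (h | h) <;> linarith [h.1, h.2]) ⟨x, ⟨hx, hx1⟩, hxΩ⟩
      (-(t • cornerDir lam μ ν (-αm))) ⟨htρ, by simp [s11, ht]⟩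
    have h2 := hside _ this
    rw [map_neg, map_smul, hrd, smul_eq_mul] at h2
    linarith
  have hD2 : ∀ x, ‖x‖ < ρ → s₂ x < 0 → κ + x ∉ Ω := by
    intro x hx hx1 hxΩ
    obtain ⟨t, ht, htρ⟩ := hsmall (cornerDir lam μ ν αp)
    have := hconn ({x | ‖x‖ < ρ} ∩ {x | s₂ x < 0})
      (hballc.inter (convex_halfSpace_lt s₂.isLinear 0)) (fun y hy => by
        rw [hfr y hy.1]
        have h2 : s₂ y < 0 := hy.2
        rintro (h | h) <;> linarith [h.1, h.2]) ⟨x, ⟨hx, hx1⟩, hxΩ⟩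
      (-(t • cornerDir lam μ ν αp)) ⟨htρ, by simp [s22, ht]⟩
    have h2 := hside _ this
    rw [map_neg, map_smul, hrd, smul_eq_mul] at h2
    linarith
  have hT : ∀ x, ‖x‖ < ρ → κ + x ∈ Ω → 0 < s₁ x ∧ 0 < s₂ x := by
    intro x hx hxΩ
    have h2 : 0 ≤ s₁ x := not_lt.1 fun h => hD1 x hx h hxΩ
    have h3 : 0 ≤ s₂ x := not_lt.1 fun h => hD2 x hx h hxΩ
    have hnf : κ + x ∉ frontier Ω := fun h => by
      rw [hΩ.frontier_eq] at h; exact h.2 hxΩ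
    rw [hfr x hx] at hnf
    exact ⟨h2.lt_of_ne fun h => hnf (Or.inr ⟨h.symm, h3⟩),
      h3.lt_of_ne fun h => hnf (Or.inl ⟨h.symm, h2⟩)⟩
  refine ⟨s₁, s₂, ρ, hρ0, fun x => ?_, s11, s12, s21, s22, fun x hx => ⟨hT x hx, fun hx' => ?_⟩⟩
  · have hm0 : m ≠ 0 := fun h => by simp [h] at hmm
    refine eq_of_ell_eq h0 h1 ν ?_ ?_
    · have : ss (s₁ x • cornerDir lam μ ν (-αm) + s₂ x • cornerDir lam μ ν αp) = ss x := by
        rw [map_add, map_smul, map_smul, hsd, hsd, hss' x, smul_eq_mul, smul_eq_mul]; ring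
      rw [ss_apply, ss_apply] at this
      exact mul_left_cancel₀ hm0 this
    · have : rr (s₁ x • cornerDir lam μ ν (-αm) + s₂ x • cornerDir lam μ ν αp) = rr x := by
        rw [map_add, map_smul, map_smul, hrd, hrd, hrs x, smul_eq_mul, smul_eq_mul]; ring
      rw [rr_apply, rr_apply] at this
      exact mul_left_cancel₀ hm0 this
  -- Conversely, κ is a boundary point, so Ω has points nearby; they lie in the sector, and
  -- connectedness fills the rest of it.
  · obtain ⟨y, hyΩ, hyd⟩ := Metric.mem_closure_iff.1 (frontier_subset_closure hκfr) ρ hρ0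
    have hyn : ‖y - κ‖ < ρ := by rw [← dist_eq_norm, dist_comm]; exact hyd
    have hy : κ + (y - κ) ∈ Ω := by rwa [add_sub_cancel]
    exact hconn ({x | ‖x‖ < ρ} ∩ ({x | 0 < s₁ x} ∩ {x | 0 < s₂ x}))
      (hballc.inter ((convex_halfSpace_gt s₁.isLinear 0).inter (convex_halfSpace_gt s₂.isLinear 0)))
      (fun z hz => by
        rw [hfr z hz.1]
        have h2 : 0 < s₁ z := hz.2.1
        have h3 : 0 < s₂ z := hz.2.2
        rintro (h | h) <;> linarith [h.1, h.2]) ⟨y - κ, ⟨hyn, hT _ hyn hy⟩, hy⟩ x ⟨hx, hx'⟩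

/-! ### Polyhomogeneous expansions from Taylor expansions -/

/-- The complex power `r ^ p` of a positive real number. -/
def realPow (p : ℂ) (r : ℝ) : ℂ := Complex.exp (p * (Real.log r : ℝ))

theorem realPow_add (p q : ℂ) (r : ℝ) : realPow (p + q) r = realPow p r * realPow q r := by
  rw [realPow, add_mul, Complex.exp_add]; rfl

theorem realPow_eq_cpow (p : ℂ) {r : ℝ} (hr : 0 < r) : (r : ℂ) ^ p = realPow p r := by
  rw [Complex.cpow_def_of_ne_zero (by exact_mod_cast hr.ne'), realPow, Complex.ofReal_log hr.le,
    mul_comm]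

theorem norm_realPow (p : ℂ) {r : ℝ} (hr : 0 < r) : ‖realPow p r‖ = r ^ p.re := by
  rw [← realPow_eq_cpow p hr, Complex.norm_cpow_eq_rpow_re_of_pos hr]

theorem realPow_mul_natCast (p : ℂ) (r : ℝ) (k : ℕ) : realPow (p * k) r = realPow p r ^ k := by
  rw [realPow, realPow, ← Complex.exp_nat_mul]; congr 1; ring

theorem hasDerivAt_realPow (p : ℂ) {r : ℝ} (hr : 0 < r) :
    HasDerivAt (realPow p) (p * realPow (p - 1) r) r := by
  have h1 : HasDerivAt (fun r : ℝ => p * ((Real.log r : ℝ) : ℂ)) (p * ((r⁻¹ : ℝ) : ℂ)) r :=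
    ((Real.hasDerivAt_log hr.ne').ofReal_comp).const_mul p
  have h2 := h1.cexp
  have h3 : realPow (-1) r = ((r⁻¹ : ℝ) : ℂ) := by
    rw [← realPow_eq_cpow _ hr, Complex.cpow_neg_one]; push_cast; rfl
  rw [sub_eq_add_neg, realPow_add, h3]
  exact h2.congr_deriv (by rw [realPow]; ring)

/-- The coefficients of the Taylor expansion at the origin. -/
def taylorCoeff (N : ℂ → ℂ) (k : ℕ) : ℂ := ((fun g => dslope g 0)^[k] N) 0

theorem differentiableOn_iterate_dslope {N : ℂ → ℂ} {η : ℝ} (hη : 0 < η)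
    (hN : DifferentiableOn ℂ N (Metric.ball 0 η)) (k : ℕ) :
    DifferentiableOn ℂ ((fun g => dslope g 0)^[k] N) (Metric.ball 0 η) := by
  induction k with
  | zero => exact hN
  | succ k ih =>
    rw [Function.iterate_succ_apply']
    exact (Complex.differentiableOn_dslope (Metric.ball_mem_nhds 0 hη)).2 ih

/-- Iterating g(ξ) = g(0) + ξ · `dslope g 0 ξ` writes the remainder as a power times a function that
is again holomorphic, so that it can be differentiated freely. -/
theorem eq_sum_taylorCoeff_add (N : ℂ → ℂ) (K : ℕ) (ξ : ℂ) :
    N ξ = ∑ k ∈ Finset.range (K + 1), taylorCoeff N k * ξ ^ k +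
      ξ ^ (K + 1) * ((fun g => dslope g 0)^[K + 1] N) ξ := by
  have hstep : ∀ k, ((fun g => dslope g 0)^[k] N) ξ =
      taylorCoeff N k + ξ * ((fun g => dslope g 0)^[k + 1] N) ξ := fun k => by
    have := sub_smul_dslope ((fun g => dslope g 0)^[k] N) 0 ξ
    rw [sub_zero, smul_eq_mul] at this
    rw [Function.iterate_succ_apply', this, taylorCoeff]; ring
  induction K with
  | zero => simpa using hstep 0
  | succ K ih =>
    rw [Finset.sum_range_succ, ih, hstep (K + 1)]
    simp only [pow_succ]; ring

/-- Finite sums of terms `r ^ p * T (r ^ l * E τ) * e τ` with `T` holomorphic, `e` and `E` smooth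
and `β ≤ re p`. -/
inductive IsCornerTerm (l : ℂ) (η δ : ℝ) (S : Set ℝ) : ℝ → (ℝ → ℝ → ℂ) → Prop
  | monomial {β : ℝ} {p : ℂ} {T : ℂ → ℂ} {E e : ℝ → ℂ} (hp : β ≤ p.re)
      (hT : DifferentiableOn ℂ T (Metric.ball 0 η)) (hE : ContDiff ℝ ∞ E)
      (hEη : ∀ r ∈ Ioo 0 δ, ∀ τ ∈ S, ‖realPow l r * E τ‖ ≤ η / 2) (he : ContDiff ℝ ∞ e) :
      IsCornerTerm l η δ S β fun r τ => realPow p r * T (realPow l r * E τ) * e τ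
  | add {β : ℝ} {H₁ H₂ : ℝ → ℝ → ℂ} (h₁ : IsCornerTerm l η δ S β H₁)
      (h₂ : IsCornerTerm l η δ S β H₂) : IsCornerTerm l η δ S β fun r τ => H₁ r τ + H₂ r τ

namespace IsCornerTerm

variable {l : ℂ} {η δ β : ℝ} {S : Set ℝ} {H : ℝ → ℝ → ℂ}

theorem exists_bound (h : IsCornerTerm l η δ S β H) (hη : 0 < η) (hδ : δ ≤ 1) (hS : IsCompact S) :
    ∃ C : ℝ, ∀ r ∈ Ioo 0 δ, ∀ τ ∈ S, ‖H r τ‖ ≤ C * r ^ β := by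
  induction h with
  | @monomial p T E e hp hT hE hEη he =>
    obtain ⟨C₁, hC₁⟩ := (isCompact_closedBall (0 : ℂ) (η / 2)).exists_bound_of_continuousOn
      (hT.continuousOn.mono (Metric.closedBall_subset_ball (by linarith)))
    obtain ⟨C₂, hC₂⟩ := hS.exists_bound_of_continuousOn he.continuous.continuousOn
    refine ⟨C₁ * C₂, fun r hr τ hτ => ?_⟩
    have h1 := hC₁ (realPow l r * E τ) (by simpa using hEη r hr τ hτ)
    have h2 := hC₂ τ hτ
    have h3 : r ^ p.re ≤ r ^ β := Real.rpow_le_rpow_of_exponent_ge hr.1 (hr.2.le.trans hδ) hp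
    have h4 : 0 ≤ r ^ p.re := Real.rpow_nonneg hr.1.le _
    have h5 : 0 ≤ C₁ := (norm_nonneg _).trans h1
    have h6 : 0 ≤ r ^ β := Real.rpow_nonneg hr.1.le _
    rw [norm_mul, norm_mul, norm_realPow p hr.1]
    calc r ^ p.re * ‖T (realPow l r * E τ)‖ * ‖e τ‖ ≤ r ^ β * C₁ * C₂ := by gcongr
      _ = C₁ * C₂ * r ^ β := by ring
  | add _ _ ih₁ ih₂ =>
    obtain ⟨C₁, hC₁⟩ := ih₁
    obtain ⟨C₂, hC₂⟩ := ih₂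
    refine ⟨C₁ + C₂, fun r hr τ hτ => (norm_add_le _ _).trans ?_⟩
    rw [add_mul]
    exact add_le_add (hC₁ r hr τ hτ) (hC₂ r hr τ hτ)

/-- Differentiating T brings out a factor r^l, which does not lower the order since Re l ≥ 0. -/
theorem exists_hasDerivAt_snd (h : IsCornerTerm l η δ S β H) (hη : 0 < η) (hl : 0 ≤ l.re) :
    ∃ H', IsCornerTerm l η δ S β H' ∧
      ∀ r ∈ Ioo 0 δ, ∀ τ ∈ S, HasDerivAt (fun t => H r t) (H' r τ) τ := by
  induction h with
  | @monomial p T E e hp hT hE hEη he =>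
    have hE' : ContDiff ℝ ∞ (deriv E) := (contDiff_infty_iff_deriv.1 hE).2
    have he' : ContDiff ℝ ∞ (deriv e) := (contDiff_infty_iff_deriv.1 he).2
    refine ⟨_, .add (.monomial (p := p + l) (T := deriv T) (E := E)
      (e := fun τ => deriv E τ * e τ) (by rw [Complex.add_re]; linarith)
      (hT.deriv Metric.isOpen_ball) hE hEη (hE'.mul he))
      (.monomial hp hT hE hEη he'), fun r hr τ hτ => ?_⟩
    have hmem : realPow l r * E τ ∈ Metric.ball (0 : ℂ) η := by
      rw [mem_ball_zero_iff]; linarith [hEη r hr τ hτ]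
    have h1 : HasDerivAt (fun t => realPow l r * E t) (realPow l r * deriv E τ) τ :=
      ((contDiff_infty_iff_deriv.1 hE).1 τ).hasDerivAt.const_mul _
    have h2 : HasDerivAt (fun t => T (realPow l r * E t)) (deriv T (realPow l r * E τ) *
        (realPow l r * deriv E τ)) τ :=
      HasDerivAt.comp (h₂ := T) τ (hT.differentiableAt
        (Metric.isOpen_ball.mem_nhds hmem)).hasDerivAt h1
    refine ((h2.const_mul (realPow p r)).mul
      ((contDiff_infty_iff_deriv.1 he).1 τ).hasDerivAt).congr_deriv ?_
    rw [realPow_add]; ring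
  | add _ _ ih₁ ih₂ =>
    obtain ⟨H₁', h₁, hd₁⟩ := ih₁
    obtain ⟨H₂', h₂, hd₂⟩ := ih₂
    exact ⟨_, h₁.add h₂, fun r hr τ hτ => (hd₁ r hr τ hτ).add (hd₂ r hr τ hτ)⟩

theorem exists_hasDerivAt_fst (h : IsCornerTerm l η δ S β H) (hη : 0 < η) (hl : 0 ≤ l.re) :
    ∃ H', IsCornerTerm l η δ S (β - 1) H' ∧
      ∀ r ∈ Ioo 0 δ, ∀ τ ∈ S, HasDerivAt (fun t => H t τ) (H' r τ) r := by
  induction h with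
  | @monomial p T E e hp hT hE hEη he =>
    refine ⟨_, .add (.monomial (p := p + l - 1) (T := deriv T) (E := E)
      (e := fun τ => l * (E τ * e τ)) (by simp; linarith)
      (hT.deriv Metric.isOpen_ball) hE hEη (contDiff_const.mul (hE.mul he)))
      (.monomial (p := p - 1) (e := fun τ => p * e τ) (by simp; linarith) hT hE hEη
        (contDiff_const.mul he)), fun r hr τ hτ => ?_⟩
    have hmem : realPow l r * E τ ∈ Metric.ball (0 : ℂ) η := by
      rw [mem_ball_zero_iff]; linarith [hEη r hr τ hτ]
    have h1 : HasDerivAt (fun t => realPow l t * E τ) (l * realPow (l - 1) r * E τ) r :=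
      (hasDerivAt_realPow l hr.1).mul_const _
    have h2 : HasDerivAt (fun t => T (realPow l t * E τ)) (deriv T (realPow l r * E τ) *
        (l * realPow (l - 1) r * E τ)) r :=
      HasDerivAt.comp (h₂ := T) r (hT.differentiableAt
        (Metric.isOpen_ball.mem_nhds hmem)).hasDerivAt h1
    refine (((hasDerivAt_realPow p hr.1).mul h2).mul_const (e τ)).congr_deriv ?_
    rw [add_sub_assoc, realPow_add]; ring
  | add _ _ ih₁ ih₂ =>
    obtain ⟨H₁', h₁, hd₁⟩ := ih₁
    obtain ⟨H₂', h₂, hd₂⟩ := ih₂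
    exact ⟨_, h₁.add h₂, fun r hr τ hτ => (hd₁ r hr τ hτ).add (hd₂ r hr τ hτ)⟩

theorem exists_iteratedDerivWithin (h : IsCornerTerm l η δ S β H) (hη : 0 < η) (hl : 0 ≤ l.re)
    (hS : UniqueDiffOn ℝ S) (j : ℕ) :
    ∃ H', IsCornerTerm l η δ S β H' ∧
      ∀ r ∈ Ioo 0 δ, ∀ τ ∈ S, iteratedDerivWithin j (fun t => H r t) S τ = H' r τ := by
  induction j with
  | zero => exact ⟨H, h, fun r _ τ _ => by simp⟩
  | succ j ih =>
    obtain ⟨H₁, h₁, he₁⟩ := ih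
    obtain ⟨H₂, h₂, hd₂⟩ := h₁.exists_hasDerivAt_snd hη hl
    refine ⟨H₂, h₂, fun r hr τ hτ => ?_⟩
    rw [iteratedDerivWithin_succ, derivWithin_congr (fun t ht => he₁ r hr t ht) (he₁ r hr τ hτ)]
    exact (hd₂ r hr τ hτ).hasDerivWithinAt.derivWithin (hS τ hτ)

theorem exists_iteratedDeriv (h : IsCornerTerm l η δ S β H) (hη : 0 < η) (hl : 0 ≤ l.re) (i : ℕ) :
    ∃ H', IsCornerTerm l η δ S (β - i) H' ∧
      ∀ r ∈ Ioo 0 δ, ∀ τ ∈ S, iteratedDeriv i (fun ρ => H ρ τ) r = H' r τ := by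
  induction i with
  | zero => exact ⟨H, by simpa using h, fun r _ τ _ => by simp⟩
  | succ i ih =>
    obtain ⟨H₁, h₁, he₁⟩ := ih
    obtain ⟨H₂, h₂, hd₂⟩ := h₁.exists_hasDerivAt_fst hη hl
    refine ⟨H₂, by convert h₂ using 1; push_cast; ring, fun r hr τ hτ => ?_⟩
    have hev : iteratedDeriv i (fun ρ => H ρ τ) =ᶠ[𝓝 r] fun ρ => H₁ ρ τ := by
      filter_upwards [isOpen_Ioo.mem_nhds hr] with ρ hρ using he₁ ρ hρ τ hτ
    rw [iteratedDeriv_succ, hev.deriv_eq]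
    exact (hd₂ r hr τ hτ).deriv

end IsCornerTerm

theorem exists_norm_realPow_mul_le {l : ℂ} (hl : 0 < l.re) {η : ℝ} (hη : 0 < η) {S : Set ℝ}
    (hS : IsCompact S) {E : ℝ → ℂ} (hE : Continuous E) :
    ∃ δ > 0, ∀ r ∈ Ioo 0 δ, ∀ τ ∈ S, ‖realPow l r * E τ‖ ≤ η := by
  obtain ⟨C, hC⟩ := hS.exists_bound_of_continuousOn hE.continuousOn
  have hC' : 0 < |C| + 1 := by positivity
  refine ⟨(η / (|C| + 1)) ^ (l.re)⁻¹, by positivity, fun r hr τ hτ => ?_⟩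
  rw [norm_mul, norm_realPow l hr.1]
  have h1 : r ^ l.re ≤ η / (|C| + 1) := by
    have := Real.rpow_le_rpow hr.1.le hr.2.le hl.le
    rwa [Real.rpow_inv_rpow (by positivity) hl.ne'] at this
  have h2 : ‖E τ‖ ≤ |C| + 1 := (hC τ hτ).trans (by linarith [le_abs_self C])
  calc r ^ l.re * ‖E τ‖ ≤ η / (|C| + 1) * (|C| + 1) := by gcongr
    _ = η := div_mul_cancel₀ _ hC'.ne'

/-- The constant term of N cancels in the difference, and the remainder after K terms is exactly a
sum of two corner terms of order (K + 1) Re l. Derivatives stay in that class, losing one order for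
each ∂_r. -/
theorem hasPolyhomExpansion_of_eq {v : ℝ × ℝ → ℂ} {a b η δ : ℝ} {l : ℂ} {N : ℂ → ℂ}
    {E E' : ℝ → ℂ} (hab : a < b) (hl : 0 < l.re) (hη : 0 < η) (hδ : 0 < δ)
    (hN : DifferentiableOn ℂ N (Metric.ball 0 η)) (hE : ContDiff ℝ ∞ E) (hE' : ContDiff ℝ ∞ E')
    (hv : ∀ r ∈ Ioo 0 δ, ∀ τ ∈ Icc a b,
      v (r, τ) = N (realPow l r * E τ) - N (realPow l r * E' τ)) :
    HasPolyhomExpansion v a b l fun k τ => taylorCoeff N k * (E τ ^ k - E' τ ^ k) := by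
  obtain ⟨δ₁, hδ₁, hE₁⟩ := exists_norm_realPow_mul_le hl (half_pos hη)
    (isCompact_Icc (a := a) (b := b)) hE.continuous
  obtain ⟨δ₂, hδ₂, hE₂⟩ := exists_norm_realPow_mul_le hl (half_pos hη)
    (isCompact_Icc (a := a) (b := b)) hE'.continuous
  set d := min (min δ₁ δ₂) (min δ 1) with hd
  have hd0 : 0 < d := by positivity
  have hd1 : Ioo 0 d ⊆ Ioo 0 δ₁ :=
    Ioo_subset_Ioo_right ((min_le_left _ _).trans (min_le_left _ _))
  have hd2 : Ioo 0 d ⊆ Ioo 0 δ₂ :=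
    Ioo_subset_Ioo_right ((min_le_left _ _).trans (min_le_right _ _))
  have hd3 : Ioo 0 d ⊆ Ioo 0 δ :=
    Ioo_subset_Ioo_right ((min_le_right _ _).trans (min_le_left _ _))
  have hd4 : d ≤ 1 := (min_le_right _ _).trans (min_le_right _ _)
  have hB1 : ∀ r ∈ Ioo 0 d, ∀ τ ∈ Icc a b, ‖realPow l r * E τ‖ ≤ η / 2 := fun r hr => hE₁ r (hd1 hr)
  have hB2 : ∀ r ∈ Ioo 0 d, ∀ τ ∈ Icc a b, ‖realPow l r * E' τ‖ ≤ η / 2 := fun r hr => hE₂ r (hd2 hr)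
  refine ⟨d, hd0, ?_, fun K i j => ?_⟩
  · have hNr : ContDiffOn ℝ ∞ N (Metric.ball 0 η) :=
      (hN.contDiffOn Metric.isOpen_ball).restrict_scalars ℝ
    have key : ∀ e : ℝ → ℂ, ContDiff ℝ ∞ e →
        (∀ r ∈ Ioo 0 d, ∀ τ ∈ Icc a b, ‖realPow l r * e τ‖ ≤ η / 2) →
        ContDiffOn ℝ ∞ (fun p : ℝ × ℝ => N (realPow l p.1 * e p.2)) (Ioo 0 d ×ˢ Icc a b) := by
      intro e he hb
      refine hNr.comp (ContDiffOn.mul ?_ (he.comp contDiff_snd).contDiffOn) fun p hp => ?_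
      · refine ContDiffOn.cexp (contDiffOn_const.mul ?_)
        exact Complex.ofRealCLM.contDiff.comp_contDiffOn
          (ContDiffOn.log contDiff_fst.contDiffOn fun p hp => hp.1.1.ne')
      · rw [mem_ball_zero_iff]; linarith [hb p.1 hp.1 p.2 hp.2]
    refine ((key E hE hB1).sub (key E' hE' hB2)).congr fun p hp => ?_
    exact hv p.1 (hd3 hp.1) p.2 hp.2
  · set T := (fun g => dslope g 0)^[K + 1] N with hT
    have hTd : DifferentiableOn ℂ T (Metric.ball 0 η) := differentiableOn_iterate_dslope hη hN _
    have hterm : IsCornerTerm l η d (Icc a b) (l.re * (K + 1)) (fun r τ =>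
        realPow (l * (K + 1 : ℕ)) r * T (realPow l r * E τ) * (fun τ : ℝ => E τ ^ (K + 1)) τ +
        realPow (l * (K + 1 : ℕ)) r * T (realPow l r * E' τ) *
          (fun τ : ℝ => -E' τ ^ (K + 1)) τ) := by
      have hre : l.re * (K + 1) ≤ (l * (K + 1 : ℕ)).re := by
        rw [← Complex.ofReal_natCast, Complex.re_mul_ofReal]; push_cast; rfl
      exact .add (.monomial hre hTd hE hB1 (hE.pow _)) (.monomial hre hTd hE' hB2 (hE'.pow _).neg)
    have hrem : ∀ r ∈ Ioo 0 d, ∀ τ ∈ Icc a b,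
        v (r, τ) - ∑ k ∈ Finset.Icc 1 K, (r : ℂ) ^ (l * k) * (taylorCoeff N k *
          (E τ ^ k - E' τ ^ k)) =
        realPow (l * (K + 1 : ℕ)) r * T (realPow l r * E τ) * (fun τ : ℝ => E τ ^ (K + 1)) τ +
        realPow (l * (K + 1 : ℕ)) r * T (realPow l r * E' τ) *
          (fun τ : ℝ => -E' τ ^ (K + 1)) τ := by
      intro r hr τ hτ
      rw [hv r (hd3 hr) τ hτ, eq_sum_taylorCoeff_add N K (realPow l r * E τ),
        eq_sum_taylorCoeff_add N K (realPow l r * E' τ), ← hT, realPow_mul_natCast]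
      have h1 : ∑ k ∈ Finset.Icc 1 K, (r : ℂ) ^ (l * k) * (taylorCoeff N k *
          (E τ ^ k - E' τ ^ k)) =
          ∑ k ∈ Finset.range (K + 1), taylorCoeff N k * (realPow l r * E τ) ^ k -
          ∑ k ∈ Finset.range (K + 1), taylorCoeff N k * (realPow l r * E' τ) ^ k := by
        rw [← Finset.sum_sub_distrib, Finset.range_eq_Ico,
          Finset.sum_eq_sum_Ico_succ_bot (Nat.succ_pos K),
          show Finset.Ico (0 + 1) (K + 1) = Finset.Icc 1 K by ext; simp]
        simp only [pow_zero, sub_self, zero_add]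
        refine Finset.sum_congr rfl fun k _ => ?_
        rw [realPow_eq_cpow _ hr.1, realPow_mul_natCast, mul_pow, mul_pow]; ring
      rw [h1]; ring
    obtain ⟨H₁, h₁, he₁⟩ := hterm.exists_iteratedDerivWithin hη hl.le (uniqueDiffOn_Icc hab) j
    obtain ⟨H₂, h₂, he₂⟩ := h₁.exists_iteratedDeriv hη hl.le i
    obtain ⟨C, hC⟩ := h₂.exists_bound hη hd4 isCompact_Icc
    refine ⟨C, fun r hr τ hτ => ?_⟩
    have hev : (fun ρ : ℝ => iteratedDerivWithin j
        (fun t : ℝ => v (ρ, t) - ∑ k ∈ Finset.Icc 1 K, (ρ : ℂ) ^ (l * k) *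
          (taylorCoeff N k * (E t ^ k - E' t ^ k))) (Icc a b) τ) =ᶠ[𝓝 r] fun ρ => H₁ ρ τ := by
      filter_upwards [isOpen_Ioo.mem_nhds hr] with ρ hρ
      rw [← he₁ ρ hρ τ hτ]
      exact iteratedDerivWithin_congr (fun t ht => hrem ρ hρ t ht) hτ
    rw [hev.iteratedDeriv_eq, he₂ r hr τ hτ]
    exact hC r hr τ hτ

/-! ### Slopes, edge ratios and the exponent -/

/-- The square of the quotient of the slopes of the two complex characteristic directions,
relative to its value at `ε = 0`. -/
def slopeSq (lam ε : ℝ) : ℂ :=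
  (lam ^ 2 / (1 - lam ^ 2) : ℝ) * (((lam + ε * Complex.I) ^ 2)⁻¹ - 1)

/-- The square root of `slopeSq` close to `1`. -/
def slopeRoot (lam ε : ℝ) : ℂ := Complex.exp (Complex.log (slopeSq lam ε) / 2)

/-- The ratio of the values of a characteristic coordinate of slope `σ` at the two edges. -/
def edgeRatio (αm αp : ℝ) (σ : ℂ) : ℂ := (αp * (1 + σ) + (1 - σ)) / (-αm * (1 + σ) + (1 - σ))

/-- The difference of logarithms of the edge ratios, continued to `ε = 0`. -/
def edgeLog (lam αm αp ε : ℝ) : ℂ :=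
  Complex.log (-edgeRatio αm αp (slopeRoot lam ε)) -
    Complex.log (edgeRatio αm αp (-slopeRoot lam ε))

/-- The exponent in the expansion at a corner. -/
def cornerExponent (lam αm αp ε : ℝ) : ℂ :=
  if 0 < ε then 2 * Real.pi * Complex.I / (Complex.I * Real.pi - edgeLog lam αm αp ε)
  else 2 * Real.pi * Complex.I / (Complex.I * Real.pi + edgeLog lam αm αp ε)

section Slope

variable {lam : ℝ}

theorem omega_ne_zero (h0 : 0 < lam) (ε : ℝ) : (lam : ℂ) + ε * Complex.I ≠ 0 := fun h => by
  have := congrArg Complex.re h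
  simp at this
  linarith

/-- Inversion reverses the sign of the imaginary part of ω², which is 2λε. -/
theorem slopeSq_im (h0 : 0 < lam) (h1 : lam < 1) (ε : ℝ) :
    ∃ c > 0, (slopeSq lam ε).im = -(c * ε) := by
  have hn : 0 < Complex.normSq (((lam : ℂ) + ε * Complex.I) ^ 2) :=
    Complex.normSq_pos.2 (pow_ne_zero 2 (omega_ne_zero h0 ε))
  have h2 : 0 < lam ^ 2 / (1 - lam ^ 2) := div_pos (by positivity) (by nlinarith)
  refine ⟨lam ^ 2 / (1 - lam ^ 2) * (2 * lam / Complex.normSq (((lam : ℂ) + ε * Complex.I) ^ 2)),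
    by positivity, ?_⟩
  rw [slopeSq, Complex.im_ofReal_mul, Complex.sub_im, Complex.inv_im]
  have : (((lam : ℂ) + ε * Complex.I) ^ 2).im = 2 * lam * ε := by
    rw [sq, Complex.mul_im]; simp; ring
  rw [this]; simp; ring

theorem slopeRoot_sq {ε : ℝ} (h : slopeSq lam ε ≠ 0) : slopeRoot lam ε ^ 2 = slopeSq lam ε := by
  rw [slopeRoot, ← Complex.exp_nat_mul]
  push_cast
  rw [mul_div_cancel₀ _ two_ne_zero, Complex.exp_log h]

theorem slopeSq_ne_zero (h0 : 0 < lam) (h1 : lam < 1) {ε : ℝ} (hε : ε ≠ 0) :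
    slopeSq lam ε ≠ 0 := by
  obtain ⟨c, hc, him⟩ := slopeSq_im h0 h1 ε
  intro h
  rw [h] at him
  have : c * ε = 0 := by simpa using him.symm
  exact hε ((mul_eq_zero.1 this).resolve_left hc.ne')

/-- The principal root has positive real part, so its imaginary part has the sign of that of its
square. -/
theorem slopeRoot_im (h0 : 0 < lam) (h1 : lam < 1) {ε : ℝ} (hε : ε ≠ 0) :
    (0 < ε → (slopeRoot lam ε).im < 0) ∧ (ε < 0 → 0 < (slopeRoot lam ε).im) := by
  obtain ⟨c, hc, him⟩ := slopeSq_im h0 h1 ε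
  have hz := slopeSq_ne_zero h0 h1 hε
  have hre : 0 < (slopeRoot lam ε).re := by
    rw [slopeRoot, Complex.exp_re]
    have hne : (slopeSq lam ε).im ≠ 0 := by
      rw [him]; exact neg_ne_zero.2 (mul_ne_zero hc.ne' hε)
    have h2 : (Complex.log (slopeSq lam ε) / 2).im = (slopeSq lam ε).arg / 2 := by
      rw [show (2 : ℂ) = ((2 : ℝ) : ℂ) by norm_num, Complex.div_ofReal_im, Complex.log_im]
    rw [h2]
    refine mul_pos (Real.exp_pos _) (Real.cos_pos_of_mem_Ioo ⟨?_, ?_⟩)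
    · linarith [Complex.neg_pi_lt_arg (slopeSq lam ε)]
    · have : (slopeSq lam ε).arg ≠ Real.pi := fun h => hne (Complex.arg_eq_pi_iff.1 h).2
      linarith [(Complex.arg_le_pi (slopeSq lam ε)).lt_of_ne this]
  have h3 : 2 * (slopeRoot lam ε).re * (slopeRoot lam ε).im = -(c * ε) := by
    rw [← him, ← slopeRoot_sq hz, sq, Complex.mul_im]; ring
  constructor <;> intro h
  · have := mul_pos hc h
    by_contra hn
    push Not at hn
    nlinarith [mul_nonneg hre.le hn]
  · have := mul_neg_of_pos_of_neg hc h
    by_contra hn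
    push Not at hn
    nlinarith [mul_nonneg hre.le (neg_nonneg.2 hn)]

end Slope

section EdgeRatio

variable {αm αp : ℝ}

theorem edge_ne_zero {σ : ℂ} (hσ : σ.im ≠ 0) (t : ℝ) : (t : ℂ) * (1 + σ) + (1 - σ) ≠ 0 := by
  intro h
  have h1 : t * σ.im - σ.im = 0 := by simpa [sub_eq_add_neg] using congrArg Complex.im h
  have h2 : t = 1 := by
    have : (t - 1) * σ.im = 0 := by linarith
    linarith [(mul_eq_zero.1 this).resolve_right hσ]
  rw [h2] at h
  have := congrArg Complex.re h
  norm_num at this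

/-- A Möbius transformation with real coefficients and determinant 2(α₊ + α₋) > 0 preserves the half
planes. -/
theorem edgeRatio_im (hαm : 0 < αm) (hαp : 0 < αp) {σ : ℂ} (hσ : σ.im ≠ 0) :
    ∃ c > 0, (edgeRatio αm αp σ).im = c * σ.im := by
  have hd := edge_ne_zero hσ (-αm)
  push_cast at hd
  have hn : 0 < Complex.normSq (-αm * (1 + σ) + (1 - σ)) := Complex.normSq_pos.2 hd
  refine ⟨2 * (αp + αm) / Complex.normSq (-αm * (1 + σ) + (1 - σ)), by positivity, ?_⟩
  rw [edgeRatio, Complex.div_im]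
  simp
  field_simp
  ring

theorem log_neg_of_im_neg {z : ℂ} (hz : z.im < 0) :
    Complex.log (-z) = Complex.log z + Complex.I * Real.pi := by
  apply Complex.ext
  · simp [Complex.log_re]
  · simp [Complex.log_im, Complex.arg_neg_eq_arg_add_pi_of_im_neg hz]

theorem log_neg_of_im_pos {z : ℂ} (hz : 0 < z.im) :
    Complex.log (-z) = Complex.log z - Complex.I * Real.pi := by
  apply Complex.ext
  · simp [Complex.log_re]
  · simp [Complex.log_im, Complex.arg_neg_eq_arg_sub_pi_of_im_pos hz]

/-- For the root in the upper half plane the two edge ratios lie in opposite half planes, so the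
difference P of their logarithms has positive imaginary part and 2πi/P has positive real part.
Undoing the minus sign in `edgeLog` costs ±iπ according to the sign of ε, which accounts for the two
cases of `cornerExponent`. -/
theorem exists_slope (hαm : 0 < αm) (hαp : 0 < αp) {lam : ℝ} (h0 : 0 < lam) (h1 : lam < 1) {ε : ℝ}
    (hε : ε ≠ 0) :
    ∃ σ : ℂ, (σ = slopeRoot lam ε ∨ σ = -slopeRoot lam ε) ∧ 0 < σ.im ∧
      cornerExponent lam αm αp ε * (Complex.log (edgeRatio αm αp σ) -
        Complex.log (edgeRatio αm αp (-σ))) = 2 * Real.pi * Complex.I ∧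
      0 < (cornerExponent lam αm αp ε).re := by
  have key : ∀ σ : ℂ, 0 < σ.im → cornerExponent lam αm αp ε = 2 * Real.pi * Complex.I /
      (Complex.log (edgeRatio αm αp σ) - Complex.log (edgeRatio αm αp (-σ))) →
      cornerExponent lam αm αp ε * (Complex.log (edgeRatio αm αp σ) -
        Complex.log (edgeRatio αm αp (-σ))) = 2 * Real.pi * Complex.I ∧
      0 < (cornerExponent lam αm αp ε).re := by
    intro σ hσ he
    obtain ⟨c, hc, hq⟩ := edgeRatio_im hαm hαp (σ := σ) hσ.ne'
    obtain ⟨c', hc', hq'⟩ := edgeRatio_im hαm hαp (σ := -σ) (by simpa using hσ.ne')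
    set P := Complex.log (edgeRatio αm αp σ) - Complex.log (edgeRatio αm αp (-σ)) with hP
    have hPim : 0 < P.im := by
      rw [hP, Complex.sub_im, Complex.log_im, Complex.log_im]
      have h2 : 0 ≤ (edgeRatio αm αp σ).arg := Complex.arg_nonneg_iff.2 (by rw [hq]; positivity)
      have h3 : (edgeRatio αm αp (-σ)).arg < 0 := Complex.arg_neg_iff.2 (by
        rw [hq', Complex.neg_im]; linarith [mul_pos hc' hσ])
      linarith
    have hP0 : P ≠ 0 := fun h => by rw [h] at hPim; simp at hPim
    refine ⟨by rw [he, div_mul_cancel₀ _ hP0], ?_⟩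
    rw [he, Complex.div_re]
    have : 0 < 2 * Real.pi * P.im / Complex.normSq P :=
      div_pos (by have := Real.pi_pos; positivity) (Complex.normSq_pos.2 hP0)
    simpa using this
  obtain ⟨hpos, hneg⟩ := slopeRoot_im h0 h1 hε
  set ρ := slopeRoot lam ε with hρ
  rcases lt_or_gt_of_ne hε with h | h
  · refine ⟨ρ, Or.inl rfl, hneg h, key ρ (hneg h) ?_⟩
    obtain ⟨c, hc, hq⟩ := edgeRatio_im hαm hαp (σ := ρ) (hneg h).ne'
    rw [cornerExponent, if_neg h.not_gt, edgeLog, ← hρ,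
      log_neg_of_im_pos (by rw [hq]; exact mul_pos hc (hneg h))]
    congr 1; ring
  · refine ⟨-ρ, Or.inr rfl, by simpa using hpos h, key (-ρ) (by simpa using hpos h) ?_⟩
    obtain ⟨c, hc, hq⟩ := edgeRatio_im hαm hαp (σ := ρ) (hpos h).ne
    rw [cornerExponent, if_pos h, edgeLog, ← hρ,
      log_neg_of_im_neg (by rw [hq]; exact mul_neg_of_pos_of_neg hc (hpos h)), neg_neg]
    congr 1; ring

theorem slopeSq_zero {lam : ℝ} (h0 : 0 < lam) (h1 : lam < 1) : slopeSq lam 0 = 1 := by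
  have h2 : (lam : ℂ) ≠ 0 := by exact_mod_cast h0.ne'
  have h3 : (1 - lam ^ 2 : ℂ) ≠ 0 := by
    exact_mod_cast (by nlinarith : (0 : ℝ) < 1 - lam ^ 2).ne'
  simp only [slopeSq]
  push_cast
  rw [zero_mul, add_zero]
  field_simp

/-- At ε = 0 the edge ratios are −α₊/α₋ and 1. The former lies on the branch cut, so its negative is
used; both logarithms are then differentiable there. -/
theorem differentiableAt_edgeLog (hαm : 0 < αm) (hαp : 0 < αp) {lam : ℝ} (h0 : 0 < lam)
    (h1 : lam < 1) :
    DifferentiableAt ℝ (edgeLog lam αm αp) 0 ∧ edgeLog lam αm αp 0 = Real.log (αp / αm) := by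
  have hS0 := slopeSq_zero h0 h1
  have hSd : DifferentiableAt ℝ (slopeSq lam) 0 := by
    unfold slopeSq
    refine DifferentiableAt.const_mul (DifferentiableAt.sub_const (DifferentiableAt.inv ?_ ?_) _) _
    · have : DifferentiableAt ℝ (fun ε : ℝ => (ε : ℂ)) 0 := Complex.ofRealCLM.differentiableAt
      fun_prop
    · exact pow_ne_zero 2 (omega_ne_zero h0 0)
  have hR0 : slopeRoot lam 0 = 1 := by rw [slopeRoot, hS0]; simp
  have hRd : DifferentiableAt ℝ (slopeRoot lam) 0 := by
    unfold slopeRoot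
    have : DifferentiableAt ℝ (fun ε => Complex.log (slopeSq lam ε)) 0 :=
      (hSd.hasDerivAt.clog_real (by rw [hS0]; exact Complex.one_mem_slitPlane)).differentiableAt
    exact (this.div_const 2).cexp
  have hm : (αm : ℂ) ≠ 0 := by exact_mod_cast hαm.ne'
  have hq1 : edgeRatio αm αp 1 = ((-(αp / αm) : ℝ) : ℂ) := by
    rw [edgeRatio]; push_cast; field_simp; ring
  have hq2 : edgeRatio αm αp (-1) = 1 := by
    rw [edgeRatio]; norm_num
  have hd1 : DifferentiableAt ℝ (fun ε => edgeRatio αm αp (slopeRoot lam ε)) 0 := by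
    unfold edgeRatio
    refine DifferentiableAt.div (by fun_prop) (by fun_prop) ?_
    rw [hR0]; norm_num [hm]
  have hd2 : DifferentiableAt ℝ (fun ε => edgeRatio αm αp (-slopeRoot lam ε)) 0 := by
    unfold edgeRatio
    refine DifferentiableAt.div (by fun_prop) (by fun_prop) ?_
    rw [hR0]; norm_num
  have hα : 0 < αp / αm := by positivity
  constructor
  · unfold edgeLog
    refine DifferentiableAt.sub (hd1.fun_neg.hasDerivAt.clog_real ?_).differentiableAt
      (hd2.hasDerivAt.clog_real ?_).differentiableAt
    · rw [hR0, hq1, ← Complex.ofReal_neg, neg_neg]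
      exact Complex.ofReal_mem_slitPlane.2 hα
    · rw [hR0, hq2]; exact Complex.one_mem_slitPlane
  · rw [edgeLog, hR0, hq1, hq2, ← Complex.ofReal_neg, neg_neg, Complex.log_one, sub_zero,
      Complex.ofReal_log hα.le]

/-- Each of the two formulas for the exponent is differentiable through ε = 0, since the denominator
has imaginary part π there. -/
theorem cornerExponent_isBigO (hαm : 0 < αm) (hαp : 0 < αp) {lam : ℝ} (h0 : 0 < lam)
    (h1 : lam < 1) :
    (fun ε : ℝ => cornerExponent lam αm αp ε -
        2 * Real.pi * Complex.I / (Complex.I * Real.pi - Real.log (αp / αm)))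
      =O[𝓝[>] 0] (fun ε : ℝ => ε) ∧
    (fun ε : ℝ => cornerExponent lam αm αp ε -
        2 * Real.pi * Complex.I / (Complex.I * Real.pi + Real.log (αp / αm)))
      =O[𝓝[<] 0] (fun ε : ℝ => ε) := by
  obtain ⟨hd, he⟩ := differentiableAt_edgeLog hαm hαp h0 h1
  constructor
  · have hD : DifferentiableAt ℝ (fun ε => 2 * Real.pi * Complex.I /
        (Complex.I * Real.pi - edgeLog lam αm αp ε)) 0 := by
      refine DifferentiableAt.div (by fun_prop) (by fun_prop) fun h => ?_
      rw [he] at h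
      have := congrArg Complex.im h
      simp at this
    have hO := (hD.isBigO_sub).mono (nhdsWithin_le_nhds (s := Ioi 0))
    simp only [sub_zero, he] at hO
    refine hO.congr' ?_ EventuallyEq.rfl
    filter_upwards [self_mem_nhdsWithin] with ε hε
    rw [cornerExponent, if_pos (show 0 < ε from hε)]
  · have hD : DifferentiableAt ℝ (fun ε => 2 * Real.pi * Complex.I /
        (Complex.I * Real.pi + edgeLog lam αm αp ε)) 0 := by
      refine DifferentiableAt.div (by fun_prop) (by fun_prop) fun h => ?_
      rw [he] at h
      have := congrArg Complex.im h
      simp at this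
    have hO := (hD.isBigO_sub).mono (nhdsWithin_le_nhds (s := Iio 0))
    simp only [sub_zero, he] at hO
    refine hO.congr' ?_ EventuallyEq.rfl
    filter_upwards [self_mem_nhdsWithin] with ε hε
    rw [cornerExponent, if_neg (not_lt.2 (le_of_lt hε))]

end EdgeRatio

/-! ### The expansion at a corner -/

/-- A power of the affine function with the values `1` and `q` at the ends of `[-αm, αp]`. -/
def edgePow (l : ℂ) (αm αp : ℝ) (q : ℂ) (τ : ℝ) : ℂ :=
  Complex.exp (l * Complex.log (((αp - τ) / (αp + αm) : ℝ) + ((τ + αm) / (αp + αm) : ℝ) * q))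

section EdgePow

variable {l q : ℂ} {αm αp : ℝ}

theorem edge_mem_slitPlane (hα : 0 < αp + αm) (hq : q.im ≠ 0) (τ : ℝ) :
    (((αp - τ) / (αp + αm) : ℝ) : ℂ) + ((τ + αm) / (αp + αm) : ℝ) * q ∈ Complex.slitPlane := by
  by_cases hτ : τ = -αm
  · have h1 : (αp - τ) / (αp + αm) = 1 := by rw [hτ, sub_neg_eq_add, div_self hα.ne']
    rw [h1, hτ]; simp
  · refine Complex.mem_slitPlane_iff.2 (Or.inr ?_)
    rw [Complex.add_im, Complex.ofReal_im, Complex.im_ofReal_mul, zero_add]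
    refine mul_ne_zero (div_ne_zero (fun h => hτ ?_) hα.ne') hq
    linarith

theorem contDiff_edgePow (hα : 0 < αp + αm) (hq : q.im ≠ 0) : ContDiff ℝ ∞ (edgePow l αm αp q) := by
  refine ContDiff.cexp (contDiff_const.mul (contDiff_iff_contDiffAt.2 fun τ => ?_))
  refine ContDiffAt.comp (g := Complex.log) τ
    ((Complex.contDiffAt_log (edge_mem_slitPlane hα hq τ)).restrict_scalars ℝ) ?_
  have h1 : ContDiff ℝ ∞ fun τ : ℝ => (τ : ℂ) := Complex.ofRealCLM.contDiff
  have h2 : ContDiff ℝ ∞ fun τ : ℝ => (((αp - τ) / (αp + αm) : ℝ) : ℂ) :=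
    h1.comp ((contDiff_const.sub contDiff_id).div_const _)
  have h3 : ContDiff ℝ ∞ fun τ : ℝ => (((τ + αm) / (αp + αm) : ℝ) : ℂ) :=
    h1.comp ((contDiff_id.add contDiff_const).div_const _)
  exact (h2.add (h3.mul contDiff_const)).contDiffAt

theorem edgePow_neg (hα : 0 < αp + αm) : edgePow l αm αp q (-αm) = 1 := by
  rw [edgePow, sub_neg_eq_add, div_self hα.ne']; simp

theorem edgePow_pos (hα : 0 < αp + αm) :
    edgePow l αm αp q αp = Complex.exp (l * Complex.log q) := by
  rw [edgePow, div_self hα.ne']; simp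

theorem exp_mul_log_eq (hα : 0 < αp + αm) (hq : q.im ≠ 0) {r : ℝ} (hr : 0 < r) (τ : ℝ) :
    Complex.exp (l * Complex.log ((r * ((αp - τ) / (αp + αm)) : ℝ) +
      (r * ((τ + αm) / (αp + αm)) : ℝ) * q)) = realPow l r * edgePow l αm αp q τ := by
  rw [realPow, edgePow, ← Complex.exp_add, ← mul_add,
    ← Complex.log_ofReal_mul hr (Complex.slitPlane_ne_zero (edge_mem_slitPlane hα hq τ))]
  congr 3; push_cast; ring

end EdgePow

/-- A characteristic coordinate in the direction with parameter `τ`. -/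
theorem charCoord_cornerDir {lam : ℝ} (h0 : lam ≠ 0) {om b ρ : ℂ}
    (hb : b = ρ * om * Real.sqrt (1 - lam ^ 2) / lam) (μ ν : ℤˣ) (τ : ℝ) :
    b * ((cornerDir lam μ ν τ).1 : ℝ) + om * ((cornerDir lam μ ν τ).2 : ℝ) =
      ((μ : ℤ) * om * Real.sqrt (1 - lam ^ 2) / 2) *
        (τ * (1 + (ν : ℤ) * ρ) + (1 - (ν : ℤ) * ρ)) := by
  have : (lam : ℂ) ≠ 0 := by exact_mod_cast h0
  rw [hb, cornerDir]
  push_cast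
  field_simp
  ring

/-- The prefactor in `charCoord_cornerDir` cancels in the quotient of the two edges, so the type of
the corner enters only through νρ. -/
theorem IsSmoothSolution.coord_cornerDir {Ω : Set (ℝ × ℝ)} {om b : ℂ} {f u : ℝ × ℝ → ℂ}
    (h : IsSmoothSolution Ω om b f u) {lam : ℝ} (h0 : lam ≠ 0) {ρ : ℂ} (hρ : ρ.im ≠ 0)
    (hb : b = ρ * om * Real.sqrt (1 - lam ^ 2) / lam) (μ ν : ℤˣ) (αm αp : ℝ) :
    h.coord (cornerDir lam μ ν αp) =
      edgeRatio αm αp ((ν : ℤ) * ρ) * h.coord (cornerDir lam μ ν (-αm)) := by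
  have him : (((ν : ℤ) : ℂ) * ρ).im ≠ 0 := by
    rcases Int.units_eq_one_or ν with rfl | rfl <;> simpa using hρ
  have hd := edge_ne_zero him (-αm)
  push_cast at hd
  rw [h.coord_apply, h.coord_apply, charCoord_cornerDir h0 hb, charCoord_cornerDir h0 hb, edgeRatio,
    Complex.ofReal_neg, mul_left_comm, div_mul_cancel₀ _ hd]

/-- The expansion at a corner. -/
theorem IsSmoothSolution.exists_expansion {Ω : Set (ℝ × ℝ)} {om b : ℂ} {f u : ℝ × ℝ → ℂ}
    (h : IsSmoothSolution Ω om b f u) {lam : ℝ} (h0 : 0 < lam) (h1 : lam < 1) {ρ l : ℂ}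
    (hb : b = ρ * om * Real.sqrt (1 - lam ^ 2) / lam) {κ : ℝ × ℝ} {μ ν : ℤˣ} {αm αp : ℝ}
    (hκ : IsCornerOfType Ω lam κ μ ν αm αp) (hρ : 0 < ((ν : ℤ) * ρ).im)
    (hl : l * (Complex.log (edgeRatio αm αp ((ν : ℤ) * ρ)) -
      Complex.log (edgeRatio αm αp (-((ν : ℤ) * ρ)))) = 2 * Real.pi * Complex.I)
    (hlre : 0 < l.re) :
    ∃ w : ℕ → ℝ → ℂ, (∀ k, 1 ≤ k → ContDiffOn ℝ ∞ (w k) (Icc (-αm) αp) ∧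
      w k (-αm) = 0 ∧ w k αp = 0) ∧
      HasPolyhomExpansion (fun p => u (blowdown lam κ μ ν p)) (-αm) αp l w := by
  obtain ⟨s₁, s₂, δ, w⟩ := hκ.exists_isWedgeAt h.isOpen h0 h1
  have hαm := hκ.αm_pos
  have hαp := hκ.αp_pos
  have hα : 0 < αp + αm := by positivity
  have hρ0 : ρ.im ≠ 0 := by
    intro h
    rcases Int.units_eq_one_or ν with rfl | rfl <;> simp [h] at hρ
  set q := edgeRatio αm αp ((ν : ℤ) * ρ) with hq
  set q' := edgeRatio αm αp (-((ν : ℤ) * ρ)) with hq'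
  have hqim : 0 < q.im := by
    obtain ⟨c, hc, he⟩ := edgeRatio_im hαm hαp hρ.ne'
    rw [hq, he]; positivity
  have hqim' : q'.im < 0 := by
    obtain ⟨c, hc, he⟩ := edgeRatio_im hαm hαp (σ := -((ν : ℤ) * ρ)) (by
      rw [Complex.neg_im]; exact neg_ne_zero.2 hρ.ne')
    rw [hq', he, Complex.neg_im]
    linarith [mul_pos hc hρ]
  -- Exchanging the two factors changes the sign of ω with b fixed, hence that of ρ.
  have hc' := h.neg.coord_cornerDir h0.ne' (ρ := -ρ) (by simpa using hρ0)
    (by rw [hb]; ring) μ ν αm αp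
  rw [mul_neg] at hc'
  obtain ⟨N, η, δ', hη, hδ', hN, hrep⟩ := h.exists_wedge_representation w
    (h.coord_cornerDir h0.ne' hρ0 hb μ ν αm αp) hqim hc' hqim' hl hlre
  refine ⟨fun k τ => taylorCoeff N k * (edgePow l αm αp q τ ^ k - edgePow l αm αp q' τ ^ k),
    fun k _ => ⟨?_, ?_, ?_⟩, ?_⟩
  · exact (contDiff_const.mul (((contDiff_edgePow hα hqim.ne').pow k).sub
      ((contDiff_edgePow hα hqim'.ne).pow k))).contDiffOn
  · simp only [edgePow_neg hα, sub_self, mul_zero]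
  -- The normalization l(log q − log q') = 2πi is exactly what makes w_k vanish at the second edge.
  · have : Complex.exp (l * Complex.log q) = Complex.exp (l * Complex.log q') := by
      rw [← sub_add_cancel (l * Complex.log q) (l * Complex.log q'), ← mul_sub, hl,
        Complex.exp_add, Complex.exp_two_pi_mul_I, one_mul]
    simp only [edgePow_pos hα, this, sub_self, mul_zero]
  · refine hasPolyhomExpansion_of_eq (by linarith) hlre hη hδ' hN (contDiff_edgePow hα hqim.ne')
      (contDiff_edgePow hα hqim'.ne) fun r hr τ hτ => ?_
    have hsum : r * ((αp - τ) / (αp + αm)) + r * ((τ + αm) / (αp + αm)) = r := by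
      field_simp; ring
    have := hrep (r * ((αp - τ) / (αp + αm))) (r * ((τ + αm) / (αp + αm)))
      (mul_nonneg hr.1.le (div_nonneg (by linarith [hτ.2]) hα.le))
      (mul_nonneg hr.1.le (div_nonneg (by linarith [hτ.1]) hα.le))
      (by rw [hsum]; exact hr.1) (by rw [hsum]; exact hr.2)
    rw [exp_mul_log_eq hα hqim.ne' hr.1, exp_mul_log_eq hα hqim'.ne hr.1] at this
    rw [← this, blowdown_eq, cornerDir_eq hαm hαp lam μ ν τ, smul_add, smul_smul, smul_smul]

/-! ### Assembling the theorem -/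

/-- The solution in `H¹₀` has a representative which is a smooth solution for the coefficient `b`
determined by the root of `slopeSq`. -/
theorem exists_isSmoothSolution {Ω : Set (ℝ × ℝ)} (hΩ : IsStraightCornerDomain Ω) {lam : ℝ}
    (h0 : 0 < lam) (h1 : lam < 1) {ε : ℝ} (hε : ε ≠ 0) {f u : ℝ × ℝ → ℂ}
    (hf : IsTestFunction Ω f) (hu : IsDirichletSolution Ω (lam + ε * Complex.I) f u) :
    ∃ u' : ℝ × ℝ → ℂ, u' =ᵐ[volume.restrict Ω] u ∧
      IsSmoothSolution Ω (lam + ε * Complex.I)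
        (slopeRoot lam ε * (lam + ε * Complex.I) * Real.sqrt (1 - lam ^ 2) / lam) f u' := by
  have hv : volume Ω ≠ ⊤ := hΩ.isBounded.measure_lt_top.ne
  set om : ℂ := lam + ε * Complex.I with hom
  have hom0 : om ≠ 0 := omega_ne_zero h0 ε
  have hlam : (lam : ℂ) ≠ 0 := by exact_mod_cast h0.ne'
  have hpos : 0 < 1 - lam ^ 2 := by nlinarith
  have hpos' : (1 - lam ^ 2 : ℂ) ≠ 0 := by exact_mod_cast hpos.ne'
  have hs : ((Real.sqrt (1 - lam ^ 2) : ℝ) : ℂ) ^ 2 = 1 - lam ^ 2 := by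
    rw [← Complex.ofReal_pow, Real.sq_sqrt hpos.le]; push_cast; rfl
  have hb : (slopeRoot lam ε * om * Real.sqrt (1 - lam ^ 2) / lam) ^ 2 = 1 - om ^ 2 := by
    rw [div_pow, mul_pow, mul_pow, hs, slopeRoot_sq (slopeSq_ne_zero h0 h1 hε), slopeSq, ← hom]
    push_cast
    field_simp
  -- Im(b ω̄) is a positive multiple of the imaginary part of the slope, which is nonzero precisely
  -- because ε is.
  have hell : (slopeRoot lam ε * om * Real.sqrt (1 - lam ^ 2) / lam *
      (starRingEnd ℂ) om).im ≠ 0 := by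
    have : slopeRoot lam ε * om * Real.sqrt (1 - lam ^ 2) / lam * (starRingEnd ℂ) om =
        ((Complex.normSq om * Real.sqrt (1 - lam ^ 2) / lam : ℝ) : ℂ) * slopeRoot lam ε := by
      push_cast
      rw [← Complex.mul_conj]; ring
    rw [this, Complex.im_ofReal_mul]
    refine mul_ne_zero (div_pos (mul_pos (Complex.normSq_pos.2 hom0) (Real.sqrt_pos.2 hpos))
      h0).ne' ?_
    rcases lt_or_gt_of_ne hε with h | h
    · exact ((slopeRoot_im h0 h1 hε).2 h).ne'
    · exact ((slopeRoot_im h0 h1 hε).1 h).ne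
  obtain ⟨u', hae, hc, hz, hH, hp, hm⟩ := exists_smooth_solution hΩ.isOpen hv hb hell hf hu
  exact ⟨u', hae, hΩ.isOpen, hv, hell, hf, hc, hz, hH, hp, hm⟩

end

end InternalWaves

theorem mainTheorem7 (lam : ℝ) (hlam : lam ∈ Set.Ioo (0 : ℝ) 1) :
    ∃ l : ℝ → ℝ → ℝ → ℂ,
      (∀ αm αp : ℝ, 0 < αm → 0 < αp →
        (fun ε : ℝ => l αm αp ε -
            2 * Real.pi * Complex.I / (Complex.I * Real.pi - Real.log (αp / αm)))
          =O[𝓝[>] 0] (fun ε : ℝ => ε) ∧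
        (fun ε : ℝ => l αm αp ε -
            2 * Real.pi * Complex.I / (Complex.I * Real.pi + Real.log (αp / αm)))
          =O[𝓝[<] 0] (fun ε : ℝ => ε) ∧
        ∀ ε : ℝ, ε ≠ 0 → 0 < (l αm αp ε).re) ∧
      ∀ Ω : Set (ℝ × ℝ), InternalWaves.IsStraightCornerDomain Ω →
      ∀ ε : ℝ, ε ≠ 0 →
      ∀ f u : ℝ × ℝ → ℂ, InternalWaves.IsTestFunction Ω f →
        InternalWaves.IsDirichletSolution Ω (lam + ε * Complex.I) f u →
        ∃ u' : ℝ × ℝ → ℂ, u' =ᵐ[volume.restrict Ω] u ∧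
          ContDiffOn ℝ ∞ u' (closure Ω \ InternalWaves.corners Ω) ∧
          ∀ (κ : ℝ × ℝ) (μ ν : ℤˣ) (αm αp : ℝ),
            InternalWaves.IsCornerOfType Ω lam κ μ ν αm αp →
            ∃ w : ℕ → ℝ → ℂ,
              (∀ k, 1 ≤ k → ContDiffOn ℝ ∞ (w k) (Set.Icc (-αm) αp) ∧
                w k (-αm) = 0 ∧ w k αp = 0) ∧
              InternalWaves.HasPolyhomExpansion
                (fun p => u' (InternalWaves.blowdown lam κ μ ν p)) (-αm) αp
                (l αm αp ε) w := by
  obtain ⟨h0, h1⟩ := hlam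
  refine ⟨InternalWaves.cornerExponent lam, fun αm αp hαm hαp => ?_, fun Ω hΩ ε hε f u hf hu => ?_⟩
  · obtain ⟨hp, hm⟩ := InternalWaves.cornerExponent_isBigO hαm hαp h0 h1
    exact ⟨hp, hm, fun ε hε => (InternalWaves.exists_slope hαm hαp h0 h1 hε).choose_spec.2.2.2⟩
  · obtain ⟨u', hae, h⟩ := InternalWaves.exists_isSmoothSolution hΩ h0 h1 hε hf hu
    refine ⟨u', hae, h.contDiffOn_closure, fun κ μ ν αm αp hκ => ?_⟩
    obtain ⟨σ, hσ, hσim, hl, hlre⟩ := InternalWaves.exists_slope hκ.αm_pos hκ.αp_pos h0 h1 hε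
    -- The representation needs νρ in the upper half plane. If `slopeRoot` has the wrong sign for
    -- this ν, its negative is used, which amounts to exchanging the two factors by `h.neg`.
    have key : ((ν : ℤ) : ℂ) * InternalWaves.slopeRoot lam ε = σ ∨
        ((ν : ℤ) : ℂ) * -InternalWaves.slopeRoot lam ε = σ := by
      rcases Int.units_eq_one_or ν with rfl | rfl <;> rcases hσ with rfl | rfl <;> simp
    rcases key with rfl | rfl
    · exact h.exists_expansion h0 h1 rfl hκ hσim hl hlre
    · exact h.neg.exists_expansion h0 h1 (by ring) hκ hσim hl hlre
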